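/- Let $k$ be a field of characteristic $0$. A \emph{stable $\mathbb S$-module} $\mathcal V$ is a collection of chain complexes $\mathcal V((g,n))$ over $k$, $g,n\ge 0$, with an action of the symmetric group $S_n$ on $\mathcal V((g,n))$, such that $\mathcal V((g,n))=0$ if $2g+n-2\le 0$; it is extended to finite sets $I$ of cardinality $n$ by $\mathcal V((g,I))=\bigl(\bigoplus_{f:\{1,\dots,n\}\cong I}\mathcal V((g,n))\bigr)_{S_n}$. A graph has a finite set of flags with an involution, whose fixed points are the legs and whose two-element orbits are the edges, and a finite set of vertices to which the flags are attached. A \emph{stable graph} $G$ is a connected graph with a genus $g(v)\ge0$ at each vertex $v$, such that $2(g(v)-1)+|\mathrm{Leg}(v)|>0$, where $\mathrm{Leg}(v)$ is the set of flags at $v$; its genus is $\sum_v (g(v)-1)+|\mathrm{Edge}(G)|+1$. Put $\mathcal V((G))=\bigotimes_v\mathcal V((g(v),\mathrm{Leg}(v)))$ (tensor product of chain complexes, with the Koszul sign rule). The free modular operad $\mathbb M\mathcal V$ generated by $\mathcal V$ has as underlying stable $\mathbb S$-module $$\mathbb M\mathcal V((g,n))=\operatorname*{colim}_{G}\ \mathcal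 V((G)),$$ the colimit being over the groupoid of stable graphs $G$ of genus $g$ with legs labelled by $\{1,\dots,n\}$ and their isomorphisms; $S_n$ permutes the labels. Let $\Lambda=k[[p_1,p_2,\dots]]$ be the ring of symmetric functions in the power sums $p_j$, with coefficients extended to $k$. Let $\Lambda((\hbar))$ be the ring of Laurent series in $\hbar$ over $\Lambda$, completed for the filtration $F^m$ in which $\hbar$ has degree $2$ and $p_j$ has degree $j$: its elements are the formal series of monomials $\hbar^i p_1^{m_1}p_2^{m_2}\cdots$, $i\in\mathbb Z$, whose degrees are bounded below and which contain finitely many monomials of each degree. For a finite-dimensional graded $S_n$-module $V=\bigoplus_i V_i$ put $$\mathrm{ch}_n(V)=\sum_i(-1)^i\,\frac1{n!}\sum_{\sigma\in S_n}\mathrm{Tr}_{V_i}(\sigma)\,p_{a_1(\sigma)}\cdots p_{a_\ell(\sigma)},$$ where $a_1(\sigma),\dots,a_\ell(\sigma)$ are the lengths of the cycles of $\sigma$, and, if all $\mathcal V((g,n))$ are finite-dimensional, $$\mathbf{Ch}(\mathcal V)=\sum_{2(g-1)+n>0}\hbar^{g-1}\,\mathrm{ch}_n(\mathcal V((g,n)))\in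 F^1\Lambda((\hbar)).$$ Let $p_n\circ f=f(\hbar^n,p_n,p_{2n},\dots)$. For $f\in F^1\Lambda((\hbar))$ and $F\in 1+F^1\Lambda((\hbar))$ let $$\mathrm{Exp}(f)=\exp\Bigl(\sum_{n\ge1}\tfrac1n\,p_n\circ f\Bigr),\qquad \mathrm{Log}(F)=\sum_{n\ge1}\frac{\mu(n)}n\log(p_n\circ F),$$ where $\mu$ is the M\"obius function, and let $$\Delta=\sum_{n=1}^\infty\hbar^n\Bigl(\frac n2\frac{\partial^2}{\partial p_n^2}+\frac{\partial}{\partial p_{2n}}\Bigr),\qquad \exp(\Delta)=\sum_{r\ge0}\frac{\Delta^r}{r!}.$$ \textbf{Theorem.} Let $\mathcal V$ be a stable $\mathbb S$-module over $k$. (1) If all $\mathcal V((g,n))$ are finite-dimensional, then so are all $\mathbb M\mathcal V((g,n))$, and in $\Lambda((\hbar))$ $$\mathbf{Ch}(\mathbb M\mathcal V)=\mathrm{Log}\bigl(\exp(\Delta)\,\mathrm{Exp}(\mathbf{Ch}(\mathcal V))\bigr).$$ (2) If all $\mathcal V((g,n))$ have finite-dimensional total homology, then so have all $\mathbb M\mathcal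 V((g,n))$, and the same formula holds when the characteristic of a stable $\mathbb S$-module is defined as that of its homology, i.e. with $\mathrm{ch}_n(H_\bullet(\mathcal V((g,n))))$ and $\mathrm{ch}_n(H_\bullet(\mathbb M\mathcal V((g,n))))$ in place of $\mathrm{ch}_n(\mathcal V((g,n)))$ and $\mathrm{ch}_n(\mathbb M\mathcal V((g,n)))$. -/

import Mathlib

universe u v

noncomputable section

namespace ModOp

/-- Exponents of monomials `ħ ^ i * p ^ m`, `i` an integer, `m j` the exponent of `p_j`. -/
def HMono : Type := ℤ × (ℕ+ →₀ ℕ)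

namespace HMono

instance : AddCommMonoid HMono := inferInstanceAs (AddCommMonoid (ℤ × (ℕ+ →₀ ℕ)))

instance : IsCancelAdd HMono := inferInstanceAs (IsCancelAdd (ℤ × (ℕ+ →₀ ℕ)))

/-- The exponent of the monomial `ħ ^ i * p ^ m`. -/
def mk (i : ℤ) (m : ℕ+ →₀ ℕ) : HMono := (i, m)

/-- The weight `2 i + ∑ j, j * m j`: `ħ` has weight `2` and `p_j` has weight `j`. -/
def weight : HMono →+ ℤ where
  toFun a := 2 * a.1 + a.2.sum fun j e => (j : ℤ) * e
  map_zero' := by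
    change 2 * (0 : ℤ) + (0 : ℕ+ →₀ ℕ).sum _ = 0
    simp
  map_add' a b := by
    change 2 * (a.1 + b.1) + (a.2 + b.2).sum _ = _
    rw [Finsupp.sum_add_index' (by simp) (by intros; push_cast; ring)]
    ring

/-- The order by weight: distinct monomials of the same weight are incomparable.  A set of
monomials is partially well-ordered for it exactly when the weights are bounded below on the set
and the set has finitely many elements of each weight. -/
instance : PartialOrder HMono where
  le a b := a = b ∨ a.weight < b.weight
  le_refl a := Or.inl rfl
  le_trans a b c := by
    rintro (rfl | h) (rfl | h')
    · exact Or.inl rfl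
    · exact Or.inr h'
    · exact Or.inr h
    · exact Or.inr (h.trans h')
  le_antisymm a b := by
    rintro (rfl | h) (h' | h')
    · rfl
    · rfl
    · exact h'.symm
    · exact absurd h' (not_lt.mpr h.le)

theorem le_def {a b : HMono} : a ≤ b ↔ a = b ∨ a.weight < b.weight := Iff.rfl

theorem add_le_add_iff' (a b c : HMono) : a + b ≤ a + c ↔ b ≤ c := by
  rw [le_def, le_def, map_add, map_add, add_right_inj, add_lt_add_iff_left]

instance : IsOrderedCancelAddMonoid HMono where
  add_le_add_left a b h c := by
    rw [add_comm a c, add_comm b c]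
    exact (add_le_add_iff' c a b).mpr h
  le_of_add_le_add_left a b c h := (add_le_add_iff' a b c).mp h

/-- Multiplication by `n` on the exponent of `ħ` and on the indices of the `p_j`, i.e. the
effect of `ħ ↦ ħ ^ n`, `p_j ↦ p_{n j}` on monomials. -/
def dilate (n : ℕ+) : HMono →+ HMono where
  toFun a := ((n : ℤ) * a.1, a.2.mapDomain (n * ·))
  map_zero' := by
    change (((n : ℤ) * 0, (0 : ℕ+ →₀ ℕ).mapDomain (n * ·)) : ℤ × (ℕ+ →₀ ℕ)) = (0, 0)
    simp
  map_add' a b := by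
    change (((n : ℤ) * (a.1 + b.1), (a.2 + b.2).mapDomain (n * ·)) : ℤ × (ℕ+ →₀ ℕ)) =
      ((n : ℤ) * a.1 + (n : ℤ) * b.1, a.2.mapDomain (n * ·) + b.2.mapDomain (n * ·))
    rw [mul_add, Finsupp.mapDomain_add]

theorem dilate_injective (n : ℕ+) : Function.Injective (dilate n) := by
  intro a b h
  have h1 : (n : ℤ) * a.1 = n * b.1 := congrArg Prod.fst h
  have h2 : a.2.mapDomain (n * ·) = b.2.mapDomain (n * ·) := congrArg Prod.snd h
  have hn : (n : ℤ) ≠ 0 := by exact_mod_cast n.ne_zero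
  exact Prod.ext (mul_left_cancel₀ hn h1)
    (Finsupp.mapDomain_injective (fun _ _ => mul_left_cancel) h2)

theorem weight_dilate (n : ℕ+) (a : HMono) : (dilate n a).weight = n * a.weight := by
  change 2 * ((n : ℤ) * a.1) + (a.2.mapDomain (n * ·)).sum (fun j e => (j : ℤ) * e) =
    n * (2 * a.1 + a.2.sum fun j e => (j : ℤ) * e)
  rw [Finsupp.sum_mapDomain_index (by simp) (by intros; push_cast; ring), mul_add,
    Finsupp.mul_sum]
  congr 1
  · ring
  · refine Finsupp.sum_congr fun j _ => ?_
    push_cast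
    ring

theorem dilate_le_iff (n : ℕ+) (a b : HMono) : dilate n a ≤ dilate n b ↔ a ≤ b := by
  have hn : (0 : ℤ) < n := by exact_mod_cast n.pos
  rw [le_def, le_def, weight_dilate, weight_dilate, (dilate_injective n).eq_iff,
    mul_lt_mul_iff_right₀ hn]

end HMono

/-- The ring `Λ((ħ))`, with the coefficients of `Λ` extended to `k`, so that
`Λ = k⟦p_1, p_2, …⟧`, and completed for the filtration in which `ħ` has degree `2` and `p_j` has
degree `j`: the formal series of monomials `ħ ^ i * p ^ m`, with `i` an integer, whose weights are
bounded below and which contain finitely many monomials of each weight. -/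
abbrev LambdaHbar (k : Type u) [Field k] : Type u := HahnSeries HMono k

section Lambda

variable {k : Type u} [Field k]

/-- The powers of `ħ`. -/
def hbarPow (i : ℤ) : LambdaHbar k := HahnSeries.single (HMono.mk i 0) 1

/-- The power sum `p_j`. -/
def pSum (j : ℕ+) : LambdaHbar k :=
  HahnSeries.single (HMono.mk 0 (Finsupp.single j 1)) 1

/-- A family of elements of `Λ((ħ))` is summable if each monomial occurs in finitely many members
of the family and the monomials which occur in some member are those of an element of `Λ((ħ))`. -/
def IsSummable {ι : Type*} (F : ι → LambdaHbar k) : Prop :=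
  (⋃ a, (F a).support).IsPWO ∧ ∀ m, {a | (F a).coeff m ≠ 0}.Finite

open scoped Classical in
/-- The sum of a summable family of elements of `Λ((ħ))`, taken coefficient by coefficient; it is
`0` by convention if the family is not summable. -/
def infSum {ι : Type*} (F : ι → LambdaHbar k) : LambdaHbar k :=
  if h : IsSummable F then (HahnSeries.SummableFamily.mk F h.1 h.2).hsum else 0

/-- The plethysm `p_n ∘ f = f(ħ ^ n, p_n, p_{2 n}, …)`, as a ring homomorphism in `f`. -/
def pleth (n : ℕ+) : LambdaHbar k →+* LambdaHbar k :=
  HahnSeries.embDomainRingHom (HMono.dilate n) (HMono.dilate_injective n) (HMono.dilate_le_iff n)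

/-- The exponential series; it converges if all weights in `f` are positive. -/
def expSeries (f : LambdaHbar k) : LambdaHbar k :=
  infSum fun r : ℕ => ((r.factorial : k)⁻¹) • f ^ r

/-- The series of the logarithm at `1`; it converges if all weights in `F - 1` are positive. -/
def logSeries (F : LambdaHbar k) : LambdaHbar k :=
  infSum fun r : ℕ+ => ((-1) ^ ((r : ℕ) + 1) / (r : k)) • (F - 1) ^ (r : ℕ)

/-- The plethystic exponential `Exp f = exp (∑ n, p_n / n) ∘ f`. -/
def plethExp (f : LambdaHbar k) : LambdaHbar k :=
  expSeries (infSum fun n : ℕ+ => ((n : k)⁻¹) • pleth n f)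

/-- The plethystic logarithm `Log F = ∑ n, (μ n / n) log (p_n ∘ F)`. -/
def plethLog (F : LambdaHbar k) : LambdaHbar k :=
  infSum fun n : ℕ+ => ((ArithmeticFunction.moebius n : k) / (n : k)) • logSeries (pleth n F)

/-- The partial derivative `∂/∂p_n`. -/
def pDeriv (n : ℕ+) (f : LambdaHbar k) : LambdaHbar k where
  coeff a := ((a.2 n : k) + 1) *
    f.coeff (a + HMono.mk 0 (Finsupp.single n 1))
  isPWO_support' := by
    intro s
    obtain ⟨i, j, hij, h⟩ := f.isPWO_support fun t =>
      ⟨(s t).1 + HMono.mk 0 (Finsupp.single n 1), right_ne_zero_of_mul (s t).2⟩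
    exact ⟨i, j, hij, le_of_add_le_add_right h⟩

/-- The Laplacian `Δ = ∑ n, ħ ^ n ((n / 2) ∂²/∂p_n² + ∂/∂p_{2 n})`. -/
def laplacian (f : LambdaHbar k) : LambdaHbar k :=
  infSum fun n : ℕ+ =>
    hbarPow (n : ℤ) * (((n : k) / 2) • pDeriv n (pDeriv n f) + pDeriv (2 * n) f)

/-- The operator `exp Δ = ∑ r, Δ ^ r / r!`. -/
def expLaplacian (f : LambdaHbar k) : LambdaHbar k :=
  infSum fun r : ℕ => ((r.factorial : k)⁻¹) • laplacian^[r] f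

/-- The cycle index `ψ(σ)`: the product of the `p_a` over the lengths `a` of the cycles of `σ`,
fixed points included. -/
def cycleIndex {n : ℕ} (σ : Equiv.Perm (Fin n)) : LambdaHbar k :=
  (σ.partition.parts.map fun a => pSum a.toPNat').prod

end Lambda

section Complexes

/-- A chain complex `V` over `k`, presented as a graded vector space `V = ⨁ i, V_i` with a
differential of degree `-1`, together with an action of the group `G` by automorphisms of the
chain complex. -/
structure DGRep (k : Type u) [Field k] (G : Type) [Group G] where
  carrier : Type v
  [addCommGroup : AddCommGroup carrier]
  [module : Module k carrier]
  gr : ℤ → Submodule k carrier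
  isInternal : DirectSum.IsInternal gr
  d : carrier →ₗ[k] carrier
  d_mem : ∀ (i : ℤ) (x : carrier), x ∈ gr i → d x ∈ gr (i - 1)
  d_d : ∀ x : carrier, d (d x) = 0
  ρ : Representation k G carrier
  ρ_mem : ∀ (σ : G) (i : ℤ) (x : carrier), x ∈ gr i → ρ σ x ∈ gr i
  ρ_d : ∀ (σ : G) (x : carrier), ρ σ (d x) = d (ρ σ x)

attribute [instance] DGRep.addCommGroup DGRep.module

/-- A grading is a direct sum decomposition as soon as it spans and some operator acts on the
piece of degree `i` as the scalar `2 ^ i`. -/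
theorem isInternal_of_eigen {k : Type u} [Field k] [CharZero k] {M : Type v} [AddCommGroup M]
    [Module k M] (gr : ℤ → Submodule k M) (θ : M →ₗ[k] M)
    (hθ : ∀ (i : ℤ) (x : M), x ∈ gr i → θ x = (2 : k) ^ i • x) (htop : ⨆ i, gr i = ⊤) :
    DirectSum.IsInternal gr := by
  refine DirectSum.isInternal_submodule_of_iSupIndep_of_iSup_eq_top ?_ htop
  have hinj : Function.Injective fun i : ℤ => (2 : k) ^ i := by
    intro i j hij
    have h2 : ((2 : ℚ) ^ i : ℚ) = (2 : ℚ) ^ j := by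
      have : (((2 : ℚ) ^ i : ℚ) : k) = (((2 : ℚ) ^ j : ℚ) : k) := by
        push_cast
        exact hij
      exact_mod_cast this
    exact zpow_right_injective₀ (by norm_num) (by norm_num) h2
  refine ((Module.End.eigenspaces_iSupIndep θ).comp hinj).mono fun i x hx => ?_
  exact Module.End.mem_eigenspace_iff.mpr (hθ i x hx)

namespace DGRep

variable {k : Type u} [Field k] {G : Type} [Group G]

section

variable (V : DGRep.{u, v} k G)

/-- The decomposition `V = ⨁ i, V_i`. -/
def decomp : (DirectSum ℤ fun i => V.gr i) ≃ₗ[k] V.carrier :=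
  LinearEquiv.ofBijective (DirectSum.coeLinearMap V.gr) V.isInternal

/-- The component of degree `i`, as an operator. -/
def proj (i : ℤ) : V.carrier →ₗ[k] V.carrier :=
  (V.gr i).subtype ∘ₗ DirectSum.component k ℤ (fun i => V.gr i) i ∘ₗ
    V.decomp.symm.toLinearMap

/-- The operator which multiplies the elements of degree `i` by `c i`. -/
def scale (c : ℤ → k) : V.carrier →ₗ[k] V.carrier :=
  DirectSum.toModule k ℤ V.carrier (fun i => c i • (V.gr i).subtype) ∘ₗ
    V.decomp.symm.toLinearMap

theorem decomp_symm_apply {i : ℤ} {x : V.carrier} (hx : x ∈ V.gr i) :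
    V.decomp.symm x = DirectSum.lof k ℤ (fun i => V.gr i) i ⟨x, hx⟩ := by
  rw [LinearEquiv.symm_apply_eq]
  exact (DirectSum.coeLinearMap_lof V.gr i ⟨x, hx⟩).symm

theorem scale_apply (c : ℤ → k) {i : ℤ} {x : V.carrier} (hx : x ∈ V.gr i) :
    V.scale c x = c i • x := by
  simp [scale, V.decomp_symm_apply hx]

theorem proj_apply_same {i : ℤ} {x : V.carrier} (hx : x ∈ V.gr i) : V.proj i x = x := by
  simp [proj, V.decomp_symm_apply hx, DirectSum.component.lof_self]

theorem proj_apply_ne {i j : ℤ} (hij : j ≠ i) {x : V.carrier} (hx : x ∈ V.gr i) :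
    V.proj j x = 0 := by
  simp [proj, V.decomp_symm_apply hx, DirectSum.component.of, hij.symm]

theorem proj_mem (i : ℤ) (x : V.carrier) : V.proj i x ∈ V.gr i := by
  simp [proj]

theorem iSup_gr : ⨆ i, V.gr i = ⊤ := V.isInternal.submodule_iSup_eq_top

theorem induction_gr {motive : V.carrier → Prop}
    (hom : ∀ (i : ℤ) (x : V.carrier), x ∈ V.gr i → motive x) (zero : motive 0)
    (add : ∀ x y, motive x → motive y → motive (x + y)) (x : V.carrier) : motive x := by
  have hx : x ∈ ⨆ i, V.gr i := by simp [V.iSup_gr]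
  exact Submodule.iSup_induction V.gr (motive := motive) hx hom zero add

theorem exists_sum_proj (x : V.carrier) : ∃ s : Finset ℤ, x = ∑ i ∈ s, V.proj i x := by
  classical
  suffices h : ∃ s : Finset ℤ, ∀ t, s ⊆ t → x = ∑ i ∈ t, V.proj i x by
    obtain ⟨s, hs⟩ := h
    exact ⟨s, hs s subset_rfl⟩
  induction x using V.induction_gr with
  | hom i x hx =>
    refine ⟨{i}, fun t ht => ?_⟩
    rw [Finset.sum_eq_single_of_mem i (by simpa using ht)
      (fun j _ hj => V.proj_apply_ne hj hx), V.proj_apply_same hx]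
  | zero => exact ⟨∅, fun t _ => by simp⟩
  | add x y hx hy =>
    obtain ⟨s, hs⟩ := hx
    obtain ⟨t, ht⟩ := hy
    refine ⟨s ∪ t, fun r hr => ?_⟩
    rw [Finset.sum_congr rfl fun i _ => map_add (V.proj i) x y, Finset.sum_add_distrib,
      ← hs r (Finset.union_subset_left hr), ← ht r (Finset.union_subset_right hr)]

theorem d_proj (i : ℤ) (x : V.carrier) : V.d (V.proj i x) = V.proj (i - 1) (V.d x) := by
  induction x using V.induction_gr with
  | hom j x hx =>
    rcases eq_or_ne i j with rfl | h
    · rw [V.proj_apply_same hx, V.proj_apply_same (V.d_mem i x hx)]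
    · rw [V.proj_apply_ne h hx, map_zero,
        V.proj_apply_ne (fun h' => h (sub_left_injective h')) (V.d_mem j x hx)]
  | zero => simp
  | add x y hx hy => simp [hx, hy]

theorem d_scale (x : V.carrier) :
    V.d (V.scale (fun i => (2 : k) ^ i) x) = V.scale (fun i => (2 : k) ^ (i + 1)) (V.d x) := by
  induction x using V.induction_gr with
  | hom j x hx =>
    rw [V.scale_apply _ hx, V.scale_apply _ (V.d_mem j x hx), map_smul, sub_add_cancel]
  | zero => simp
  | add x y hx hy => simp [hx, hy]

/-- The boundaries, as a subspace of the cycles. -/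
abbrev bdry : Submodule k (LinearMap.ker V.d) :=
  (LinearMap.range V.d).submoduleOf (LinearMap.ker V.d)

theorem ker_le_of_comm {f : V.carrier →ₗ[k] V.carrier} (hf : ∀ x, f (V.d x) = V.d (f x)) :
    ∀ x ∈ LinearMap.ker V.d, f x ∈ LinearMap.ker V.d := by
  intro x hx
  rw [LinearMap.mem_ker] at hx ⊢
  rw [← hf, hx, map_zero]

theorem bdry_le_of_comm {f : V.carrier →ₗ[k] V.carrier} (hf : ∀ x, f (V.d x) = V.d (f x)) :
    V.bdry ≤ V.bdry.comap (f.restrict (V.ker_le_of_comm hf)) := by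
  rintro x ⟨y, hy⟩
  exact ⟨f y, by rw [← hf, hy]; rfl⟩

/-- The map on homology induced by a linear map which commutes with `d`. -/
def homologyMap (f : V.carrier →ₗ[k] V.carrier) (hf : ∀ x, f (V.d x) = V.d (f x)) :
    (LinearMap.ker V.d ⧸ V.bdry) →ₗ[k] (LinearMap.ker V.d ⧸ V.bdry) :=
  V.bdry.mapQ V.bdry (f.restrict (V.ker_le_of_comm hf)) (V.bdry_le_of_comm hf)

end

/-- The homology of a chain complex with an action of `G`: the quotient of the cycles by the
boundaries, with the induced grading and the induced action of `G`, and with zero differential. -/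
def homology [CharZero k] (V : DGRep.{u, v} k G) : DGRep.{u, v} k G where
  carrier := LinearMap.ker V.d ⧸ V.bdry
  gr i := ((V.gr i).submoduleOf (LinearMap.ker V.d)).map V.bdry.mkQ
  isInternal := by
    have hs : ∀ x ∈ LinearMap.ker V.d,
        V.scale (fun i => (2 : k) ^ i) x ∈ LinearMap.ker V.d := by
      intro x hx
      rw [LinearMap.mem_ker] at hx ⊢
      rw [V.d_scale, hx, map_zero]
    refine isInternal_of_eigen _ (V.bdry.mapQ V.bdry
      ((V.scale (fun i => (2 : k) ^ i)).restrict hs) ?_) ?_ ?_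
    · rintro x ⟨y, hy⟩
      refine ⟨(2 : k)⁻¹ • V.scale (fun i => (2 : k) ^ i) y, ?_⟩
      rw [map_smul, V.d_scale, hy]
      change _ = V.scale _ (x : V.carrier)
      change _ • V.scale _ (x : V.carrier) = _
      generalize (x : V.carrier) = z
      induction z using V.induction_gr with
      | hom j z hz =>
        rw [V.scale_apply _ hz, V.scale_apply _ hz, smul_smul, zpow_add₀ two_ne_zero]
        congr 1
        field_simp
      | zero => simp
      | add z w hz hw => simp [hz, hw]
    · rintro i _ ⟨x, hx, rfl⟩
      rw [Submodule.mkQ_apply, Submodule.mapQ_apply, ← Submodule.Quotient.mk_smul]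
      congr 1
      exact Subtype.ext (V.scale_apply _ hx)
    · rw [eq_top_iff]
      rintro x -
      obtain ⟨⟨x, hx⟩, rfl⟩ := V.bdry.mkQ_surjective x
      obtain ⟨s, hs⟩ := V.exists_sum_proj x
      have hk : ∀ i, V.proj i x ∈ LinearMap.ker V.d := fun i => by
        rw [LinearMap.mem_ker] at hx ⊢
        rw [V.d_proj, hx, map_zero]
      have : (⟨x, hx⟩ : LinearMap.ker V.d) = ∑ i ∈ s, ⟨V.proj i x, hk i⟩ :=
        Subtype.ext (by simpa using hs)
      rw [this, map_sum]
      exact Submodule.sum_mem _ fun i _ => Submodule.mem_iSup_of_mem i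
        ⟨_, V.proj_mem i x, rfl⟩
  d := 0
  d_mem := by simp
  d_d := by simp
  ρ :=
    { toFun σ := V.homologyMap (V.ρ σ) (V.ρ_d σ)
      map_one' := by
        refine LinearMap.ext fun x => ?_
        obtain ⟨x, rfl⟩ := V.bdry.mkQ_surjective x
        refine congrArg V.bdry.mkQ (Subtype.ext ?_)
        change V.ρ 1 (x : V.carrier) = x
        simp
      map_mul' σ τ := by
        refine LinearMap.ext fun x => ?_
        obtain ⟨x, rfl⟩ := V.bdry.mkQ_surjective x
        refine congrArg V.bdry.mkQ (Subtype.ext ?_)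
        change V.ρ (σ * τ) (x : V.carrier) = V.ρ σ (V.ρ τ x)
        simp }
  ρ_mem := by
    rintro σ i _ ⟨x, hx, rfl⟩
    exact ⟨⟨V.ρ σ x, V.ker_le_of_comm (V.ρ_d σ) x x.2⟩, V.ρ_mem σ i x hx, rfl⟩
  ρ_d := by simp

/-- The character of the action of `G` on the component of degree `i`. -/
def grTrace (V : DGRep.{u, v} k G) (i : ℤ) (σ : G) : k :=
  LinearMap.trace k (V.gr i) ((V.ρ σ).restrict (V.ρ_mem σ i))

/-- The characteristic `ch_n(V) = ∑ i, (-1) ^ i ch_n(V_i)` of a finite-dimensional graded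
`S_n`-module, where `ch_n(V_i) = (1 / n!) ∑ σ, Tr(σ | V_i) ψ(σ)`. -/
def ch {n : ℕ} (V : DGRep.{u, v} k (Equiv.Perm (Fin n))) : LambdaHbar k :=
  ∑ᶠ i : ℤ, ((i.negOnePow : ℤˣ) : ℤ) •
    ((n.factorial : k)⁻¹ • ∑ σ : Equiv.Perm (Fin n), V.grTrace i σ • cycleIndex σ)

end DGRep

/-- A stable `S`-module: chain complexes `V((g, n))` with actions of `S_n`, which vanish if
`2 g + n - 2 ≤ 0`. -/
structure StableSModule (k : Type u) [Field k] where
  obj : (g n : ℕ) → DGRep.{u, v} k (Equiv.Perm (Fin n))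
  stable : ∀ g n : ℕ, 2 * g + n ≤ 2 → Subsingleton (obj g n).carrier

namespace StableSModule

variable {k : Type u} [Field k]

/-- The homology of a stable `S`-module. -/
def homology [CharZero k] (V : StableSModule.{u, v} k) : StableSModule.{u, v} k where
  obj g n := (V.obj g n).homology
  stable g n h := by
    have := V.stable g n h
    change Subsingleton (LinearMap.ker (V.obj g n).d ⧸ (V.obj g n).bdry)
    infer_instance

/-- The characteristic `∑ ħ ^ (g - 1) ch_n(V((g, n)))` of a stable `S`-module all of whose
chain complexes are finite-dimensional; the sum is over all `g` and `n` with
`2 (g - 1) + n > 0`. -/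
def characteristic (V : StableSModule.{u, v} k) : LambdaHbar k :=
  infSum fun a : {a : ℕ × ℕ // 2 < 2 * a.1 + a.2} =>
    hbarPow ((a.1.1 : ℤ) - 1) * (V.obj a.1.1 a.1.2).ch

/-- The map `V((g, I)) → V((g', J))` induced by an equality `g = g'` and a bijection `I → J`, for
`I = {1, …, a}` and `J = {1, …, b}`. -/
def relabel (V : StableSModule.{u, v} k) {g g' a b : ℕ} (hg : g = g') (φ : Fin a ≃ Fin b) :
    (V.obj g a).carrier →ₗ[k] (V.obj g' b).carrier :=
  have hab : a = b := by simpa using Fintype.card_congr φ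
  match g', b, hg, hab, φ with
  | _, _, rfl, rfl, φ => (V.obj g a).ρ φ

theorem relabel_mem (V : StableSModule.{u, v} k) {g g' a b : ℕ} (hg : g = g')
    (φ : Fin a ≃ Fin b) (i : ℤ) (x : (V.obj g a).carrier) (hx : x ∈ (V.obj g a).gr i) :
    V.relabel hg φ x ∈ (V.obj g' b).gr i := by
  have hab : a = b := by simpa using Fintype.card_congr φ
  subst hg hab
  exact (V.obj g a).ρ_mem φ i x hx

theorem relabel_d (V : StableSModule.{u, v} k) {g g' a b : ℕ} (hg : g = g')
    (φ : Fin a ≃ Fin b) (x : (V.obj g a).carrier) :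
    V.relabel hg φ ((V.obj g a).d x) = (V.obj g' b).d (V.relabel hg φ x) := by
  have hab : a = b := by simpa using Fintype.card_congr φ
  subst hg hab
  exact (V.obj g a).ρ_d φ x

end StableSModule

end Complexes

section Graphs

/-- The set of edges of a graph with set of flags `F` and involution `inv`: the two-element
orbits of the involution. -/
def edgeFinset {F : Type} [Fintype F] [DecidableEq F] (inv : F → F) : Finset (Sym2 F) :=
  (Finset.univ.filter fun a => inv a ≠ a).image fun a => s(a, inv a)

/-- An object of `Γ((g, n))`, i.e. a stable graph of genus `g` with legs labelled by `{1, …, n}`,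
together with a numbering `1, …, nv` of its vertices and, for each vertex `v`, a numbering of the
`val v` flags at `v`. Every object of `Γ((g, n))` has such numberings. The involution is `inv`, its
fixed points are the legs, and the labelling of the legs is the inverse of `leg`. -/
structure StableGraph (g n : ℕ) where
  nv : ℕ
  genus : Fin nv → ℕ
  val : Fin nv → ℕ
  inv : (Σ v : Fin nv, Fin (val v)) → Σ v : Fin nv, Fin (val v)
  inv_inv : Function.Involutive inv
  leg : Fin n ≃ {a // inv a = a}
  connected : (SimpleGraph.fromRel fun v w : Fin nv => ∃ a, a.1 = v ∧ (inv a).1 = w).Connected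
  stable : ∀ v, 2 < 2 * genus v + val v
  genus_eq : ∑ v, ((genus v : ℤ) - 1) + ((edgeFinset inv).card : ℤ) + 1 = g

namespace StableGraph

instance (g n : ℕ) : DecidableEq (StableGraph g n) := Classical.decEq _

/-- The type of flags. -/
abbrev Flag {g n : ℕ} (Γ : StableGraph g n) : Type := Σ v : Fin Γ.nv, Fin (Γ.val v)

/-- There is no stable graph of genus `g` with `n` legs unless `2 (g - 1) + n > 0`. -/
theorem stable_genus {g n : ℕ} (Γ : StableGraph g n) : 2 < 2 * g + n := by
  have hflag : Fintype.card Γ.Flag = ∑ v, Γ.val v := by simp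
  have hleg : Fintype.card {a // Γ.inv a = a} = n := by
    rw [← Fintype.card_congr Γ.leg, Fintype.card_fin]
  have hedge : (Finset.univ.filter fun a => Γ.inv a ≠ a).card ≤ 2 * (edgeFinset Γ.inv).card := by
    refine Finset.card_le_mul_card_image _ 2 fun b hb => ?_
    obtain ⟨a, -, rfl⟩ := Finset.mem_image.mp hb
    refine (Finset.card_le_card (t := {a, Γ.inv a}) fun c hc => ?_).trans Finset.card_le_two
    have h := (Finset.mem_filter.mp hc).2
    rw [Sym2.eq_iff] at h
    rcases h with h | h
    · simp [h.1]
    · simp [h.1]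
  have hsplit : n + (Finset.univ.filter fun a => Γ.inv a ≠ a).card = ∑ v, Γ.val v := by
    rw [← hflag, ← Finset.card_univ]
    refine (congrArg (· + _) hleg.symm).trans ?_
    rw [Fintype.card_subtype]
    convert Finset.card_filter_add_card_filter_not (s := (Finset.univ : Finset Γ.Flag))
      (fun a => Γ.inv a = a)
  have hne : 0 < Γ.nv := by
    obtain ⟨v⟩ := Γ.connected.nonempty
    exact v.pos
  have hsum : ∑ v : Fin Γ.nv, (1 : ℤ) ≤ ∑ v, (2 * ((Γ.genus v : ℤ) - 1) + Γ.val v) :=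
    Finset.sum_le_sum fun v _ => by
      have := Γ.stable v
      omega
  rw [Finset.sum_add_distrib, ← Finset.mul_sum] at hsum
  have hval : ∑ v, (Γ.val v : ℤ) = ((∑ v, Γ.val v : ℕ) : ℤ) := by push_cast; rfl
  have hone : ∑ v : Fin Γ.nv, (1 : ℤ) = Γ.nv := by simp
  have hg := Γ.genus_eq
  omega

/-- The action of `S_n` on the labels of the legs. -/
def smulLeg {g n : ℕ} (σ : Equiv.Perm (Fin n)) (Γ : StableGraph g n) : StableGraph g n :=
  { Γ with leg := σ.symm.trans Γ.leg }

/-- An isomorphism of stable graphs with labelled legs. It need not respect the numberings of the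
vertices and of the flags. -/
structure Iso {g n : ℕ} (Γ Γ' : StableGraph g n) where
  vert : Fin Γ.nv ≃ Fin Γ'.nv
  genus_vert : ∀ v, Γ.genus v = Γ'.genus (vert v)
  flag : ∀ v, Fin (Γ.val v) ≃ Fin (Γ'.val (vert v))
  inv_flag : ∀ a : Γ.Flag, Γ'.inv ⟨vert a.1, flag a.1 a.2⟩ =
    ⟨vert (Γ.inv a).1, flag (Γ.inv a).1 (Γ.inv a).2⟩
  leg_flag : ∀ i, (Γ'.leg i : Γ'.Flag) =
    ⟨vert (Γ.leg i : Γ.Flag).1, flag (Γ.leg i : Γ.Flag).1 (Γ.leg i : Γ.Flag).2⟩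

/-- Isomorphisms are compatible with the action of `S_n`. -/
def Iso.smulLeg {g n : ℕ} {Γ Γ' : StableGraph g n} (e : Γ.Iso Γ') (σ : Equiv.Perm (Fin n)) :
    (Γ.smulLeg σ).Iso (Γ'.smulLeg σ) where
  vert := e.vert
  genus_vert := e.genus_vert
  flag := e.flag
  inv_flag := e.inv_flag
  leg_flag i := e.leg_flag (σ.symm i)

end StableGraph

/-- The exponent of the Koszul sign of a permutation `e` of homogeneous factors of degrees `δ`:
the sum of the products of the degrees over all the pairs of factors which are interchanged. -/
def koszulExp {m m' : ℕ} (e : Fin m → Fin m') (δ : Fin m → ℤ) : ℤ :=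
  ∑ v, ∑ w, if v < w ∧ e w < e v then δ v * δ w else 0

/-- The sum of the degrees of the factors which precede the factor `v`. -/
def degBefore {m : ℕ} (δ : Fin m → ℤ) (v : Fin m) : ℤ := ∑ w, if w < v then δ w else 0

theorem degBefore_update_of_le {m : ℕ} (δ : Fin m → ℤ) {v w : Fin m} (h : w ≤ v) (c : ℤ) :
    degBefore (Function.update δ v c) w = degBefore δ w := by
  refine Finset.sum_congr rfl fun u _ => ?_
  split_ifs with hu
  · rw [Function.update_of_ne (hu.trans_le h).ne]
  · rfl

theorem degBefore_update_of_lt {m : ℕ} (δ : Fin m → ℤ) {v w : Fin m} (h : v < w) :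
    degBefore (Function.update δ v (δ v - 1)) w = degBefore δ w - 1 := by
  have : (1 : ℤ) = ∑ u, if u = v then 1 else 0 := by simp
  rw [degBefore, degBefore, this, ← Finset.sum_sub_distrib]
  refine Finset.sum_congr rfl fun u _ => ?_
  rcases eq_or_ne u v with rfl | hu
  · simp [h]
  · simp [hu]

theorem sum_update_sub_one {m : ℕ} (δ : Fin m → ℤ) (v : Fin m) :
    ∑ w, Function.update δ v (δ v - 1) w = ∑ w, δ w - 1 := by
  have : (1 : ℤ) = ∑ u, if u = v then 1 else 0 := by simp
  rw [this, ← Finset.sum_sub_distrib]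
  refine Finset.sum_congr rfl fun u _ => ?_
  rcases eq_or_ne u v with rfl | hu
  · simp
  · simp [hu]

/-- Compatibility of Koszul signs with the differential. -/
theorem koszulExp_update {m m' : ℕ} (e : Fin m ≃ Fin m') (δ : Fin m → ℤ) (δ' : Fin m' → ℤ)
    (hδ : ∀ v, δ' (e v) = δ v) (v : Fin m) :
    Even (koszulExp e (Function.update δ v (δ v - 1)) + degBefore δ v -
      (koszulExp e δ + degBefore δ' (e v))) := by
  have h1 : koszulExp e (Function.update δ v (δ v - 1)) = koszulExp e δ -
      ∑ w, ((if v < w ∧ e w < e v then δ w else 0) + if w < v ∧ e v < e w then δ w else 0) := by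
    have h2 : ∑ w, ((if v < w ∧ e w < e v then δ w else 0) +
        if w < v ∧ e v < e w then δ w else 0) =
        ∑ u, ∑ w, ((if u = v then if v < w ∧ e w < e v then δ w else 0 else 0) +
          if w = v then if u < v ∧ e v < e u then δ u else 0 else 0) := by
      simp only [Finset.sum_add_distrib, Finset.sum_ite_eq', Finset.mem_univ, if_true]
      congr 1
      rw [Finset.sum_comm]
      simp
    rw [h2, koszulExp, koszulExp, ← Finset.sum_sub_distrib]
    refine Finset.sum_congr rfl fun u _ => ?_
    rw [← Finset.sum_sub_distrib]
    refine Finset.sum_congr rfl fun w _ => ?_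
    rcases eq_or_ne u v with rfl | hu
    · rcases eq_or_ne w u with rfl | hw
      · simp
      · simp only [Function.update_self, Function.update_of_ne hw, if_true, if_neg hw]
        split_ifs <;> ring
    · rcases eq_or_ne w v with rfl | hw
      · simp only [Function.update_self, Function.update_of_ne hu, if_true, if_neg hu]
        split_ifs <;> ring
      · simp [hu, hw, Function.update_of_ne]
  have h3 : degBefore δ' (e v) = ∑ w, if e w < e v then δ w else 0 := by
    rw [degBefore, ← e.sum_comp]
    simp only [hδ]
  rw [h1, h3, degBefore]
  have h4 : ∀ a b c d : ℤ, a - b + c - (a + d) = c - (b + d) := by intros; ring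
  rw [h4, ← Finset.sum_add_distrib, ← Finset.sum_sub_distrib]
  refine Finset.even_sum _ fun w _ => ?_
  have hinj : e w = e v ↔ w = v := e.injective.eq_iff
  rcases lt_trichotomy w v with h | h | h <;>
    rcases lt_trichotomy (e w) (e v) with h' | h' | h' <;>
    first
    | (exfalso; rw [hinj] at h'; exact absurd h' (by first | exact h.ne | exact h.ne'))
    | simp [h, h', h.not_gt, h'.not_gt]

end Graphs

section FreeModularOperad

open scoped TensorProduct

/-- The sign `(-1) ^ i` in `k`. -/
def signOf (k : Type u) [Field k] (i : ℤ) : k := ((i.negOnePow : ℤˣ) : ℤ)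

theorem signOf_add {k : Type u} [Field k] (i j : ℤ) :
    signOf k (i + j) = signOf k i * signOf k j := by
  simp [signOf, Int.negOnePow_add]

theorem signOf_eq_of_even {k : Type u} [Field k] {i j : ℤ} (h : Even (i - j)) :
    signOf k i = signOf k j := by
  rw [signOf, signOf, Int.negOnePow_eq_iff _ _ |>.mpr h]

namespace StableSModule

variable {k : Type u} [Field k] (V : StableSModule.{u, v} k)

/-- The underlying vector space of `V((Γ)) = ⨂ v, V((g(v), Leg(v)))`. -/
abbrev tensor {g n : ℕ} (Γ : StableGraph g n) : Type (max u v) :=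
  ⨂[k] v : Fin Γ.nv, (V.obj (Γ.genus v) (Γ.val v)).carrier

/-- The summand of the differential of `V((Γ))` which applies `d` at the vertex `v`:
`x_1 ⊗ ⋯ ⊗ x_m ↦ ± x_1 ⊗ ⋯ ⊗ d x_v ⊗ ⋯ ⊗ x_m`, the sign being `-1` to the sum of the degrees of
the factors before `x_v`. -/
def tensorDAt {g n : ℕ} (Γ : StableGraph g n) (v : Fin Γ.nv) : V.tensor Γ →ₗ[k] V.tensor Γ :=
  PiTensorProduct.map fun w =>
    if w < v then (V.obj (Γ.genus w) (Γ.val w)).scale (signOf k)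
    else if w = v then (V.obj (Γ.genus w) (Γ.val w)).d
    else LinearMap.id

/-- The direct sum of the `V((Γ))` over the stable graphs `Γ` of genus `g` with `n` labelled legs
and with numbered vertices and flags. -/
abbrev graphSum (g n : ℕ) : Type (max u v) := DirectSum (StableGraph g n) fun Γ => V.tensor Γ

/-- The decomposable element `⨂ v, x v` of `V((Γ))`, in the direct sum over all graphs. -/
def pureAt {g n : ℕ} (Γ : StableGraph g n)
    (x : ∀ v, (V.obj (Γ.genus v) (Γ.val v)).carrier) : V.graphSum g n :=
  DirectSum.lof k (StableGraph g n) (fun Γ => V.tensor Γ) Γ (PiTensorProduct.tprod k x)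

/-- The relation which an isomorphism `e` of stable graphs imposes: a homogeneous decomposable
element `⨂ v, x v` is identified with its image under `e`, up to the Koszul sign of the
permutation of its factors. -/
structure IsRelated {g n : ℕ} (Γ Γ' : StableGraph g n) (e : Γ.Iso Γ') (δ : Fin Γ.nv → ℤ)
    (x : ∀ v, (V.obj (Γ.genus v) (Γ.val v)).carrier)
    (y : ∀ v, (V.obj (Γ'.genus v) (Γ'.val v)).carrier) : Prop where
  mem : ∀ v, x v ∈ (V.obj (Γ.genus v) (Γ.val v)).gr (δ v)
  eq : ∀ v, y (e.vert v) = V.relabel (e.genus_vert v) (e.flag v) (x v)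

/-- The subspace spanned by all these relations; the quotient by it is the colimit of
`Γ ↦ V((Γ))` over the isomorphisms of stable graphs. -/
def relations (g n : ℕ) : Submodule k (V.graphSum g n) :=
  Submodule.span k {r | ∃ (Γ Γ' : StableGraph g n) (e : Γ.Iso Γ') (δ : Fin Γ.nv → ℤ)
    (x : ∀ v, (V.obj (Γ.genus v) (Γ.val v)).carrier)
    (y : ∀ v, (V.obj (Γ'.genus v) (Γ'.val v)).carrier), V.IsRelated Γ Γ' e δ x y ∧
      r = V.pureAt Γ' y - signOf k (koszulExp e.vert δ) • V.pureAt Γ x}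

/-- The underlying vector space of `𝕄V((g, n))`. -/
abbrev freeCarrier (g n : ℕ) : Type (max u v) := V.graphSum g n ⧸ V.relations g n

/-- The component of degree `i` of `𝕄V((g, n))`: it is spanned by the classes of the homogeneous
decomposable elements of total degree `i`. -/
def freeGr (g n : ℕ) (i : ℤ) : Submodule k (V.freeCarrier g n) :=
  Submodule.span k {z | ∃ (Γ : StableGraph g n) (δ : Fin Γ.nv → ℤ)
    (x : ∀ v, (V.obj (Γ.genus v) (Γ.val v)).carrier),
    (∀ v, x v ∈ (V.obj (Γ.genus v) (Γ.val v)).gr (δ v)) ∧ ∑ v, δ v = i ∧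
      z = (V.relations g n).mkQ (V.pureAt Γ x)}

/-- The linear map on the direct sum over all graphs given by endomorphisms of its summands. -/
def graphMap {g n : ℕ} (F : ∀ Γ : StableGraph g n, V.tensor Γ →ₗ[k] V.tensor Γ) :
    V.graphSum g n →ₗ[k] V.graphSum g n :=
  DirectSum.toModule k _ _ fun Γ => DirectSum.lof k _ (fun Γ => V.tensor Γ) Γ ∘ₗ F Γ

theorem graphMap_pureAt {g n : ℕ} (F : ∀ Γ : StableGraph g n, V.tensor Γ →ₗ[k] V.tensor Γ)
    (Γ : StableGraph g n) (x : ∀ v, (V.obj (Γ.genus v) (Γ.val v)).carrier) :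
    V.graphMap F (V.pureAt Γ x) = DirectSum.lof k _ (fun Γ => V.tensor Γ) Γ
      (F Γ (PiTensorProduct.tprod k x)) := by
  simp [graphMap, pureAt]

/-- The differential on the direct sum over all graphs. -/
def graphD (g n : ℕ) : V.graphSum g n →ₗ[k] V.graphSum g n :=
  V.graphMap fun Γ => ∑ v, V.tensorDAt Γ v

/-- Relabelling the legs of `Γ` does not change `V((Γ))`. -/
def tensorRelabel {g n : ℕ} (σ : Equiv.Perm (Fin n)) (Γ : StableGraph g n) :
    V.tensor Γ →ₗ[k] V.tensor (Γ.smulLeg σ) :=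
  LinearMap.id (R := k) (M := V.tensor Γ)

/-- The action of `S_n` on the direct sum over all graphs, by relabelling the legs. -/
def graphRho (g n : ℕ) (σ : Equiv.Perm (Fin n)) : V.graphSum g n →ₗ[k] V.graphSum g n :=
  DirectSum.toModule k _ _ fun Γ =>
    DirectSum.lof k (StableGraph g n) (fun Γ => V.tensor Γ) (Γ.smulLeg σ) ∘ₗ V.tensorRelabel σ Γ

theorem graphRho_pureAt {g n : ℕ} (σ : Equiv.Perm (Fin n)) (Γ : StableGraph g n)
    (x : ∀ v, (V.obj (Γ.genus v) (Γ.val v)).carrier) :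
    V.graphRho g n σ (V.pureAt Γ x) = V.pureAt (Γ.smulLeg σ) x := by
  rw [graphRho, pureAt, DirectSum.toModule_lof]
  rfl

theorem tensorDAt_tprod {g n : ℕ} (Γ : StableGraph g n) (v : Fin Γ.nv) (δ : Fin Γ.nv → ℤ)
    (x : ∀ v, (V.obj (Γ.genus v) (Γ.val v)).carrier)
    (hx : ∀ v, x v ∈ (V.obj (Γ.genus v) (Γ.val v)).gr (δ v)) :
    V.tensorDAt Γ v (PiTensorProduct.tprod k x) = signOf k (degBefore δ v) •
      PiTensorProduct.tprod k (Function.update x v ((V.obj (Γ.genus v) (Γ.val v)).d (x v))) := by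
  have hsign : signOf k (degBefore δ v) = ∏ w, if w < v then signOf k (δ w) else 1 := by
    have h0 : signOf k 0 = 1 := by simp [signOf]
    let f : Multiplicative ℤ →* k :=
      { toFun a := signOf k a.toAdd
        map_one' := h0
        map_mul' a b := signOf_add _ _ }
    have hf := map_prod f (fun w => Multiplicative.ofAdd (if w < v then δ w else 0)) Finset.univ
    rw [← ofAdd_sum] at hf
    refine hf.trans (Finset.prod_congr rfl fun w _ => ?_)
    change signOf k (if w < v then δ w else 0) = _
    split_ifs
    · rfl
    · exact h0
  rw [hsign, ← MultilinearMap.map_smul_univ, tensorDAt, PiTensorProduct.map_tprod]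
  congr 1
  funext w
  rcases lt_trichotomy w v with h | rfl | h
  · rw [if_pos h, if_pos h, Function.update_of_ne h.ne, DGRep.scale_apply _ _ (hx w)]
  · rw [if_neg (lt_irrefl _), if_neg (lt_irrefl _), if_pos rfl, Function.update_self, one_smul]
  · rw [if_neg h.not_gt, if_neg h.not_gt, if_neg h.ne', Function.update_of_ne h.ne', one_smul]
    rfl

theorem update_mem {g n : ℕ} (Γ : StableGraph g n) (v : Fin Γ.nv) (δ : Fin Γ.nv → ℤ)
    (x : ∀ v, (V.obj (Γ.genus v) (Γ.val v)).carrier)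
    (hx : ∀ v, x v ∈ (V.obj (Γ.genus v) (Γ.val v)).gr (δ v)) (w : Fin Γ.nv) :
    Function.update x v ((V.obj (Γ.genus v) (Γ.val v)).d (x v)) w ∈
      (V.obj (Γ.genus w) (Γ.val w)).gr (Function.update δ v (δ v - 1) w) := by
  rcases eq_or_ne w v with rfl | h
  · rw [Function.update_self, Function.update_self]
    exact (V.obj _ _).d_mem _ _ (hx w)
  · rw [Function.update_of_ne h, Function.update_of_ne h]
    exact hx w

theorem graphD_pureAt {g n : ℕ} (Γ : StableGraph g n) (δ : Fin Γ.nv → ℤ)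
    (x : ∀ v, (V.obj (Γ.genus v) (Γ.val v)).carrier)
    (hx : ∀ v, x v ∈ (V.obj (Γ.genus v) (Γ.val v)).gr (δ v)) :
    V.graphD g n (V.pureAt Γ x) = ∑ v, signOf k (degBefore δ v) •
      V.pureAt Γ (Function.update x v ((V.obj (Γ.genus v) (Γ.val v)).d (x v))) := by
  rw [graphD, graphMap_pureAt, LinearMap.sum_apply, map_sum]
  refine Finset.sum_congr rfl fun v _ => ?_
  rw [V.tensorDAt_tprod Γ v δ x hx, map_smul]
  rfl

variable {V} in
theorem IsRelated.mem' {g n : ℕ} {Γ Γ' : StableGraph g n} {e : Γ.Iso Γ'} {δ : Fin Γ.nv → ℤ}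
    {x : ∀ v, (V.obj (Γ.genus v) (Γ.val v)).carrier}
    {y : ∀ v, (V.obj (Γ'.genus v) (Γ'.val v)).carrier} (h : V.IsRelated Γ Γ' e δ x y)
    (v : Fin Γ'.nv) : y v ∈ (V.obj (Γ'.genus v) (Γ'.val v)).gr (δ (e.vert.symm v)) := by
  obtain ⟨v, rfl⟩ := e.vert.surjective v
  rw [h.eq, Equiv.symm_apply_apply]
  exact V.relabel_mem _ _ _ _ (h.mem v)

variable {V} in
theorem IsRelated.update {g n : ℕ} {Γ Γ' : StableGraph g n} {e : Γ.Iso Γ'} {δ : Fin Γ.nv → ℤ}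
    {x : ∀ v, (V.obj (Γ.genus v) (Γ.val v)).carrier}
    {y : ∀ v, (V.obj (Γ'.genus v) (Γ'.val v)).carrier} (h : V.IsRelated Γ Γ' e δ x y)
    (v : Fin Γ.nv) : V.IsRelated Γ Γ' e (Function.update δ v (δ v - 1))
      (Function.update x v ((V.obj (Γ.genus v) (Γ.val v)).d (x v)))
      (Function.update y (e.vert v) ((V.obj _ _).d (y (e.vert v)))) where
  mem := V.update_mem Γ v δ x h.mem
  eq w := by
    rcases eq_or_ne w v with rfl | hw
    · rw [Function.update_self, Function.update_self, h.eq, V.relabel_d]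
    · rw [Function.update_of_ne hw, Function.update_of_ne (e.vert.injective.ne hw), h.eq]

theorem graphD_relations (g n : ℕ) : V.relations g n ≤ (V.relations g n).comap (V.graphD g n) := by
  refine Submodule.span_le.mpr ?_
  rintro _ ⟨Γ, Γ', e, δ, x, y, h, rfl⟩
  change V.graphD g n _ ∈ V.relations g n
  rw [map_sub, map_smul, V.graphD_pureAt Γ δ x h.mem,
    V.graphD_pureAt Γ' (fun v => δ (e.vert.symm v)) y h.mem', ← e.vert.sum_comp, Finset.smul_sum,
    ← Finset.sum_sub_distrib]
  refine Submodule.sum_mem _ fun v _ => ?_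
  have hr : V.pureAt Γ' (Function.update y (e.vert v) ((V.obj _ _).d (y (e.vert v)))) -
      signOf k (koszulExp e.vert (Function.update δ v (δ v - 1))) • V.pureAt Γ
        (Function.update x v ((V.obj (Γ.genus v) (Γ.val v)).d (x v))) ∈ V.relations g n :=
    Submodule.subset_span ⟨Γ, Γ', e, _, _, _, h.update v, rfl⟩
  have hs := koszulExp_update e.vert δ (fun v => δ (e.vert.symm v)) (by simp) v
  convert Submodule.smul_mem _
    (signOf k (degBefore (fun v => δ (e.vert.symm v)) (e.vert v))) hr using 1
  rw [smul_sub, smul_smul, smul_smul, ← signOf_add, ← signOf_add]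
  congr 2
  refine signOf_eq_of_even ?_
  obtain ⟨c, hc⟩ := hs
  exact ⟨-c - degBefore (fun v => δ (e.vert.symm v)) (e.vert v) + degBefore δ v, by linarith⟩

theorem graphRho_relations (g n : ℕ) (σ : Equiv.Perm (Fin n)) :
    V.relations g n ≤ (V.relations g n).comap (V.graphRho g n σ) := by
  refine Submodule.span_le.mpr ?_
  rintro _ ⟨Γ, Γ', e, δ, x, y, h, rfl⟩
  change V.graphRho g n σ _ ∈ V.relations g n
  rw [map_sub, map_smul, graphRho_pureAt, graphRho_pureAt]
  exact Submodule.subset_span ⟨Γ.smulLeg σ, Γ'.smulLeg σ, e.smulLeg σ, δ, x, y, ⟨h.mem, h.eq⟩, rfl⟩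

/-- The differential of `𝕄V((g, n))`. -/
def freeD (g n : ℕ) : V.freeCarrier g n →ₗ[k] V.freeCarrier g n :=
  (V.relations g n).mapQ (V.relations g n) (V.graphD g n) (V.graphD_relations g n)

/-- The action of a permutation on `𝕄V((g, n))`. -/
def freeRho (g n : ℕ) (σ : Equiv.Perm (Fin n)) : V.freeCarrier g n →ₗ[k] V.freeCarrier g n :=
  (V.relations g n).mapQ (V.relations g n) (V.graphRho g n σ) (V.graphRho_relations g n σ)

theorem freeRho_mkQ {g n : ℕ} (σ : Equiv.Perm (Fin n)) (Γ : StableGraph g n)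
    (x : ∀ v, (V.obj (Γ.genus v) (Γ.val v)).carrier) :
    V.freeRho g n σ ((V.relations g n).mkQ (V.pureAt Γ x)) =
      (V.relations g n).mkQ (V.pureAt (Γ.smulLeg σ) x) := by
  rw [← V.graphRho_pureAt]
  rfl

theorem freeD_mkQ {g n : ℕ} (Γ : StableGraph g n) (δ : Fin Γ.nv → ℤ)
    (x : ∀ v, (V.obj (Γ.genus v) (Γ.val v)).carrier)
    (hx : ∀ v, x v ∈ (V.obj (Γ.genus v) (Γ.val v)).gr (δ v)) :
    V.freeD g n ((V.relations g n).mkQ (V.pureAt Γ x)) = ∑ v, signOf k (degBefore δ v) •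
      (V.relations g n).mkQ
        (V.pureAt Γ (Function.update x v ((V.obj (Γ.genus v) (Γ.val v)).d (x v)))) := by
  change (V.relations g n).mkQ (V.graphD g n _) = _
  rw [V.graphD_pureAt Γ δ x hx, map_sum]
  simp only [map_smul]

theorem iSup_freeGr (g n : ℕ) : ⨆ i, V.freeGr g n i = ⊤ := by
  rw [eq_top_iff]
  rintro z -
  obtain ⟨z, rfl⟩ := (V.relations g n).mkQ_surjective z
  induction z using DirectSum.induction_on with
  | zero => simp
  | add x y hx hy => rw [map_add]; exact Submodule.add_mem _ hx hy
  | of Γ t =>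
    have ht : t ∈ Submodule.span k (Set.range (PiTensorProduct.tprod k
        (s := fun v : Fin Γ.nv => (V.obj (Γ.genus v) (Γ.val v)).carrier))) := by
      rw [PiTensorProduct.span_tprod_eq_top]
      trivial
    change (V.relations g n).mkQ (DirectSum.lof k _ (fun Γ => V.tensor Γ) Γ t) ∈ _
    induction ht using Submodule.span_induction with
    | zero => simp
    | add x y _ _ hx hy => rw [map_add, map_add]; exact Submodule.add_mem _ hx hy
    | smul c x _ hx => rw [map_smul, map_smul]; exact Submodule.smul_mem _ c hx
    | mem t ht =>
      obtain ⟨x, rfl⟩ := ht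
      choose s hs using fun v => (V.obj (Γ.genus v) (Γ.val v)).exists_sum_proj (x v)
      have hx : x = fun v => ∑ i ∈ s v, (V.obj (Γ.genus v) (Γ.val v)).proj i (x v) :=
        funext hs
      have ht := (PiTensorProduct.tprod k
        (s := fun v : Fin Γ.nv => (V.obj (Γ.genus v) (Γ.val v)).carrier)).map_sum_finset
        (fun v i => (V.obj (Γ.genus v) (Γ.val v)).proj i (x v)) s
      rw [← hx] at ht
      rw [ht, map_sum, map_sum]
      refine Submodule.sum_mem _ fun δ _ => Submodule.mem_iSup_of_mem (∑ v, δ v) ?_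
      exact Submodule.subset_span ⟨Γ, δ, _, fun v => (V.obj _ _).proj_mem _ _, rfl, rfl⟩

/-- A property of the elements of `𝕄V((g, n))` closed under linear combinations holds if it holds
for the classes of the homogeneous decomposable elements. -/
theorem free_induction {g n : ℕ} (P : Submodule k (V.freeCarrier g n))
    (hP : ∀ (Γ : StableGraph g n) (δ : Fin Γ.nv → ℤ)
      (x : ∀ v, (V.obj (Γ.genus v) (Γ.val v)).carrier),
      (∀ v, x v ∈ (V.obj (Γ.genus v) (Γ.val v)).gr (δ v)) →
        (V.relations g n).mkQ (V.pureAt Γ x) ∈ P) (z : V.freeCarrier g n) : z ∈ P := by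
  have h : (⊤ : Submodule k (V.freeCarrier g n)) ≤ P := by
    rw [← V.iSup_freeGr]
    refine iSup_le fun i => Submodule.span_le.mpr ?_
    rintro _ ⟨Γ, δ, x, hx, -, rfl⟩
    exact hP Γ δ x hx
  exact h trivial

theorem freeD_freeD [CharZero k] (g n : ℕ) (z : V.freeCarrier g n) :
    V.freeD g n (V.freeD g n z) = 0 := by
  refine V.free_induction (LinearMap.ker (V.freeD g n ∘ₗ V.freeD g n)) ?_ z
  intro Γ δ x hx
  rw [LinearMap.mem_ker, LinearMap.comp_apply, V.freeD_mkQ Γ δ x hx, map_sum]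
  let D : Fin Γ.nv → (∀ v, (V.obj (Γ.genus v) (Γ.val v)).carrier) →
      ∀ v, (V.obj (Γ.genus v) (Γ.val v)).carrier :=
    fun v x => Function.update x v ((V.obj (Γ.genus v) (Γ.val v)).d (x v))
  let a : Fin Γ.nv → Fin Γ.nv → V.freeCarrier g n := fun v w =>
    signOf k (degBefore δ v + degBefore (Function.update δ v (δ v - 1)) w) •
      (V.relations g n).mkQ (V.pureAt Γ (D w (D v x)))
  have hsum : ∑ v, V.freeD g n (signOf k (degBefore δ v) •
      (V.relations g n).mkQ (V.pureAt Γ (D v x))) = ∑ v, ∑ w, a v w := by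
    refine Finset.sum_congr rfl fun v _ => ?_
    rw [map_smul, V.freeD_mkQ Γ _ _ (V.update_mem Γ v δ x hx), Finset.smul_sum]
    refine Finset.sum_congr rfl fun w _ => ?_
    rw [smul_smul, ← signOf_add]
  change ∑ v, V.freeD g n (signOf k (degBefore δ v) •
      (V.relations g n).mkQ (V.pureAt Γ (D v x))) = 0
  rw [hsum]
  have hlt : ∀ v w, v < w → a w v = - a v w := by
    intro v w h
    have hD : D v (D w x) = D w (D v x) := by
      simp only [D]
      rw [Function.update_of_ne h.ne, Function.update_of_ne h.ne',
        Function.update_comm h.ne']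
    have hs : signOf k (degBefore δ w + degBefore (Function.update δ w (δ w - 1)) v) =
        - signOf k (degBefore δ v + degBefore (Function.update δ v (δ v - 1)) w) := by
      rw [degBefore_update_of_le δ h.le, degBefore_update_of_lt δ h]
      have h1 : signOf k (-1) = -1 := by simp [signOf]
      rw [← neg_one_mul, ← h1, ← signOf_add]
      refine signOf_eq_of_even ⟨1, by ring⟩
    simp only [a]
    rw [hD, hs, neg_smul]
  have heq : ∀ v, a v v = 0 := by
    intro v
    have hz : D v (D v x) v = 0 := by simp [D, (V.obj _ _).d_d]
    simp only [a, pureAt]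
    rw [MultilinearMap.map_coord_zero _ v hz, map_zero, map_zero, smul_zero]
  have hanti : ∀ v w, a w v = - a v w := by
    intro v w
    rcases lt_trichotomy v w with h | rfl | h
    · exact hlt v w h
    · rw [heq, neg_zero]
    · rw [hlt w v h, neg_neg]
  have hneg : ∑ v, ∑ w, a v w = - ∑ v, ∑ w, a v w := by
    conv_lhs => rw [Finset.sum_comm]
    rw [← Finset.sum_neg_distrib]
    refine Finset.sum_congr rfl fun v _ => ?_
    rw [← Finset.sum_neg_distrib]
    exact Finset.sum_congr rfl fun w _ => hanti v w
  have h2 : (2 : k) • ∑ v, ∑ w, a v w = 0 := by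
    rw [two_smul]
    exact eq_neg_iff_add_eq_zero.mp hneg
  exact (smul_eq_zero.mp h2).resolve_left two_ne_zero

/-- The free modular operad `𝕄V` generated by `V`, as a stable `S`-module: `𝕄V((g, n))` is the
colimit of `Γ ↦ V((Γ))` over the isomorphisms of stable graphs of genus `g` with `n` labelled
legs. -/
def free [CharZero k] : StableSModule.{u, max u v} k where
  obj g n :=
    { carrier := V.freeCarrier g n
      gr := V.freeGr g n
      isInternal := by
        let F : V.graphSum g n →ₗ[k] V.graphSum g n := V.graphMap fun Γ =>
          PiTensorProduct.map fun v =>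
            (V.obj (Γ.genus v) (Γ.val v)).scale fun i => (2 : k) ^ i
        have hF : ∀ (Γ : StableGraph g n) (δ : Fin Γ.nv → ℤ)
            (x : ∀ v, (V.obj (Γ.genus v) (Γ.val v)).carrier),
            (∀ v, x v ∈ (V.obj (Γ.genus v) (Γ.val v)).gr (δ v)) →
            F (V.pureAt Γ x) = (2 : k) ^ (∑ v, δ v) • V.pureAt Γ x := by
          intro Γ δ x hx
          have h2 : (2 : k) ^ (∑ v, δ v) = ∏ v, (2 : k) ^ δ v := by
            classical
            refine Finset.induction_on Finset.univ (by simp) fun v s hv ih => ?_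
            rw [Finset.sum_insert hv, Finset.prod_insert hv, zpow_add₀ two_ne_zero, ih]
          rw [h2, V.graphMap_pureAt, PiTensorProduct.map_tprod, pureAt, ← map_smul,
            ← MultilinearMap.map_smul_univ]
          congr 2
          exact funext fun v => DGRep.scale_apply _ _ (hx v)
        have hrel : V.relations g n ≤ (V.relations g n).comap F := by
          refine Submodule.span_le.mpr ?_
          rintro _ ⟨Γ, Γ', e, δ, x, y, h, rfl⟩
          change F _ ∈ V.relations g n
          rw [map_sub, map_smul, hF Γ δ x h.mem, hF Γ' _ y h.mem', ← e.vert.sum_comp]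
          simp only [Equiv.symm_apply_apply]
          have hr : V.pureAt Γ' y - signOf k (koszulExp e.vert δ) • V.pureAt Γ x ∈
              V.relations g n := Submodule.subset_span ⟨Γ, Γ', e, δ, x, y, h, rfl⟩
          have hr2 := Submodule.smul_mem _ ((2 : k) ^ ∑ v, δ v) hr
          rw [smul_sub] at hr2
          rw [smul_comm]
          exact hr2
        refine isInternal_of_eigen _ ((V.relations g n).mapQ (V.relations g n) F hrel) ?_
          (V.iSup_freeGr g n)
        intro i z hz
        refine Submodule.span_induction (p := fun z _ =>
          (V.relations g n).mapQ (V.relations g n) F hrel z = (2 : k) ^ i • z)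
          ?_ (by simp) (fun x y _ _ hx hy => by rw [map_add, hx, hy, smul_add])
          (fun c x _ hx => by rw [map_smul, hx, smul_comm]) hz
        rintro _ ⟨Γ, δ, x, hx, rfl, rfl⟩
        change (V.relations g n).mkQ (F _) = _
        rw [hF Γ δ x hx, map_smul]
      d := V.freeD g n
      d_mem := by
        rintro i z hz
        refine Submodule.span_induction (p := fun z _ => V.freeD g n z ∈ V.freeGr g n (i - 1))
          ?_ (by simp) (fun x y _ _ hx hy => by rw [map_add]; exact Submodule.add_mem _ hx hy)
          (fun c x _ hx => by rw [map_smul]; exact Submodule.smul_mem _ c hx) hz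
        rintro _ ⟨Γ, δ, x, hx, rfl, rfl⟩
        rw [V.freeD_mkQ Γ δ x hx]
        refine Submodule.sum_mem _ fun v _ => Submodule.smul_mem _ _ (Submodule.subset_span ?_)
        exact ⟨Γ, _, _, V.update_mem Γ v δ x hx, sum_update_sub_one δ v, rfl⟩
      d_d := V.freeD_freeD g n
      ρ :=
        { toFun := V.freeRho g n
          map_one' := by
            refine LinearMap.ext fun z => ?_
            refine V.free_induction (LinearMap.eqLocus (V.freeRho g n 1) 1) ?_ z
            intro Γ δ x _
            exact V.freeRho_mkQ 1 Γ x
          map_mul' σ τ := by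
            refine LinearMap.ext fun z => ?_
            refine V.free_induction (LinearMap.eqLocus (V.freeRho g n (σ * τ))
              (V.freeRho g n σ * V.freeRho g n τ)) ?_ z
            intro Γ δ x _
            refine (V.freeRho_mkQ (σ * τ) Γ x).trans ?_
            rw [Module.End.mul_apply, V.freeRho_mkQ τ]
            exact (V.freeRho_mkQ σ (Γ.smulLeg τ) x).symm }
      ρ_mem := by
        rintro σ i z hz
        refine Submodule.span_induction (p := fun z _ => V.freeRho g n σ z ∈ V.freeGr g n i)
          ?_ (by simp) (fun x y _ _ hx hy => by rw [map_add]; exact Submodule.add_mem _ hx hy)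
          (fun c x _ hx => by rw [map_smul]; exact Submodule.smul_mem _ c hx) hz
        rintro _ ⟨Γ, δ, x, hx, rfl, rfl⟩
        rw [V.freeRho_mkQ]
        exact Submodule.subset_span ⟨Γ.smulLeg σ, δ, x, hx, rfl, rfl⟩
      ρ_d := by
        intro σ z
        refine V.free_induction (LinearMap.eqLocus (V.freeRho g n σ ∘ₗ V.freeD g n)
          (V.freeD g n ∘ₗ V.freeRho g n σ)) ?_ z
        intro Γ δ x hx
        rw [LinearMap.mem_eqLocus, LinearMap.comp_apply, LinearMap.comp_apply, V.freeRho_mkQ,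
          V.freeD_mkQ Γ δ x hx, V.freeD_mkQ (Γ.smulLeg σ) δ x hx, map_sum]
        refine Finset.sum_congr rfl fun v _ => ?_
        rw [map_smul, V.freeRho_mkQ]
        rfl }
  stable g n h := by
    have : IsEmpty (StableGraph g n) := ⟨fun Γ => absurd Γ.stable_genus (not_lt.mpr h)⟩
    have : Subsingleton (V.graphSum g n) := by
      refine ⟨fun x y => DFinsupp.ext fun Γ => isEmptyElim Γ⟩
    exact (V.relations g n).mkQ_surjective.subsingleton

end StableSModule
end FreeModularOperad

section Convergence

/-! The families whose sums are taken in these definitions are summable. -/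

variable {k : Type u} [Field k]

theorem HMono.isPWO_of_weight {S : Set HMono} (N : ℤ) (hN : ∀ m ∈ S, N ≤ m.weight)
    (hfin : ∀ w : ℤ, {m ∈ S | m.weight = w}.Finite) : S.IsPWO := by
  intro s
  by_cases h : ∃ j, 0 < j ∧ (s 0).1.weight < (s j).1.weight
  · obtain ⟨j, hj, h⟩ := h
    exact ⟨0, j, hj, Or.inr h⟩
  · push Not at h
    have hT : (⋃ w ∈ Set.Icc N (s 0).1.weight, {m ∈ S | m.weight = w}).Finite :=
      (Set.finite_Icc _ _).biUnion fun w _ => hfin w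
    have hmem : ∀ j, (s j).1 ∈ ⋃ w ∈ Set.Icc N (s 0).1.weight, {m ∈ S | m.weight = w} := by
      intro j
      refine Set.mem_biUnion (x := (s j).1.weight) ⟨hN _ (s j).2, ?_⟩ ⟨(s j).2, rfl⟩
      rcases Nat.eq_zero_or_pos j with rfl | hj
      · exact le_rfl
      · exact h j hj
    have : Finite ↥(⋃ w ∈ Set.Icc N (s 0).1.weight, {m ∈ S | m.weight = w}) := hT
    obtain ⟨i, j, hij, he⟩ := Finite.exists_ne_map_eq_of_infinite
      (fun j => (⟨(s j).1, hmem j⟩ : ↥(⋃ w ∈ Set.Icc N (s 0).1.weight, {m ∈ S | m.weight = w})))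
    have he' : (s i).1 = (s j).1 := by simpa using he
    rcases lt_or_gt_of_ne hij with h' | h'
    · exact ⟨i, j, h', Or.inl he'⟩
    · exact ⟨j, i, h', Or.inl he'.symm⟩

theorem HMono.finite_of_isPWO {S : Set HMono} (hS : S.IsPWO) (w : ℤ) :
    {m ∈ S | m.weight = w}.Finite := by
  by_contra h
  let s := Set.Infinite.natEmbedding _ h
  obtain ⟨i, j, hij, hle⟩ := hS fun t => ⟨(s t).1, (s t).2.1⟩
  rcases hle with hle | hle
  · exact hij.ne (s.injective (Subtype.ext hle))
  · exact absurd hle (by simp [(s i).2.2, (s j).2.2])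

/-- All the monomials of `f` have weight at least `N`, i.e. `f ∈ F^N Λ((ħ))`. -/
def WeightGE (N : ℤ) (f : LambdaHbar k) : Prop := ∀ m, f.coeff m ≠ 0 → N ≤ m.weight

theorem isSummable_of_weight {ι : Type*} {F : ι → LambdaHbar k} (N : ℤ)
    (hN : ∀ a, WeightGE N (F a))
    (hfin : ∀ w : ℤ, {a | ∃ m, (F a).coeff m ≠ 0 ∧ m.weight = w}.Finite) : IsSummable F := by
  refine ⟨HMono.isPWO_of_weight N ?_ fun w => ?_, fun m => ?_⟩
  · intro m hm
    obtain ⟨a, ha⟩ := Set.mem_iUnion.mp hm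
    exact hN a m ha
  · refine ((hfin w).biUnion fun a _ => HMono.finite_of_isPWO (F a).isPWO_support w).subset ?_
    rintro m ⟨hm, hw⟩
    obtain ⟨a, ha⟩ := Set.mem_iUnion.mp hm
    exact Set.mem_biUnion (show a ∈ {a | ∃ m, (F a).coeff m ≠ 0 ∧ m.weight = w} from
      ⟨m, ha, hw⟩) ⟨ha, hw⟩
  · exact (hfin m.weight).subset fun a ha => ⟨m, ha, rfl⟩

theorem exists_of_infSum_coeff_ne {ι : Type*} {F : ι → LambdaHbar k} {m : HMono}
    (h : (infSum F).coeff m ≠ 0) : ∃ a, (F a).coeff m ≠ 0 := by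
  by_contra hF
  push Not at hF
  refine h ?_
  rw [infSum]
  split_ifs with hs
  · exact (finsum_congr hF).trans finsum_zero
  · rfl

theorem WeightGE.infSum {ι : Type*} {F : ι → LambdaHbar k} {N : ℤ}
    (h : ∀ a, WeightGE N (F a)) : WeightGE N (infSum F) := by
  intro m hm
  obtain ⟨a, ha⟩ := exists_of_infSum_coeff_ne hm
  exact h a m ha

theorem WeightGE.smul {N : ℤ} {f : LambdaHbar k} (h : WeightGE N f) (c : k) :
    WeightGE N (c • f) := fun m hm => h m (right_ne_zero_of_mul (by simpa using hm))

theorem WeightGE.mono {N N' : ℤ} {f : LambdaHbar k} (h : WeightGE N f) (h' : N' ≤ N) :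
    WeightGE N' f := fun m hm => h'.trans (h m hm)

theorem WeightGE.mul {N N' : ℤ} {f f' : LambdaHbar k} (h : WeightGE N f) (h' : WeightGE N' f') :
    WeightGE (N + N') (f * f') := by
  intro m hm
  obtain ⟨a, ha, b, hb, rfl⟩ := HahnSeries.support_mul_subset hm
  rw [map_add]
  exact add_le_add (h a ha) (h' b hb)

theorem WeightGE.one : WeightGE 0 (1 : LambdaHbar k) := by
  intro m hm
  have : m = 0 := by
    by_contra h
    exact hm (by simp [HahnSeries.coeff_one, h])
  simp [this]

theorem WeightGE.pow {f : LambdaHbar k} (h : WeightGE 1 f) (r : ℕ) : WeightGE r (f ^ r) := by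
  induction r with
  | zero => simpa using WeightGE.one
  | succ r ih =>
    rw [pow_succ]
    push_cast
    exact ih.mul h

theorem WeightGE.pleth {f : LambdaHbar k} (h : WeightGE 1 f) (n : ℕ+) :
    WeightGE n (pleth n f) := by
  intro m hm
  obtain ⟨a, ha, rfl⟩ := HahnSeries.support_embDomain_subset hm
  change (n : ℤ) ≤ (HMono.dilate n a).weight
  rw [HMono.weight_dilate]
  have := h a ha
  have hn : (0 : ℤ) < n := by exact_mod_cast n.pos
  nlinarith

/-- A family is summable if the weights of its members are positive and tend to infinity. -/
theorem isSummable_of_le {ι : Type*} {F : ι → LambdaHbar k} (c : ι → ℕ)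
    (hc : Function.Injective c) (hF : ∀ a, WeightGE (c a) (F a)) : IsSummable F := by
  refine isSummable_of_weight 0 (fun a => (hF a).mono (by positivity)) fun w => ?_
  refine ((Set.finite_Iic w.toNat).preimage hc.injOn).subset ?_
  rintro a ⟨m, hm, rfl⟩
  have := hF a m hm
  simp only [Set.mem_preimage, Set.mem_Iic]
  omega

theorem isSummable_expSeries {f : LambdaHbar k} (h : WeightGE 1 f) :
    IsSummable fun r : ℕ => ((r.factorial : k)⁻¹) • f ^ r :=
  isSummable_of_le id Function.injective_id fun r => (h.pow r).smul _

theorem isSummable_logSeries {F : LambdaHbar k} (h : WeightGE 1 (F - 1)) :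
    IsSummable fun r : ℕ+ => ((-1) ^ ((r : ℕ) + 1) / (r : k)) • (F - 1) ^ (r : ℕ) :=
  isSummable_of_le _ PNat.coe_injective fun r => (h.pow r).smul _

theorem isSummable_plethExp {f : LambdaHbar k} (h : WeightGE 1 f) :
    IsSummable fun n : ℕ+ => ((n : k)⁻¹) • pleth n f :=
  isSummable_of_le _ PNat.coe_injective fun n => (h.pleth n).smul _

theorem isSummable_plethLog {F : LambdaHbar k} (h : WeightGE 1 (F - 1)) :
    IsSummable fun n : ℕ+ =>
      ((ArithmeticFunction.moebius n : k) / (n : k)) • logSeries (pleth n F) := by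
  refine isSummable_of_le _ PNat.coe_injective fun n => (WeightGE.infSum fun r => ?_).smul _
  refine WeightGE.smul (WeightGE.mono (N := r * n) ?_ ?_) _
  · rw [← map_one (pleth n), ← map_sub, ← map_pow]
    intro m hm
    obtain ⟨a, ha, rfl⟩ := HahnSeries.support_embDomain_subset hm
    change _ ≤ (HMono.dilate n a).weight
    rw [HMono.weight_dilate, mul_comm]
    exact mul_le_mul_of_nonneg_left (h.pow r a ha) (by positivity)
  · have : (1 : ℤ) ≤ (r : ℕ) := by exact_mod_cast r.pos
    have hn : (0 : ℤ) ≤ ((n : ℕ) : ℤ) := by positivity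
    nlinarith

theorem weight_mk (i : ℤ) (m : ℕ+ →₀ ℕ) :
    (HMono.mk i m).weight = 2 * i + m.sum fun j e => (j : ℤ) * e := rfl

/-- The number of factors `p_j` of a monomial. -/
def HMono.deg (m : HMono) : ℕ := m.2.degree

theorem HMono.deg_add (a b : HMono) : (a + b).deg = a.deg + b.deg := map_add Finsupp.degree a.2 b.2

theorem laplacian_term {f : LambdaHbar k} {n : ℕ+} {m : HMono}
    (h : (hbarPow (n : ℤ) * (((n : k) / 2) • pDeriv n (pDeriv n f) + pDeriv (2 * n) f)).coeff m
      ≠ 0) :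
    ∃ m' : HMono, f.coeff m' ≠ 0 ∧ m'.weight = m.weight ∧ m.deg + 1 ≤ m'.deg ∧
      (m'.2 n ≠ 0 ∨ m'.2 (2 * n) ≠ 0) := by
  obtain ⟨a, ha, b, hb, rfl⟩ := HahnSeries.support_mul_subset h
  have ha' : a = HMono.mk n 0 := by
    by_contra hne
    exact ha (HahnSeries.coeff_single_of_ne hne)
  subst ha'
  have hdeg0 : (HMono.mk (n : ℤ) 0).deg = 0 := map_zero Finsupp.degree
  have hdeg1 : ∀ j : ℕ+, (HMono.mk 0 (Finsupp.single j 1)).deg = 1 :=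
    fun j => Finsupp.degree_single j 1
  have hsec : ∀ (x y : HMono) (j : ℕ+), (x + y).2 j = x.2 j + y.2 j := fun _ _ _ => rfl
  have hone : ∀ j : ℕ+, (HMono.mk 0 (Finsupp.single j 1)).2 j = 1 :=
    fun j => Finsupp.single_eq_same
  by_cases h1 : (pDeriv n (pDeriv n f)).coeff b = 0
  · have h2 : (pDeriv (2 * n) f).coeff b ≠ 0 := by
      intro h2
      refine hb ?_
      simp [h1, h2]
    refine ⟨_, right_ne_zero_of_mul h2, ?_, ?_, Or.inr ?_⟩
    · rw [map_add, map_add, weight_mk, weight_mk]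
      simp
      ring
    · simp only [HMono.deg_add, hdeg0, hdeg1]
      omega
    · rw [hsec, hone]
      omega
  · refine ⟨_, right_ne_zero_of_mul (right_ne_zero_of_mul h1), ?_, ?_, Or.inl ?_⟩
    · rw [map_add, map_add, map_add, weight_mk, weight_mk]
      simp
      ring
    · simp only [HMono.deg_add, hdeg0, hdeg1]
      omega
    · rw [hsec, hone]
      omega

theorem exists_weight_bound (f : LambdaHbar k) : ∃ N : ℤ, WeightGE N f := by
  rcases f.support.eq_empty_or_nonempty with h | h
  · exact ⟨0, fun m hm => absurd (show m ∈ f.support from hm) (by simp [h])⟩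
  · refine ⟨(f.isPWO_support.isWF.min h).weight, fun m hm => ?_⟩
    by_contra hlt
    refine f.isPWO_support.isWF.not_lt_min h hm (lt_of_le_of_ne (Or.inr (not_le.mp hlt)) ?_)
    rintro rfl
    exact hlt le_rfl

theorem isSummable_laplacian (f : LambdaHbar k) : IsSummable fun n : ℕ+ =>
    hbarPow (n : ℤ) * (((n : k) / 2) • pDeriv n (pDeriv n f) + pDeriv (2 * n) f) := by
  obtain ⟨N, hN⟩ := exists_weight_bound f
  refine isSummable_of_weight N (fun n m hm => ?_) fun w => ?_
  · obtain ⟨m', h1, h2, -⟩ := laplacian_term hm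
    exact h2 ▸ hN m' h1
  · refine ((HMono.finite_of_isPWO f.isPWO_support w).biUnion fun m' _ =>
      (m'.2.support.finite_toSet.union
        (m'.2.support.finite_toSet.preimage (mul_right_injective (2 : ℕ+)).injOn))).subset ?_
    rintro n ⟨m, hm, rfl⟩
    obtain ⟨m', h1, h2, -, h3⟩ := laplacian_term hm
    refine Set.mem_biUnion (x := m') ⟨h1, h2⟩ ?_
    rcases h3 with h3 | h3
    · exact Or.inl (by simpa using h3)
    · exact Or.inr (by simpa using h3)

theorem laplacian_iterate_term {f : LambdaHbar k} (r : ℕ) {m : HMono}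
    (h : (laplacian^[r] f).coeff m ≠ 0) :
    ∃ m' : HMono, f.coeff m' ≠ 0 ∧ m'.weight = m.weight ∧ m.deg + r ≤ m'.deg := by
  induction r generalizing m with
  | zero => exact ⟨m, h, rfl, le_rfl⟩
  | succ r ih =>
    rw [Function.iterate_succ_apply'] at h
    obtain ⟨n, hn⟩ := exists_of_infSum_coeff_ne h
    obtain ⟨m', h1, h2, h3, -⟩ := laplacian_term hn
    obtain ⟨m'', h4, h5, h6⟩ := ih h1
    exact ⟨m'', h4, h5.trans h2, by omega⟩

theorem isSummable_expLaplacian (f : LambdaHbar k) :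
    IsSummable fun r : ℕ => ((r.factorial : k)⁻¹) • laplacian^[r] f := by
  obtain ⟨N, hN⟩ := exists_weight_bound f
  refine isSummable_of_weight N (fun r => WeightGE.smul (fun m hm => ?_) _) fun w => ?_
  · obtain ⟨m', h1, h2, -⟩ := laplacian_iterate_term r hm
    exact h2 ▸ hN m' h1
  · refine ((HMono.finite_of_isPWO f.isPWO_support w).biUnion fun m' _ =>
      Set.finite_Iic m'.deg).subset ?_
    rintro r ⟨m, hm, rfl⟩
    obtain ⟨m', h1, h2, h3⟩ := laplacian_iterate_term r (right_ne_zero_of_mul hm)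
    refine Set.mem_biUnion (x := m') ⟨h1, h2⟩ ?_
    simp only [Set.mem_Iic]
    omega

theorem infSum_coeff_of_zero {F : ℕ → LambdaHbar k} (hF : IsSummable F) {m : HMono}
    (h : ∀ r, r ≠ 0 → (F r).coeff m = 0) : (infSum F).coeff m = (F 0).coeff m := by
  rw [infSum, dif_pos hF]
  exact finsum_eq_single (fun r => (F r).coeff m) 0 h

/-- `Exp` maps `F^1 Λ((ħ))` to `1 + F^1 Λ((ħ))`. -/
theorem WeightGE.plethExp {f : LambdaHbar k} (h : WeightGE 1 f) :
    WeightGE 1 (plethExp f - 1) := by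
  have hg : WeightGE 1 (ModOp.infSum fun n : ℕ+ => ((n : k)⁻¹) • ModOp.pleth n f) :=
    WeightGE.infSum fun n => ((h.pleth n).smul _).mono (by exact_mod_cast n.pos)
  intro m hm
  by_contra hlt
  refine hm ?_
  rw [HahnSeries.coeff_sub, sub_eq_zero]
  refine (infSum_coeff_of_zero (isSummable_expSeries hg) fun r hr => ?_).trans (by simp)
  by_contra hne
  have := (hg.pow r).smul _ m hne
  omega

/-- `exp Δ` maps `1 + F^1 Λ((ħ))` to itself. -/
theorem WeightGE.expLaplacian {F : LambdaHbar k} (h : WeightGE 1 (F - 1)) :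
    WeightGE 1 (expLaplacian F - 1) := by
  intro m hm
  by_contra hlt
  have hone : ∀ m : HMono, m.weight < 1 → F.coeff m = (1 : LambdaHbar k).coeff m := by
    intro m hm
    by_contra hne
    exact absurd (h m (by rwa [HahnSeries.coeff_sub, sub_ne_zero])) (not_le.mpr hm)
  refine hm ?_
  rw [HahnSeries.coeff_sub, sub_eq_zero]
  refine (infSum_coeff_of_zero (isSummable_expLaplacian F) fun r hr => ?_).trans
    (by simpa using hone m (not_le.mp hlt))
  by_contra hne
  obtain ⟨m', h1, h2, h3⟩ := laplacian_iterate_term r (right_ne_zero_of_mul hne)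
  rw [hone m' (h2 ▸ not_le.mp hlt)] at h1
  have h0 : m' = 0 := by
    by_contra h0
    exact h1 (by simp [HahnSeries.coeff_one, h0])
  have hd : (0 : HMono).deg = 0 := map_zero Finsupp.degree
  rw [h0, hd] at h3
  omega

theorem WeightGE.zero (N : ℤ) : WeightGE N (0 : LambdaHbar k) := fun _ hm => absurd rfl hm

theorem WeightGE.add {N : ℤ} {f f' : LambdaHbar k} (h : WeightGE N f) (h' : WeightGE N f') :
    WeightGE N (f + f') := by
  intro m hm
  by_cases hf : f.coeff m = 0
  · exact h' m (by simpa [hf] using hm)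
  · exact h m hf

theorem WeightGE.single (m : HMono) (c : k) : WeightGE m.weight (HahnSeries.single m c) := by
  intro m' hm
  by_cases h : m' = m
  · rw [h]
  · exact absurd (HahnSeries.coeff_single_of_ne h) hm

theorem WeightGE.cycleIndex {n : ℕ} (σ : Equiv.Perm (Fin n)) :
    WeightGE n (cycleIndex σ : LambdaHbar k) := by
  have h : ∀ s : Multiset ℕ, WeightGE s.sum (s.map fun a => pSum (k := k) a.toPNat').prod := by
    intro s
    induction s using Multiset.induction_on with
    | empty => simpa using WeightGE.one
    | cons a s ih =>
      rw [Multiset.map_cons, Multiset.prod_cons, Multiset.sum_cons]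
      push_cast
      refine WeightGE.mul (WeightGE.mono (WeightGE.single _ _) ?_) (by exact_mod_cast ih)
      rw [weight_mk]
      simp only [mul_zero, zero_add]
      rw [Finsupp.sum_single_index (by simp)]
      rcases Nat.eq_zero_or_pos a with rfl | ha
      · simp
      · simp [Nat.toPNat'_coe, ha]
  exact (h σ.partition.parts).mono (by simp [σ.partition.parts_sum])

theorem WeightGE.ch {n : ℕ} (V : DGRep.{u, v} k (Equiv.Perm (Fin n))) : WeightGE n V.ch := by
  refine finsum_induction (WeightGE (n : ℤ)) (WeightGE.zero _) (fun _ _ => WeightGE.add) fun i => ?_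
  rw [← Int.cast_smul_eq_zsmul k]
  refine WeightGE.smul (WeightGE.smul ?_ _) _
  exact Finset.sum_induction _ (WeightGE (n : ℤ)) (fun _ _ => WeightGE.add) (WeightGE.zero _)
    fun σ _ => (WeightGE.cycleIndex σ).smul _

theorem StableSModule.weightGE_term (V : StableSModule.{u, v} k) (g n : ℕ) :
    WeightGE (2 * ((g : ℤ) - 1) + n) (hbarPow ((g : ℤ) - 1) * (V.obj g n).ch) := by
  refine WeightGE.mul (WeightGE.mono (WeightGE.single _ _) ?_) (WeightGE.ch _)
  rw [weight_mk]
  simp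

theorem StableSModule.isSummable_characteristic (V : StableSModule.{u, v} k) :
    IsSummable fun a : {a : ℕ × ℕ // 2 < 2 * a.1 + a.2} =>
      hbarPow ((a.1.1 : ℤ) - 1) * (V.obj a.1.1 a.1.2).ch := by
  refine isSummable_of_weight 1 (fun a => (V.weightGE_term _ _).mono (by have := a.2; omega))
    fun w => ?_
  have hfin : ({a : ℕ × ℕ | a.1 ≤ (w + 2).toNat ∧ a.2 ≤ (w + 2).toNat} : Set (ℕ × ℕ)).Finite :=
    (Set.finite_Iic ((w + 2).toNat, (w + 2).toNat)).subset fun a ha => ha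
  refine (hfin.preimage Subtype.val_injective.injOn).subset ?_
  rintro a ⟨m, hm, rfl⟩
  have := V.weightGE_term _ _ m hm
  simp only [Set.mem_preimage, Set.mem_ofPred_eq]
  omega

/-- The characteristic of a stable `S`-module lies in `F^1 Λ((ħ))`. -/
theorem StableSModule.weightGE_characteristic (V : StableSModule.{u, v} k) :
    WeightGE 1 V.characteristic :=
  WeightGE.infSum fun a => (V.weightGE_term _ _).mono (by have := a.2; omega)

end Convergence

end ModOp

end

/-! Both characteristics are generating functions of stable graphs equipped with an automorphism,
and the two outer operations of the formula are combinatorial operations on such graphs.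

A graph with automorphism φ, connected or not, has a `Conf.weight`: a factor ħ for each edge, a
factor p_j for each cycle of j legs, and, for an orbit of ℓ vertices of genus g, the factor
ħ^(ℓ(g-1)) times the supertrace of the first return φ^ℓ on the factor of 𝒱 at one of these vertices.
`Conf.gsum` adds the weights of the graphs numbered by {1, …, M}, divided by M!. Over connected
graphs without edges, which are corollas, this gives Ch(𝒱) (`StableSModule.characteristic_eq`). Over
all connected graphs it gives Ch(𝕄𝒱) (`Conf.gsum_graphs` and `StableSModule.free_str`).

Disjoint unions account for Exp and Log. The Euler derivation θ marks a vertex or a flag. The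
φ-orbit of the component of the marked point consists of n copies of a connected graph, permuted
cyclically, and φ^n restricts to an automorphism of one copy. Arranging n copies in this way
multiplies the number of edges and all orbit lengths by n, so it acts on weights as the plethysm p_n
∘. Hence the series C of connected graphs and D of all graphs satisfy θD = (∑ p_n ∘ θC) D
(`Conf.euler_gsum_adm`). The solution with constant term 1 is unique, so D = Exp C, and Möbius
inversion gives C = Log D.

Edges account for exp(Δ). A graph with automorphism is an edgeless one together with an involution
of its flags commuting with φ. Such an involution either fixes a cycle pointwise, or exchanges it
with another cycle of the same length n, creating n edges, or rotates a cycle of length 2n by half a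
turn, again creating n edges. These are the terms p_n, ħ^n (n/2) ∂²/∂p_n² and ħ^n ∂/∂p_(2n)
(`isum_eq_expLaplacian`).

For the link with 𝕄𝒱, the colimit is a retract of the finite direct sum of all 𝒱((Γ)), by averaging
over isomorphisms. So the supertrace of a permutation σ of the labels is a weighted sum of
supertraces of those graph automorphisms which induce σ on the legs. The supertrace of a permutation
of tensor factors is a product over orbits of vertices, because the Koszul sign cancels all but one
of the sign operators along each orbit (`koszul_sign_eq`, `trace_tensor_eq`).

For the second statement, in characteristic 0 a complex with a finite group action retracts
equivariantly onto its homology, with a homotopy h (`DGRep.exists_retract`). Extend h to 𝕄𝒱 as a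
derivation. Then dh + hd is a derivation as well, and it multiplies a decomposable tensor by the
number of its factors lying in the acyclic complement. Since the number of vertices is bounded for
fixed g and n, a polynomial in dh + hd is the projector onto the tensors with all factors in the
image of the homology, and it is the identity up to boundaries on cycles. So 𝕄 commutes with
homology, and the first statement applies to H(𝒱). -/

noncomputable section

set_option linter.unusedSectionVars false

namespace ModOp

/-! ### Rearrangement of infinite sums in Λ((ħ)), and plethysms. -/

section SummationCalculus

variable {k : Type u} [Field k] {ι κ : Type*}

theorem infSum_coeff {F : ι → LambdaHbar k} (hF : IsSummable F) (m : HMono) :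
    (infSum F).coeff m = ∑ᶠ a, (F a).coeff m := by
  rw [infSum, dif_pos hF]
  rfl

theorem infSum_add {F G : ι → LambdaHbar k} (hF : IsSummable F) (hG : IsSummable G) :
    infSum (fun a => F a + G a) = infSum F + infSum G ∧ IsSummable fun a => F a + G a := by
  have h := HahnSeries.SummableFamily.hsum_add
    (s := HahnSeries.SummableFamily.mk F hF.1 hF.2) (t := HahnSeries.SummableFamily.mk G hG.1 hG.2)
  have hs : IsSummable fun a => F a + G a :=
    ⟨HahnSeries.SummableFamily.isPWO_iUnion_support
      (HahnSeries.SummableFamily.mk F hF.1 hF.2 + HahnSeries.SummableFamily.mk G hG.1 hG.2),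
      HahnSeries.SummableFamily.finite_co_support
      (HahnSeries.SummableFamily.mk F hF.1 hF.2 + HahnSeries.SummableFamily.mk G hG.1 hG.2)⟩
  refine ⟨?_, hs⟩
  rw [infSum, infSum, infSum, dif_pos hF, dif_pos hG, dif_pos hs, ← h]
  rfl

theorem infSum_mul_infSum {F : ι → LambdaHbar k} {G : κ → LambdaHbar k} (hF : IsSummable F)
    (hG : IsSummable G) : infSum F * infSum G = infSum (fun a : ι × κ => F a.1 * G a.2) ∧
      IsSummable fun a : ι × κ => F a.1 * G a.2 := by
  have h := HahnSeries.SummableFamily.hsum_mul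
    (HahnSeries.SummableFamily.mk F hF.1 hF.2) (HahnSeries.SummableFamily.mk G hG.1 hG.2)
  have hs : IsSummable fun a : ι × κ => F a.1 * G a.2 :=
    ⟨HahnSeries.SummableFamily.isPWO_iUnion_support
      ((HahnSeries.SummableFamily.mk F hF.1 hF.2).mul (HahnSeries.SummableFamily.mk G hG.1 hG.2)),
      HahnSeries.SummableFamily.finite_co_support
      ((HahnSeries.SummableFamily.mk F hF.1 hF.2).mul (HahnSeries.SummableFamily.mk G hG.1 hG.2))⟩
  refine ⟨?_, hs⟩
  rw [infSum, infSum, infSum, dif_pos hF, dif_pos hG, dif_pos hs, ← h]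
  rfl

theorem mul_infSum (f : LambdaHbar k) {F : ι → LambdaHbar k} (hF : IsSummable F) :
    f * infSum F = infSum (fun a => f * F a) ∧ IsSummable fun a => f * F a := by
  have h := HahnSeries.SummableFamily.hsum_smul (x := f)
    (s := HahnSeries.SummableFamily.mk F hF.1 hF.2)
  have he : ∀ a, (f • HahnSeries.SummableFamily.mk F hF.1 hF.2) a = f * F a := fun a => by
    rw [HahnSeries.SummableFamily.smul_apply]
    exact HahnSeries.of_symm_smul_of_eq_mul
  have hs : IsSummable fun a => f * F a := by
    have := HahnSeries.SummableFamily.isPWO_iUnion_support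
      (f • HahnSeries.SummableFamily.mk F hF.1 hF.2)
    have h2 := HahnSeries.SummableFamily.finite_co_support
      (f • HahnSeries.SummableFamily.mk F hF.1 hF.2)
    simp only [he] at this h2
    exact ⟨this, h2⟩
  refine ⟨?_, hs⟩
  rw [infSum, infSum, dif_pos hF, dif_pos hs]
  exact h.symm.trans (congrArg HahnSeries.SummableFamily.hsum
    (HahnSeries.SummableFamily.ext fun a => he a))

theorem smul_infSum (c : k) {F : ι → LambdaHbar k} (hF : IsSummable F) :
    c • infSum F = infSum (fun a => c • F a) ∧ IsSummable fun a => c • F a := by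
  have h := mul_infSum (HahnSeries.C c) hF
  simpa only [HahnSeries.C_mul_eq_smul] using h

theorem IsSummable.comp_injective {F : ι → LambdaHbar k} (hF : IsSummable F) {q : κ → ι}
    (hq : Function.Injective q) : IsSummable fun b => F (q b) :=
  ⟨hF.1.mono (Set.iUnion_subset fun b => Set.subset_iUnion (fun a => (F a).support) (q b)),
    fun m => (hF.2 m).preimage hq.injOn⟩

theorem infSum_equiv (e : κ ≃ ι) (F : ι → LambdaHbar k) :
    infSum (fun b => F (e b)) = infSum F := by
  by_cases hF : IsSummable F
  · refine HahnSeries.ext (funext fun m => ?_)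
    rw [infSum_coeff hF, infSum_coeff (hF.comp_injective e.injective)]
    exact finsum_comp_equiv e (f := fun a => (F a).coeff m)
  -- No summability is assumed: if one family is not summable neither is the other, and both sums
  -- are 0 by convention.
  · have hF' : ¬ IsSummable fun b => F (e b) := fun h => hF (by
      simpa using h.comp_injective e.symm.injective)
    rw [infSum, infSum, dif_neg hF, dif_neg hF']

theorem finsum_sigma {M : Type*} [AddCommMonoid M] {κ : ι → Type*} (f : (Σ i, κ i) → M)
    (hf : (Function.support f).Finite) :
    (∑ᶠ a, f a = ∑ᶠ i, ∑ᶠ j, f ⟨i, j⟩) ∧ (Function.support fun i => ∑ᶠ j, f ⟨i, j⟩).Finite := by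
  classical
  let S := hf.toFinset
  let I := S.image Sigma.fst
  let T : ∀ i, Finset (κ i) := fun i => S.preimage (Sigma.mk i) sigma_mk_injective.injOn
  have h1 : ∑ᶠ a, f a = ∑ a ∈ I.sigma T, f a := by
    refine finsum_eq_sum_of_support_subset f fun a ha => ?_
    have haS : a ∈ S := hf.mem_toFinset.mpr ha
    simp only [Finset.coe_sigma, Set.mem_sigma_iff, Finset.mem_coe]
    exact ⟨Finset.mem_image_of_mem _ haS, by simpa [T] using haS⟩
  have h2 : ∀ i, ∑ᶠ j, f ⟨i, j⟩ = ∑ j ∈ T i, f ⟨i, j⟩ := fun i =>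
    finsum_eq_sum_of_support_subset _ fun j hj => by
      simpa [T, S] using hj
  have h3 : (Function.support fun i => ∑ᶠ j, f ⟨i, j⟩) ⊆ I := fun i hi => by
    rw [Function.mem_support, h2] at hi
    obtain ⟨j, hj, -⟩ := Finset.exists_ne_zero_of_sum_ne_zero hi
    exact Finset.mem_coe.mpr (Finset.mem_image.mpr ⟨⟨i, j⟩, by simpa [T] using hj, rfl⟩)
  refine ⟨?_, I.finite_toSet.subset h3⟩
  rw [h1, Finset.sum_sigma, finsum_eq_sum_of_support_subset _ h3]
  exact Finset.sum_congr rfl fun i _ => (h2 i).symm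

theorem infSum_sigma {κ : ι → Type*} {F : (Σ i, κ i) → LambdaHbar k} (hF : IsSummable F) :
    infSum F = infSum (fun i => infSum fun j => F ⟨i, j⟩) ∧
      IsSummable fun i => infSum fun j => F ⟨i, j⟩ := by
  have hi : ∀ i, IsSummable fun j => F ⟨i, j⟩ := fun i => hF.comp_injective sigma_mk_injective
  have hs : IsSummable fun i => infSum fun j => F ⟨i, j⟩ := by
    refine ⟨hF.1.mono ?_, fun m => ?_⟩
    · refine Set.iUnion_subset fun i m hm => ?_
      obtain ⟨j, hj⟩ := exists_of_infSum_coeff_ne hm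
      exact Set.mem_iUnion.mpr ⟨⟨i, j⟩, hj⟩
    · have := (finsum_sigma (fun a => (F a).coeff m) (hF.2 m)).2
      simp only [infSum_coeff (hi _)]
      exact this
  refine ⟨HahnSeries.ext (funext fun m => ?_), hs⟩
  rw [infSum_coeff hF, infSum_coeff hs, (finsum_sigma (fun a => (F a).coeff m) (hF.2 m)).1]
  exact finsum_congr fun i => (infSum_coeff (hi i) m).symm

theorem infSum_prod {F : ι × κ → LambdaHbar k} (hF : IsSummable F) :
    infSum F = infSum (fun i => infSum fun j => F (i, j)) ∧
      IsSummable fun i => infSum fun j => F (i, j) := by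
  have := infSum_sigma (κ := fun _ : ι => κ) (F := fun a => F (Equiv.sigmaEquivProd ι κ a))
    (hF.comp_injective (Equiv.sigmaEquivProd ι κ).injective)
  rwa [infSum_equiv (Equiv.sigmaEquivProd ι κ) F] at this

/-- Summation over the fibres of a map. -/
theorem infSum_fiberwise {F : ι → LambdaHbar k} (hF : IsSummable F) (q : ι → κ) :
    infSum F = infSum (fun b => infSum fun a : {a // q a = b} => F a) ∧
      IsSummable fun b => infSum fun a : {a // q a = b} => F a := by
  have := infSum_sigma (κ := fun b : κ => {a // q a = b})
    (F := fun a => F (Equiv.sigmaFiberEquiv q a))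
    (hF.comp_injective (Equiv.sigmaFiberEquiv q).injective)
  rwa [infSum_equiv (Equiv.sigmaFiberEquiv q) F] at this

/-- By the pigeonhole principle, a sequence of monomials in a finite union of supports has an
infinite subsequence in a single support, to which partial well-ordering applies. -/
theorem isSummable_of_finite [Finite ι] (F : ι → LambdaHbar k) : IsSummable F := by
  classical
  refine ⟨?_, fun m => Set.toFinite _⟩
  intro s
  choose a ha using fun t => Set.mem_iUnion.mp (s t).2
  obtain ⟨i, hi⟩ := Finite.exists_infinite_fiber a
  let e := Nat.orderEmbeddingOfSet (a ⁻¹' {i})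
  have he : ∀ t, a (e t) = i := fun t => by
    have : e t ∈ Set.range e := ⟨t, rfl⟩
    rwa [Nat.orderEmbeddingOfSet_range] at this
  obtain ⟨t, t', h, hle⟩ := (F i).isPWO_support fun t => ⟨(s (e t)).1, he t ▸ ha (e t)⟩
  exact ⟨e t, e t', e.strictMono h, hle⟩

theorem coeff_sum' (s : Finset ι) (F : ι → LambdaHbar k) (m : HMono) :
    (∑ a ∈ s, F a).coeff m = ∑ a ∈ s, (F a).coeff m := by
  classical
  induction s using Finset.induction_on with
  | empty => simp
  | insert a s ha ih => rw [Finset.sum_insert ha, Finset.sum_insert ha, HahnSeries.coeff_add, ih]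

theorem infSum_fintype [Fintype ι] (F : ι → LambdaHbar k) : infSum F = ∑ a, F a := by
  refine HahnSeries.ext (funext fun m => ?_)
  rw [infSum_coeff (isSummable_of_finite F), finsum_eq_sum_of_fintype, coeff_sum']

theorem infSum_nat {F : ℕ → LambdaHbar k} (hF : IsSummable F) :
    infSum F = F 0 + infSum fun r => F (r + 1) := by
  have h := hF.comp_injective (add_left_injective 1)
  refine HahnSeries.ext (funext fun m => ?_)
  rw [HahnSeries.coeff_add, infSum_coeff hF, infSum_coeff h]
  have hfin : (Function.support fun r => (F r).coeff m).Finite := hF.2 m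
  -- With N the largest index that contributes to this monomial, the full sum runs over r ≤ N and
  -- the shifted one over r < N.
  rw [finsum_eq_sum_of_support_subset (s := Finset.range (hfin.toFinset.sup id + 1)) _ ?_,
    finsum_eq_sum_of_support_subset (s := Finset.range (hfin.toFinset.sup id)) _ ?_,
    Finset.sum_range_succ', add_comm]
  · intro r hr
    have : r + 1 ∈ hfin.toFinset := hfin.mem_toFinset.mpr hr
    have := Finset.le_sup (f := id) this
    simp only [id] at this
    simp only [Finset.coe_range, Set.mem_Iio]
    omega
  · intro r hr
    have : r ∈ hfin.toFinset := hfin.mem_toFinset.mpr hr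
    have := Finset.le_sup (f := id) this
    simp only [id] at this
    simp only [Finset.coe_range, Set.mem_Iio]
    omega

theorem infSum_zero : infSum (fun _ : ι => (0 : LambdaHbar k)) = 0 := by
  have : IsSummable (fun _ : ι => (0 : LambdaHbar k)) := ⟨by simp, fun m => by simp⟩
  refine HahnSeries.ext (funext fun m => ?_)
  rw [infSum_coeff this]
  simp

theorem coeff_pleth_dilate (n : ℕ+) (f : LambdaHbar k) (m : HMono) :
    (pleth n f).coeff (HMono.dilate n m) = f.coeff m := by
  exact HahnSeries.embDomain_mk_coeff (HMono.dilate_injective n) (HMono.dilate_le_iff n)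

theorem coeff_pleth_of_notMem (n : ℕ+) (f : LambdaHbar k) {m : HMono}
    (hm : m ∉ Set.range (HMono.dilate n)) : (pleth n f).coeff m = 0 :=
  HahnSeries.embDomain_of_notMem_range hm

theorem pleth_infSum (n : ℕ+) {F : ι → LambdaHbar k} (hF : IsSummable F) :
    pleth n (infSum F) = infSum (fun a => pleth n (F a)) ∧ IsSummable fun a => pleth n (F a) := by
  have hs : IsSummable fun a => pleth n (F a) := by
    refine ⟨?_, fun m => ?_⟩
    · intro s
      have hex : ∀ t, ∃ a ∈ ⋃ a, (F a).support, HMono.dilate n a = (s t).1 := fun t => by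
        obtain ⟨i, hi⟩ := Set.mem_iUnion.mp (s t).2
        obtain ⟨a, ha, h⟩ := HahnSeries.support_embDomain_subset hi
        exact ⟨a, Set.mem_iUnion.mpr ⟨i, ha⟩, h⟩
      choose a ha h using hex
      obtain ⟨i, j, hij, hle⟩ := hF.1 fun t => ⟨a t, ha t⟩
      refine ⟨i, j, hij, ?_⟩
      change (s i).1 ≤ (s j).1
      rw [← h i, ← h j]
      exact (HMono.dilate_le_iff n _ _).mpr hle
    · by_cases hm : m ∈ Set.range (HMono.dilate n)
      · obtain ⟨m, rfl⟩ := hm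
        simpa only [coeff_pleth_dilate] using hF.2 m
      · simp [coeff_pleth_of_notMem n _ hm]
  refine ⟨HahnSeries.ext (funext fun m => ?_), hs⟩
  rw [infSum_coeff hs]
  by_cases hm : m ∈ Set.range (HMono.dilate n)
  · obtain ⟨m, rfl⟩ := hm
    simp only [coeff_pleth_dilate, infSum_coeff hF]
  · simp [coeff_pleth_of_notMem n _ hm]

theorem pleth_smul (n : ℕ+) (c : k) (f : LambdaHbar k) : pleth n (c • f) = c • pleth n f := by
  rw [← HahnSeries.C_mul_eq_smul, ← HahnSeries.C_mul_eq_smul, map_mul]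
  congr 1
  exact HahnSeries.embDomainRingHom_C

theorem pleth_pleth (n n' : ℕ+) (f : LambdaHbar k) : pleth n (pleth n' f) = pleth (n * n') f := by
  have hd : ∀ m, HMono.dilate n (HMono.dilate n' m) = HMono.dilate (n * n') m := fun m => by
    refine Prod.ext ?_ ?_
    · change (n : ℤ) * ((n' : ℤ) * m.1) = ((n * n' : ℕ+) : ℕ) * m.1
      push_cast
      ring
    · change (m.2.mapDomain (n' * ·)).mapDomain (n * ·) = m.2.mapDomain ((n * n') * ·)
      rw [← Finsupp.mapDomain_comp]
      congr 1
      funext x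
      exact (mul_assoc n n' x).symm
  refine HahnSeries.ext (funext fun m => ?_)
  by_cases hm : m ∈ Set.range (HMono.dilate (n * n'))
  · obtain ⟨m, rfl⟩ := hm
    rw [coeff_pleth_dilate, ← hd, coeff_pleth_dilate, coeff_pleth_dilate]
  · rw [coeff_pleth_of_notMem _ _ hm]
    by_cases h1 : m ∈ Set.range (HMono.dilate n)
    · obtain ⟨m, rfl⟩ := h1
      rw [coeff_pleth_dilate, coeff_pleth_of_notMem]
      rintro ⟨m, rfl⟩
      exact hm ⟨m, (hd m).symm⟩
    · rw [coeff_pleth_of_notMem _ _ h1]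

theorem pleth_one (f : LambdaHbar k) : pleth 1 f = f := by
  refine HahnSeries.ext (funext fun m => ?_)
  have hd : HMono.dilate 1 m = m := by
    refine Prod.ext ?_ ?_
    · change ((1 : ℕ+) : ℤ) * m.1 = m.1
      simp
    · change m.2.mapDomain (1 * ·) = m.2
      simp only [one_mul]
      exact Finsupp.mapDomain_id
  conv_lhs => rw [← hd]
  exact coeff_pleth_dilate 1 f m

end SummationCalculus

/-! ### The Euler derivation θ and differential equations for exp and log. -/

section Euler

variable {k : Type u} [Field k]

/-- The Euler derivation, which multiplies each monomial by its weight. -/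
def euler (f : LambdaHbar k) : LambdaHbar k where
  coeff m := (m.weight : k) * f.coeff m
  isPWO_support' := f.isPWO_support.mono fun _ hm => right_ne_zero_of_mul hm

theorem coeff_euler (f : LambdaHbar k) (m : HMono) :
    (euler f).coeff m = (m.weight : k) * f.coeff m := rfl

theorem euler_sub (f g : LambdaHbar k) : euler (f - g) = euler f - euler g := by
  refine HahnSeries.ext (funext fun m => ?_)
  simp [coeff_euler, mul_sub]

theorem euler_smul (c : k) (f : LambdaHbar k) : euler (c • f) = c • euler f := by
  refine HahnSeries.ext (funext fun m => ?_)
  simp only [coeff_euler, HahnSeries.coeff_smul, smul_eq_mul]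
  ring

theorem euler_one : euler (1 : LambdaHbar k) = 0 := by
  refine HahnSeries.ext (funext fun m => ?_)
  rw [coeff_euler, HahnSeries.coeff_one]
  split_ifs with h
  · simp [h]
  · simp

theorem euler_mul (f g : LambdaHbar k) : euler (f * g) = euler f * g + f * euler g := by
  refine HahnSeries.ext (funext fun m => ?_)
  have h1 : (euler f).support ⊆ f.support := fun m hm => right_ne_zero_of_mul hm
  have h2 : (euler g).support ⊆ g.support := fun m hm => right_ne_zero_of_mul hm
  rw [HahnSeries.coeff_add, coeff_euler, HahnSeries.coeff_mul,
    HahnSeries.coeff_mul_left' f.isPWO_support h1, HahnSeries.coeff_mul_right' g.isPWO_support h2,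
    Finset.mul_sum, ← Finset.sum_add_distrib]
  refine Finset.sum_congr rfl fun a ha => ?_
  have hm : a.1 + a.2 = m := (Finset.mem_antidiagonal.mp ha).2.2
  rw [← hm, map_add, coeff_euler, coeff_euler]
  push_cast
  ring

theorem euler_infSum {ι : Type*} {F : ι → LambdaHbar k} (hF : IsSummable F) :
    euler (infSum F) = infSum (fun a => euler (F a)) ∧ IsSummable fun a => euler (F a) := by
  have hs : IsSummable fun a => euler (F a) :=
    ⟨hF.1.mono (Set.iUnion_mono fun a m hm => right_ne_zero_of_mul hm),
      fun m => (hF.2 m).subset fun a ha => right_ne_zero_of_mul ha⟩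
  refine ⟨HahnSeries.ext (funext fun m => ?_), hs⟩
  rw [infSum_coeff hs, coeff_euler, infSum_coeff hF, mul_finsum]
  rfl

theorem euler_pleth (n : ℕ+) (f : LambdaHbar k) :
    euler (pleth n f) = (n : k) • pleth n (euler f) := by
  refine HahnSeries.ext (funext fun m => ?_)
  rw [coeff_euler, HahnSeries.coeff_smul]
  by_cases hm : m ∈ Set.range (HMono.dilate n)
  · obtain ⟨m, rfl⟩ := hm
    rw [coeff_pleth_dilate, coeff_pleth_dilate, HMono.weight_dilate, coeff_euler]
    push_cast
    rw [smul_eq_mul, mul_assoc]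
  · rw [coeff_pleth_of_notMem n _ hm, coeff_pleth_of_notMem n _ hm]
    simp

theorem euler_pow_succ (f : LambdaHbar k) (r : ℕ) :
    euler (f ^ (r + 1)) = ((r : k) + 1) • (f ^ r * euler f) := by
  induction r with
  | zero => simp
  | succ r ih =>
    rw [pow_succ, euler_mul, ih]
    simp only [Algebra.smul_def, map_add, map_one, map_natCast]
    push_cast
    ring

theorem WeightGE.euler {N : ℤ} {f : LambdaHbar k} (h : WeightGE N f) : WeightGE N (euler f) :=
  fun _ hm => h _ (right_ne_zero_of_mul hm)

theorem WeightGE.sub {N : ℤ} {f g : LambdaHbar k} (h : WeightGE N f) (h' : WeightGE N g) :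
    WeightGE N (f - g) := by
  have := h.add (h'.smul (-1))
  rwa [neg_one_smul, ← sub_eq_add_neg] at this

/-- An element whose weights can be raised indefinitely vanishes. -/
theorem eq_zero_of_weight {f : LambdaHbar k} {N : ℤ} (h0 : WeightGE N f)
    (h : ∀ M : ℤ, N ≤ M → WeightGE M f → WeightGE (M + 1) f) : f = 0 := by
  have hall : ∀ r : ℕ, WeightGE (N + r) f := fun r => by
    induction r with
    | zero => simpa using h0
    | succ r ih =>
      have := h (N + r) (by omega) ih
      push_cast
      rwa [← add_assoc]
  refine HahnSeries.ext (funext fun m => ?_)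
  by_contra hm
  have := hall (m.weight - N + 1).toNat m hm
  omega

/-- As D has constant term 1, f - g equals -(f - g)(D - 1), and multiplication by D - 1 raises
weights by at least 1. -/
theorem eq_of_mul_eq {f g D : LambdaHbar k} (hD : WeightGE 1 (D - 1)) (h : f * D = g * D) :
    f = g := by
  rw [← sub_eq_zero]
  obtain ⟨N, hN⟩ := exists_weight_bound (f - g)
  refine eq_zero_of_weight hN fun M _ hM => ?_
  have h1 : f - g = 0 - (f - g) * (D - 1) := by
    rw [mul_sub, sub_mul, h]
    ring
  rw [h1]
  exact (WeightGE.zero _).sub (hM.mul hD)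

variable [CharZero k]

/-- In positive weight w, θ is multiplication by w, which is invertible in characteristic 0. This
replaces integration. -/
theorem eq_of_euler_eq {f g : LambdaHbar k} (hf : WeightGE 1 f) (hg : WeightGE 1 g)
    (h : euler f = euler g) : f = g := by
  refine HahnSeries.ext (funext fun m => ?_)
  have hm := congrArg (fun f => f.coeff m) h
  simp only [coeff_euler] at hm
  by_cases h0 : m.weight = 0
  · have h1 : f.coeff m = 0 := by
      by_contra h1
      have := hf m h1
      omega
    have h2 : g.coeff m = 0 := by
      by_contra h1
      have := hg m h1
      omega
    rw [h1, h2]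
  · exact mul_left_cancel₀ (Int.cast_ne_zero.mpr h0) hm

/-- Uniqueness for the differential equation `θ F = G F`. -/
theorem eq_of_euler_eq_mul {F F' G : LambdaHbar k} (hG : WeightGE 1 G) (hF : WeightGE 1 (F - 1))
    (hF' : WeightGE 1 (F' - 1)) (h : euler F = G * F) (h' : euler F' = G * F') : F = F' := by
  rw [← sub_eq_zero]
  have h1 : WeightGE 1 (F - F') := by
    have := hF.sub hF'
    rwa [sub_sub_sub_cancel_right] at this
  refine eq_zero_of_weight h1 fun M hM1 hM m hm => ?_
  have h2 : euler (F - F') = G * (F - F') := by rw [euler_sub, h, h', mul_sub]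
  have hw := hM m hm
  -- In a weight M ≥ 1 the left side of θ(F - F') = G(F - F') does not vanish where F - F' does not,
  -- whereas the right side only starts in weight M + 1.
  have h3 : (euler (F - F')).coeff m ≠ 0 :=
    mul_ne_zero (Int.cast_ne_zero.mpr (by omega)) hm
  rw [h2] at h3
  have := (hG.mul hM) m h3
  omega

theorem WeightGE.expSeries {f : LambdaHbar k} (h : WeightGE 1 f) :
    WeightGE 1 (ModOp.expSeries f - 1) := by
  rw [ModOp.expSeries, infSum_nat (isSummable_expSeries h)]
  simp only [Nat.factorial_zero, Nat.cast_one, inv_one, pow_zero, one_smul, add_sub_cancel_left]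
  exact WeightGE.infSum fun r => ((h.pow (r + 1)).mono (by push_cast; omega)).smul _

/-- Termwise differentiation: θ kills the term of index 0 and turns the term of index r + 1 into θf
times the term of index r. -/
theorem euler_expSeries {f : LambdaHbar k} (h : WeightGE 1 f) :
    euler (expSeries f) = euler f * expSeries f := by
  have hs := isSummable_expSeries h
  have he := euler_infSum hs
  rw [expSeries, he.1, infSum_nat he.2, (mul_infSum (euler f) hs).1]
  simp only [pow_zero, euler_smul, euler_one, smul_zero, zero_add]
  congr 1
  funext r
  rw [euler_pow_succ, smul_smul, mul_comm (euler f), smul_mul_assoc, Nat.factorial_succ]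
  congr 1
  push_cast
  have h1 : ((r : k) + 1) ≠ 0 := by exact_mod_cast r.succ_ne_zero
  have h2 : (r.factorial : k) ≠ 0 := by exact_mod_cast r.factorial_ne_zero
  field_simp

theorem infSum_pnat (F : ℕ+ → LambdaHbar k) :
    infSum F = infSum fun r : ℕ => F (Equiv.pnatEquivNat.symm r) :=
  (infSum_equiv Equiv.pnatEquivNat.symm F).symm

theorem WeightGE.logSeries {F : LambdaHbar k} (h : WeightGE 1 (F - 1)) :
    WeightGE 1 (ModOp.logSeries F) :=
  WeightGE.infSum fun r => ((h.pow r).mono (by exact_mod_cast r.pos)).smul _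

/-- With F = 1 + w, termwise differentiation gives θw times the geometric series in -w, which is the
inverse of F. Multiplying by F avoids division. -/
theorem euler_logSeries {F : LambdaHbar k} (h : WeightGE 1 (F - 1)) :
    euler (logSeries F) * F = euler F := by
  set w := F - 1 with hw
  have hF : F = 1 + w := by rw [hw]; ring
  have hG : IsSummable fun r : ℕ => ((-1 : k) ^ r) • w ^ r :=
    isSummable_of_le id Function.injective_id fun r => (h.pow r).smul _
  have he := euler_infSum (isSummable_logSeries h)
  have h1 : euler (logSeries F) = euler w * infSum fun r : ℕ => ((-1 : k) ^ r) • w ^ r := by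
    rw [logSeries, he.1, infSum_pnat, (mul_infSum (euler w) hG).1]
    congr 1
    funext r
    have hr : ((Equiv.pnatEquivNat.symm r : ℕ+) : ℕ) = r + 1 := by simp
    rw [hr, ← hw, euler_smul, euler_pow_succ, smul_smul, mul_comm (euler w), smul_mul_assoc]
    congr 1
    have h1 : ((r : k) + 1) ≠ 0 := by exact_mod_cast r.succ_ne_zero
    push_cast
    field_simp
    ring
  have h2 : (infSum fun r : ℕ => ((-1 : k) ^ r) • w ^ r) * F = 1 := by
    have h3 : infSum (fun r : ℕ => ((-1 : k) ^ (r + 1)) • w ^ (r + 1)) =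
        -(w * infSum fun r : ℕ => ((-1 : k) ^ r) • w ^ r) := by
      rw [(mul_infSum w hG).1, ← neg_one_smul k (infSum _),
        (smul_infSum (-1 : k) (mul_infSum w hG).2).1]
      congr 1
      funext r
      rw [mul_smul_comm, smul_smul, pow_succ', pow_succ' w]
    have h4 := infSum_nat hG
    rw [h3] at h4
    simp only [pow_zero, one_smul] at h4
    rw [hF, mul_add, mul_one, mul_comm _ w]
    exact add_eq_of_eq_add_neg h4
  rw [h1, mul_assoc, h2, mul_one, hw, euler_sub, euler_one, sub_zero]

theorem logSeries_pleth {F : LambdaHbar k} (h : WeightGE 1 (F - 1)) (n : ℕ+) :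
    logSeries (pleth n F) = pleth n (logSeries F) := by
  rw [logSeries, logSeries, (pleth_infSum n (isSummable_logSeries h)).1]
  congr 1
  funext r
  rw [pleth_smul, map_pow, map_sub, map_one]

/-! ### The equation θD = (∑ p_n ∘ θC) D, which characterizes D = Exp C and gives C = Log D. -/

section PlethysticEquation

variable {C D : LambdaHbar k} (hC : WeightGE 1 C) (hD : WeightGE 1 (D - 1))
  (h : euler D = (infSum fun n : ℕ+ => pleth n (euler C)) * D)

include hC in
theorem weightGE_plethSum : WeightGE 1 (infSum fun n : ℕ+ => ((n : k)⁻¹) • pleth n C) :=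
  WeightGE.infSum fun n => ((hC.pleth n).smul _).mono (by exact_mod_cast n.pos)

include hC in
-- The plethysm p_n ∘ multiplies weights by n, so θ(p_n ∘ C) = n p_n ∘ θC and the factors 1/n
-- disappear.
theorem euler_plethSum : euler (infSum fun n : ℕ+ => ((n : k)⁻¹) • pleth n C) =
    infSum fun n : ℕ+ => pleth n (euler C) := by
  rw [(euler_infSum (isSummable_plethExp hC)).1]
  congr 1
  funext n
  have hn : (n : k) ≠ 0 := by exact_mod_cast n.ne_zero
  rw [euler_smul, euler_pleth, smul_smul, inv_mul_cancel₀ hn, one_smul]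

include hC hD h in
theorem plethExp_eq : plethExp C = D := by
  have hw := weightGE_plethSum hC
  refine eq_of_euler_eq_mul hw.euler hw.expSeries hD (euler_expSeries hw) ?_
  rw [h, euler_plethSum hC]

include hC hD h in
theorem logSeries_eq : logSeries D = infSum fun n : ℕ+ => ((n : k)⁻¹) • pleth n C := by
  refine eq_of_euler_eq hD.logSeries (weightGE_plethSum hC) (eq_of_mul_eq hD ?_)
  rw [euler_logSeries hD, h, euler_plethSum hC]

include hC hD h in
-- Since log D = ∑ (1/b) p_b ∘ C, the plethystic logarithm is the double sum of (μ(a)/ab) p_(ab) ∘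
-- C. Collecting the terms with ab = N leaves the factor ∑_(d | N) μ(d), which vanishes unless N =
-- 1.
theorem plethLog_eq : plethLog D = C := by
  have hs : IsSummable fun a : ℕ+ × ℕ+ =>
      ((ArithmeticFunction.moebius a.1 : k) / (a.1 : k)) • (((a.2 : k)⁻¹) •
        pleth (a.1 * a.2) C) := by
    -- The term of index (a, b) has weight at least ab, hence at least a and at least b, so finitely
    -- many pairs reach a given weight.
    refine isSummable_of_weight 0 (fun a => (((hC.pleth _).smul _).smul _).mono (by positivity))
      fun w => ?_
    have hf : ({a : ℕ | a ≤ w.toNat} ×ˢ {a : ℕ | a ≤ w.toNat}).Finite :=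
      (Set.finite_Iic w.toNat).prod (Set.finite_Iic w.toNat)
    refine (hf.preimage (f := fun a : ℕ+ × ℕ+ => ((a.1 : ℕ), (a.2 : ℕ))) ?_).subset ?_
    · intro a _ b _ hab
      simp only [Prod.mk.injEq, PNat.coe_inj] at hab
      exact Prod.ext hab.1 hab.2
    · rintro a ⟨m, hm, rfl⟩
      have := (((hC.pleth (a.1 * a.2)).smul ((a.2 : k)⁻¹)).smul _) m hm
      push_cast at this
      have h1 : (1 : ℤ) ≤ (a.1 : ℕ) := by exact_mod_cast a.1.pos
      have h2 : (1 : ℤ) ≤ (a.2 : ℕ) := by exact_mod_cast a.2.pos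
      simp only [Set.mem_preimage, Set.mem_prod, Set.mem_ofPred_eq]
      constructor <;> zify <;> rw [Int.toNat_of_nonneg] <;> nlinarith
  have h1 : plethLog D = infSum fun a : ℕ+ × ℕ+ =>
      ((ArithmeticFunction.moebius a.1 : k) / (a.1 : k)) • (((a.2 : k)⁻¹) •
        pleth (a.1 * a.2) C) := by
    rw [(infSum_prod hs).1, plethLog]
    congr 1
    funext n
    rw [logSeries_pleth hD, logSeries_eq hC hD h, (pleth_infSum n (isSummable_plethExp hC)).1,
      (smul_infSum _ (pleth_infSum n (isSummable_plethExp hC)).2).1]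
    congr 1
    funext r
    rw [pleth_smul, pleth_pleth]
  rw [h1, (infSum_fiberwise hs fun a => a.1 * a.2).1]
  have h2 : ∀ N : ℕ+, (infSum fun a : {a : ℕ+ × ℕ+ // a.1 * a.2 = N} =>
      ((ArithmeticFunction.moebius a.1.1 : k) / (a.1.1 : k)) • (((a.1.2 : k)⁻¹) •
        pleth (a.1.1 * a.1.2) C)) = if N = 1 then C else 0 := by
    intro N
    have hN : (N : k) ≠ 0 := by exact_mod_cast N.ne_zero
    let e : {a : ℕ+ × ℕ+ // a.1 * a.2 = N} ≃ (N : ℕ).divisorsAntidiagonal :=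
      { toFun := fun a => ⟨((a.1.1 : ℕ), (a.1.2 : ℕ)), by
          rw [Nat.mem_divisorsAntidiagonal]
          exact ⟨by rw [← PNat.mul_coe, a.2], N.ne_zero⟩⟩
        invFun := fun a => ⟨(⟨a.1.1, Nat.pos_of_ne_zero (by
            have := (Nat.mem_divisorsAntidiagonal.mp a.2)
            rintro h0
            rw [h0, zero_mul] at this
            exact this.2 this.1.symm)⟩, ⟨a.1.2, Nat.pos_of_ne_zero (by
            have := (Nat.mem_divisorsAntidiagonal.mp a.2)
            rintro h0
            rw [h0, mul_zero] at this
            exact this.2 this.1.symm)⟩), by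
          have := (Nat.mem_divisorsAntidiagonal.mp a.2).1
          exact PNat.coe_inj.mp this⟩
        left_inv := fun a => rfl
        right_inv := fun a => rfl }
    have : Fintype {a : ℕ+ × ℕ+ // a.1 * a.2 = N} := Fintype.ofEquiv _ e.symm
    rw [infSum_fintype]
    have h3 : ∀ a : {a : ℕ+ × ℕ+ // a.1 * a.2 = N},
        ((ArithmeticFunction.moebius a.1.1 : k) / (a.1.1 : k)) • (((a.1.2 : k)⁻¹) •
        pleth (a.1.1 * a.1.2) C) = ((ArithmeticFunction.moebius (a.1.1 : ℕ) : k)) •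
          ((N : k)⁻¹ • pleth N C) := by
      rintro ⟨a, rfl⟩
      rw [smul_smul, smul_smul]
      congr 1
      push_cast
      rw [div_eq_mul_inv, mul_inv, mul_assoc]
    simp only [h3]
    rw [← Finset.sum_smul]
    have h4 : ∑ a : {a : ℕ+ × ℕ+ // a.1 * a.2 = N},
        (ArithmeticFunction.moebius (a.1.1 : ℕ) : k) = if (N : ℕ) = 1 then 1 else 0 := by
      refine (Fintype.sum_equiv e _ (fun a => (ArithmeticFunction.moebius a.1.1 : k))
        (fun a => rfl)).trans ?_
      rw [Finset.sum_coe_sort (N : ℕ).divisorsAntidiagonal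
        (fun a => (ArithmeticFunction.moebius a.1 : k)),
        Nat.sum_divisorsAntidiagonal (fun i _ => (ArithmeticFunction.moebius i : k))]
      have := congrArg (fun f => f (N : ℕ)) ArithmeticFunction.moebius_mul_coe_zeta
      simp only [ArithmeticFunction.coe_mul_zeta_apply, ArithmeticFunction.one_apply] at this
      exact_mod_cast congrArg (Int.cast (R := k)) this
    rw [h4]
    by_cases hN1 : N = 1
    · subst hN1
      simp [pleth_one]
    · rw [if_neg hN1, if_neg (by simpa using hN1), zero_smul]
  simp only [h2]
  refine HahnSeries.ext (funext fun m => ?_)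
  have hs2 : IsSummable fun N : ℕ+ => if N = 1 then C else 0 := by
    have := (infSum_fiberwise hs fun a => a.1 * a.2).2
    simpa only [h2] using this
  rw [infSum_coeff hs2, finsum_eq_single _ (1 : ℕ+) (fun n hn => by simp [hn])]
  simp

end PlethysticEquation

end Euler

open Equiv (Perm)

/-! ### Orbits of a permutation of a finite set and products over orbits. -/

section Orbits

theorem pow_semiconj {X Y : Type} {φ : Perm X} {ψ : Perm Y} {j : X → Y} (h : ∀ x, ψ (j x) = j (φ x)) (n : ℕ)
    (x : X) : (ψ ^ n) (j x) = j ((φ ^ n) x) := by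
  induction n with
  | zero => rfl
  | succ n ih => rw [pow_succ', pow_succ', Perm.mul_apply, Perm.mul_apply, ih, h]

variable {X Y : Type} [Fintype X] [Fintype Y]

open scoped Classical in
/-- The orbit of a point under a permutation. -/
def orb (φ : Perm X) (x : X) : Finset X := Finset.univ.filter fun y => φ.SameCycle x y

theorem mem_orb {φ : Perm X} {x y : X} : y ∈ orb φ x ↔ φ.SameCycle x y := by
  simp [orb]

theorem mem_orb_self (φ : Perm X) (x : X) : x ∈ orb φ x := mem_orb.mpr (Perm.SameCycle.refl φ x)

theorem orb_nonempty (φ : Perm X) (x : X) : (orb φ x).Nonempty := ⟨x, mem_orb_self φ x⟩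

theorem card_orb_pos (φ : Perm X) (x : X) : 0 < (orb φ x).card := (orb_nonempty φ x).card_pos

theorem orb_eq_of_sameCycle {φ : Perm X} {x y : X} (h : φ.SameCycle x y) : orb φ x = orb φ y := by
  ext z
  rw [mem_orb, mem_orb]
  exact ⟨fun hz => h.symm.trans hz, fun hz => h.trans hz⟩

theorem orb_apply (φ : Perm X) (x : X) : orb φ (φ x) = orb φ x :=
  (orb_eq_of_sameCycle ⟨1, by simp⟩).symm

theorem sameCycle_of_step {φ : Perm X} {ψ : Perm Y} {f : Y → X}
    (h : ∀ y, φ.SameCycle (f y) (f (ψ y))) {y z : Y} (hyz : ψ.SameCycle y z) :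
    φ.SameCycle (f y) (f z) := by
  obtain ⟨n, -, -, rfl⟩ := hyz.exists_pow_eq'
  induction n with
  | zero => exact Perm.SameCycle.refl _ _
  | succ n ih =>
    rw [pow_succ', Perm.mul_apply]
    exact (ih ⟨n, by simp⟩).trans (h _)

theorem invariant_of_step {φ : Perm X} {α : Type*} {f : X → α} (h : ∀ x, f (φ x) = f x) {x y : X}
    (hxy : φ.SameCycle x y) : f y = f x := by
  obtain ⟨n, -, -, rfl⟩ := hxy.exists_pow_eq'
  induction n with
  | zero => rfl
  | succ n ih => rw [pow_succ', Perm.mul_apply, h, ih ⟨n, by simp⟩]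

theorem orb_map {φ : Perm X} {ψ : Perm Y} (j : X ↪ Y) (h : ∀ x, ψ (j x) = j (φ x)) (x : X) :
    orb ψ (j x) = (orb φ x).map j := by
  ext y
  rw [mem_orb, Finset.mem_map]
  constructor
  · intro hy
    obtain ⟨n, -, -, rfl⟩ := hy.exists_pow_eq'
    exact ⟨(φ ^ n) x, mem_orb.mpr ⟨n, by simp⟩, (pow_semiconj h n x).symm⟩
  · rintro ⟨z, hz, rfl⟩
    exact sameCycle_of_step (f := j) (fun y => ⟨1, by simp [h]⟩) (mem_orb.mp hz)

theorem card_orb_map {φ : Perm X} {ψ : Perm Y} (j : X ↪ Y) (h : ∀ x, ψ (j x) = j (φ x)) (x : X) :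
    (orb ψ (j x)).card = (orb φ x).card := by
  rw [orb_map j h, Finset.card_map]

open scoped Classical in
/-- The set of the orbits of the points of `L`. -/
def orbs (φ : Perm X) (L : Finset X) : Finset (Finset X) := L.image (orb φ)

theorem mem_orbs {φ : Perm X} {L : Finset X} {o : Finset X} :
    o ∈ orbs φ L ↔ ∃ x ∈ L, orb φ x = o := by
  simp [orbs]

theorem orbs_map {φ : Perm X} {ψ : Perm Y} (j : X ↪ Y) (h : ∀ x, ψ (j x) = j (φ x))
    (L : Finset X) : orbs ψ (L.map j) =
      (orbs φ L).map ⟨Finset.map j, Finset.map_injective j⟩ := by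
  ext o
  simp only [mem_orbs, Finset.mem_map, Function.Embedding.coeFn_mk]
  constructor
  · rintro ⟨_, ⟨x, hx, rfl⟩, rfl⟩
    exact ⟨_, ⟨x, hx, rfl⟩, (orb_map j h x).symm⟩
  · rintro ⟨_, ⟨x, hx, rfl⟩, rfl⟩
    exact ⟨_, ⟨x, hx, rfl⟩, orb_map j h x⟩

/-- The lengths of the cycles of a permutation in an invariant set. -/
def cyc (φ : Perm X) (L : Finset X) : Multiset ℕ := (orbs φ L).val.map Finset.card

theorem cyc_map {φ : Perm X} {ψ : Perm Y} (j : X ↪ Y) (h : ∀ x, ψ (j x) = j (φ x))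
    (L : Finset X) : cyc ψ (L.map j) = cyc φ L := by
  rw [cyc, orbs_map j h, Finset.map_val, Multiset.map_map]
  refine Multiset.map_congr rfl fun o _ => ?_
  simp

variable {R : Type*} [CommMonoid R]

open scoped Classical in
/-- The product over the orbits in an invariant set `L` of a function which is constant on
orbits. -/
def oprod (φ : Perm X) (L : Finset X) (h : X → R) : R :=
  ∏ o ∈ orbs φ L, if ho : o.Nonempty then h ho.choose else 1

/-- The chosen point of an orbit is irrelevant for an invariant function. This converts `oprod` into
an ordinary product of any function on subsets with the right values on orbits, which is how all its
properties are proved. -/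
theorem oprod_eq_prod {φ : Perm X} {L : Finset X} {h : X → R} (hh : ∀ x, h (φ x) = h x)
    {H : Finset X → R} (hH : ∀ x ∈ L, H (orb φ x) = h x) :
    oprod φ L h = ∏ o ∈ orbs φ L, H o := by
  refine Finset.prod_congr rfl fun o ho => ?_
  obtain ⟨x, hx, rfl⟩ := mem_orbs.mp ho
  rw [dif_pos (orb_nonempty φ x), hH x hx]
  exact invariant_of_step hh (mem_orb.mp (orb_nonempty φ x).choose_spec)

theorem exists_orbit_function {φ : Perm X} {h : X → R} (hh : ∀ x, h (φ x) = h x) :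
    ∃ H : Finset X → R, ∀ x, H (orb φ x) = h x := by
  classical
  refine ⟨fun o => if ho : o.Nonempty then h ho.choose else 1, fun x => ?_⟩
  simp only
  rw [dif_pos (orb_nonempty φ x)]
  exact invariant_of_step hh (mem_orb.mp (orb_nonempty φ x).choose_spec)

theorem oprod_map {φ : Perm X} {ψ : Perm Y} (j : X ↪ Y) (h : ∀ x, ψ (j x) = j (φ x))
    (L : Finset X) {f : X → R} {g : Y → R} (hf : ∀ x, f (φ x) = f x) (hg : ∀ y, g (ψ y) = g y)
    (hgf : ∀ x, g (j x) = f x) : oprod ψ (L.map j) g = oprod φ L f := by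
  obtain ⟨H, hH⟩ := exists_orbit_function hg
  rw [oprod_eq_prod hg (fun x _ => hH x), orbs_map j h, Finset.prod_map,
    oprod_eq_prod hf (H := fun o => H (o.map j))]
  · rfl
  · intro x _
    rw [← orb_map j h, hH, hgf]

theorem oprod_congr {φ : Perm X} {L : Finset X} {f g : X → R} (hf : ∀ x, f (φ x) = f x)
    (hg : ∀ x, g (φ x) = g x) (h : ∀ x ∈ L, f x = g x) : oprod φ L f = oprod φ L g := by
  obtain ⟨H, hH⟩ := exists_orbit_function hg
  rw [oprod_eq_prod hg (fun x _ => hH x), oprod_eq_prod hf (H := H)]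
  intro x hx
  rw [hH, h x hx]

/-- Invariance of one of the two sets is enough: an orbit which starts in L stays in L, so it cannot
be the orbit of a point of L'. -/
theorem oprod_union [DecidableEq X] {φ : Perm X} {L L' : Finset X} (hL : ∀ x ∈ L, φ x ∈ L) (hd : Disjoint L L')
    (f : X → R) : oprod φ (L ∪ L') f = oprod φ L f * oprod φ L' f := by
  classical
  have hu : orbs φ (L ∪ L') = orbs φ L ∪ orbs φ L' := by
    ext o
    simp only [mem_orbs, Finset.mem_union, or_and_right, exists_or]
  rw [oprod, hu, Finset.prod_union]
  · rfl
  · rw [Finset.disjoint_left]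
    intro o ho ho'
    obtain ⟨x, hx, rfl⟩ := mem_orbs.mp ho
    obtain ⟨y, hy, he⟩ := mem_orbs.mp ho'
    have hxy : φ.SameCycle x y := mem_orb.mp (he ▸ mem_orb_self φ y)
    obtain ⟨n, -, -, rfl⟩ := hxy.exists_pow_eq'
    have : ∀ n, (φ ^ n) x ∈ L := fun n => by
      induction n with
      | zero => exact hx
      | succ n ih => rw [pow_succ', Perm.mul_apply]; exact hL _ ih
    exact Finset.disjoint_left.mp hd (this n) hy

theorem oprod_empty (φ : Perm X) (f : X → R) : oprod φ ∅ f = 1 := by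
  simp [oprod, orbs]

theorem orbs_orb (φ : Perm X) (x : X) : orbs φ (orb φ x) = {orb φ x} := by
  ext o
  rw [mem_orbs, Finset.mem_singleton]
  constructor
  · rintro ⟨y, hy, rfl⟩
    exact (orb_eq_of_sameCycle (mem_orb.mp hy)).symm
  · rintro rfl
    exact ⟨x, mem_orb_self φ x, rfl⟩

theorem oprod_orb {φ : Perm X} {f : X → R} (hf : ∀ x, f (φ x) = f x) (x : X) :
    oprod φ (orb φ x) f = f x := by
  obtain ⟨H, hH⟩ := exists_orbit_function hf
  rw [oprod_eq_prod hf (fun x _ => hH x), orbs_orb, Finset.prod_singleton, hH]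

theorem oprod_one (φ : Perm X) (L : Finset X) : oprod φ L (fun _ => (1 : R)) = 1 := by
  rw [oprod_eq_prod (H := fun _ => 1) (fun _ => rfl) (fun _ _ => rfl)]
  simp

theorem sum_orbs {A : Type*} [AddCommMonoid A] (φ : Perm X) (q : X → A) :
    ∑ o ∈ orbs φ Finset.univ, ∑ x ∈ o, q x = ∑ x, q x := by
  classical
  rw [← Finset.sum_fiberwise_of_maps_to (s := Finset.univ) (t := orbs φ Finset.univ) (g := orb φ)
    (fun x _ => mem_orbs.mpr ⟨x, Finset.mem_univ x, rfl⟩)]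
  refine Finset.sum_congr rfl fun o ho => ?_
  obtain ⟨y, -, rfl⟩ := mem_orbs.mp ho
  refine Finset.sum_congr ?_ fun _ _ => rfl
  ext x
  rw [Finset.mem_filter]
  constructor
  · exact fun hx => ⟨Finset.mem_univ x, (orb_eq_of_sameCycle (mem_orb.mp hx)).symm⟩
  · exact fun hx => hx.2 ▸ mem_orb_self φ x

end Orbits

/-! ### Cyclic arrangements of copies of a permutation. -/

section Suspension

variable {X : Type}

/-- The permutation of `n + 1` copies of `X` which permutes the copies cyclically and whose power
of exponent `n + 1` is `φ` on each copy. -/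
def suspPerm (n : ℕ) (φ : Perm X) : Perm (Fin (n + 1) × X) :=
  (Perm.prodExtendRight (Fin.last n) φ).trans ((finRotate (n + 1)).prodCongr (Equiv.refl X))

theorem suspPerm_of_ne {n : ℕ} (φ : Perm X) {i : Fin (n + 1)} (hi : i ≠ Fin.last n) (x : X) :
    suspPerm n φ (i, x) = (i + 1, x) := by
  simp [suspPerm, Perm.prodExtendRight_apply_ne φ hi]

theorem suspPerm_last {n : ℕ} (φ : Perm X) (x : X) :
    suspPerm n φ (Fin.last n, x) = (0, φ x) := by
  simp [suspPerm, Perm.prodExtendRight_apply_eq]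

theorem suspPerm_pow_zero {n : ℕ} (φ : Perm X) (x : X) (i : ℕ) (hi : i < n + 1) :
    ((suspPerm n φ) ^ i) (0, x) = (⟨i, hi⟩, x) := by
  induction i with
  | zero => rfl
  | succ i ih =>
    rw [pow_succ', Perm.mul_apply, ih (by omega), suspPerm_of_ne]
    · refine Prod.ext (Fin.ext ?_) rfl
      rw [Fin.val_add_one_of_lt]
      simpa [Fin.lt_def] using hi
    · intro h
      have := congrArg Fin.val h
      simp only [Fin.val_last] at this
      omega

theorem suspPerm_pow (n : ℕ) (φ : Perm X) (i : Fin (n + 1)) (x : X) :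
    ((suspPerm n φ) ^ (n + 1)) (i, x) = (i, φ x) := by
  have h0 : ((suspPerm n φ) ^ (n + 1)) (0, x) = (0, φ x) := by
    rw [pow_succ', Perm.mul_apply, suspPerm_pow_zero φ x n (by omega)]
    exact suspPerm_last φ x
  have hi : ∀ x : X, (i, x) = ((suspPerm n φ) ^ (i : ℕ)) (0, x) := fun x =>
    (suspPerm_pow_zero φ x i i.2).symm
  rw [hi x, hi (φ x), ← Perm.mul_apply, (Commute.pow_pow_self (suspPerm n φ) (n + 1) i).eq,
    Perm.mul_apply, h0]

theorem suspPerm_pow_mul (n : ℕ) (φ : Perm X) (c : ℕ) (i : Fin (n + 1)) (x : X) :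
    ((suspPerm n φ) ^ ((n + 1) * c)) (i, x) = (i, (φ ^ c) x) := by
  rw [pow_mul]
  induction c generalizing x with
  | zero => rfl
  | succ c ih => rw [pow_succ, Perm.mul_apply, suspPerm_pow, ih, pow_succ, Perm.mul_apply]

variable [Fintype X]

/-- All the copies of a point are reached from copy 0, and a full turn acts on copy 0 as φ. -/
theorem orb_suspPerm (n : ℕ) (φ : Perm X) (i : Fin (n + 1)) (x : X) :
    orb (suspPerm n φ) (i, x) = Finset.univ ×ˢ orb φ x := by
  have h0 : ∀ (i : Fin (n + 1)) (x : X), (suspPerm n φ).SameCycle (0, x) (i, x) := fun i x =>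
    ⟨i, by
      rw [zpow_natCast]
      exact suspPerm_pow_zero φ x i i.2⟩
  ext ⟨i', y⟩
  rw [mem_orb, Finset.mem_product, mem_orb]
  constructor
  · intro h
    refine ⟨Finset.mem_univ _, sameCycle_of_step (f := Prod.snd) ?_ h⟩
    rintro ⟨a, z⟩
    by_cases ha : a = Fin.last n
    · subst ha
      exact ⟨1, by simp [suspPerm_last]⟩
    · rw [suspPerm_of_ne φ ha]
  · rintro ⟨-, h⟩
    refine (h0 i x).symm.trans (Perm.SameCycle.trans ?_ (h0 i' y))
    refine sameCycle_of_step (f := fun z => ((0 : Fin (n + 1)), z)) (fun z => ?_) h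
    exact ⟨(n + 1 : ℕ), by rw [zpow_natCast, suspPerm_pow]⟩

/-- The origin of the plethysms: a cycle of length j becomes a cycle of length (n + 1) j, as p_j
becomes p_((n+1) j). -/
theorem card_orb_suspPerm (n : ℕ) (φ : Perm X) (i : Fin (n + 1)) (x : X) :
    (orb (suspPerm n φ) (i, x)).card = (n + 1) * (orb φ x).card := by
  rw [orb_suspPerm, Finset.card_product, Finset.card_univ, Fintype.card_fin]

theorem oprod_suspPerm {R : Type*} [CommMonoid R] (n : ℕ) (φ : Perm X) {f : X → R}
    {g : Fin (n + 1) × X → R} (hf : ∀ x, f (φ x) = f x)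
    (hgf : ∀ i x, g (i, x) = f x) :
    oprod (suspPerm n φ) Finset.univ g = oprod φ Finset.univ f := by
  have hg : ∀ y, g (suspPerm n φ y) = g y := by
    rintro ⟨a, z⟩
    by_cases ha : a = Fin.last n
    · subst ha
      rw [suspPerm_last, hgf, hgf, hf]
    · rw [suspPerm_of_ne φ ha, hgf, hgf]
  obtain ⟨H, hH⟩ := exists_orbit_function hg
  have hinj : Function.Injective fun o : Finset X => (Finset.univ : Finset (Fin (n + 1))) ×ˢ o := by
    intro o o' h
    ext x
    have := congrArg (fun s => ((0 : Fin (n + 1)), x) ∈ s) h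
    simpa using this
  have ho : orbs (suspPerm n φ) Finset.univ = (orbs φ Finset.univ).map ⟨_, hinj⟩ := by
    ext o
    simp only [mem_orbs, Finset.mem_map, Function.Embedding.coeFn_mk]
    constructor
    · rintro ⟨⟨i, x⟩, -, rfl⟩
      exact ⟨_, ⟨x, Finset.mem_univ x, rfl⟩, (orb_suspPerm n φ i x).symm⟩
    · rintro ⟨_, ⟨x, -, rfl⟩, rfl⟩
      exact ⟨(0, x), Finset.mem_univ _, orb_suspPerm n φ 0 x⟩
  rw [oprod_eq_prod hg (fun x _ => hH x), ho, Finset.prod_map,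
    oprod_eq_prod hf (H := fun o => H ((Finset.univ : Finset (Fin (n + 1))) ×ˢ o))]
  · rfl
  · intro x _
    rw [← orb_suspPerm n φ 0, hH, hgf]

theorem map_oprod {R R' : Type*} [CommMonoid R] [CommMonoid R'] (F : R →* R') (φ : Perm X)
    (L : Finset X) {f : X → R} (hf : ∀ x, f (φ x) = f x) :
    F (oprod φ L f) = oprod φ L fun x => F (f x) := by
  obtain ⟨H, hH⟩ := exists_orbit_function hf
  rw [oprod_eq_prod hf (fun x _ => hH x), map_prod, oprod_eq_prod (H := fun o => F (H o))]
  · intro x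
    rw [hf]
  · intro x _
    rw [hH]

end Suspension

/-! ### Stable graphs with an automorphism, their disjoint unions and cyclic arrangements, and their
weights. -/

/-- A stable graph, possibly disconnected, with an automorphism `φ`. The elements of `X` are the
vertices and the flags of the graph; `vx x` is the vertex at which the flag `x` is, or `x` itself
if `x` is a vertex, and `gen x` is the genus of the vertex `vx x`. -/
structure Conf (X : Type) where
  vx : X → X
  gen : X → ℕ
  inv : X → X
  φ : Perm X
  vx_vx : ∀ x, vx (vx x) = vx x
  gen_vx : ∀ x, gen (vx x) = gen x
  inv_inv : ∀ x, inv (inv x) = x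
  inv_vx : ∀ x, inv (vx x) = vx x
  φ_vx : ∀ x, vx (φ x) = φ (vx x)
  φ_gen : ∀ x, gen (φ x) = gen x
  φ_inv : ∀ x, inv (φ x) = φ (inv x)
  stable : ∀ x, 2 < 2 * gen x + Nat.card {y // vx y = vx x ∧ vx y ≠ y}

namespace Conf

@[ext]
theorem ext {X : Type} {c c' : Conf X} (h1 : ∀ x, c.vx x = c'.vx x) (h2 : ∀ x, c.gen x = c'.gen x)
    (h3 : ∀ x, c.inv x = c'.inv x) (h4 : ∀ x, c.φ x = c'.φ x) : c = c' := by
  obtain ⟨a, b, d, e, _⟩ := c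
  obtain ⟨a', b', d', e', _⟩ := c'
  obtain rfl : a = a' := funext h1
  obtain rfl : b = b' := funext h2
  obtain rfl : d = d' := funext h3
  obtain rfl : e = e' := Equiv.ext h4
  rfl

/-- An embedding of a graph with automorphism as a union of components of another one. -/
structure IsEmb {X Y : Type} (c : Conf X) (c' : Conf Y) (j : X ↪ Y) : Prop where
  vx : ∀ x, c'.vx (j x) = j (c.vx x)
  gen : ∀ x, c'.gen (j x) = c.gen x
  inv : ∀ x, c'.inv (j x) = j (c.inv x)
  φ : ∀ x, c'.φ (j x) = j (c.φ x)
  mem : ∀ y x, c'.vx y = j x → ∃ z, j z = y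

theorem isEmb_φ {X : Type} (c : Conf X) : c.IsEmb c c.φ.toEmbedding where
  vx := c.φ_vx
  gen := c.φ_gen
  inv := c.φ_inv
  φ _ := rfl
  mem y _ _ := ⟨c.φ.symm y, by simp⟩

/-- Transport along a bijection. -/
def map {X Y : Type} (c : Conf X) (e : X ≃ Y) : Conf Y where
  vx y := e (c.vx (e.symm y))
  gen y := c.gen (e.symm y)
  inv y := e (c.inv (e.symm y))
  φ := (e.symm.trans c.φ).trans e
  vx_vx y := by simp [c.vx_vx]
  gen_vx y := by simp [c.gen_vx]
  inv_inv y := by simp [c.inv_inv]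
  inv_vx y := by simp [c.inv_vx]
  φ_vx y := by simp [c.φ_vx]
  φ_gen y := by simp [c.φ_gen]
  φ_inv y := by simp [c.φ_inv]
  stable y := by
    have h := c.stable (e.symm y)
    rwa [Nat.card_congr (e.subtypeEquiv (q := fun z => e (c.vx (e.symm z)) = e (c.vx (e.symm y)) ∧
      e (c.vx (e.symm z)) ≠ z) fun z => by simp)] at h

theorem isEmb_map {X Y : Type} (c : Conf X) (e : X ≃ Y) : c.IsEmb (c.map e) e.toEmbedding where
  vx x := by simp [map]
  gen x := by simp [map]
  inv x := by simp [map]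
  φ x := by simp [map]
  mem y _ _ := ⟨e.symm y, by simp⟩

theorem map_map {X Y Z : Type} (c : Conf X) (e : X ≃ Y) (e' : Y ≃ Z) :
    (c.map e).map e' = c.map (e.trans e') := rfl

theorem map_refl {X : Type} (c : Conf X) : c.map (Equiv.refl X) = c := rfl

theorem map_injective {X Y : Type} (e : X ≃ Y) : Function.Injective fun c : Conf X => c.map e := by
  intro c c' h
  have := congrArg (fun c : Conf Y => c.map e.symm) h
  simpa [map_map, map_refl] using this

/-- The disjoint union. -/
def sum {X Y : Type} (c : Conf X) (c' : Conf Y) : Conf (X ⊕ Y) where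
  vx := Sum.map c.vx c'.vx
  gen := Sum.elim c.gen c'.gen
  inv := Sum.map c.inv c'.inv
  φ := Equiv.sumCongr c.φ c'.φ
  vx_vx y := by rcases y with x | x <;> simp [vx_vx]
  gen_vx y := by rcases y with x | x <;> simp [gen_vx]
  inv_inv y := by rcases y with x | x <;> simp [inv_inv]
  inv_vx y := by rcases y with x | x <;> simp [inv_vx]
  φ_vx y := by rcases y with x | x <;> simp [φ_vx]
  φ_gen y := by rcases y with x | x <;> simp [φ_gen]
  φ_inv y := by rcases y with x | x <;> simp [φ_inv]
  stable y := by
    rcases y with x | x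
    · have h := c.stable x
      rwa [Nat.card_congr (β := {y : X ⊕ Y // Sum.map c.vx c'.vx y = Sum.map c.vx c'.vx (.inl x) ∧
        Sum.map c.vx c'.vx y ≠ y}) (Equiv.ofBijective (fun z => ⟨.inl z.1, by simpa using z.2⟩)
          ⟨fun a b hab => Subtype.ext (Sum.inl_injective (congrArg Subtype.val hab)), by
            rintro ⟨z | z, hz⟩
            · exact ⟨⟨z, by simpa using hz⟩, rfl⟩
            · exact absurd hz.1 (by simp)⟩)] at h
    · have h := c'.stable x
      rwa [Nat.card_congr (β := {y : X ⊕ Y // Sum.map c.vx c'.vx y = Sum.map c.vx c'.vx (.inr x) ∧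
        Sum.map c.vx c'.vx y ≠ y}) (Equiv.ofBijective (fun z => ⟨.inr z.1, by simpa using z.2⟩)
          ⟨fun a b hab => Subtype.ext (Sum.inr_injective (congrArg Subtype.val hab)), by
            rintro ⟨z | z, hz⟩
            · exact absurd hz.1 (by simp)
            · exact ⟨⟨z, by simpa using hz⟩, rfl⟩⟩)] at h

theorem isEmb_inl {X Y : Type} (c : Conf X) (c' : Conf Y) :
    c.IsEmb (c.sum c') Function.Embedding.inl where
  vx _ := rfl
  gen _ := rfl
  inv _ := rfl
  φ _ := rfl
  mem y x h := by
    rcases y with y | y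
    · exact ⟨y, rfl⟩
    · cases h

theorem isEmb_inr {X Y : Type} (c : Conf X) (c' : Conf Y) :
    c'.IsEmb (c.sum c') Function.Embedding.inr where
  vx _ := rfl
  gen _ := rfl
  inv _ := rfl
  φ _ := rfl
  mem y x h := by
    rcases y with y | y
    · cases h
    · exact ⟨y, rfl⟩

/-- The disjoint union of `n + 1` copies of a graph, permuted cyclically. -/
def susp {X : Type} (n : ℕ) (c : Conf X) : Conf (Fin (n + 1) × X) where
  vx y := (y.1, c.vx y.2)
  gen y := c.gen y.2
  inv y := (y.1, c.inv y.2)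
  φ := suspPerm n c.φ
  vx_vx y := by simp [vx_vx]
  gen_vx y := by simp [gen_vx]
  inv_inv y := by simp [inv_inv]
  inv_vx y := by simp [inv_vx]
  φ_vx := by
    rintro ⟨i, x⟩
    by_cases h : i = Fin.last n
    · subst h; simp [suspPerm_last, φ_vx]
    · simp [suspPerm_of_ne _ h]
  φ_gen := by
    rintro ⟨i, x⟩
    by_cases h : i = Fin.last n
    · subst h; simp [suspPerm_last, φ_gen]
    · simp [suspPerm_of_ne _ h]
  φ_inv := by
    rintro ⟨i, x⟩
    by_cases h : i = Fin.last n
    · subst h; simp [suspPerm_last, φ_inv]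
    · simp [suspPerm_of_ne _ h]
  stable := by
    rintro ⟨i, x⟩
    have h := c.stable x
    rwa [Nat.card_congr (β := {y : Fin (n + 1) × X //
      ((y.1, c.vx y.2) : Fin (n + 1) × X) = (i, c.vx x) ∧ ((y.1, c.vx y.2) : Fin (n + 1) × X) ≠ y})
        { toFun := fun z => ⟨(i, z.1), by simpa using z.2⟩
          invFun := fun z => ⟨z.1.2, (Prod.mk.inj z.2.1).2, fun he => z.2.2 (Prod.ext rfl he)⟩
          left_inv := fun z => rfl
          right_inv := fun z => Subtype.ext (Prod.ext (Prod.mk.inj z.2.1).1.symm rfl) }] at h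

/-- The vertices `x` and flags `y` in the same connected component. -/
def Rel {X : Type} (c : Conf X) : X → X → Prop :=
  Relation.EqvGen fun x y => y = c.vx x ∨ y = c.inv x

/-- Connected graphs. -/
def Conn {X : Type} (c : Conf X) : Prop := Nonempty X ∧ ∀ x y, c.Rel x y

theorem Rel.emb {X Y : Type} {c : Conf X} {c' : Conf Y} {j : X ↪ Y} (h : c.IsEmb c' j) {x y : X}
    (hxy : c.Rel x y) : c'.Rel (j x) (j y) := by
  induction hxy with
  | rel x y hxy =>
    refine Relation.EqvGen.rel _ _ ?_
    rw [h.vx, h.inv]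
    rcases hxy with rfl | rfl
    · exact Or.inl rfl
    · exact Or.inr rfl
  | refl x => exact Relation.EqvGen.refl _
  | symm x y _ ih => exact ih.symm
  | trans x y z _ _ h1 h2 => exact h1.trans _ _ _ h2

section Weight

variable {X Y : Type} [Fintype X] [Fintype Y] {k : Type u} [Field k]

open scoped Classical in
/-- The set of flags at the vertex `x`. -/
def flags (c : Conf X) (x : X) : Finset X := Finset.univ.filter fun y => c.vx y = x ∧ c.vx y ≠ y

theorem mem_flags {c : Conf X} {x y : X} : y ∈ c.flags x ↔ c.vx y = x ∧ c.vx y ≠ y := by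
  simp [flags]

theorem IsEmb.flags {c : Conf X} {c' : Conf Y} {j : X ↪ Y} (h : c.IsEmb c' j) (x : X) :
    c'.flags (j x) = (c.flags x).map j := by
  ext y
  simp only [mem_flags, Finset.mem_map]
  constructor
  · rintro ⟨h1, h2⟩
    obtain ⟨z, rfl⟩ := h.mem y x h1
    rw [h.vx] at h1 h2
    exact ⟨z, ⟨j.injective h1, fun he => h2 (congrArg j he)⟩, rfl⟩
  · rintro ⟨z, ⟨h1, h2⟩, rfl⟩
    rw [h.vx]
    exact ⟨congrArg j h1, fun he => h2 (j.injective he)⟩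

variable (χ : ℕ → Multiset ℕ → k)

/-- The character attached to the orbit of a vertex. -/
def vfac (c : Conf X) (x : X) : k :=
  χ (c.gen x) (cyc (c.φ ^ (orb c.φ x).card) (c.flags x))

theorem IsEmb.vfac {c : Conf X} {c' : Conf Y} {j : X ↪ Y} (h : c.IsEmb c' j) (x : X) :
    c'.vfac χ (j x) = c.vfac χ x := by
  rw [Conf.vfac, Conf.vfac, h.gen, h.flags, card_orb_map j h.φ, cyc_map j]
  exact pow_semiconj h.φ _

open scoped Classical in
/-- The factor attached to the orbit of a vertex or of a flag. -/
def loc (c : Conf X) (x : X) : LambdaHbar k :=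
  if c.vx x = x then
    hbarPow ((orb c.φ x).card * ((c.gen x : ℤ) - 1)) * HahnSeries.C (c.vfac χ x)
  else if c.inv x = x then pSum (orb c.φ x).card.toPNat' else 1

theorem IsEmb.loc {c : Conf X} {c' : Conf Y} {j : X ↪ Y} (h : c.IsEmb c' j) (x : X) :
    c'.loc χ (j x) = c.loc χ x := by
  classical
  unfold Conf.loc
  rw [h.vx, h.inv, h.gen, h.vfac, card_orb_map j h.φ]
  exact if_congr j.injective.eq_iff rfl (if_congr j.injective.eq_iff rfl rfl)

theorem loc_φ (c : Conf X) (x : X) : c.loc χ (c.φ x) = c.loc χ x := c.isEmb_φ.loc χ x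

open scoped Classical in
/-- The number of flags which are not legs. -/
def nonfix (c : Conf X) : Finset X := Finset.univ.filter fun x => c.inv x ≠ x

theorem mem_nonfix {c : Conf X} {x : X} : x ∈ c.nonfix ↔ c.inv x ≠ x := by
  simp [nonfix]

/-- The number of edges. -/
def edges (c : Conf X) : ℕ := c.nonfix.card / 2

theorem two_mul_edges (c : Conf X) : 2 * c.edges = c.nonfix.card := by
  -- Parity is obtained modulo 2: on `nonfix` the involution has no fixed points, and its pairs of
  -- points cancel.
  have h : ∑ x ∈ c.nonfix, (1 : ZMod 2) = 0 := by
    refine Finset.sum_involution (fun x _ => c.inv x) ?_ ?_ ?_ ?_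
    · intro x hx
      decide
    · intro x hx _
      exact mem_nonfix.mp hx
    · intro x hx
      rw [mem_nonfix] at hx ⊢
      rw [c.inv_inv]
      exact fun h => hx h.symm
    · intro x hx
      exact c.inv_inv x
  rw [Finset.sum_const, nsmul_eq_mul, mul_one, ZMod.natCast_eq_zero_iff] at h
  exact Nat.mul_div_cancel' h

/-- The contribution of a graph with automorphism. -/
def weight (c : Conf X) : LambdaHbar k := hbarPow c.edges * oprod c.φ Finset.univ (c.loc χ)

theorem hbarPow_add (i j : ℤ) : (hbarPow (i + j) : LambdaHbar k) = hbarPow i * hbarPow j := by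
  rw [hbarPow, hbarPow, hbarPow, HahnSeries.single_mul_single, mul_one]
  rfl

theorem hbarPow_zero : (hbarPow 0 : LambdaHbar k) = 1 := rfl

theorem pleth_single (n : ℕ+) (m : HMono) (a : k) :
    pleth n (HahnSeries.single m a) = HahnSeries.single (HMono.dilate n m) a :=
  HahnSeries.embDomain_single

theorem pleth_hbarPow (n : ℕ+) (i : ℤ) : pleth n (hbarPow i : LambdaHbar k) = hbarPow (n * i) := by
  rw [hbarPow, pleth_single, hbarPow]
  refine congrArg (fun m => HahnSeries.single m (1 : k)) (Prod.ext rfl ?_)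
  exact Finsupp.mapDomain_zero (f := ((n : ℕ+) * · : ℕ+ → ℕ+))

theorem pleth_pSum (n j : ℕ+) : pleth n (pSum j : LambdaHbar k) = pSum (n * j) := by
  rw [pSum, pleth_single, pSum]
  refine congrArg (fun m => HahnSeries.single m (1 : k)) (Prod.ext ?_ ?_)
  · exact mul_zero (n : ℤ)
  · exact Finsupp.mapDomain_single

theorem pleth_C (n : ℕ+) (a : k) : pleth n (HahnSeries.C a) = HahnSeries.C a :=
  HahnSeries.embDomainRingHom_C

theorem edges_map (c : Conf X) (e : X ≃ Y) : (c.map e).edges = c.edges := by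
  rw [edges, edges]
  congr 1
  refine Finset.card_bij' (fun y _ => e.symm y) (fun x _ => e x) ?_ ?_ (by simp) (by simp)
  · intro y hy
    rw [mem_nonfix] at hy ⊢
    exact fun h => hy (by simp [map, h])
  · intro y hy
    rw [mem_nonfix] at hy ⊢
    simpa [map] using hy

theorem weight_map (c : Conf X) (e : X ≃ Y) : (c.map e).weight χ = c.weight χ := by
  have h := c.isEmb_map e
  rw [weight, weight, edges_map, ← oprod_map e.toEmbedding h.φ Finset.univ (c.loc_φ χ)
    ((c.map e).loc_φ χ) (h.loc χ)]
  simp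

theorem nonfix_sum (c : Conf X) (c' : Conf Y) : (c.sum c').nonfix = c.nonfix.disjSum c'.nonfix := by
  ext (x | x)
  · rw [mem_nonfix, Finset.inl_mem_disjSum, mem_nonfix]
    simp [sum]
  · rw [mem_nonfix, Finset.inr_mem_disjSum, mem_nonfix]
    simp [sum]

theorem edges_sum (c : Conf X) (c' : Conf Y) : (c.sum c').edges = c.edges + c'.edges := by
  have h1 := c.two_mul_edges
  have h2 := c'.two_mul_edges
  have h3 := (c.sum c').two_mul_edges
  rw [nonfix_sum, Finset.card_disjSum] at h3
  omega

/-- Edges add, and no orbit of the automorphism meets both summands, so the product over orbits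
splits. -/
theorem weight_sum (c : Conf X) (c' : Conf Y) :
    (c.sum c').weight χ = c.weight χ * c'.weight χ := by
  classical
  have h1 := c.isEmb_inl c'
  have h2 := c.isEmb_inr c'
  have hu : (Finset.univ : Finset (X ⊕ Y)) =
      Finset.univ.map Function.Embedding.inl ∪ Finset.univ.map Function.Embedding.inr := by
    ext (x | x) <;> simp
  rw [weight, weight, weight, edges_sum, hu]
  rw [oprod_union, oprod_map _ h1.φ Finset.univ (c.loc_φ χ) ((c.sum c').loc_φ χ) (h1.loc χ),
    oprod_map _ h2.φ Finset.univ (c'.loc_φ χ) ((c.sum c').loc_φ χ) (h2.loc χ)]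
  · push_cast
    rw [hbarPow_add]
    ring
  · intro x hx
    rcases x with x | x
    · simp [sum]
    · simp at hx
  · rw [Finset.disjoint_left]
    intro x hx hx'
    rcases x with x | x
    · simp at hx'
    · simp at hx

theorem edges_susp (n : ℕ) (c : Conf X) : (c.susp n).edges = (n + 1) * c.edges := by
  have h1 := c.two_mul_edges
  have h3 := (c.susp n).two_mul_edges
  have h2 : (c.susp n).nonfix = Finset.univ ×ˢ c.nonfix := by
    ext ⟨i, x⟩
    rw [mem_nonfix, Finset.mem_product, mem_nonfix]
    simp [susp]
  rw [h2, Finset.card_product, Finset.card_univ, Fintype.card_fin, ← h1] at h3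
  nlinarith

/-- A vertex first returns after n + 1 times as many steps, but the first return acts on its flags
as it did before, since n + 1 steps act on each copy as φ. So the scalar attached to the vertex is
unchanged, as scalars are under plethysm. -/
theorem vfac_susp (n : ℕ) (c : Conf X) (i : Fin (n + 1)) (x : X) :
    (c.susp n).vfac χ (i, x) = c.vfac χ x := by
  let j : X ↪ Fin (n + 1) × X := ⟨fun x => (i, x), fun x y h => (Prod.mk.inj h).2⟩
  have hf : (c.susp n).flags (i, x) = (c.flags x).map j := by
    ext ⟨a, y⟩
    simp only [mem_flags, susp, Finset.mem_map, Prod.mk.injEq, ne_eq]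
    constructor
    · rintro ⟨⟨rfl, h1⟩, h2⟩
      exact ⟨y, ⟨h1, fun h => h2 ⟨trivial, h⟩⟩, rfl⟩
    · rintro ⟨z, ⟨h1, h2⟩, he⟩
      obtain ⟨rfl, rfl⟩ := Prod.mk.inj he
      exact ⟨⟨rfl, h1⟩, fun h => h2 h.2⟩
  rw [vfac, vfac, hf]
  congr 1
  change cyc ((suspPerm n c.φ) ^ (orb (suspPerm n c.φ) (i, x)).card) _ = _
  rw [card_orb_suspPerm]
  exact cyc_map j (fun y => suspPerm_pow_mul n c.φ _ i y) _

theorem loc_susp (n : ℕ) (c : Conf X) (i : Fin (n + 1)) (x : X) :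
    (c.susp n).loc χ (i, x) = pleth n.succPNat (c.loc χ x) := by
  have hvx : (c.susp n).vx (i, x) = (i, x) ↔ c.vx x = x := by simp [susp]
  have hinv : (c.susp n).inv (i, x) = (i, x) ↔ c.inv x = x := by simp [susp]
  have hc : (orb (c.susp n).φ (i, x)).card = (n + 1) * (orb c.φ x).card :=
    card_orb_suspPerm n c.φ i x
  have hg : (c.susp n).gen (i, x) = c.gen x := rfl
  rw [loc, loc, vfac_susp, hc, hg]
  by_cases h1 : c.vx x = x
  · rw [if_pos h1, if_pos (hvx.mpr h1), map_mul, pleth_hbarPow, pleth_C]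
    congr 2
    push_cast [Nat.succPNat_coe]
    ring
  rw [if_neg h1, if_neg (mt hvx.mp h1)]
  by_cases h2 : c.inv x = x
  · rw [if_pos h2, if_pos (hinv.mpr h2), pleth_pSum]
    congr 1
    refine PNat.eq ?_
    have := card_orb_pos c.φ x
    rw [PNat.mul_coe, Nat.succPNat_coe, Nat.toPNat'_coe, Nat.toPNat'_coe, if_pos this,
      if_pos (by positivity)]
  · rw [if_neg h2, if_neg (mt hinv.mp h2), map_one]

/-- Every exponent of ħ and every cycle length is multiplied by n + 1 and the scalars stay fixed,
which is the effect of the plethysm of index n + 1. -/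
theorem weight_susp (n : ℕ) (c : Conf X) : (c.susp n).weight χ = pleth n.succPNat (c.weight χ) := by
  rw [weight, weight, map_mul, pleth_hbarPow, edges_susp]
  refine congrArg₂ (· * ·) ?_ ?_
  · push_cast [Nat.succPNat_coe]
    rfl
  · have := map_oprod (pleth n.succPNat).toMonoidHom c.φ Finset.univ (c.loc_φ χ)
    refine Eq.trans ?_ this.symm
    refine oprod_suspPerm n c.φ (fun x => ?_) (fun i x => c.loc_susp χ n i x)
    rw [loc_φ]

open scoped Classical in
/-- The weight of a vertex or flag. -/
def pt (c : Conf X) (x : X) : ℤ := if c.vx x = x then 2 * c.gen x - 2 else 1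

/-- The total weight. -/
def wt (c : Conf X) : ℤ := ∑ x, c.pt x

theorem IsEmb.pt {c : Conf X} {c' : Conf Y} {j : X ↪ Y} (h : c.IsEmb c' j) (x : X) :
    c'.pt (j x) = c.pt x := by
  classical
  unfold Conf.pt
  rw [h.vx, h.gen]
  exact if_congr j.injective.eq_iff rfl rfl

theorem pt_susp (n : ℕ) (c : Conf X) (i : Fin (n + 1)) (x : X) : (c.susp n).pt (i, x) = c.pt x := by
  have hvx : (c.susp n).vx (i, x) = (i, x) ↔ c.vx x = x := by simp [susp]
  rw [pt, pt]
  by_cases h : c.vx x = x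
  · rw [if_pos h, if_pos (hvx.mpr h)]
    rfl
  · rw [if_neg h, if_neg (mt hvx.mp h)]

end Weight

end Conf

/-! ### Homogeneity of the weights. -/

section Homogeneous

variable {k : Type u} [Field k]

/-- All the monomials of `f` have weight `w`. -/
def Homog (w : ℤ) (f : LambdaHbar k) : Prop := ∀ m, f.coeff m ≠ 0 → m.weight = w

theorem Homog.weightGE {w : ℤ} {f : LambdaHbar k} (h : Homog w f) : WeightGE w f :=
  fun m hm => (h m hm).ge

theorem Homog.mul {w w' : ℤ} {f f' : LambdaHbar k} (h : Homog w f) (h' : Homog w' f') :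
    Homog (w + w') (f * f') := by
  intro m hm
  obtain ⟨a, ha, b, hb, rfl⟩ := HahnSeries.support_mul_subset hm
  rw [map_add, h a ha, h' b hb]

theorem Homog.single (m : HMono) (c : k) : Homog m.weight (HahnSeries.single m c) := by
  intro m' hm
  by_cases h : m' = m
  · rw [h]
  · exact absurd (HahnSeries.coeff_single_of_ne h) hm

theorem Homog.C (c : k) : Homog 0 (HahnSeries.C c : LambdaHbar k) := by
  have := Homog.single (k := k) 0 c
  rwa [map_zero] at this

theorem Homog.one : Homog 0 (1 : LambdaHbar k) := by
  simpa using Homog.C (1 : k)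

theorem Homog.hbarPow (i : ℤ) : Homog (2 * i) (hbarPow i : LambdaHbar k) := by
  have := Homog.single (k := k) (HMono.mk i 0) 1
  rwa [weight_mk, Finsupp.sum_zero_index, add_zero] at this

theorem Homog.pSum (j : ℕ+) : Homog j (pSum j : LambdaHbar k) := by
  have := Homog.single (k := k) (HMono.mk 0 (Finsupp.single j 1)) 1
  rwa [weight_mk, Finsupp.sum_single_index (by simp), mul_zero, zero_add, Nat.cast_one,
    mul_one] at this

theorem Homog.smul {w : ℤ} {f : LambdaHbar k} (h : Homog w f) (c : k) : Homog w (c • f) :=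
  fun m hm => h m (right_ne_zero_of_mul (by simpa using hm))

theorem Homog.prod {ι : Type*} {s : Finset ι} {w : ι → ℤ} {f : ι → LambdaHbar k}
    (h : ∀ i ∈ s, Homog (w i) (f i)) : Homog (∑ i ∈ s, w i) (∏ i ∈ s, f i) := by
  classical
  induction s using Finset.induction_on with
  | empty => simpa using Homog.one
  | insert a s ha ih =>
    rw [Finset.sum_insert ha, Finset.prod_insert ha]
    exact (h a (Finset.mem_insert_self a s)).mul
      (ih fun i hi => h i (Finset.mem_insert_of_mem hi))

theorem Homog.pleth {w : ℤ} {f : LambdaHbar k} (h : Homog w f) (n : ℕ+) :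
    Homog (n * w) (ModOp.pleth n f) := by
  intro m hm
  obtain ⟨a, ha, rfl⟩ := HahnSeries.support_embDomain_subset hm
  change (HMono.dilate n a).weight = _
  rw [HMono.weight_dilate, h a ha]

theorem Homog.euler {w : ℤ} {f : LambdaHbar k} (h : Homog w f) : euler f = (w : k) • f := by
  refine HahnSeries.ext (funext fun m => ?_)
  rw [coeff_euler, HahnSeries.coeff_smul, smul_eq_mul]
  by_cases hm : f.coeff m = 0
  · rw [hm, mul_zero, mul_zero]
  · rw [h m hm]

theorem Homog.oprod {X : Type} [Fintype X] {φ : Perm X} {f : X → LambdaHbar k}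
    (hf : ∀ x, f (φ x) = f x) {q : X → ℤ} (hq : ∀ x, q (φ x) = q x)
    (h : ∀ x, Homog ((orb φ x).card * q x) (f x)) :
    Homog (∑ x, q x) (oprod φ Finset.univ f) := by
  obtain ⟨H, hH⟩ := exists_orbit_function hf
  rw [oprod_eq_prod hf fun x _ => hH x, ← sum_orbs φ q]
  refine Homog.prod fun o ho => ?_
  obtain ⟨x, -, rfl⟩ := mem_orbs.mp ho
  rw [hH, Finset.sum_congr rfl (g := fun _ => q x) fun y hy =>
    invariant_of_step hq (mem_orb.mp hy), Finset.sum_const, nsmul_eq_mul]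
  exact h x

/-- A family of homogeneous elements is summable if there are finitely many of them in each
weight. -/
theorem isSummable_of_homog {ι : Type*} {F : ι → LambdaHbar k} (w : ι → ℤ)
    (hw : ∀ a, Homog (w a) (F a)) (h0 : ∀ a, 0 ≤ w a) (hfin : ∀ n, {a | w a = n}.Finite) :
    IsSummable F := by
  refine isSummable_of_weight 0 (fun a => (hw a).weightGE.mono (h0 a)) fun n => ?_
  refine (hfin n).subset ?_
  rintro a ⟨m, hm, rfl⟩
  exact (hw a m hm).symm

/-- An orbit of ℓ vertices contributes ħ^(ℓ(g-1)), of degree ℓ(2g-2); a cycle of j legs contributes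
p_j, of degree j; an edge contributes ħ, whose degree 2 accounts for its two flags. The total is the
sum of `pt`. -/
theorem Conf.homog_weight {X : Type} [Fintype X] (χ : ℕ → Multiset ℕ → k) (c : Conf X) :
    Homog c.wt (c.weight χ) := by
  classical
  -- The degree per point seen by the orbit factors alone: flags on edges count 0 here, and their
  -- share is supplied by the power of ħ counting edges.
  let q : X → ℤ := fun x => if c.vx x = x then 2 * c.gen x - 2 else if c.inv x = x then 1 else 0
  have h : c.wt = 2 * (c.edges : ℤ) + ∑ x, q x := by
    have h2 : ∑ x, (if c.inv x ≠ x then (1 : ℤ) else 0) = 2 * c.edges := by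
      rw [← Finset.sum_filter, Finset.sum_const, nsmul_eq_mul, mul_one]
      have := c.two_mul_edges
      rw [nonfix] at this
      exact_mod_cast this.symm
    rw [← h2, wt, ← Finset.sum_add_distrib]
    refine Finset.sum_congr rfl fun x _ => ?_
    have hx : c.vx x = x → c.inv x = x := fun hx => by rw [← hx, c.inv_vx]
    simp only [pt, q]
    split_ifs <;> simp_all
  rw [h]
  refine (Homog.hbarPow _).mul (Homog.oprod (c.loc_φ χ) ?_ ?_)
  · intro x
    simp only [q, c.φ_vx, c.φ_inv, c.φ_gen, c.φ.injective.eq_iff]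
  · intro x
    simp only [loc, q]
    split_ifs
    · have := (Homog.hbarPow (k := k) ((orb c.φ x).card * ((c.gen x : ℤ) - 1))).mul
        (Homog.C (c.vfac χ x))
      convert this using 1
      ring
    · have := Homog.pSum (k := k) (orb c.φ x).card.toPNat'
      rw [Nat.toPNat'_coe, if_pos (card_orb_pos c.φ x)] at this
      simpa using this
    · simpa using Homog.one

end Homogeneous

/-! ### Finitely many graphs in each weight. -/

namespace Conf

section Bounds

variable {X : Type} [Fintype X] (c : Conf X)

theorem natCard_flags (x : X) : Nat.card {y // c.vx y = x ∧ c.vx y ≠ y} = (c.flags x).card := by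
  classical
  rw [Nat.card_eq_fintype_card, Fintype.card_subtype]
  congr 1

open scoped Classical in
/-- The set of vertices. -/
def verts : Finset X := Finset.univ.filter fun x => c.vx x = x

theorem mem_verts {c : Conf X} {x : X} : x ∈ c.verts ↔ c.vx x = x := by
  simp [verts]

theorem vx_mem_verts (x : X) : c.vx x ∈ c.verts := mem_verts.mpr (c.vx_vx x)

/-- Grouping the points by their vertex: a vertex v contributes 2g(v) - 2 and each of its flags 1.
By stability every summand is at least 1, and all the bounds below come from this. -/
theorem wt_eq : c.wt = ∑ v ∈ c.verts, (2 * (c.gen v : ℤ) - 2 + (c.flags v).card) := by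
  classical
  have h1 : c.wt = ∑ v ∈ c.verts, ∑ x with c.vx x = v, c.pt x :=
    (Finset.sum_fiberwise_of_maps_to (fun x _ => c.vx_mem_verts x) _).symm
  rw [h1]
  refine Finset.sum_congr rfl fun v hv => ?_
  have hv' := mem_verts.mp hv
  have h2 : (Finset.univ.filter fun x => c.vx x = v) = insert v (c.flags v) := by
    ext x
    rw [Finset.mem_filter, Finset.mem_insert, mem_flags]
    constructor
    · rintro ⟨-, h⟩
      by_cases hx : x = v
      · exact Or.inl hx
      · exact Or.inr ⟨h, fun h' => hx (h'.symm.trans h)⟩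
    · rintro (rfl | h)
      · exact ⟨Finset.mem_univ _, hv'⟩
      · exact ⟨Finset.mem_univ _, h.1⟩
  rw [h2, Finset.sum_insert (fun h => (mem_flags.mp h).2 hv'), pt, if_pos hv',
    Finset.sum_congr rfl (g := fun _ => (1 : ℤ)) fun x hx => ?_]
  · simp
  · rw [pt, if_neg (mem_flags.mp hx).2]

theorem stable' {v : X} (hv : v ∈ c.verts) : 1 ≤ 2 * (c.gen v : ℤ) - 2 + (c.flags v).card := by
  have h := c.stable v
  rw [mem_verts.mp hv, natCard_flags] at h
  omega

theorem card_verts_le : (c.verts.card : ℤ) ≤ c.wt := by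
  rw [wt_eq]
  have := Finset.card_nsmul_le_sum c.verts _ 1 fun v hv => c.stable' hv
  simpa using this

theorem card_eq : (Fintype.card X : ℤ) = c.verts.card + ∑ v ∈ c.verts, ((c.flags v).card : ℤ) := by
  classical
  have h1 : Fintype.card X = ∑ v ∈ c.verts, (Finset.univ.filter fun x => c.vx x = v).card :=
    Finset.card_eq_sum_card_fiberwise fun x _ => c.vx_mem_verts x
  have h2 : ∀ v ∈ c.verts,
      (Finset.univ.filter fun x => c.vx x = v).card = (c.flags v).card + 1 := by
    intro v hv
    have hv' := mem_verts.mp hv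
    rw [← Finset.card_insert_of_notMem (fun h : v ∈ c.flags v => (mem_flags.mp h).2 hv')]
    congr 1
    ext x
    rw [Finset.mem_filter, Finset.mem_insert, mem_flags]
    constructor
    · rintro ⟨-, h⟩
      by_cases hx : x = v
      · exact Or.inl hx
      · exact Or.inr ⟨h, fun h' => hx (h'.symm.trans h)⟩
    · rintro (rfl | h)
      · exact ⟨Finset.mem_univ _, hv'⟩
      · exact ⟨Finset.mem_univ _, h.1⟩
  rw [h1, Finset.sum_congr rfl h2, Finset.sum_add_distrib]
  push_cast
  simp
  ring

/-- There are at most wt vertices, and at most wt + 2 · (number of vertices) ≤ 3 wt flags, since 2g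
- 2 ≥ -2. -/
theorem card_le : (Fintype.card X : ℤ) ≤ 4 * c.wt := by
  have h1 := c.card_verts_le
  have h2 := c.card_eq
  have h3 := c.wt_eq
  rw [Finset.sum_add_distrib] at h3
  have h4 : ∑ v ∈ c.verts, (2 * (c.gen v : ℤ) - 2) ≥ ∑ v ∈ c.verts, (-2 : ℤ) :=
    Finset.sum_le_sum fun v _ => by omega
  rw [Finset.sum_const, nsmul_eq_mul] at h4
  linarith

theorem wt_nonneg : 0 ≤ c.wt := by
  have := c.card_le
  omega

theorem one_le_wt [Nonempty X] : 1 ≤ c.wt := by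
  have := c.card_le
  have : 0 < Fintype.card X := Fintype.card_pos
  omega

theorem gen_le (x : X) : (c.gen x : ℤ) ≤ c.wt + 2 := by
  have h3 := c.wt_eq
  have h := Finset.single_le_sum (f := fun v => 2 * (c.gen v : ℤ) - 2 + (c.flags v).card)
    (fun v hv => (zero_le_one.trans (c.stable' hv))) (c.vx_mem_verts x)
  rw [← h3] at h
  simp only [c.gen_vx] at h
  omega

theorem finite_gen_le (X : Type) [Finite X] (G : ℕ) : {c : Conf X | ∀ x, c.gen x ≤ G}.Finite := by
  let F : {c : Conf X | ∀ x, c.gen x ≤ G} →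
      (X → X) × (X → Fin (G + 1)) × (X → X) × Perm X :=
    fun c => (c.1.vx, fun x => ⟨c.1.gen x, Nat.lt_succ_of_le (c.2 x)⟩, c.1.inv, c.1.φ)
  have hF : Function.Injective F := by
    intro c c' h
    simp only [F, Prod.mk.injEq] at h
    obtain ⟨h1, h2, h3, h4⟩ := h
    refine Subtype.ext (Conf.ext (congrFun h1) (fun x => ?_) (congrFun h3) (fun x => ?_))
    · exact congrArg Fin.val (congrFun h2 x)
    · rw [h4]
  exact Set.finite_coe_iff.mp (Finite.of_injective F hF)

/-- A bounded number of points and bounded genera leave finitely many graphs. This makes the sums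
over all numbered graphs converge. -/
theorem finite_wt (w : ℤ) : {a : Σ M : ℕ, Conf (Fin M) | a.2.wt = w}.Finite := by
  have h : (⋃ M ∈ Set.Iic (4 * w).toNat, Sigma.mk M ''
      {c : Conf (Fin M) | ∀ x, c.gen x ≤ (w + 2).toNat}).Finite :=
    (Set.finite_Iic _).biUnion fun M _ => (finite_gen_le (Fin M) _).image _
  refine h.subset ?_
  rintro ⟨M, c⟩ hc
  change c.wt = w at hc
  refine Set.mem_biUnion (x := M) ?_ ⟨c, fun x => ?_, rfl⟩
  · have := c.card_le
    rw [Fintype.card_fin] at this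
    simp only [Set.mem_Iic]
    omega
  · have := c.gen_le x
    omega

end Bounds

theorem map_eq {X Y : Type} {c : Conf X} {c' : Conf Y} {e : X ≃ Y}
    (h1 : ∀ x, c'.vx (e x) = e (c.vx x)) (h2 : ∀ x, c'.gen (e x) = c.gen x)
    (h3 : ∀ x, c'.inv (e x) = e (c.inv x)) (h4 : ∀ x, c'.φ (e x) = e (c.φ x)) : c.map e = c' := by
  refine Conf.ext (fun y => ?_) (fun y => ?_) (fun y => ?_) (fun y => ?_) <;>
    obtain ⟨x, rfl⟩ := e.surjective y
  · rw [h1]; simp [map]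
  · rw [h2]; simp [map]
  · rw [h3]; simp [map]
  · rw [h4]; simp [map]

/-- A union of components stable under a power of the automorphism is again a graph with an
automorphism. -/
theorem exists_pull {X Y : Type} [Finite Y] (c : Conf X) (j : Y ↪ X) (m : ℕ)
    (hvx : ∀ y, ∃ z, j z = c.vx (j y)) (hinv : ∀ y, ∃ z, j z = c.inv (j y))
    (hφ : ∀ y, ∃ z, j z = (c.φ ^ m) (j y)) (hmem : ∀ x y, c.vx x = j y → ∃ z, j z = x) :
    ∃ c' : Conf Y, (∀ y, j (c'.vx y) = c.vx (j y)) ∧ (∀ y, c'.gen y = c.gen (j y)) ∧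
      (∀ y, j (c'.inv y) = c.inv (j y)) ∧ (∀ y, j (c'.φ y) = (c.φ ^ m) (j y)) := by
  choose vx hvx using hvx
  choose inv hinv using hinv
  choose φ hφ using hφ
  have hφi : Function.Injective φ := by
    intro y y' h
    have := hφ y
    rw [h, hφ y'] at this
    exact j.injective ((c.φ ^ m).injective this.symm)
  have hpow1 : ∀ (m : ℕ) x, c.vx ((c.φ ^ m) x) = (c.φ ^ m) (c.vx x) := fun m x => by
    induction m with
    | zero => rfl
    | succ m ih => rw [pow_succ', Perm.mul_apply, Perm.mul_apply, c.φ_vx, ih]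
  have hpow2 : ∀ (m : ℕ) x, c.gen ((c.φ ^ m) x) = c.gen x := fun m x => by
    induction m with
    | zero => rfl
    | succ m ih => rw [pow_succ', Perm.mul_apply, c.φ_gen, ih]
  have hpow3 : ∀ (m : ℕ) x, c.inv ((c.φ ^ m) x) = (c.φ ^ m) (c.inv x) := fun m x => by
    induction m with
    | zero => rfl
    | succ m ih => rw [pow_succ', Perm.mul_apply, Perm.mul_apply, c.φ_inv, ih]
  refine ⟨{ vx := vx, gen := fun y => c.gen (j y), inv := inv
            φ := Equiv.ofBijective φ (Finite.injective_iff_bijective.mp hφi)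
            vx_vx := fun y => j.injective (by rw [hvx, hvx, c.vx_vx])
            gen_vx := fun y => by rw [hvx, c.gen_vx]
            inv_inv := fun y => j.injective (by rw [hinv, hinv, c.inv_inv])
            inv_vx := fun y => j.injective (by rw [hinv, hvx, c.inv_vx])
            φ_vx := fun y => j.injective (by
              simp only [Equiv.ofBijective_apply]
              rw [hvx, hφ, hφ, hvx, hpow1])
            φ_gen := fun y => by
              simp only [Equiv.ofBijective_apply]
              rw [hφ, hpow2]
            φ_inv := fun y => j.injective (by
              simp only [Equiv.ofBijective_apply]
              rw [hinv, hφ, hφ, hinv, hpow3])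
            stable := fun y => ?_ }, hvx, fun _ => rfl, hinv, hφ⟩
  have h := c.stable (j y)
  let F : {z // vx z = vx y ∧ vx z ≠ z} → {x // c.vx x = c.vx (j y) ∧ c.vx x ≠ x} := fun z =>
    ⟨j z.1, by rw [← hvx, ← hvx, z.2.1], by
      rw [← hvx]
      exact fun h => z.2.2 (j.injective h)⟩
  have hF : Function.Bijective F := by
    refine ⟨fun a b hab => Subtype.ext (j.injective (congrArg Subtype.val hab)), ?_⟩
    rintro ⟨x, h1, h2⟩
    obtain ⟨z, rfl⟩ := hmem x (vx y) (by rw [h1, hvx])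
    refine ⟨⟨z, j.injective (by rw [hvx, hvx, h1]), fun h => h2 ?_⟩, rfl⟩
    rw [← hvx, h]
  rwa [← Nat.card_congr (Equiv.ofBijective F hF)] at h

/-- A path which starts in the image of j cannot leave it, since the image is closed under the
involution and contains a flag if and only if it contains its vertex. -/
theorem Rel.of_emb {X Y : Type} {c : Conf X} {c' : Conf Y} {j : Y ↪ X}
    (hvx : ∀ y, j (c'.vx y) = c.vx (j y)) (hinv : ∀ y, j (c'.inv y) = c.inv (j y))
    (hmem : ∀ x y, c.vx x = j y → ∃ z, j z = x) {y y' : Y} (h : c.Rel (j y) (j y')) :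
    c'.Rel y y' := by
  -- Constancy of membership in the image is carried along the induction, so that the middle point
  -- of a transitivity step can be lifted.
  have key : ∀ u v, c.Rel u v → (u ∈ Set.range j ↔ v ∈ Set.range j) ∧
      ∀ y y', j y = u → j y' = v → c'.Rel y y' := by
    intro u v h
    induction h with
    | rel u v h =>
      rcases h with rfl | rfl
      · refine ⟨⟨?_, ?_⟩, ?_⟩
        · rintro ⟨y, rfl⟩
          exact ⟨_, hvx y⟩
        · rintro ⟨y, hy⟩
          exact hmem u y hy.symm
        · rintro y y' rfl h
          rw [← hvx] at h
          exact Relation.EqvGen.rel _ _ (Or.inl (j.injective h))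
      · refine ⟨⟨?_, ?_⟩, ?_⟩
        · rintro ⟨y, rfl⟩
          exact ⟨_, hinv y⟩
        · rintro ⟨y, hy⟩
          exact ⟨c'.inv y, by rw [hinv, hy, c.inv_inv]⟩
        · rintro y y' rfl h
          rw [← hinv] at h
          exact Relation.EqvGen.rel _ _ (Or.inr (j.injective h))
    | refl u =>
      refine ⟨Iff.rfl, ?_⟩
      rintro y y' rfl h
      rw [j.injective h]
      exact Relation.EqvGen.refl _
    | symm u v _ ih => exact ⟨ih.1.symm, fun y y' h h' => (ih.2 y' y h' h).symm⟩
    | trans u v w _ _ h1 h2 =>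
      refine ⟨h1.1.trans h2.1, ?_⟩
      rintro y y' rfl rfl
      obtain ⟨z, hz⟩ := h1.1.mp ⟨y, rfl⟩
      exact (h1.2 y z rfl hz).trans _ _ _ (h2.2 z y' hz rfl)
  exact (key _ _ h).2 y y' rfl rfl

theorem Rel.invariant {X : Type} {c : Conf X} {α : Type*} {f : X → α}
    (h1 : ∀ x, f (c.vx x) = f x) (h2 : ∀ x, f (c.inv x) = f x) {x y : X} (h : c.Rel x y) :
    f x = f y := by
  induction h with
  | rel x y h => rcases h with rfl | rfl; exacts [(h1 x).symm, (h2 x).symm]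
  | refl x => rfl
  | symm x y _ ih => exact ih.symm
  | trans x y z _ _ h1 h2 => exact h1.trans h2

theorem Rel.map {X Y : Type} {c : Conf X} {c' : Conf Y} {j : X → Y}
    (h1 : ∀ x, c'.vx (j x) = j (c.vx x)) (h2 : ∀ x, c'.inv (j x) = j (c.inv x)) {x y : X}
    (hxy : c.Rel x y) : c'.Rel (j x) (j y) := by
  induction hxy with
  | rel x y hxy =>
    refine Relation.EqvGen.rel _ _ ?_
    rw [h1, h2]
    rcases hxy with rfl | rfl
    · exact Or.inl rfl
    · exact Or.inr rfl
  | refl x => exact Relation.EqvGen.refl _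
  | symm x y _ ih => exact ih.symm
  | trans x y z _ _ h1 h2 => exact h1.trans _ _ _ h2

/-! ### Decomposition of a marked graph into the orbit of the marked component and the rest. -/

/-- Graphs without edges, if edges are not admitted. -/
def Adm {X : Type} (E : Prop) (c : Conf X) : Prop := E ∨ ∀ x, c.inv x = x

/-- A decomposition of a graph with automorphism, as the orbit of one of its components and the
union of the other components. -/
structure Dec (E : Prop) where
  n : ℕ
  r : ℕ
  s : ℕ
  M : ℕ
  b : Conf (Fin r)
  hb : b.Adm E ∧ b.Conn
  y : Fin r
  d : Conf (Fin s)
  hd : d.Adm E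
  f : (Fin (n + 1) × Fin r) ⊕ Fin s ≃ Fin M

/-- The graph which is decomposed. -/
def Dec.conf {E : Prop} (z : Dec E) : Conf (Fin z.M) := ((z.b.susp z.n).sum z.d).map z.f

/-- The marked point. -/
def Dec.pos {E : Prop} (z : Dec E) : Fin z.M := z.f (.inl (0, z.y))

theorem Dec.adm {E : Prop} (z : Dec E) : z.conf.Adm E := by
  rcases z.hb.1 with h | h
  · exact Or.inl h
  · rcases z.hd with h' | h'
    · exact Or.inl h'
    · refine Or.inr fun x => ?_
      obtain ⟨p, rfl⟩ := z.f.surjective x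
      rcases p with ⟨i, a⟩ | t
      · simp [Dec.conf, Conf.map, Conf.sum, Conf.susp, h]
      · simp [Dec.conf, Conf.map, Conf.sum, Conf.susp, h']

theorem susp_map {X Y : Type} (n : ℕ) (c : Conf X) (e : X ≃ Y) :
    (c.susp n).map ((Equiv.refl (Fin (n + 1))).prodCongr e) = (c.map e).susp n := by
  refine map_eq ?_ ?_ ?_ ?_
  · rintro ⟨i, x⟩; simp [susp, map]
  · rintro ⟨i, x⟩; simp [susp, map]
  · rintro ⟨i, x⟩; simp [susp, map]
  · rintro ⟨i, x⟩
    by_cases h : i = Fin.last n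
    · subst h
      simp [susp, map, suspPerm_last]
    · simp [susp, map, suspPerm_of_ne _ h]

theorem sum_map {X Y X' Y' : Type} (c : Conf X) (c' : Conf X') (e : X ≃ Y) (e' : X' ≃ Y') :
    (c.sum c').map (e.sumCongr e') = (c.map e).sum (c'.map e') := by
  refine map_eq ?_ ?_ ?_ ?_ <;> rintro (x | x) <;> simp [sum, map]

theorem adm_map {X Y : Type} {E : Prop} {c : Conf X} (h : c.Adm E) (e : X ≃ Y) :
    (c.map e).Adm E := h.imp id fun h y => by simp [map, h]

theorem conn_map {X Y : Type} {c : Conf X} (h : c.Conn) (e : X ≃ Y) : (c.map e).Conn := by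
  refine ⟨h.1.map e, fun x y => ?_⟩
  have := (h.2 (e.symm x) (e.symm y)).emb (c.isEmb_map e)
  simpa using this

/-- Change of the numberings in a decomposition. -/
def Dec.act {E : Prop} (z : Dec E) (α : Perm (Fin z.r) × Perm (Fin z.s)) : Dec E where
  n := z.n
  r := z.r
  s := z.s
  M := z.M
  b := z.b.map α.1
  hb := ⟨adm_map z.hb.1 _, conn_map z.hb.2 _⟩
  y := α.1 z.y
  d := z.d.map α.2
  hd := adm_map z.hd _
  f := (((Equiv.refl (Fin (z.n + 1))).prodCongr α.1).sumCongr α.2).symm.trans z.f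

theorem Dec.act_conf {E : Prop} (z : Dec E) (α : Perm (Fin z.r) × Perm (Fin z.s)) :
    (z.act α).conf = z.conf := by
  change (((z.b.map α.1).susp z.n).sum (z.d.map α.2)).map
    ((((Equiv.refl (Fin (z.n + 1))).prodCongr α.1).sumCongr α.2).symm.trans z.f) = _
  rw [← susp_map, ← sum_map, map_map, ← Equiv.trans_assoc, Equiv.self_trans_symm,
    Equiv.refl_trans]
  rfl

theorem Dec.act_pos {E : Prop} (z : Dec E) (α : Perm (Fin z.r) × Perm (Fin z.s)) :
    (z.act α).pos = z.pos := by
  change z.f (.inl (0, α.1.symm (α.1 z.y))) = z.f (.inl (0, z.y))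
  rw [Equiv.symm_apply_apply]

theorem Dec.act_injective {E : Prop} (z : Dec E) : Function.Injective z.act := by
  intro α β h
  -- The numbering of the whole graph alone determines both renumberings.
  have hf : HEq (z.act α).f (z.act β).f := by rw [h]
  have hf' := eq_of_heq hf
  simp only [Dec.act] at hf'
  have h2 := congrArg (fun e => (e.trans z.f.symm).symm) hf'
  simp only [Equiv.trans_assoc, Equiv.self_trans_symm, Equiv.trans_refl, Equiv.symm_symm] at h2
  refine Prod.ext (Equiv.ext fun a => ?_) (Equiv.ext fun t => ?_)
  · have := congrArg (fun e => e (.inl (0, a))) h2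
    simpa using this
  · have := congrArg (fun e => e (.inr t)) h2
    simpa using this

/-! ### Uniqueness of the decomposition up to renumbering. -/

section Uniqueness

variable {n n' : ℕ} {A A' S S' : Type} {b : Conf A} {b' : Conf A'} {d : Conf S} {d' : Conf S'}

theorem pow_sum_susp_zero (a : A) (i : ℕ) (hi : i < n + 1) :
    (((b.susp n).sum d).φ ^ i) (.inl (0, a)) = .inl (⟨i, hi⟩, a) := by
  rw [pow_semiconj (φ := suspPerm n b.φ) (j := Sum.inl) (fun _ => rfl), suspPerm_pow_zero b.φ a i hi]

theorem pow_sum_susp (a : A) (i : Fin (n + 1)) :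
    (((b.susp n).sum d).φ ^ (n + 1)) (.inl (i, a)) = .inl (i, b.φ a) := by
  rw [pow_semiconj (φ := suspPerm n b.φ) (j := Sum.inl) (fun _ => rfl), suspPerm_pow]

/-- The copy in which a point is. -/
def lab (p : (Fin (n + 1) × A) ⊕ S) : Option (Fin (n + 1)) := p.elim (fun q => some q.1) fun _ => none

theorem lab_rel {p q : (Fin (n + 1) × A) ⊕ S} (h : ((b.susp n).sum d).Rel p q) : lab p = lab q := by
  refine h.invariant ?_ ?_ <;> rintro (⟨i, a⟩ | t) <;> rfl

theorem rel_zero (hb : b.Conn) (a a' : A) :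
    ((b.susp n).sum d).Rel (.inl (0, a)) (.inl (0, a')) :=
  (hb.2 a a').map (c' := (b.susp n).sum d) (j := fun a => .inl (0, a)) (fun _ => rfl) fun _ => rfl

variable {g : (Fin (n + 1) × A) ⊕ S ≃ (Fin (n' + 1) × A') ⊕ S'}

theorem exists_of_map (hb : b.Conn) (hg : ((b.susp n).sum d).map g = (b'.susp n').sum d')
    {y : A} {y' : A'} (hy : g (.inl (0, y)) = .inl (0, y')) (a : A) :
    ∃ a', g (.inl (0, a)) = .inl (0, a') := by
  have h1 := (rel_zero (n := n) (d := d) hb y a).emb (Conf.isEmb_map _ g)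
  rw [hg] at h1
  have h2 := lab_rel h1
  change lab (g _) = lab (g _) at h2
  rw [hy] at h2
  rcases hga : g (.inl (0, a)) with ⟨i, a'⟩ | t
  · rw [hga] at h2
    simp only [lab, Sum.elim_inl, Option.some.injEq] at h2
    subst h2
    exact ⟨a', rfl⟩
  · rw [hga] at h2
    simp [lab] at h2

theorem map_pow (hg : ((b.susp n).sum d).map g = (b'.susp n').sum d') (i : ℕ) (p) :
    (((b'.susp n').sum d').φ ^ i) (g p) = g ((((b.susp n).sum d).φ ^ i) p) := by
  rw [← hg]
  exact pow_semiconj (Conf.isEmb_map _ g).φ i p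

/-- The number n + 1 is the first return time of the marked component. If n < n', then n + 1 steps
from the marked point lead back to copy 0 in one decomposition and to copy n + 1 ≠ 0 in the other.
By symmetry the two numbers of copies agree. -/
theorem le_of_map (hb : b.Conn) (hg : ((b.susp n).sum d).map g = (b'.susp n').sum d')
    {y : A} {y' : A'} (hy : g (.inl (0, y)) = .inl (0, y')) : n' ≤ n := by
  by_contra hlt
  have h1 := map_pow hg (n + 1) (.inl (0, y))
  obtain ⟨a', ha'⟩ := exists_of_map hb hg hy (b.φ y)
  rw [pow_sum_susp, hy, ha', pow_sum_susp_zero y' (n + 1) (by omega)] at h1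
  have := congrArg Fin.val (Prod.mk.inj (Sum.inl_injective h1)).1
  simp at this

theorem map_symm (hg : ((b.susp n).sum d).map g = (b'.susp n').sum d') :
    ((b'.susp n').sum d').map g.symm = (b.susp n).sum d := by
  rw [← hg, map_map, Equiv.self_trans_symm, map_refl]

/-- Copy 0 is the component of the marked point, so g maps copy 0 to copy 0; this defines α. Since g
commutes with the automorphisms, it is α on every other copy too, and what remains is a bijection β
of the complements. -/
theorem exists_equiv_of_map {g : (Fin (n + 1) × A) ⊕ S ≃ (Fin (n + 1) × A') ⊕ S'}
    (hb : b.Conn) (hb' : b'.Conn)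
    (hg : ((b.susp n).sum d).map g = (b'.susp n).sum d')
    {y : A} {y' : A'} (hy : g (.inl (0, y)) = .inl (0, y')) :
    ∃ (α : A ≃ A') (β : S ≃ S'), b.map α = b' ∧ d.map β = d' ∧ α y = y' ∧
      ((Equiv.refl (Fin (n + 1))).prodCongr α).sumCongr β = g := by
  have hy' : g.symm (.inl (0, y')) = .inl (0, y) := by rw [← hy, Equiv.symm_apply_apply]
  choose α hα using exists_of_map hb hg hy
  choose α' hα' using exists_of_map hb' (map_symm hg) hy'
  let αe : A ≃ A' :=
    { toFun := α
      invFun := α'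
      left_inv := fun a => by
        have := hα' (α a)
        rw [← hα, Equiv.symm_apply_apply] at this
        exact (Prod.mk.inj (Sum.inl_injective this)).2.symm
      right_inv := fun a => by
        have := hα (α' a)
        rw [← hα', Equiv.apply_symm_apply] at this
        exact (Prod.mk.inj (Sum.inl_injective this)).2.symm }
  have hα2 : ∀ i a, g (.inl (i, a)) = .inl (i, α a) := by
    intro i a
    have h1 := map_pow hg i (.inl (0, a))
    rw [pow_sum_susp_zero a i i.2, hα, pow_sum_susp_zero (α a) i i.2] at h1
    exact h1.symm
  have hα2' : ∀ i a, g.symm (.inl (i, a)) = .inl (i, α' a) := by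
    intro i a
    have h1 := map_pow (map_symm hg) i (.inl (0, a))
    rw [pow_sum_susp_zero a i i.2, hα', pow_sum_susp_zero (α' a) i i.2] at h1
    exact h1.symm
  have hβ : ∀ t, ∃ t', g (.inr t) = .inr t' := by
    intro t
    rcases h : g (.inr t) with ⟨i, a⟩ | t'
    · have := hα2' i a
      rw [← h, Equiv.symm_apply_apply] at this
      cases this
    · exact ⟨t', rfl⟩
  have hβ' : ∀ t, ∃ t', g.symm (.inr t) = .inr t' := by
    intro t
    rcases h : g.symm (.inr t) with ⟨i, a⟩ | t'
    · have := hα2 i a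
      rw [← h, Equiv.apply_symm_apply] at this
      cases this
    · exact ⟨t', rfl⟩
  choose β hβ using hβ
  choose β' hβ' using hβ'
  let βe : S ≃ S' :=
    { toFun := β
      invFun := β'
      left_inv := fun a => by
        have := hβ' (β a)
        rw [← hβ, Equiv.symm_apply_apply] at this
        exact (Sum.inr_injective this).symm
      right_inv := fun a => by
        have := hβ (β' a)
        rw [← hβ', Equiv.apply_symm_apply] at this
        exact (Sum.inr_injective this).symm }
  have hge : ((Equiv.refl (Fin (n + 1))).prodCongr αe).sumCongr βe = g := by
    refine Equiv.ext ?_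
    rintro (⟨i, a⟩ | t)
    · exact (hα2 i a).symm
    · exact (hβ t).symm
  have hgm := hg
  rw [← hge, sum_map, susp_map] at hgm
  refine ⟨αe, βe, ?_, ?_, ?_, hge⟩
  · refine Conf.ext (fun a => ?_) (fun a => ?_) (fun a => ?_) (fun a => ?_)
    · have := congrArg (fun c => c.vx (.inl (0, a))) hgm
      exact (Prod.mk.inj (Sum.inl_injective this)).2
    · exact congrArg (fun c => c.gen (.inl (0, a))) hgm
    · have := congrArg (fun c => c.inv (.inl (0, a))) hgm
      exact (Prod.mk.inj (Sum.inl_injective this)).2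
    -- The automorphism of the component is visible only as the first return to copy 0, that is, as
    -- the power n + 1.
    · have := congrArg (fun c => (c.φ ^ (n + 1)) (.inl (0, a))) hgm
      simp only [pow_sum_susp] at this
      exact (Prod.mk.inj (Sum.inl_injective this)).2
  · refine Conf.ext (fun a => ?_) (fun a => ?_) (fun a => ?_) (fun a => ?_)
    · exact Sum.inr_injective (congrArg (fun c => c.vx (.inr a)) hgm)
    · exact congrArg (fun c => c.gen (.inr a)) hgm
    · exact Sum.inr_injective (congrArg (fun c => c.inv (.inr a)) hgm)
    · exact Sum.inr_injective (congrArg (fun c => c.φ (.inr a)) hgm)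
  · have := hα y
    rw [hy] at this
    exact (Prod.mk.inj (Sum.inl_injective this)).2.symm

end Uniqueness

/-- Two decompositions of the same graph with the same marked point differ by a change of the
numberings. -/
theorem Dec.exists_act {E : Prop} (z z' : Dec E) (hM : z.M = z'.M)
    (hc : hM ▸ z.conf = z'.conf) (hp : hM ▸ z.pos = z'.pos) : ∃ α, z.act α = z' := by
  obtain ⟨n, r, s, M, b, hb, y, d, hd, f⟩ := z
  obtain ⟨n', r', s', M', b', hb', y', d', hd', f'⟩ := z'
  simp only at hM
  subst hM
  simp only [Dec.conf, Dec.pos] at hc hp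
  let g := f.trans f'.symm
  have hg : ((b.susp n).sum d).map g = (b'.susp n').sum d' := by
    rw [← map_map, hc, map_map, Equiv.self_trans_symm, map_refl]
  have hy : g (.inl (0, y)) = .inl (0, y') := by
    simp only [g, Equiv.trans_apply, hp, Equiv.symm_apply_apply]
  have hy' : g.symm (.inl (0, y')) = .inl (0, y) := by rw [← hy, Equiv.symm_apply_apply]
  obtain rfl : n = n' := le_antisymm (le_of_map hb'.2 (map_symm hg) hy') (le_of_map hb.2 hg hy)
  obtain ⟨α, β, h1, h2, h3, h4⟩ := exists_equiv_of_map hb.2 hb'.2 hg hy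
  obtain rfl : r = r' := by simpa using Fintype.card_congr α
  obtain rfl : s = s' := by simpa using Fintype.card_congr β
  refine ⟨(α, β), ?_⟩
  subst h1 h2 h3
  simp only [Dec.act, Dec.mk.injEq, heq_eq_eq, true_and]
  rw [h4]
  ext p
  simp [g]

/-- Every graph with a marked point has a decomposition. -/
theorem exists_dec {E : Prop} {M : ℕ} (c : Conf (Fin M)) (hc : c.Adm E) (x : Fin M) :
    ∃ (z : Dec E) (hM : z.M = M), hM ▸ z.conf = c ∧ hM ▸ z.pos = x := by
  classical
  have hφR : ∀ {u v : Fin M}, c.Rel u v → c.Rel (c.φ u) (c.φ v) := fun h => h.emb c.isEmb_φ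
  have hφR' : ∀ (i : ℕ) {u v : Fin M}, c.Rel u v → c.Rel ((c.φ ^ i) u) ((c.φ ^ i) v) := by
    intro i u v h
    induction i with
    | zero => exact h
    | succ i ih =>
      rw [pow_succ', Perm.mul_apply, Perm.mul_apply]
      exact hφR ih
  have hvxR : ∀ u, c.Rel u (c.vx u) := fun u => Relation.EqvGen.rel _ _ (Or.inl rfl)
  have hinvR : ∀ u, c.Rel u (c.inv u) := fun u => Relation.EqvGen.rel _ _ (Or.inr rfl)
  have hex : ∃ m, c.Rel x ((c.φ ^ (m + 1)) x) := by
    refine ⟨orderOf c.φ - 1, ?_⟩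
    rw [Nat.sub_add_cancel (orderOf_pos c.φ), pow_orderOf_eq_one]
    exact Relation.EqvGen.refl _
  -- The first return time n + 1 of the component of x; it exists because φ has finite order.
  obtain ⟨n, hn, hmin⟩ : ∃ n, c.Rel x ((c.φ ^ (n + 1)) x) ∧
      ∀ m < n, ¬ c.Rel x ((c.φ ^ (m + 1)) x) :=
    ⟨Nat.find hex, Nat.find_spec hex, fun m hm => Nat.find_min hex hm⟩
  -- the component of `x`
  let eB := (Fintype.equivFin {u // c.Rel x u}).symm
  -- The orbit of the component of x: the union of its translates by φ^i for i ≤ n.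
  let S : Fin M → Prop := fun u => ∃ (i : ℕ) (a : {u // c.Rel x u}), i < n + 1 ∧ (c.φ ^ i) a.1 = u
  have hSR : ∀ {u v}, c.Rel u v → S u → S v := by
    rintro u v h ⟨i, a, hi, rfl⟩
    refine ⟨i, ⟨(c.φ ^ i).symm v, ?_⟩, hi, by simp⟩
    -- The inverse of φ^i is written as a power with natural exponent, as invariance of the
    -- component relation is known for these.
    have h1 := hφR' (orderOf c.φ * i - i) h
    have h2 : ∀ w, (c.φ ^ (orderOf c.φ * i - i)) w = (c.φ ^ i).symm w := by
      intro w
      rw [Equiv.eq_symm_apply, ← Perm.mul_apply, ← pow_add,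
        Nat.add_sub_cancel' (Nat.le_mul_of_pos_left i (orderOf_pos c.φ)), pow_mul,
        pow_orderOf_eq_one, one_pow, Perm.one_apply]
    rw [h2, h2, Equiv.symm_apply_apply] at h1
    exact a.2.trans _ _ _ h1
  have hSφ : ∀ {u}, S u → S (c.φ u) := by
    rintro u ⟨i, a, hi, rfl⟩
    by_cases hin : i + 1 < n + 1
    · exact ⟨i + 1, a, hin, by rw [pow_succ', Perm.mul_apply]⟩
    · obtain rfl : i = n := by omega
      refine ⟨0, ⟨(c.φ ^ (i + 1)) a.1, ?_⟩, by omega, ?_⟩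
      · exact hn.trans _ _ _ (hφR' (i + 1) a.2)
      · change (c.φ ^ (i + 1)) a.1 = c.φ ((c.φ ^ i) a.1)
        rw [pow_succ', Perm.mul_apply]
  -- If φ u were in S, so would be all further iterates, and one of them is u because φ has finite
  -- order.
  have hSφ' : ∀ {u}, ¬ S u → ¬ S (c.φ u) := by
    intro u h h'
    have h1 : ∀ i : ℕ, S ((c.φ ^ (i + 1)) u) := fun i => by
      induction i with
      | zero => simpa using h'
      | succ i ih =>
        rw [pow_succ', Perm.mul_apply]
        exact hSφ ih
    have h2 := h1 (orderOf c.φ - 1)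
    rw [Nat.sub_add_cancel (orderOf_pos c.φ), pow_orderOf_eq_one] at h2
    exact h h2
  let eS := (Fintype.equivFin {u // ¬ S u}).symm
  let jB : Fin (Fintype.card {u // c.Rel x u}) ↪ Fin M :=
    eB.toEmbedding.trans (Function.Embedding.subtype _)
  let jS : Fin (Fintype.card {u // ¬ S u}) ↪ Fin M :=
    eS.toEmbedding.trans (Function.Embedding.subtype _)
  have hjB : ∀ u, c.Rel x u → ∃ a, jB a = u := fun u hu => ⟨eB.symm ⟨u, hu⟩, by simp [jB]⟩
  have hjS : ∀ u, ¬ S u → ∃ a, jS a = u := fun u hu => ⟨eS.symm ⟨u, hu⟩, by simp [jS]⟩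
  have hjB' : ∀ a, c.Rel x (jB a) := fun a => (eB a).2
  have hjS' : ∀ a, ¬ S (jS a) := fun a => (eS a).2
  obtain ⟨b, hb1, hb2, hb3, hb4⟩ := c.exists_pull jB (n + 1)
    (fun a => hjB _ ((hjB' a).trans _ _ _ (hvxR _)))
    (fun a => hjB _ ((hjB' a).trans _ _ _ (hinvR _)))
    (fun a => hjB _ (hn.trans _ _ _ (hφR' (n + 1) (hjB' a))))
    (fun u a h => hjB _ ((hjB' a).trans _ _ _ (h ▸ (hvxR u).symm)))
  obtain ⟨d, hd1, hd2, hd3, hd4⟩ := c.exists_pull jS 1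
    (fun a => hjS _ fun h => hjS' a (hSR (hvxR _).symm h))
    (fun a => hjS _ fun h => hjS' a (hSR (hinvR _).symm h))
    (fun a => hjS _ (hSφ' (hjS' a)))
    (fun u a h => hjS _ fun h' => hjS' a (h ▸ hSR (hvxR u) h'))
  rw [pow_one] at hd4
  let f0 : (Fin (n + 1) × Fin (Fintype.card {u // c.Rel x u})) ⊕ Fin (Fintype.card {u // ¬ S u}) →
      Fin M := Sum.elim (fun p => (c.φ ^ (p.1 : ℕ)) (jB p.2)) jS
  -- The translates are disjoint: a coincidence between two of them would give a return before the
  -- time n + 1.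
  have haux : ∀ (i i' : ℕ) a a', i ≤ i' → i' < n + 1 →
      (c.φ ^ i) (jB a) = (c.φ ^ i') (jB a') → i = i' ∧ a = a' := by
    intro i i' a a' hle hi' h
    obtain ⟨t, rfl⟩ := Nat.exists_eq_add_of_le hle
    rw [pow_add, Perm.mul_apply] at h
    have h1 := (c.φ ^ i).injective h
    rcases t with _ | t
    · exact ⟨rfl, jB.injective h1⟩
    · refine absurd ?_ (hmin t (by omega))
      have h2 := hφR' (t + 1) (hjB' a')
      rw [← h1] at h2
      exact (hjB' a).trans _ _ _ h2.symm
  have hf0 : Function.Bijective f0 := by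
    constructor
    · rintro (⟨i, a⟩ | t) (⟨i', a'⟩ | t') h
      · simp only [f0, Sum.elim_inl] at h
        rcases le_total (i : ℕ) i' with hle | hle
        · obtain ⟨h1, h2⟩ := haux i i' a a' hle i'.2 h
          rw [Fin.ext h1, h2]
        · obtain ⟨h1, h2⟩ := haux i' i a' a hle i.2 h.symm
          rw [Fin.ext h1, h2]
      · simp only [f0, Sum.elim_inl, Sum.elim_inr] at h
        exact absurd ⟨i, ⟨jB a, hjB' a⟩, i.2, h⟩ (hjS' t')
      · simp only [f0, Sum.elim_inl, Sum.elim_inr] at h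
        exact absurd ⟨i', ⟨jB a', hjB' a'⟩, i'.2, h.symm⟩ (hjS' t)
      · simp only [f0, Sum.elim_inr] at h
        rw [jS.injective h]
    · intro u
      by_cases hu : S u
      · obtain ⟨i, a, hi, rfl⟩ := hu
        obtain ⟨a', ha'⟩ := hjB a.1 a.2
        exact ⟨.inl (⟨i, hi⟩, a'), by simp [f0, ha']⟩
      · obtain ⟨t, rfl⟩ := hjS u hu
        exact ⟨.inr t, rfl⟩
  obtain ⟨y, hy⟩ := hjB x (Relation.EqvGen.refl _)
  have hpow1 : ∀ (m : ℕ) u, c.vx ((c.φ ^ m) u) = (c.φ ^ m) (c.vx u) := fun m u => by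
    induction m with
    | zero => rfl
    | succ m ih => rw [pow_succ', Perm.mul_apply, Perm.mul_apply, c.φ_vx, ih]
  have hpow2 : ∀ (m : ℕ) u, c.gen ((c.φ ^ m) u) = c.gen u := fun m u => by
    induction m with
    | zero => rfl
    | succ m ih => rw [pow_succ', Perm.mul_apply, c.φ_gen, ih]
  have hpow3 : ∀ (m : ℕ) u, c.inv ((c.φ ^ m) u) = (c.φ ^ m) (c.inv u) := fun m u => by
    induction m with
    | zero => rfl
    | succ m ih => rw [pow_succ', Perm.mul_apply, Perm.mul_apply, c.φ_inv, ih]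
  have hbc : b.Conn := ⟨⟨y⟩, fun a a' => Rel.of_emb hb1 hb3
    (fun u a h => hjB _ ((hjB' a).trans _ _ _ (h ▸ (hvxR u).symm)))
    ((hjB' a).symm.trans _ _ _ (hjB' a'))⟩
  refine ⟨⟨n, _, _, M, b, ⟨hc.imp id fun h a => jB.injective ((hb3 a).trans (h _)), hbc⟩, y, d,
    hc.imp id fun h a => jS.injective ((hd3 a).trans (h _)), Equiv.ofBijective f0 hf0⟩, rfl, ?_, ?_⟩
  · refine map_eq ?_ ?_ ?_ ?_
    · rintro (⟨i, a⟩ | t)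
      · change c.vx ((c.φ ^ (i : ℕ)) (jB a)) = (c.φ ^ (i : ℕ)) (jB (b.vx a))
        rw [hpow1, hb1]
      · exact (hd1 t).symm
    · rintro (⟨i, a⟩ | t)
      · change c.gen ((c.φ ^ (i : ℕ)) (jB a)) = b.gen a
        rw [hpow2, hb2]
      · exact (hd2 t).symm
    · rintro (⟨i, a⟩ | t)
      · change c.inv ((c.φ ^ (i : ℕ)) (jB a)) = (c.φ ^ (i : ℕ)) (jB (b.inv a))
        rw [hpow3, hb3]
      · exact (hd3 t).symm
    · rintro (⟨i, a⟩ | t)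
      · change c.φ ((c.φ ^ (i : ℕ)) (jB a)) = f0 (.inl (suspPerm n b.φ (i, a)))
        by_cases h : i = Fin.last n
        · subst h
          rw [suspPerm_last]
          change _ = jB (b.φ a)
          rw [hb4, pow_succ', Perm.mul_apply]
          rfl
        · rw [suspPerm_of_ne _ h]
          change _ = (c.φ ^ ((i + 1 : Fin (n + 1)) : ℕ)) (jB a)
          rw [Fin.val_add_one_of_lt (lt_of_le_of_ne (Fin.le_last i) h), pow_succ', Perm.mul_apply]
      · exact (hd4 t).symm
  · change f0 (.inl (0, y)) = x
    simpa [f0] using hy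

end Conf

/-! ### Generating functions of graphs with automorphism and the plethystic equation. -/

namespace Conf

variable {k : Type u} [Field k] (χ : ℕ → Multiset ℕ → k)

/-- Numbered graphs with automorphisms. -/
abbrev Num : Type := Σ M : ℕ, Conf (Fin M)

/-- The contribution of a graph with automorphism, divided by the number of the numberings. -/
def term (a : Num) : LambdaHbar k := ((a.1.factorial : k)⁻¹) • a.2.weight χ

theorem homog_term (a : Num) : Homog a.2.wt (term χ a) := (homog_weight χ a.2).smul _

/-- The generating function of graphs with automorphisms, over all the graphs which satisfy a
condition. -/
def gsum (P : Num → Prop) : LambdaHbar k := infSum fun a : {a // P a} => term χ a.1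

theorem isSummable_term (P : Num → Prop) : IsSummable fun a : {a // P a} => term χ a.1 :=
  isSummable_of_homog (fun a => a.1.2.wt) (fun a => homog_term χ a.1) (fun a => a.1.2.wt_nonneg)
    fun n => (finite_wt n).preimage Subtype.val_injective.injOn

/-- Numbered graphs with automorphisms and a marked vertex or flag. -/
abbrev Marked (P : Num → Prop) : Type := Σ a : {a // P a}, Fin a.1.1

theorem finite_marked (P : Num → Prop) (w : ℤ) : {a : Marked P | a.1.1.2.wt = w}.Finite := by
  have h : (⋃ a ∈ {a : {a // P a} | a.1.2.wt = w}, Set.range (Sigma.mk a)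
      : Set (Marked P)).Finite :=
    ((finite_wt w).preimage Subtype.val_injective.injOn).biUnion fun a _ => Set.finite_range _
  refine h.subset ?_
  rintro ⟨a, x⟩ ha
  exact Set.mem_biUnion (show a ∈ {a : {a // P a} | a.1.2.wt = w} from ha) ⟨x, rfl⟩

/-- The contribution of a marked graph to the Euler derivative. -/
def mterm {P : Num → Prop} (a : Marked P) : LambdaHbar k := (a.1.1.2.pt a.2 : k) • term χ a.1.1

theorem isSummable_mterm (P : Num → Prop) : IsSummable fun a : Marked P => mterm χ a :=
  isSummable_of_homog (fun a => a.1.1.2.wt) (fun a => (homog_term χ a.1.1).smul _)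
    (fun a => a.1.1.2.wt_nonneg) (finite_marked P)

/-- The weight of a graph is the sum of `pt` over its points, so differentiating amounts to marking
a point and counting it with the factor `pt`. -/
theorem euler_gsum (P : Num → Prop) :
    euler (gsum χ P) = infSum fun a : Marked P => mterm χ a := by
  rw [gsum, (euler_infSum (isSummable_term χ P)).1, (infSum_sigma (isSummable_mterm χ P)).1]
  congr 1
  funext a
  rw [(homog_term χ a.1).euler, infSum_fintype]
  simp only [mterm]
  rw [← Finset.sum_smul]
  congr 1
  rw [wt]
  push_cast
  rfl

/-- The graphs which occur, edges being admitted or not. -/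
def IsAdm (E : Prop) (a : Num) : Prop := a.2.Adm E

/-- The connected graphs which occur, edges being admitted or not. -/
def IsConn (E : Prop) (a : Num) : Prop := a.2.Adm E ∧ a.2.Conn

/-- The marked graph which is decomposed. -/
def Dec.marked {E : Prop} (z : Dec E) : Marked (IsAdm E) := ⟨⟨⟨z.M, z.conf⟩, z.adm⟩, z.pos⟩

theorem marked_ext {P : Num → Prop} {a a' : Marked P} (h : a = a') :
    ∃ hM : a.1.1.1 = a'.1.1.1, hM ▸ a.1.1.2 = a'.1.1.2 ∧ hM ▸ a.2 = a'.2 := by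
  subst h
  exact ⟨rfl, rfl, rfl⟩

theorem Dec.marked_act {E : Prop} (z : Dec E) (α : Perm (Fin z.r) × Perm (Fin z.s)) :
    (z.act α).marked = z.marked := by
  have h1 := z.act_conf α
  have h2 := z.act_pos α
  have key : ∀ (M : ℕ) (c c' : Conf (Fin M)) (hc : c.Adm E) (hc' : c'.Adm E) (x x' : Fin M),
      c = c' → x = x' →
      (⟨⟨⟨M, c⟩, hc⟩, x⟩ : Marked (IsAdm E)) = ⟨⟨⟨M, c'⟩, hc'⟩, x'⟩ := by
    rintro M c _ hc hc' x _ rfl rfl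
    rfl
  exact key z.M _ _ _ _ _ _ h1 h2

theorem Dec.exists_marked {E : Prop} (a : Marked (IsAdm E)) : ∃ z : Dec E, z.marked = a := by
  obtain ⟨⟨⟨M, c⟩, hc⟩, x⟩ := a
  obtain ⟨z, rfl, h1, h2⟩ := exists_dec c hc x
  simp only at h1 h2
  subst h1 h2
  exact ⟨z, rfl⟩

/-- The decompositions of the same marked graph. -/
theorem Dec.bijective_act {E : Prop} (z : Dec E) : Function.Bijective
    fun α : Perm (Fin z.r) × Perm (Fin z.s) =>
      (⟨z.act α, z.marked_act α⟩ : {z' : Dec E // z'.marked = z.marked}) := by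
  refine ⟨fun α β h => z.act_injective (congrArg Subtype.val h), ?_⟩
  rintro ⟨z', h⟩
  obtain ⟨hM, h1, h2⟩ := marked_ext h.symm
  obtain ⟨α, hα⟩ := z.exists_act z' hM h1 h2
  exact ⟨α, Subtype.ext hα⟩

/-- The contribution of a decomposition. -/
def Dec.term {E : Prop} (z : Dec E) : LambdaHbar k :=
  ((z.r.factorial : k)⁻¹ * (z.s.factorial : k)⁻¹ * (z.M.factorial : k)⁻¹ * (z.b.pt z.y : k)) •
    z.conf.weight χ

theorem Dec.pt_pos {E : Prop} (z : Dec E) : z.conf.pt z.pos = z.b.pt z.y := by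
  refine ((isEmb_map _ z.f).pt _).trans (((isEmb_inl _ _).pt _).trans (pt_susp _ _ _ _))

theorem Dec.isSummable {E : Prop} : IsSummable fun z : Dec E => z.term χ := by
  refine isSummable_of_homog (fun z => z.conf.wt) (fun z => (homog_weight χ z.conf).smul _)
    (fun z => z.conf.wt_nonneg) fun n => ?_
  refine ((finite_marked (IsAdm E) n).preimage' (f := Dec.marked) fun a _ => ?_).subset
    fun z hz => hz
  obtain ⟨z, rfl⟩ := Dec.exists_marked a
  exact Set.finite_coe_iff.mp (Finite.of_surjective _ z.bijective_act.2)

variable [CharZero k]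

/-- A marked graph has exactly r! s! decompositions, one for each pair of numberings of the
component and of the complement. This cancels two of the three factorials in `Dec.term`; the
remaining 1/M! is that of the marked graph. -/
theorem Dec.infSum_eq_euler {E : Prop} :
    infSum (fun z : Dec E => z.term χ) = euler (gsum χ (IsAdm E)) := by
  rw [euler_gsum, (infSum_fiberwise (Dec.isSummable χ) Dec.marked).1]
  congr 1
  funext a
  obtain ⟨z, rfl⟩ := Dec.exists_marked a
  rw [← infSum_equiv (Equiv.ofBijective _ z.bijective_act), infSum_fintype]
  have h : ∀ α, (z.act α).term χ = ((z.r.factorial : k)⁻¹ * (z.s.factorial : k)⁻¹) •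
      mterm χ z.marked := by
    intro α
    have h1 : (z.act α).b.pt (z.act α).y = z.conf.pt z.pos :=
      ((isEmb_map _ α.1).pt _).trans z.pt_pos.symm
    rw [Dec.term, h1, mterm, Conf.term, smul_smul, smul_smul, z.act_conf α]
    congr 1
    change (z.r.factorial : k)⁻¹ * (z.s.factorial : k)⁻¹ * (z.M.factorial : k)⁻¹ *
      (z.conf.pt z.pos : k) = (z.r.factorial : k)⁻¹ * (z.s.factorial : k)⁻¹ *
      (z.conf.pt z.pos : k) * (z.M.factorial : k)⁻¹
    ring
  refine (Finset.sum_congr rfl fun α _ => h α).trans ?_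
  rw [Finset.sum_const, Finset.card_univ, Fintype.card_prod, Fintype.card_perm, Fintype.card_perm,
    Fintype.card_fin, Fintype.card_fin, ← Nat.cast_smul_eq_nsmul k, smul_smul]
  have h1 : (z.r.factorial : k) ≠ 0 := by exact_mod_cast z.r.factorial_ne_zero
  have h2 : (z.s.factorial : k) ≠ 0 := by exact_mod_cast z.s.factorial_ne_zero
  push_cast
  rw [show (z.r.factorial : k) * z.s.factorial * ((z.r.factorial : k)⁻¹ * (z.s.factorial : k)⁻¹) = 1
    by field_simp, one_smul]

/-- The sum over all numberings. -/
theorem infSum_numberings (α : Type) [Fintype α] (w : LambdaHbar k) :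
    (infSum fun p : Σ M, α ≃ Fin M => ((p.1.factorial : k)⁻¹) • w) = w := by
  classical
  have hb : Function.Bijective fun e : α ≃ Fin (Fintype.card α) =>
      (⟨_, e⟩ : Σ M, α ≃ Fin M) := by
    refine ⟨fun e e' h => eq_of_heq (Sigma.mk.inj h).2, ?_⟩
    rintro ⟨M, e⟩
    obtain rfl : M = Fintype.card α := by simpa using (Fintype.card_congr e).symm
    exact ⟨e, rfl⟩
  rw [← infSum_equiv (Equiv.ofBijective _ hb), infSum_fintype]
  simp only [Equiv.ofBijective_apply]
  rw [Finset.sum_const, Finset.card_univ, Fintype.card_equiv (Fintype.equivFin α),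
    ← Nat.cast_smul_eq_nsmul k, smul_smul, mul_inv_cancel₀, one_smul]
  exact_mod_cast (Fintype.card α).factorial_ne_zero

/-- A decomposition is given by its parts and a numbering of their union. -/
def Dec.parts {E : Prop} : Dec E ≃ Σ q : (ℕ × Marked (IsConn E)) × {a // IsAdm E a},
    Σ M, (Fin (q.1.1 + 1) × Fin q.1.2.1.1.1) ⊕ Fin q.2.1.1 ≃ Fin M where
  toFun z := ⟨((z.n, ⟨⟨⟨z.r, z.b⟩, z.hb⟩, z.y⟩), ⟨⟨z.s, z.d⟩, z.hd⟩), ⟨z.M, z.f⟩⟩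
  invFun p := ⟨p.1.1.1, p.1.1.2.1.1.1, p.1.2.1.1, p.2.1, p.1.1.2.1.1.2, p.1.1.2.1.2, p.1.1.2.2,
    p.1.2.1.2, p.1.2.2, p.2.2⟩
  left_inv _ := rfl
  right_inv _ := rfl

/-- Marking a point of an arbitrary graph is the same as choosing a marked connected graph, a number
n + 1 of copies of it arranged cyclically, and an arbitrary graph beside them. Weights are
multiplicative on disjoint unions and cyclic arrangement is a plethysm, whence the product on the
right. -/
theorem euler_gsum_adm (E : Prop) : euler (gsum χ (IsAdm E)) =
    (infSum fun n : ℕ+ => pleth n (euler (gsum χ (IsConn E)))) * gsum χ (IsAdm E) := by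
  have hm := isSummable_mterm χ (IsConn E)
  have hp : IsSummable fun q : ℕ × Marked (IsConn E) => pleth q.1.succPNat (mterm χ q.2) := by
    refine isSummable_of_homog (fun q => q.1.succPNat * q.2.1.1.2.wt)
      (fun q => ((homog_term χ q.2.1.1).smul _).pleth _)
      (fun q => mul_nonneg (by positivity) q.2.1.1.2.wt_nonneg) fun n => ?_
    -- From (i + 1) · wt = n with wt ≥ 1, because connected graphs are nonempty, both i and wt are
    -- bounded.
    refine ((Set.finite_Iic n.toNat).prod ((Set.finite_Icc (0 : ℤ) n).biUnion
      fun w _ => finite_marked (IsConn E) w)).subset ?_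
    rintro ⟨i, a⟩ h
    have := a.1.2.2.1
    have h1 := a.1.1.2.one_le_wt
    simp only [Set.mem_ofPred_eq, Nat.succPNat_coe] at h
    push_cast at h
    simp only [Set.mem_prod, Set.mem_Iic, Set.mem_iUnion, Set.mem_Icc, Set.mem_ofPred_eq,
      exists_prop, exists_eq_right']
    refine ⟨?_, by omega, ?_⟩
    · have : (i : ℤ) ≤ n := by nlinarith
      omega
    · nlinarith
  have h1 : (infSum fun n : ℕ+ => pleth n (euler (gsum χ (IsConn E)))) =
      infSum fun q : ℕ × Marked (IsConn E) => pleth q.1.succPNat (mterm χ q.2) := by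
    rw [infSum_pnat, (infSum_prod hp).1]
    congr 1
    funext n
    rw [euler_gsum]
    exact (pleth_infSum _ hm).1
  rw [h1, gsum, (infSum_mul_infSum hp (isSummable_term χ (IsAdm E))).1, ← gsum,
    ← Dec.infSum_eq_euler, ← infSum_equiv Dec.parts.symm,
    (infSum_sigma ((Dec.isSummable χ).comp_injective Dec.parts.symm.injective)).1]
  congr 1
  funext q
  -- The M! numberings of the union, each with the factor 1/M!, are inserted in order to match the
  -- sum over decompositions.
  rw [← infSum_numberings ((Fin (q.1.1 + 1) × Fin q.1.2.1.1.1) ⊕ Fin q.2.1.1)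
    (pleth q.1.1.succPNat (mterm χ q.1.2) * term χ q.2.1)]
  congr 1
  funext p
  have h2 : ((Dec.parts (E := E)).symm ⟨q, p⟩).conf.weight χ =
      pleth q.1.1.succPNat (q.1.2.1.1.2.weight χ) * q.2.1.2.weight χ := by
    rw [Dec.conf, weight_map, weight_sum, weight_susp]
    rfl
  rw [Dec.term, h2, mterm, term, term, pleth_smul, pleth_smul, smul_mul_assoc, smul_mul_assoc,
    mul_smul_comm, smul_smul, smul_smul, smul_smul]
  congr 1
  change (q.1.2.1.1.1.factorial : k)⁻¹ * (q.2.1.1.factorial : k)⁻¹ * (p.1.factorial : k)⁻¹ *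
    (q.1.2.1.1.2.pt q.1.2.2 : k) = _
  ring

theorem weightGE_conn (E : Prop) : WeightGE 1 (gsum χ (IsConn E)) :=
  WeightGE.infSum fun a => (homog_term χ a.1).weightGE.mono (by
    have := a.2.2.1
    exact a.1.2.one_le_wt)

/-- The empty graph. -/
def empty : Conf (Fin 0) where
  vx := id
  gen := finZeroElim
  inv := id
  φ := 1
  vx_vx _ := rfl
  gen_vx _ := rfl
  inv_inv _ := rfl
  inv_vx _ := rfl
  φ_vx _ := rfl
  φ_gen _ := rfl
  φ_inv _ := rfl
  stable := finZeroElim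

theorem eq_empty (c : Conf (Fin 0)) : c = empty :=
  Conf.ext finZeroElim finZeroElim finZeroElim finZeroElim

theorem weight_empty : empty.weight χ = 1 := by
  have h : empty.edges = 0 := by
    rw [edges, Finset.card_eq_zero.mpr (Finset.eq_empty_of_isEmpty _)]
  rw [weight, h, Finset.univ_eq_empty, oprod_empty]
  exact mul_one _

/-- The empty graph contributes the constant term 1, and every other graph has weight at least 1. -/
theorem weightGE_adm (E : Prop) : WeightGE 1 (gsum χ (IsAdm E) - 1) := by
  intro m hm
  by_contra hlt
  refine hm ?_
  rw [HahnSeries.coeff_sub, sub_eq_zero, gsum, infSum_coeff (isSummable_term χ _)]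
  rw [finsum_eq_single _ (⟨⟨0, empty⟩, Or.inr finZeroElim⟩ : {a // IsAdm E a})]
  · simp [term, weight_empty]
  · rintro ⟨⟨M, c⟩, hc⟩ hne
    by_contra h
    have h1 := homog_term χ ⟨M, c⟩ m h
    rcases M with _ | M
    · exact hne (by
        have := eq_empty c
        subst this
        rfl)
    · have := c.one_le_wt
      simp only at h1
      omega

theorem plethExp_gsum (E : Prop) : plethExp (gsum χ (IsConn E)) = gsum χ (IsAdm E) :=
  plethExp_eq (weightGE_conn χ E) (weightGE_adm χ E) (euler_gsum_adm χ E)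

theorem plethLog_gsum (E : Prop) : plethLog (gsum χ (IsAdm E)) = gsum χ (IsConn E) :=
  plethLog_eq (weightGE_conn χ E) (weightGE_adm χ E) (euler_gsum_adm χ E)

end Conf

/-! ### The Laplacian, its commutator with p_j, and exp(Δ). -/

section Laplacian

variable {k : Type u} [Field k]

theorem coeff_pDeriv (n : ℕ+) (f : LambdaHbar k) (a : HMono) : (pDeriv n f).coeff a =
    ((a.2 n : k) + 1) * f.coeff (a + HMono.mk 0 (Finsupp.single n 1)) := rfl

theorem pDeriv_add (n : ℕ+) (f g : LambdaHbar k) : pDeriv n (f + g) = pDeriv n f + pDeriv n g := by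
  refine HahnSeries.ext (funext fun m => ?_)
  rw [HahnSeries.coeff_add, coeff_pDeriv, coeff_pDeriv, coeff_pDeriv, HahnSeries.coeff_add, mul_add]

theorem pDeriv_smul (n : ℕ+) (c : k) (f : LambdaHbar k) : pDeriv n (c • f) = c • pDeriv n f := by
  refine HahnSeries.ext (funext fun m => ?_)
  rw [HahnSeries.coeff_smul, coeff_pDeriv, coeff_pDeriv, HahnSeries.coeff_smul, smul_eq_mul,
    smul_eq_mul]
  ring

theorem pDeriv_comm (n j : ℕ+) (f : LambdaHbar k) :
    pDeriv n (pDeriv j f) = pDeriv j (pDeriv n f) := by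
  refine HahnSeries.ext (funext fun m => ?_)
  simp only [coeff_pDeriv]
  have h : ∀ (i j : ℕ+), (m + HMono.mk 0 (Finsupp.single i 1)).2 j =
      m.2 j + Finsupp.single i 1 j := fun _ _ => rfl
  rw [h, h, add_right_comm m]
  rcases eq_or_ne n j with rfl | hne
  · rfl
  · rw [Finsupp.single_eq_of_ne hne, Finsupp.single_eq_of_ne hne.symm]
    push_cast
    ring

theorem pDeriv_infSum {ι : Type*} (n : ℕ+) {F : ι → LambdaHbar k} (hF : IsSummable F) :
    pDeriv n (infSum F) = infSum (fun a => pDeriv n (F a)) ∧ IsSummable fun a => pDeriv n (F a) := by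
  have hs : IsSummable fun a => pDeriv n (F a) := by
    refine ⟨fun s => ?_, fun m => ?_⟩
    · obtain ⟨i, j, hij, h⟩ := hF.1 fun t => ⟨(s t).1 + HMono.mk 0 (Finsupp.single n 1), by
        obtain ⟨a, ha⟩ := Set.mem_iUnion.mp (s t).2
        exact Set.mem_iUnion.mpr ⟨a, right_ne_zero_of_mul ha⟩⟩
      exact ⟨i, j, hij, le_of_add_le_add_right h⟩
    · exact (hF.2 (m + HMono.mk 0 (Finsupp.single n 1))).subset fun a ha =>
        right_ne_zero_of_mul ha
  refine ⟨HahnSeries.ext (funext fun m => ?_), hs⟩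
  rw [infSum_coeff hs, coeff_pDeriv, infSum_coeff hF]
  simp only [coeff_pDeriv]
  exact mul_finsum' _ _ (hF.2 _)

theorem coeff_hbarPow_mul (i : ℤ) (f : LambdaHbar k) (a : HMono) :
    (hbarPow i * f).coeff (a + HMono.mk i 0) = f.coeff a := by
  rw [hbarPow, HahnSeries.coeff_single_mul_add, one_mul]

theorem coeff_pSum_mul (j : ℕ+) (f : LambdaHbar k) (a : HMono) :
    (pSum j * f).coeff (a + HMono.mk 0 (Finsupp.single j 1)) = f.coeff a := by
  rw [pSum, HahnSeries.coeff_single_mul_add, one_mul]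

theorem coeff_pSum_mul_of_eq_zero (j : ℕ+) (f : LambdaHbar k) {a : HMono} (h : a.2 j = 0) :
    (pSum j * f).coeff a = 0 := by
  by_contra hne
  obtain ⟨b, hb, c, hc, rfl⟩ := HahnSeries.support_mul_subset hne
  have hb' : b = HMono.mk 0 (Finsupp.single j 1) := by
    by_contra hne
    exact hb (HahnSeries.coeff_single_of_ne hne)
  subst hb'
  change (Finsupp.single j 1 + c.2 : ℕ+ →₀ ℕ) j = 0 at h
  simp at h

theorem exists_eq_add_hbar (i : ℤ) (a : HMono) : ∃ b, a = b + HMono.mk i 0 :=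
  ⟨HMono.mk (a.1 - i) a.2, Prod.ext (sub_add_cancel a.1 i).symm (add_zero a.2).symm⟩

theorem exists_eq_add_p {j : ℕ+} {a : HMono} (h : a.2 j ≠ 0) :
    ∃ b, a = b + HMono.mk 0 (Finsupp.single j 1) := by
  refine ⟨HMono.mk a.1 (a.2 - Finsupp.single j 1), Prod.ext (add_zero a.1).symm ?_⟩
  exact (tsub_add_cancel_of_le (Finsupp.single_le_iff.mpr (Nat.one_le_iff_ne_zero.mpr h))).symm

theorem pDeriv_hbarPow_mul (n : ℕ+) (i : ℤ) (f : LambdaHbar k) :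
    pDeriv n (hbarPow i * f) = hbarPow i * pDeriv n f := by
  refine HahnSeries.ext (funext fun m => ?_)
  obtain ⟨b, rfl⟩ := exists_eq_add_hbar i m
  rw [coeff_pDeriv, add_right_comm, coeff_hbarPow_mul, coeff_hbarPow_mul, coeff_pDeriv]
  congr 3

theorem pDeriv_pSum_mul (n j : ℕ+) (f : LambdaHbar k) :
    pDeriv n (pSum j * f) = pSum j * pDeriv n f + if n = j then f else 0 := by
  have h2 : ∀ (m : HMono) (i j : ℕ+), (m + HMono.mk 0 (Finsupp.single i 1)).2 j =
      m.2 j + Finsupp.single i 1 j := fun _ _ _ => rfl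
  refine HahnSeries.ext (funext fun m => ?_)
  rw [HahnSeries.coeff_add, coeff_pDeriv]
  by_cases hm : m.2 j = 0
  · rw [coeff_pSum_mul_of_eq_zero j _ hm]
    split_ifs with h
    · subst h
      rw [coeff_pSum_mul, hm]
      simp
    · rw [coeff_pSum_mul_of_eq_zero]
      · simp
      · rw [h2, hm, Finsupp.single_eq_of_ne (Ne.symm h), add_zero]
  · obtain ⟨b, rfl⟩ := exists_eq_add_p hm
    rw [coeff_pSum_mul, coeff_pDeriv, h2, add_right_comm, coeff_pSum_mul]
    split_ifs with h
    · subst h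
      rw [Finsupp.single_eq_same]
      push_cast
      ring
    · rw [Finsupp.single_eq_of_ne h]
      simp

/-- The term of index `n` of the Laplacian. -/
def lapTerm (n : ℕ+) (f : LambdaHbar k) : LambdaHbar k :=
  hbarPow (n : ℤ) * (((n : k) / 2) • pDeriv n (pDeriv n f) + pDeriv (2 * n) f)

theorem laplacian_eq (f : LambdaHbar k) : laplacian f = infSum fun n => lapTerm n f := rfl

theorem isSummable_lapTerm (f : LambdaHbar k) : IsSummable fun n => lapTerm n f :=
  isSummable_laplacian f

theorem lapTerm_add (n : ℕ+) (f g : LambdaHbar k) :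
    lapTerm n (f + g) = lapTerm n f + lapTerm n g := by
  simp only [lapTerm, pDeriv_add, smul_add]
  ring

theorem lapTerm_smul (n : ℕ+) (c : k) (f : LambdaHbar k) : lapTerm n (c • f) = c • lapTerm n f := by
  simp only [lapTerm, pDeriv_smul]
  rw [smul_comm _ c, ← smul_add, mul_smul_comm]

theorem lapTerm_hbarPow_mul (n : ℕ+) (i : ℤ) (f : LambdaHbar k) :
    lapTerm n (hbarPow i * f) = hbarPow i * lapTerm n f := by
  simp only [lapTerm, pDeriv_hbarPow_mul]
  rw [← mul_smul_comm]
  ring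

theorem pDeriv_lapTerm (n j : ℕ+) (f : LambdaHbar k) :
    pDeriv j (lapTerm n f) = lapTerm n (pDeriv j f) := by
  simp only [lapTerm, pDeriv_hbarPow_mul, pDeriv_add, pDeriv_smul]
  rw [pDeriv_comm j n, pDeriv_comm j n, pDeriv_comm j]

theorem laplacian_add (f g : LambdaHbar k) : laplacian (f + g) = laplacian f + laplacian g := by
  simp only [laplacian_eq, lapTerm_add]
  exact (infSum_add (isSummable_lapTerm f) (isSummable_lapTerm g)).1

theorem laplacian_smul (c : k) (f : LambdaHbar k) : laplacian (c • f) = c • laplacian f := by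
  simp only [laplacian_eq, lapTerm_smul]
  exact (smul_infSum c (isSummable_lapTerm f)).1.symm

theorem laplacian_hbarPow_mul (i : ℤ) (f : LambdaHbar k) :
    laplacian (hbarPow i * f) = hbarPow i * laplacian f := by
  simp only [laplacian_eq, lapTerm_hbarPow_mul]
  exact (mul_infSum _ (isSummable_lapTerm f)).1.symm

theorem laplacian_pDeriv (j : ℕ+) (f : LambdaHbar k) :
    laplacian (pDeriv j f) = pDeriv j (laplacian f) := by
  rw [laplacian_eq, laplacian_eq, (pDeriv_infSum j (isSummable_lapTerm f)).1]
  simp only [pDeriv_lapTerm]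

/-- The commutator of the Laplacian and the multiplication by `p_j`. -/
def lapComm (j : ℕ+) (f : LambdaHbar k) : LambdaHbar k :=
  hbarPow (j : ℤ) * ((j : k) • pDeriv j f) +
    if Even (j : ℕ) then hbarPow ((j : ℕ) / 2 : ℕ) * f else 0

/-- The commutator involves only derivatives and powers of ħ, and Δ commutes with both. So the
expansion of exp(Δ) p_j stops after one commutator. -/
theorem laplacian_lapComm (j : ℕ+) (f : LambdaHbar k) :
    laplacian (lapComm j f) = lapComm j (laplacian f) := by
  rw [lapComm, lapComm, laplacian_add, laplacian_hbarPow_mul, laplacian_smul, laplacian_pDeriv]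
  congr 1
  split_ifs
  · rw [laplacian_hbarPow_mul]
  · simpa using laplacian_smul 0 (0 : LambdaHbar k)

theorem infSum_ite {ι : Type*} [DecidableEq ι] (a₀ : ι) (G : ι → LambdaHbar k) :
    infSum (fun a => if a = a₀ then G a else 0) = G a₀ ∧
      IsSummable fun a => if a = a₀ then G a else 0 := by
  have hs : IsSummable fun a => if a = a₀ then G a else 0 := by
    refine ⟨(G a₀).isPWO_support.mono (Set.iUnion_subset fun a => ?_), fun m =>
      (Set.finite_singleton a₀).subset fun a ha => ?_⟩
    · beta_reduce
      split_ifs with h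
      · rw [h]
      · simp
    · by_contra h
      simp only [Set.mem_singleton_iff] at h
      simp [h] at ha
  refine ⟨HahnSeries.ext (funext fun m => ?_), hs⟩
  rw [infSum_coeff hs, finsum_eq_single _ a₀]
  · rw [if_pos rfl]
  · intro a ha
    rw [if_neg ha]
    rfl

/-- The first-order part ∑ ħ^n ∂/∂p_(2n) detects p_j only for n = j/2, hence only for even j. -/
theorem infSum_half (j : ℕ+) (f : LambdaHbar k) :
    infSum (fun n : ℕ+ => if 2 * n = j then hbarPow (n : ℤ) * f else 0) =
      (if Even (j : ℕ) then hbarPow ((j : ℕ) / 2 : ℕ) * f else 0) ∧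
    IsSummable fun n : ℕ+ => if 2 * n = j then hbarPow (n : ℤ) * f else 0 := by
  have hc : ∀ n : ℕ+, 2 * n = j ↔ 2 * (n : ℕ) = j := fun n => by
    rw [← PNat.coe_inj, PNat.mul_coe]
    rfl
  by_cases h : Even (j : ℕ)
  · obtain ⟨i, hi⟩ := h
    have hi0 : 0 < i := by
      have := j.pos
      omega
    obtain ⟨i, rfl⟩ : ∃ i' : ℕ+, (i' : ℕ) = i := ⟨⟨i, hi0⟩, rfl⟩
    have h2 : (fun n : ℕ+ => if 2 * n = j then hbarPow (n : ℤ) * f else 0) =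
        fun n : ℕ+ => if n = i then hbarPow (n : ℤ) * f else 0 := by
      funext n
      refine if_congr ?_ rfl rfl
      refine (hc n).trans ((?_ : _ ↔ (n : ℕ) = (i : ℕ)).trans PNat.coe_inj)
      omega
    rw [h2, if_pos ⟨i, hi⟩]
    have h3 : (j : ℕ) / 2 = i := by omega
    rw [h3]
    exact infSum_ite i fun n => hbarPow (n : ℤ) * f
  · have h2 : (fun n : ℕ+ => if 2 * n = j then hbarPow (n : ℤ) * f else 0) = fun n => 0 := by
      funext n
      rw [if_neg fun hn => h ⟨n, ?_⟩]
      have := (hc n).mp hn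
      omega
    rw [h2, if_neg h]
    exact ⟨infSum_zero, ⟨by simp, fun m => by simp⟩⟩

variable [CharZero k]

theorem laplacian_pSum_mul (j : ℕ+) (f : LambdaHbar k) :
    laplacian (pSum j * f) = pSum j * laplacian f + lapComm j f := by
  have h1 : ∀ n : ℕ+, lapTerm n (pSum j * f) = pSum j * lapTerm n f +
      ((if n = j then hbarPow (n : ℤ) * ((n : k) • pDeriv n f) else 0) +
        if 2 * n = j then hbarPow (n : ℤ) * f else 0) := by
    intro n
    simp only [lapTerm, pDeriv_pSum_mul, pDeriv_add]
    have h2 : pDeriv n (if n = j then f else 0) = if n = j then pDeriv n f else 0 := by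
      split_ifs
      · rfl
      · simpa using pDeriv_smul n 0 (0 : LambdaHbar k)
    rw [h2]
    -- The second derivative of p_n f produces ∂f/∂p_n twice; with the factor n/2 this makes n
    -- ∂f/∂p_n.
    have h3 : ∀ g : LambdaHbar k, (n : k) • g = ((n : k) / 2) • g + ((n : k) / 2) • g := by
      intro g
      rw [← add_smul, add_halves]
    split_ifs <;> simp only [smul_add, h3 (pDeriv n f), mul_add, add_zero, zero_add, mul_smul_comm,
      mul_left_comm (pSum j) (hbarPow (n : ℤ))] <;> abel
  have hs := mul_infSum (pSum j) (isSummable_lapTerm f)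
  have ha := infSum_ite j fun n : ℕ+ => hbarPow (n : ℤ) * ((n : k) • pDeriv n f)
  have hb := infSum_half j f
  rw [laplacian_eq, laplacian_eq]
  simp only [h1]
  rw [(infSum_add hs.2 (infSum_add ha.2 hb.2).2).1, (infSum_add ha.2 hb.2).1, ha.1, hb.1, hs.1]
  rfl

theorem laplacian_iterate_add (r : ℕ) (f g : LambdaHbar k) :
    laplacian^[r] (f + g) = laplacian^[r] f + laplacian^[r] g := by
  induction r generalizing f g with
  | zero => rfl
  | succ r ih => simp only [Function.iterate_succ_apply, laplacian_add, ih]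

theorem laplacian_iterate_smul (r : ℕ) (c : k) (f : LambdaHbar k) :
    laplacian^[r] (c • f) = c • laplacian^[r] f := by
  induction r generalizing f with
  | zero => rfl
  | succ r ih => simp only [Function.iterate_succ_apply, laplacian_smul, ih]

theorem laplacian_iterate_hbarPow_mul (r : ℕ) (i : ℤ) (f : LambdaHbar k) :
    laplacian^[r] (hbarPow i * f) = hbarPow i * laplacian^[r] f := by
  induction r generalizing f with
  | zero => rfl
  | succ r ih => simp only [Function.iterate_succ_apply, laplacian_hbarPow_mul, ih]

theorem laplacian_iterate_lapComm (r : ℕ) (j : ℕ+) (f : LambdaHbar k) :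
    laplacian^[r] (lapComm j f) = lapComm j (laplacian^[r] f) := by
  induction r generalizing f with
  | zero => rfl
  | succ r ih => simp only [Function.iterate_succ_apply, laplacian_lapComm, ih]

theorem laplacian_iterate_pSum_mul (r : ℕ) (j : ℕ+) (f : LambdaHbar k) :
    laplacian^[r + 1] (pSum j * f) =
      pSum j * laplacian^[r + 1] f + ((r : k) + 1) • laplacian^[r] (lapComm j f) := by
  induction r with
  | zero => simp [laplacian_pSum_mul]
  | succ r ih =>
    rw [Function.iterate_succ_apply', ih, laplacian_add, laplacian_pSum_mul, laplacian_smul,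
      ← Function.iterate_succ_apply' laplacian, ← Function.iterate_succ_apply' laplacian,
      ← laplacian_iterate_lapComm, add_assoc]
    congr 1
    push_cast
    module

theorem expLaplacian_add (f g : LambdaHbar k) :
    expLaplacian (f + g) = expLaplacian f + expLaplacian g := by
  simp only [expLaplacian, laplacian_iterate_add, smul_add]
  exact (infSum_add (isSummable_expLaplacian f) (isSummable_expLaplacian g)).1

theorem expLaplacian_smul (c : k) (f : LambdaHbar k) :
    expLaplacian (c • f) = c • expLaplacian f := by
  simp only [expLaplacian, laplacian_iterate_smul, smul_comm _ c]
  exact (smul_infSum c (isSummable_expLaplacian f)).1.symm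

theorem expLaplacian_sum {ι : Type*} (s : Finset ι) (F : ι → LambdaHbar k) :
    expLaplacian (∑ a ∈ s, F a) = ∑ a ∈ s, expLaplacian (F a) := by
  classical
  induction s using Finset.induction_on with
  | empty => simpa using expLaplacian_smul 0 (0 : LambdaHbar k)
  | insert a s ha ih => rw [Finset.sum_insert ha, Finset.sum_insert ha, expLaplacian_add, ih]

theorem expLaplacian_hbarPow_mul (i : ℤ) (f : LambdaHbar k) :
    expLaplacian (hbarPow i * f) = hbarPow i * expLaplacian f := by
  simp only [expLaplacian, laplacian_iterate_hbarPow_mul, ← mul_smul_comm]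
  exact (mul_infSum _ (isSummable_expLaplacian f)).1.symm

/-- From Δ^(r+1) p_j = p_j Δ^(r+1) + (r + 1) Δ^r [Δ, p_j], after division by (r + 1)!. This is the
recursion matched below by removing a cycle of flags. -/
theorem expLaplacian_pSum_mul (j : ℕ+) (f : LambdaHbar k) :
    expLaplacian (pSum j * f) = pSum j * expLaplacian f + expLaplacian (lapComm j f) := by
  have hs := mul_infSum (pSum j) (isSummable_expLaplacian f)
  have h1 := isSummable_expLaplacian (lapComm j f)
  have h2 := hs.2.comp_injective (add_left_injective 1)
  rw [expLaplacian, infSum_nat (isSummable_expLaplacian _), expLaplacian, hs.1, infSum_nat hs.2,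
    expLaplacian, add_assoc, ← (infSum_add h2 h1).1]
  congr 1
  · simp
  · congr 1
    funext r
    rw [laplacian_iterate_pSum_mul, smul_add, smul_smul, mul_smul_comm, Nat.factorial_succ]
    congr 2
    have : (r : k) + 1 ≠ 0 := by exact_mod_cast r.succ_ne_zero
    push_cast
    field_simp

theorem expLaplacian_coeff {f : LambdaHbar k} {m : HMono} (h : (expLaplacian f).coeff m ≠ 0) :
    ∃ m', f.coeff m' ≠ 0 ∧ m'.weight = m.weight := by
  obtain ⟨r, hr⟩ := exists_of_infSum_coeff_ne h
  obtain ⟨m', h1, h2, -⟩ := laplacian_iterate_term r (right_ne_zero_of_mul hr)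
  exact ⟨m', h1, h2⟩

theorem Homog.expLaplacian {w : ℤ} {f : LambdaHbar k} (h : Homog w f) :
    Homog w (expLaplacian f) := by
  intro m hm
  obtain ⟨m', h1, h2⟩ := expLaplacian_coeff hm
  rw [← h2, h m' h1]

/-- Because Δ preserves weights, a coefficient of the result only depends on the part of the same
weight, to which finitely many members contribute. The statement is thus reduced to finite
additivity. -/
theorem expLaplacian_infSum {ι : Type*} {F : ι → LambdaHbar k} (w : ι → ℤ)
    (hw : ∀ a, Homog (w a) (F a)) (h0 : ∀ a, 0 ≤ w a) (hfin : ∀ n, {a | w a = n}.Finite) :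
    expLaplacian (infSum F) = infSum fun a => expLaplacian (F a) := by
  have hs := isSummable_of_homog w hw h0 hfin
  have hs' := isSummable_of_homog w (fun a => (hw a).expLaplacian) h0 hfin
  refine HahnSeries.ext (funext fun m => ?_)
  let S := (hfin m.weight).toFinset
  have hS : ∀ (G : ι → LambdaHbar k), (∀ a, Homog (w a) (G a)) → ∀ m' : HMono,
      m'.weight = m.weight → ∑ᶠ a, (G a).coeff m' = (∑ a ∈ S, G a).coeff m' := by
    intro G hG m' hm'
    rw [coeff_sum', finsum_eq_sum_of_support_subset]
    intro a ha
    have := hG a m' ha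
    simp [S, ← this, hm']
  rw [infSum_coeff hs', hS _ (fun a => (hw a).expLaplacian) m rfl, ← expLaplacian_sum, ← sub_eq_zero,
    ← HahnSeries.coeff_sub]
  have h2 : expLaplacian (infSum F) - expLaplacian (∑ a ∈ S, F a) =
      expLaplacian (infSum F + (-1 : k) • ∑ a ∈ S, F a) := by
    rw [expLaplacian_add, expLaplacian_smul]
    module
  -- The difference between the full sum and the finite one has no monomial in the weight
  -- considered, and exp(Δ) cannot create one.
  rw [h2]
  by_contra hne
  obtain ⟨m', h3, h4⟩ := expLaplacian_coeff hne
  refine h3 ?_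
  rw [HahnSeries.coeff_add, HahnSeries.coeff_smul, infSum_coeff hs, hS F hw m' h4]
  simp

theorem expLaplacian_one : expLaplacian (1 : LambdaHbar k) = 1 := by
  have h : laplacian (1 : LambdaHbar k) = 0 := by
    refine HahnSeries.ext (funext fun m => ?_)
    by_contra hne
    obtain ⟨m', h1, -, h3⟩ := laplacian_iterate_term (f := (1 : LambdaHbar k)) 1 hne
    obtain rfl : m' = 0 := by
      by_contra hm
      exact h1 (by simp [HahnSeries.coeff_one, hm])
    have : (0 : HMono).deg = 0 := map_zero Finsupp.degree
    omega
  have h2 : ∀ r, laplacian^[r + 1] (1 : LambdaHbar k) = 0 := by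
    intro r
    induction r with
    | zero => exact h
    | succ r ih =>
      rw [Function.iterate_succ_apply', ih]
      simpa using laplacian_smul 0 (0 : LambdaHbar k)
  rw [expLaplacian, infSum_nat (isSummable_expLaplacian _)]
  simp only [h2, smul_zero, infSum_zero]
  simp

end Laplacian

/-! ### Involutions commuting with a permutation, and exp(Δ) as the sum over them. -/

section Involutions

open scoped Classical

variable {X : Type} [Fintype X]

theorem pow_eq_pow_iff (φ : Perm X) (x : X) (m n : ℕ) :
    (φ ^ m) x = (φ ^ n) x ↔ m ≡ n [MOD (orb φ x).card] := by
  have h : φ.IsCycleOn (orb φ x : Set X) := by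
    refine ⟨⟨fun y hy => ?_, φ.injective.injOn, fun y hy => ⟨φ.symm y, ?_, by simp⟩⟩, ?_⟩
    · rw [Finset.mem_coe, mem_orb] at hy ⊢
      exact hy.apply_right
    · rw [Finset.mem_coe, mem_orb] at hy ⊢
      rw [← Perm.sameCycle_apply_right]
      simpa using hy
    · intro y hy z hz
      rw [Finset.mem_coe, mem_orb] at hy hz
      exact hy.symm.trans hz
  exact h.pow_apply_eq_pow_apply (mem_orb_self φ x)

theorem pow_eq_self_iff (φ : Perm X) (x : X) (n : ℕ) :
    (φ ^ n) x = x ↔ (orb φ x).card ∣ n := by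
  rw [← Nat.modEq_zero_iff_dvd, ← pow_eq_pow_iff]
  rfl

theorem exists_pow_of_mem_orb {φ : Perm X} {x y : X} (h : y ∈ orb φ x) : ∃ n : ℕ, (φ ^ n) x = y := by
  obtain ⟨n, -, hn⟩ := (mem_orb.mp h).exists_pow_eq'
  exact ⟨n, hn⟩

theorem pow_mem_orb (φ : Perm X) (x : X) (n : ℕ) : (φ ^ n) x ∈ orb φ x :=
  mem_orb.mpr ⟨n, by simp⟩

/-- The involutions which commute with `φ` and move only elements of `L`. -/
def invols (φ : Perm X) (L : Finset X) : Finset (Perm X) :=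
  Finset.univ.filter fun τ => (∀ x, τ (τ x) = x) ∧ (∀ x, τ (φ x) = φ (τ x)) ∧ ∀ x, x ∉ L → τ x = x

theorem mem_invols {φ : Perm X} {L : Finset X} {τ : Perm X} : τ ∈ invols φ L ↔
    (∀ x, τ (τ x) = x) ∧ (∀ x, τ (φ x) = φ (τ x)) ∧ ∀ x, x ∉ L → τ x = x := by
  simp [invols]

variable {φ : Perm X} {L U : Finset X} {σ τ : Perm X}

theorem invols_pow (h : τ ∈ invols φ L) (n : ℕ) (x : X) : τ ((φ ^ n) x) = (φ ^ n) (τ x) :=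
  (pow_semiconj (j := τ) (fun x => ((mem_invols.mp h).2.1 x).symm) n x).symm

theorem invols_mem (h : τ ∈ invols φ L) {x : X} (hx : x ∈ L) : τ x ∈ L := by
  by_contra h'
  have h1 := (mem_invols.mp h).2.2 _ h'
  exact h' (by rwa [← τ.injective h1] at hx)

theorem card_orb_invols (h : τ ∈ invols φ L) (x : X) : (orb φ (τ x)).card = (orb φ x).card :=
  card_orb_map τ.toEmbedding (fun x => ((mem_invols.mp h).2.1 x).symm) x

/-- The exchange of φ^n x and φ^n y is well defined because the two cycles have the same length. -/
theorem exists_swap {x y : X} (hy : y ∉ orb φ x) (hc : (orb φ y).card = (orb φ x).card) :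
    ∃ σ ∈ invols φ (orb φ x ∪ orb φ y), σ x = y := by
  have hd : ∀ z, z ∈ orb φ x → z ∉ orb φ y := fun z hz hz' =>
    hy (mem_orb.mpr ((mem_orb.mp hz).trans (mem_orb.mp hz').symm))
  let F : X → X := fun z => if hz : z ∈ orb φ x then (φ ^ (exists_pow_of_mem_orb hz).choose) y
    else if hz : z ∈ orb φ y then (φ ^ (exists_pow_of_mem_orb hz).choose) x else z
  have h1 : ∀ n : ℕ, F ((φ ^ n) x) = (φ ^ n) y := by
    intro n
    have hz := pow_mem_orb φ x n
    simp only [F]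
    rw [dif_pos hz, pow_eq_pow_iff, hc, ← pow_eq_pow_iff]
    exact (exists_pow_of_mem_orb hz).choose_spec
  have h2 : ∀ n : ℕ, F ((φ ^ n) y) = (φ ^ n) x := by
    intro n
    have hz := pow_mem_orb φ y n
    simp only [F]
    rw [dif_neg (fun h => hd _ h hz), dif_pos hz, pow_eq_pow_iff, ← hc, ← pow_eq_pow_iff]
    exact (exists_pow_of_mem_orb hz).choose_spec
  have h3 : ∀ z, z ∉ orb φ x ∪ orb φ y → F z = z := by
    intro z hz
    rw [Finset.mem_union, not_or] at hz
    simp only [F]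
    rw [dif_neg hz.1, dif_neg hz.2]
  have h4 : ∀ z, (∃ n : ℕ, z = (φ ^ n) x) ∨ (∃ n : ℕ, z = (φ ^ n) y) ∨
      (z ∉ orb φ x ∪ orb φ y) := by
    intro z
    by_cases hz : z ∈ orb φ x
    · obtain ⟨n, rfl⟩ := exists_pow_of_mem_orb hz
      exact Or.inl ⟨n, rfl⟩
    · by_cases hz' : z ∈ orb φ y
      · obtain ⟨n, rfl⟩ := exists_pow_of_mem_orb hz'
        exact Or.inr (Or.inl ⟨n, rfl⟩)
      · exact Or.inr (Or.inr (by simp [hz, hz']))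
  have hF : Function.Involutive F := by
    intro z
    rcases h4 z with ⟨n, rfl⟩ | ⟨n, rfl⟩ | hz
    · rw [h1, h2]
    · rw [h2, h1]
    · rw [h3 z hz, h3 z hz]
  refine ⟨hF.toPerm, mem_invols.mpr ⟨hF, fun z => ?_, h3⟩, h1 0⟩
  change F (φ z) = φ (F z)
  have hs : ∀ (n : ℕ) w, φ ((φ ^ n) w) = (φ ^ (n + 1)) w := fun n w => by
    rw [pow_succ', Perm.mul_apply]
  rcases h4 z with ⟨n, rfl⟩ | ⟨n, rfl⟩ | hz
  · rw [h1, hs, hs, h1]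
  · rw [h2, hs, hs, h2]
  · rw [h3 z hz, h3]
    rw [Finset.mem_union, not_or, mem_orb, mem_orb] at hz ⊢
    rwa [Perm.sameCycle_apply_right, Perm.sameCycle_apply_right]

/-- On a cycle of even length 2i, rotation by half a turn is an involution commuting with φ. -/
theorem exists_half {x : X} {i : ℕ} (hc : (orb φ x).card = 2 * i) :
    ∃ σ ∈ invols φ (orb φ x), σ x = (φ ^ i) x := by
  let F : X → X := fun z => if z ∈ orb φ x then (φ ^ i) z else z
  have hm : ∀ (n : ℕ) z, z ∈ orb φ x → (φ ^ n) z ∈ orb φ x := fun n z hz => by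
    rw [orb_eq_of_sameCycle (mem_orb.mp hz)]
    exact pow_mem_orb φ z n
  have hF : Function.Involutive F := by
    intro z
    by_cases hz : z ∈ orb φ x
    · have hz' : (φ ^ i) z ∈ orb φ x := hm i z hz
      simp only [F, if_pos hz, if_pos hz']
      rw [← Perm.mul_apply, ← pow_add, pow_eq_self_iff, ← orb_eq_of_sameCycle (mem_orb.mp hz), hc,
        two_mul]
    · simp only [F, if_neg hz]
  refine ⟨hF.toPerm, mem_invols.mpr ⟨hF, fun z => ?_, fun z hz => if_neg hz⟩,
    if_pos (mem_orb_self φ x)⟩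
  change F (φ z) = φ (F z)
  have hiff : φ z ∈ orb φ x ↔ z ∈ orb φ x := by
    rw [mem_orb, mem_orb, Perm.sameCycle_apply_right]
  by_cases hz : z ∈ orb φ x
  · simp only [F, if_pos hz, if_pos (hiff.mpr hz)]
    rw [← Perm.mul_apply, ← pow_succ, pow_succ', Perm.mul_apply]
  · simp only [F, if_neg hz, if_neg (mt hiff.mp hz)]

/-- Commuting with φ, an involution is determined on the cycles of x and of its image by the image
of x alone. -/
theorem invols_eqOn {x y : X} (hσ : σ ∈ invols φ U) (hτ : τ ∈ invols φ L) (hx : σ x = y)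
    (hx' : τ x = y) {z : X} (hz : z ∈ orb φ x ∪ orb φ y) : τ z = σ z := by
  have h1 := (mem_invols.mp hσ).1 x
  have h2 := (mem_invols.mp hτ).1 x
  rw [hx] at h1
  rw [hx'] at h2
  rcases Finset.mem_union.mp hz with hz | hz <;> obtain ⟨n, rfl⟩ := exists_pow_of_mem_orb hz <;>
    rw [invols_pow hσ, invols_pow hτ]
  · rw [hx, hx']
  · rw [h1, h2]

theorem mul_mem_invols (hU : U ⊆ L) (hσ : σ ∈ invols φ U) (hτ : τ ∈ invols φ (L \ U)) :
    σ * τ ∈ invols φ L := by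
  have h1 : ∀ z, z ∈ U → τ z = z := fun z hz => (mem_invols.mp hτ).2.2 z (by simp [hz])
  have h2 : ∀ z, z ∉ U → σ z = z := (mem_invols.mp hσ).2.2
  have h3 : ∀ z, z ∉ U → τ z ∉ U := fun z hz h => hz (by
    have := h1 _ h
    rwa [← τ.injective this])
  refine mem_invols.mpr ⟨fun z => ?_, fun z => ?_, fun z hz => ?_⟩
  · simp only [Perm.mul_apply]
    by_cases hz : z ∈ U
    · rw [h1 z hz, h1 _ (invols_mem hσ hz), (mem_invols.mp hσ).1]
    · rw [h2 _ (h3 z hz), (mem_invols.mp hτ).1, h2 z hz]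
  · simp only [Perm.mul_apply]
    rw [(mem_invols.mp hτ).2.1, (mem_invols.mp hσ).2.1]
  · rw [Perm.mul_apply, (mem_invols.mp hτ).2.2 z (by simp [hz]), h2 z fun h => hz (hU h)]

theorem mul_mem_invols_sdiff {x y : X} (hσ : σ ∈ invols φ (orb φ x ∪ orb φ y))
    (hτ : τ ∈ invols φ L) (hx : σ x = y) (hx' : τ x = y) :
    σ * τ ∈ invols φ (L \ (orb φ x ∪ orb φ y)) := by
  have h1 : ∀ z, z ∈ orb φ x ∪ orb φ y → τ z = σ z := fun z hz => invols_eqOn hσ hτ hx hx' hz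
  have h2 : ∀ z, z ∉ orb φ x ∪ orb φ y → σ z = z := (mem_invols.mp hσ).2.2
  have h3 : ∀ z, z ∉ orb φ x ∪ orb φ y → τ z ∉ orb φ x ∪ orb φ y := fun z hz h => hz (by
    have h4 := invols_mem hσ h
    rwa [← h1 _ h, (mem_invols.mp hτ).1] at h4)
  have h5 : ∀ z, z ∈ orb φ x ∪ orb φ y → (σ * τ) z = z := fun z hz => by
    rw [Perm.mul_apply, h1 z hz, (mem_invols.mp hσ).1]
  have h6 : ∀ z, z ∉ orb φ x ∪ orb φ y → (σ * τ) z = τ z := fun z hz => by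
    rw [Perm.mul_apply, h2 _ (h3 z hz)]
  refine mem_invols.mpr ⟨fun z => ?_, fun z => ?_, fun z hz => ?_⟩
  · by_cases hz : z ∈ orb φ x ∪ orb φ y
    · rw [h5 z hz, h5 z hz]
    · rw [h6 z hz, h6 _ (h3 z hz), (mem_invols.mp hτ).1]
  · simp only [Perm.mul_apply]
    rw [(mem_invols.mp hτ).2.1, (mem_invols.mp hσ).2.1]
  · by_cases hz' : z ∈ orb φ x ∪ orb φ y
    · exact h5 z hz'
    · rw [h6 z hz', (mem_invols.mp hτ).2.2 z fun h => hz (by simp [h, hz'])]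

variable {k : Type u} [Field k]

/-- The product of the `p_j` over the lengths of the cycles in an invariant set. -/
def pcyc (k : Type u) [Field k] (φ : Perm X) (L : Finset X) : LambdaHbar k :=
  oprod φ L fun x => pSum (orb φ x).card.toPNat'

/-- The contribution of an involution. -/
def iterm (k : Type u) [Field k] (φ : Perm X) (L : Finset X) (τ : Perm X) : LambdaHbar k :=
  hbarPow ((Finset.univ.filter fun x => τ x ≠ x).card / 2 : ℕ) * pcyc k φ (L.filter fun x => τ x = x)

/-- The generating function of involutions. -/
def isum (k : Type u) [Field k] (φ : Perm X) (L : Finset X) : LambdaHbar k :=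
  ∑ τ ∈ invols φ L, iterm k φ L τ

theorem pcyc_union {L L' : Finset X} (hL : ∀ x ∈ L, φ x ∈ L) (hd : Disjoint L L') :
    pcyc k φ (L ∪ L') = pcyc k φ L * pcyc k φ L' :=
  oprod_union hL hd _

theorem apply_mem_orb {x : X} : ∀ z ∈ orb φ x, φ z ∈ orb φ x := fun _ hz =>
  mem_orb.mpr (mem_orb.mp hz).apply_right

theorem pcyc_orb (x : X) : pcyc k φ (orb φ x) = pSum (orb φ x).card.toPNat' :=
  oprod_orb (fun x => by rw [orb_apply]) x

theorem pcyc_of_mem {x : X} (h : orb φ x ⊆ L) :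
    pcyc k φ L = pSum (orb φ x).card.toPNat' * pcyc k φ (L \ orb φ x) := by
  rw [← pcyc_orb, ← pcyc_union apply_mem_orb Finset.disjoint_sdiff,
    Finset.union_sdiff_of_subset h]

theorem orb_subset (hL : ∀ x ∈ L, φ x ∈ L) {x : X} (hx : x ∈ L) : orb φ x ⊆ L := by
  intro z hz
  obtain ⟨n, rfl⟩ := exists_pow_of_mem_orb hz
  induction n with
  | zero => exact hx
  | succ n ih =>
    rw [pow_succ', Perm.mul_apply]
    exact hL _ (ih (pow_mem_orb φ x n))

theorem sdiff_invariant (hL : ∀ x ∈ L, φ x ∈ L) (x : X) :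
    ∀ z ∈ L \ orb φ x, φ z ∈ L \ orb φ x := by
  intro z hz
  rw [Finset.mem_sdiff, mem_orb] at hz ⊢
  exact ⟨hL z hz.1, by rw [Perm.sameCycle_apply_right]; exact hz.2⟩

/-- Composition with the standard involution σ identifies the involutions sending x to y with those
supported off the two cycles, since any two of them agree on these cycles. -/
theorem sum_fiber {x y : X} (hσ : σ ∈ invols φ (orb φ x ∪ orb φ y)) (hx : σ x = y)
    (hU : orb φ x ∪ orb φ y ⊆ L) (f : Perm X → LambdaHbar k) :
    ∑ τ ∈ invols φ L with τ x = y, f τ =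
      ∑ τ ∈ invols φ (L \ (orb φ x ∪ orb φ y)), f (σ * τ) := by
  have hσσ : ∀ τ, σ * (σ * τ) = τ := fun τ => by
    ext z
    simp only [Perm.mul_apply]
    exact (mem_invols.mp hσ).1 _
  refine Finset.sum_bij' (fun τ _ => σ * τ) (fun τ _ => σ * τ) ?_ ?_ (fun τ _ => hσσ τ)
    (fun τ _ => hσσ τ) fun τ _ => by rw [hσσ]
  · intro τ hτ
    rw [Finset.mem_filter] at hτ
    exact mul_mem_invols_sdiff hσ hτ.1 hx hτ.2
  · intro τ hτ
    rw [Finset.mem_filter]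
    refine ⟨mul_mem_invols hU hσ hτ, ?_⟩
    rw [Perm.mul_apply, (mem_invols.mp hτ).2.2 x (by simp [mem_orb_self]), hx]

theorem sum_fiber_self {x : X} (hU : orb φ x ⊆ L) :
    ∑ τ ∈ invols φ L with τ x = x, iterm k φ L τ =
      pSum (orb φ x).card.toPNat' * isum k φ (L \ orb φ x) := by
  have h1 : (1 : Perm X) ∈ invols φ (orb φ x ∪ orb φ x) :=
    mem_invols.mpr ⟨fun _ => rfl, fun _ => rfl, fun _ _ => rfl⟩
  rw [sum_fiber h1 rfl (by rwa [Finset.union_self]), Finset.union_self, isum, Finset.mul_sum]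
  refine Finset.sum_congr rfl fun τ hτ => ?_
  have h2 : ∀ z ∈ orb φ x, τ z = z := fun z hz => (mem_invols.mp hτ).2.2 z (by simp [hz])
  rw [one_mul, iterm, iterm, pcyc_of_mem (x := x) (L := L.filter _)]
  · rw [mul_left_comm]
    congr 3
    ext z
    simp only [Finset.mem_sdiff, Finset.mem_filter]
    tauto
  · exact fun z hz => Finset.mem_filter.mpr ⟨hU hz, h2 z hz⟩

/-- On the two cycles, 2i points in all, σ moves every point. It thus creates i edges and removes
these points from the legs. -/
theorem sum_fiber_ne {x y : X} (hσ : σ ∈ invols φ (orb φ x ∪ orb φ y)) (hx : σ x = y)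
    (hU : orb φ x ∪ orb φ y ⊆ L) (hxy : y ≠ x) {i : ℕ} (hi : (orb φ x ∪ orb φ y).card = 2 * i) :
    ∑ τ ∈ invols φ L with τ x = y, iterm k φ L τ =
      hbarPow i * isum k φ (L \ (orb φ x ∪ orb φ y)) := by
  rw [sum_fiber hσ hx hU, isum, Finset.mul_sum]
  refine Finset.sum_congr rfl fun τ hτ => ?_
  have hy : σ y = x := by rw [← hx, (mem_invols.mp hσ).1]
  have h2 : ∀ z ∈ orb φ x ∪ orb φ y, τ z = z := fun z hz =>
    (mem_invols.mp hτ).2.2 z (by simp only [Finset.mem_sdiff]; tauto)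
  have h3 : ∀ z ∈ orb φ x ∪ orb φ y, σ z ≠ z := by
    intro z hz
    rcases Finset.mem_union.mp hz with hz | hz <;> obtain ⟨n, rfl⟩ := exists_pow_of_mem_orb hz <;>
      rw [invols_pow hσ]
    · rw [hx]
      exact fun h => hxy ((φ ^ n).injective h)
    · rw [hy]
      exact fun h => hxy ((φ ^ n).injective h).symm
  have h4 : ∀ z, z ∉ orb φ x ∪ orb φ y → (σ * τ) z = τ z := by
    intro z hz
    rw [Perm.mul_apply, (mem_invols.mp hσ).2.2]
    intro h
    have := h2 _ h
    rw [τ.injective this] at h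
    exact hz h
  have h5 : ∀ z ∈ orb φ x ∪ orb φ y, (σ * τ) z ≠ z := fun z hz => by
    rw [Perm.mul_apply, h2 z hz]
    exact h3 z hz
  have h6 : (Finset.univ.filter fun z => (σ * τ) z ≠ z) =
      (orb φ x ∪ orb φ y) ∪ Finset.univ.filter fun z => τ z ≠ z := by
    ext z
    rw [Finset.mem_union, Finset.mem_filter, Finset.mem_filter]
    by_cases hz : z ∈ orb φ x ∪ orb φ y
    · simp only [hz, h5 z hz, Finset.mem_univ, ne_eq, not_false_eq_true, and_self, true_or]
    · simp only [hz, h4 z hz, false_or]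
  have h7 : (L.filter fun z => (σ * τ) z = z) =
      (L \ (orb φ x ∪ orb φ y)).filter fun z => τ z = z := by
    ext z
    rw [Finset.mem_filter, Finset.mem_filter, Finset.mem_sdiff]
    by_cases hz : z ∈ orb φ x ∪ orb φ y
    · simp only [hz, h5 z hz, and_false, not_true_eq_false, false_and]
    · simp only [hz, h4 z hz, not_false_eq_true, and_true]
  have h8 : Disjoint (orb φ x ∪ orb φ y) (Finset.univ.filter fun z => τ z ≠ z) := by
    rw [Finset.disjoint_left]
    intro z hz hz'
    exact (Finset.mem_filter.mp hz').2 (h2 z hz)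
  rw [iterm, iterm, h6, h7, Finset.card_union_of_disjoint h8, hi,
    Nat.mul_add_div (by norm_num : 2 > 0), Nat.cast_add, Conf.hbarPow_add, mul_assoc]

/-- The derivative with respect to p_j removes a cycle of length j in all possible ways. The factor
j turns the sum over cycles into a sum over their points. -/
theorem pDeriv_pcyc (j : ℕ+) : ∀ (n : ℕ) (L : Finset X), L.card = n → (∀ x ∈ L, φ x ∈ L) →
    (j : k) • pDeriv j (pcyc k φ L) =
      ∑ y ∈ L, if (orb φ y).card = j then pcyc k φ (L \ orb φ y) else 0 := by
  intro n
  induction n using Nat.strong_induction_on with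
  | _ n ih =>
  intro L hn hL
  rcases L.eq_empty_or_nonempty with rfl | ⟨x, hx⟩
  · rw [Finset.sum_empty, pcyc, oprod_empty]
    have : pDeriv j (1 : LambdaHbar k) = 0 := by
      refine HahnSeries.ext (funext fun m => ?_)
      rw [coeff_pDeriv, HahnSeries.coeff_one, if_neg, mul_zero]
      · rfl
      · intro h
        have h2 : (m.2 + Finsupp.single j 1 : ℕ+ →₀ ℕ) j = 0 :=
          congrArg (fun m : HMono => m.2 j) h
        simp at h2
    rw [this, smul_zero]
  have hs := orb_subset hL hx
  have hc := card_orb_pos φ x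
  have hlt : (L \ orb φ x).card < n := by
    have := Finset.card_le_card hs
    rw [Finset.card_sdiff_of_subset hs]
    omega
  have h1 := ih _ hlt _ rfl (sdiff_invariant hL x)
  rw [pcyc_of_mem hs, pDeriv_pSum_mul, smul_add, ← mul_smul_comm, h1,
    ← Finset.sum_sdiff hs, Finset.mul_sum]
  congr 1
  · refine Finset.sum_congr rfl fun y hy => ?_
    rw [mul_ite, mul_zero]
    refine if_congr Iff.rfl ?_ rfl
    rw [pcyc_of_mem (x := x) (L := L \ orb φ y)]
    · rw [sdiff_sdiff_comm]
    · intro z hz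
      rw [Finset.mem_sdiff]
      refine ⟨hs hz, fun hz' => (Finset.mem_sdiff.mp hy).2 ?_⟩
      exact mem_orb.mpr ((mem_orb.mp hz).trans (mem_orb.mp hz').symm)
  -- All points of the cycle of x give the same term, so if the cycle has length j it is counted j
  -- times.
  · have h2 : ∀ y ∈ orb φ x, (if (orb φ y).card = j then pcyc k φ (L \ orb φ y) else 0) =
        if (orb φ x).card = j then pcyc k φ (L \ orb φ x) else 0 := fun y hy => by
      rw [← orb_eq_of_sameCycle (mem_orb.mp hy)]
    rw [Finset.sum_congr rfl h2, Finset.sum_const]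
    have hj : j = (orb φ x).card.toPNat' ↔ (orb φ x).card = j := by
      rw [← PNat.coe_inj, Nat.toPNat'_coe, if_pos hc]
      exact eq_comm
    by_cases h : (orb φ x).card = j
    · rw [if_pos h, if_pos (hj.mpr h), h, Nat.cast_smul_eq_nsmul]
    · rw [if_neg h, if_neg (mt hj.mp h), smul_zero, smul_zero]

/-- Within its own cycle, a point can only be fixed or sent to the opposite point: the first case
leaves a leg cycle, the second folds an even cycle into half as many edges. -/
theorem sum_orb_fiber (hL : ∀ x ∈ L, φ x ∈ L) {x : X} (hx : x ∈ L) :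
    ∑ y ∈ orb φ x, ∑ τ ∈ invols φ L with τ x = y, iterm k φ L τ =
      pSum (orb φ x).card.toPNat' * isum k φ (L \ orb φ x) +
        if Even (orb φ x).card then
          hbarPow ((orb φ x).card / 2 : ℕ) * isum k φ (L \ orb φ x) else 0 := by
  have hs := orb_subset hL hx
  have hc := card_orb_pos φ x
  rw [← sum_fiber_self hs]
  -- From τ x = φ^i x and τ² = 1 it follows that φ^(2i) x = x, so the length of the cycle divides
  -- 2i. With i below the length, only 0 and half the length remain.
  have h0 : ∀ i, i < (orb φ x).card → i ≠ 0 → 2 * i ≠ (orb φ x).card →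
      ∑ τ ∈ invols φ L with τ x = (φ ^ i) x, iterm k φ L τ = 0 := by
    intro i hi hi0 hi2
    refine Finset.sum_eq_zero fun τ hτ => absurd hi2 ?_
    rw [Finset.mem_filter] at hτ
    have h1 := (mem_invols.mp hτ.1).1 x
    rw [hτ.2, invols_pow hτ.1, hτ.2, ← Perm.mul_apply, ← pow_add, pow_eq_self_iff] at h1
    obtain ⟨c, hc⟩ := h1
    push Not
    have : c = 1 := by
      have h2 : c < 2 := by
        by_contra hge
        have := Nat.mul_le_mul_left (orb φ x).card (not_lt.mp hge)
        omega
      have h3 : c ≠ 0 := by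
        rintro rfl
        omega
      omega
    rw [this] at hc
    omega
  have h1 : ∀ y ∈ orb φ x, ∃ i < (orb φ x).card, (φ ^ i) x = y := by
    intro y hy
    obtain ⟨n, rfl⟩ := exists_pow_of_mem_orb hy
    refine ⟨n % (orb φ x).card, Nat.mod_lt _ hc, ?_⟩
    rw [pow_eq_pow_iff]
    exact Nat.mod_modEq _ _
  split_ifs with he
  · obtain ⟨i, hi⟩ := he
    have hi' : (orb φ x).card = 2 * i := by omega
    have hne : (φ ^ i) x ≠ x := by
      rw [ne_eq, pow_eq_self_iff]
      intro h
      have := Nat.le_of_dvd (by omega) h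
      omega
    obtain ⟨σ, hσ, hσx⟩ := exists_half hi'
    have hu : orb φ x ∪ orb φ ((φ ^ i) x) = orb φ x := by
      rw [← orb_eq_of_sameCycle (mem_orb.mp (pow_mem_orb φ x i)), Finset.union_self]
    have h2 := sum_fiber_ne (k := k) (L := L) (i := i) (by rwa [hu]) hσx (by rwa [hu]) hne
      (by rw [hu, hi'])
    rw [hu] at h2
    rw [← Finset.sum_subset (s₁ := {x, (φ ^ i) x}), Finset.sum_pair hne.symm, h2]
    · congr 4
      omega
    · intro z hz
      rw [Finset.mem_insert, Finset.mem_singleton] at hz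
      rcases hz with rfl | rfl
      · exact mem_orb_self φ z
      · exact pow_mem_orb φ x i
    · intro y hy hy'
      obtain ⟨a, ha, rfl⟩ := h1 y hy
      rw [Finset.mem_insert, Finset.mem_singleton, not_or] at hy'
      refine h0 a ha (fun h => hy'.1 (by rw [h]; rfl)) fun h => hy'.2 ?_
      rw [show a = i by omega]
  · rw [add_zero, Finset.sum_eq_single x]
    · intro y hy hne
      obtain ⟨a, ha, rfl⟩ := h1 y hy
      refine h0 a ha (fun h => hne (by rw [h]; rfl)) fun h => he ⟨a, by omega⟩
    · exact fun h => absurd (mem_orb_self φ x) h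

variable [CharZero k]

/-- Induction on the number of points. Choose x in a cycle of length j and distinguish the image of
x: x itself gives p_j, the opposite point gives ħ^(j/2) for even j, and the points of other cycles
of length j give ħ^j j ∂/∂p_j. These are the terms of `expLaplacian_pSum_mul`. -/
theorem isum_eq_expLaplacian : ∀ (n : ℕ) (L : Finset X), L.card = n → (∀ x ∈ L, φ x ∈ L) →
    isum k φ L = expLaplacian (pcyc k φ L) := by
  intro n
  induction n using Nat.strong_induction_on with
  | _ n ih =>
  intro L hn hL
  rcases L.eq_empty_or_nonempty with rfl | ⟨x, hx⟩
  · rw [pcyc, oprod_empty, expLaplacian_one, isum, Finset.sum_eq_single 1]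
    · simp [iterm, pcyc, oprod_empty, Conf.hbarPow_zero]
    · intro τ hτ hne
      exact absurd (Equiv.ext fun z => (mem_invols.mp hτ).2.2 z (by simp)) hne
    · intro h
      exact (h (mem_invols.mpr ⟨fun _ => rfl, fun _ => rfl, fun _ _ => rfl⟩)).elim
  have hs := orb_subset hL hx
  have hc := card_orb_pos φ x
  have hL' := sdiff_invariant hL x
  have hlt : (L \ orb φ x).card < n := by
    have := Finset.card_le_card hs
    rw [Finset.card_sdiff_of_subset hs]
    omega
  have hj : ((orb φ x).card.toPNat' : ℕ) = (orb φ x).card := by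
    rw [Nat.toPNat'_coe, if_pos hc]
  rw [pcyc_of_mem hs, expLaplacian_pSum_mul, lapComm, pDeriv_pcyc _ _ _ rfl hL', expLaplacian_add,
    expLaplacian_hbarPow_mul, expLaplacian_sum, ← ih _ hlt _ rfl hL', hj, isum,
    ← Finset.sum_fiberwise_of_maps_to (t := L) (g := fun τ => τ x)
      (fun τ hτ => invols_mem hτ hx), ← Finset.sum_sdiff hs, sum_orb_fiber hL hx]
  have h1 : expLaplacian (if Even (orb φ x).card then
      hbarPow ((orb φ x).card / 2 : ℕ) * pcyc k φ (L \ orb φ x) else 0) =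
      if Even (orb φ x).card then
        hbarPow ((orb φ x).card / 2 : ℕ) * isum k φ (L \ orb φ x) else 0 := by
    split_ifs
    · rw [expLaplacian_hbarPow_mul, ih _ hlt _ rfl hL']
    · simpa using expLaplacian_smul 0 (0 : LambdaHbar k)
  rw [h1, Finset.mul_sum, add_comm, add_assoc, add_comm (Finset.sum _ _)]
  congr 2
  refine Finset.sum_congr rfl fun y hy => ?_
  have hy' := (Finset.mem_sdiff.mp hy)
  have hdis : Disjoint (orb φ x) (orb φ y) := by
    rw [Finset.disjoint_left]
    exact fun z hz hz' => hy'.2 (mem_orb.mpr ((mem_orb.mp hz).trans (mem_orb.mp hz').symm))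
  split_ifs with h
  · obtain ⟨σ, hσ, hσx⟩ := exists_swap hy'.2 h
    have hsy := orb_subset hL hy'.1
    have hlt2 : ((L \ orb φ x) \ orb φ y).card < n :=
      (Finset.card_le_card Finset.sdiff_subset).trans_lt hlt
    rw [sum_fiber_ne hσ hσx (Finset.union_subset hs hsy)
      (fun h => hy'.2 (h ▸ mem_orb_self φ x)) (i := (orb φ x).card)
      (by rw [Finset.card_union_of_disjoint hdis, h, two_mul]),
      ← ih _ hlt2 _ rfl (sdiff_invariant hL' y), sdiff_sdiff_left, Finset.sup_eq_union]
  · rw [Finset.sum_eq_zero]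
    · rw [show expLaplacian (0 : LambdaHbar k) = 0 by
        simpa using expLaplacian_smul 0 (0 : LambdaHbar k), mul_zero]
    · intro τ hτ
      rw [Finset.mem_filter] at hτ
      exact absurd (by rw [← hτ.2, card_orb_invols hτ.1]) h

end Involutions

/-! ### Edges as invariant involutions of the flags, and the formula for connected graphs. -/

namespace Conf

open scoped Classical

section

variable {X : Type} [Fintype X] {k : Type u} [Field k] (χ : ℕ → Multiset ℕ → k) (c : Conf X)

/-- The set of all flags. -/
def allFlags : Finset X := Finset.univ.filter fun x => c.vx x ≠ x

theorem mem_allFlags {c : Conf X} {x : X} : x ∈ c.allFlags ↔ c.vx x ≠ x := by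
  simp [allFlags]

theorem vx_φ_iff (x : X) : c.vx (c.φ x) = c.φ x ↔ c.vx x = x := by
  rw [c.φ_vx, c.φ.injective.eq_iff]

/-- The same graph with another involution. -/
def withInv (τ : Perm X) (hτ : τ ∈ invols c.φ c.allFlags) : Conf X :=
  { c with
    inv := τ
    inv_inv := (mem_invols.mp hτ).1
    inv_vx := fun x => (mem_invols.mp hτ).2.2 _ fun h => mem_allFlags.mp h (c.vx_vx x)
    φ_inv := (mem_invols.mp hτ).2.1 }

/-- The involution, as a permutation. -/
def invPerm : Perm X := Function.Involutive.toPerm c.inv c.inv_inv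

theorem invPerm_mem : c.invPerm ∈ invols c.φ c.allFlags :=
  mem_invols.mpr ⟨c.inv_inv, c.φ_inv, fun x hx => by
    rw [mem_allFlags, not_not] at hx
    change c.inv x = x
    rw [← hx, c.inv_vx]⟩

theorem one_mem_invols (φ : Perm X) (L : Finset X) : (1 : Perm X) ∈ invols φ L :=
  mem_invols.mpr ⟨fun _ => rfl, fun _ => rfl, fun _ _ => rfl⟩

/-- The product of the factors of the vertices. -/
def vprod : LambdaHbar k := oprod c.φ c.verts fun x =>
  hbarPow ((orb c.φ x).card * ((c.gen x : ℤ) - 1)) * HahnSeries.C (c.vfac χ x)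

theorem vfac_φ (x : X) : c.vfac χ (c.φ x) = c.vfac χ x := c.isEmb_φ.vfac χ x

/-- The points fall into vertices, legs and flags on edges, each invariant. Only the last two
classes depend on the involution, and they give exactly `iterm`. -/
theorem weight_eq : c.weight χ = c.vprod χ * iterm k c.φ c.allFlags c.invPerm := by
  have hu : (Finset.univ : Finset X) = c.verts ∪ ((c.allFlags.filter fun x => c.invPerm x = x) ∪
      c.allFlags.filter fun x => ¬ c.invPerm x = x) := by
    rw [Finset.filter_union_filter_not_eq]
    ext x
    rw [Finset.mem_union, mem_verts, mem_allFlags]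
    simp [em]
  have h1 : oprod c.φ c.verts (c.loc χ) = c.vprod χ := by
    refine oprod_congr (c.loc_φ χ) (fun x => ?_) fun x hx => ?_
    · rw [orb_apply, c.φ_gen, vfac_φ]
    · rw [loc, if_pos (mem_verts.mp hx)]
  have h2 : oprod c.φ (c.allFlags.filter fun x => c.invPerm x = x) (c.loc χ) =
      pcyc k c.φ (c.allFlags.filter fun x => c.invPerm x = x) := by
    refine oprod_congr (c.loc_φ χ) (fun x => ?_) fun x hx => ?_
    · rw [orb_apply]
    · rw [Finset.mem_filter] at hx
      rw [loc, if_neg (mem_allFlags.mp hx.1), if_pos (show c.inv x = x from hx.2)]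
  have h3 : oprod c.φ (c.allFlags.filter fun x => ¬ c.invPerm x = x) (c.loc χ) = 1 := by
    rw [← oprod_one c.φ (c.allFlags.filter fun x => ¬ c.invPerm x = x)]
    refine oprod_congr (c.loc_φ χ) (fun x => rfl) fun x hx => ?_
    rw [Finset.mem_filter] at hx
    rw [loc, if_neg (mem_allFlags.mp hx.1), if_neg (show ¬ c.inv x = x from hx.2)]
  have h4 : c.edges = (Finset.univ.filter fun x => c.invPerm x ≠ x).card / 2 := by
    rw [edges]
    congr 2
  have h5 : ∀ x, c.invPerm (c.φ x) = c.φ x ↔ c.invPerm x = x := fun x => by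
    change c.inv _ = _ ↔ c.inv _ = _
    rw [c.φ_inv, c.φ.injective.eq_iff]
  have h6 : oprod c.φ Finset.univ (c.loc χ) =
      c.vprod χ * pcyc k c.φ (c.allFlags.filter fun x => c.invPerm x = x) := by
    rw [hu, oprod_union, oprod_union, h1, h2, h3, mul_one]
    · intro x hx
      rw [Finset.mem_filter, mem_allFlags] at hx ⊢
      rw [ne_eq, vx_φ_iff, h5]
      exact hx
    · exact Finset.disjoint_filter_filter_not _ _ _
    · intro x hx
      rw [mem_verts] at hx ⊢
      rw [vx_φ_iff, hx]
    · rw [Finset.filter_union_filter_not_eq, Finset.disjoint_left]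
      intro x hx hx'
      exact mem_allFlags.mp hx' (mem_verts.mp hx)
  rw [weight, iterm, h6, h4]
  ring

theorem weight_withInv (τ : Perm X) (hτ : τ ∈ invols c.φ c.allFlags) :
    (c.withInv τ hτ).weight χ = c.vprod χ * iterm k c.φ c.allFlags τ := by
  rw [weight_eq]
  congr 1

theorem iterm_one (φ : Perm X) (L : Finset X) : iterm k φ L 1 = pcyc k φ L := by
  simp [iterm, hbarPow_zero]

variable [CharZero k]

/-- The factors of vertices are powers of ħ and scalars, which exp(Δ) does not see. -/
theorem expLaplacian_vprod_mul (f : LambdaHbar k) :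
    expLaplacian (c.vprod χ * f) = c.vprod χ * expLaplacian f := by
  refine Finset.prod_induction (p := fun g : LambdaHbar k =>
    ∀ f, expLaplacian (g * f) = g * expLaplacian f) _ ?_ (by simp) ?_ f
  · intro a b ha hb f
    rw [mul_assoc, ha, hb, mul_assoc]
  · intro o _ f
    split_ifs
    · rw [mul_assoc, expLaplacian_hbarPow_mul, HahnSeries.C_mul_eq_smul, expLaplacian_smul,
        mul_assoc, HahnSeries.C_mul_eq_smul]
    · rw [one_mul, one_mul]

theorem expLaplacian_weight (hc : ∀ x, c.inv x = x) : expLaplacian (c.weight χ) =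
    ∑ τ : {τ // τ ∈ invols c.φ c.allFlags}, (c.withInv τ.1 τ.2).weight χ := by
  have h1 : c.invPerm = 1 := Equiv.ext hc
  rw [weight_eq, h1, iterm_one, expLaplacian_vprod_mul, ← isum_eq_expLaplacian _ _ rfl, isum,
    Finset.mul_sum, ← Finset.sum_coe_sort]
  · simp only [weight_withInv]
  · intro x hx
    rw [mem_allFlags] at hx ⊢
    rwa [ne_eq, vx_φ_iff]

end

/-- Cutting every edge into two legs is inverse to gluing: the cut graph carries the identity as
involution, and the original involution, which commutes with φ and fixes the vertices, is the gluing
datum. -/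
theorem bijective_withInv : Function.Bijective
    fun p : Σ a : {a // IsAdm False a}, {τ // τ ∈ invols a.1.2.φ a.1.2.allFlags} =>
      (⟨⟨p.1.1.1, p.1.1.2.withInv p.2.1 p.2.2⟩, Or.inl trivial⟩ : {a // IsAdm True a}) := by
  constructor
  · rintro ⟨⟨⟨M, c⟩, hc⟩, τ, hτ⟩ ⟨⟨⟨M', c'⟩, hc'⟩, τ', hτ'⟩ h
    have h := congrArg Subtype.val h
    obtain rfl : M = M' := congrArg Sigma.fst h
    replace h : c.withInv τ hτ = c'.withInv τ' hτ' := eq_of_heq (Sigma.mk.inj h).2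
    replace hc : ∀ x, c.inv x = x := hc.resolve_left id
    replace hc' : ∀ x, c'.inv x = x := hc'.resolve_left id
    obtain rfl : c = c' := Conf.ext (fun x => congrArg (fun c => c.vx x) h)
      (fun x => congrArg (fun c => c.gen x) h) (fun x => by rw [hc, hc'])
      (fun x => congrArg (fun c => c.φ x) h)
    obtain rfl : τ = τ' := Equiv.ext fun x => congrArg (fun c => c.inv x) h
    rfl
  · rintro ⟨⟨M, c⟩, hc⟩
    exact ⟨⟨⟨⟨M, c.withInv 1 (one_mem_invols _ _)⟩, Or.inr fun _ => rfl⟩, c.invPerm,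
      c.invPerm_mem⟩, rfl⟩

variable {k : Type u} [Field k] [CharZero k] (χ : ℕ → Multiset ℕ → k)

theorem expLaplacian_gsum :
    expLaplacian (gsum χ (IsAdm False)) = gsum χ (IsAdm True) := by
  rw [gsum, expLaplacian_infSum (fun a : {a // IsAdm False a} => a.1.2.wt) (fun a => homog_term χ a.1)
    (fun a => a.1.2.wt_nonneg) fun n => (finite_wt n).preimage Subtype.val_injective.injOn,
    gsum, ← infSum_equiv (Equiv.ofBijective _ bijective_withInv),
    (infSum_sigma ((isSummable_term χ (IsAdm True)).comp_injective
      (Equiv.ofBijective _ bijective_withInv).injective)).1]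
  congr 1
  funext a
  rw [infSum_fintype, term, expLaplacian_smul, expLaplacian_weight χ _ (a.2.resolve_left id),
    Finset.smul_sum]
  rfl

/-- The generating function of connected graphs in terms of the one of graphs with one vertex. -/
theorem gsum_conn_eq : gsum χ (IsConn True) =
    plethLog (expLaplacian (plethExp (gsum χ (IsConn False)))) := by
  rw [plethExp_gsum, expLaplacian_gsum, plethLog_gsum]

end Conf

/-! ### From numbered graphs to families of representatives. -/

namespace Conf

section

variable {X Y : Type}

/-- The same graph with the trivial automorphism. -/
def skel (c : Conf X) : Conf X :=
  { c with
    φ := 1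
    φ_vx := fun _ => rfl
    φ_gen := fun _ => rfl
    φ_inv := fun _ => rfl }

theorem skel_map (c : Conf X) (e : X ≃ Y) : (c.map e).skel = c.skel.map e :=
  Conf.ext (fun _ => rfl) (fun _ => rfl) (fun _ => rfl) fun y => by simp [skel, map]

theorem eq_of_skel {c c' : Conf X} (h : c.skel = c'.skel) (h' : c.φ = c'.φ) : c = c' :=
  Conf.ext (fun x => congrArg (fun c => c.vx x) h) (fun x => congrArg (fun c => c.gen x) h)
    (fun x => congrArg (fun c => c.inv x) h) fun x => by rw [h']

theorem skel_map_iff {c : Conf X} {c' : Conf Y} {e : X ≃ Y} : c.skel.map e = c'.skel ↔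
    (∀ x, c'.vx (e x) = e (c.vx x)) ∧ (∀ x, c'.gen (e x) = c.gen x) ∧
      ∀ x, c'.inv (e x) = e (c.inv x) := by
  constructor
  · intro h
    refine ⟨fun x => ?_, fun x => ?_, fun x => ?_⟩
    · simpa [map, skel] using (congrArg (fun c => c.vx (e x)) h).symm
    · simpa [map, skel] using (congrArg (fun c => c.gen (e x)) h).symm
    · simpa [map, skel] using (congrArg (fun c => c.inv (e x)) h).symm
  · rintro ⟨h1, h2, h3⟩
    exact map_eq h1 h2 h3 fun _ => rfl

/-- The same graph with another automorphism. -/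
def withAut (c : Conf X) (θ : Perm X) (h : c.skel.map θ = c.skel) : Conf X :=
  { c with
    φ := θ
    φ_vx := (skel_map_iff.mp h).1
    φ_gen := (skel_map_iff.mp h).2.1
    φ_inv := (skel_map_iff.mp h).2.2 }

theorem skel_withAut (c : Conf X) (θ : Perm X) (h : c.skel.map θ = c.skel) :
    (c.withAut θ h).skel = c.skel := rfl

theorem skel_map_φ (c : Conf X) : c.skel.map c.φ = c.skel :=
  skel_map_iff.mpr ⟨c.φ_vx, c.φ_gen, c.φ_inv⟩

end

theorem conn_of_skel {X Y : Type} {c : Conf X} {c' : Conf Y} {e : X ≃ Y}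
    (h : c.skel.map e = c'.skel) (hc : c.Conn) : c'.Conn := by
  obtain ⟨h1, -, h3⟩ := skel_map_iff.mp h
  refine ⟨hc.1.map e, fun x y => ?_⟩
  obtain ⟨x, rfl⟩ := e.surjective x
  obtain ⟨y, rfl⟩ := e.surjective y
  exact Rel.map h1 h3 (hc.2 x y)

section Groupoid

variable {O : Type} {X : O → Type} (c : ∀ o, Conf (X o))

/-- The isomorphisms of the graphs of a family of graphs. -/
abbrev GIso (o o' : O) : Type := {θ : X o ≃ X o' // (c o).skel.map θ = (c o').skel}

/-- The number of isomorphisms with given source. -/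
def numIso (o : O) : ℕ := Nat.card (Σ o', GIso c o o')

theorem giso_symm {o o' : O} {θ : X o ≃ X o'} (h : (c o).skel.map θ = (c o').skel) :
    (c o').skel.map θ.symm = (c o).skel := by
  rw [← h, map_map, Equiv.self_trans_symm, map_refl]

theorem giso_trans {o o' o'' : O} {θ : X o ≃ X o'} {η : X o' ≃ X o''}
    (h : (c o).skel.map θ = (c o').skel) (h' : (c o').skel.map η = (c o'').skel) :
    (c o).skel.map (θ.trans η) = (c o'').skel := by
  rw [← map_map, h, h']

theorem numIso_eq {o o' : O} (θ : GIso c o o') : numIso c o = numIso c o' := by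
  refine Nat.card_congr (Equiv.sigmaCongrRight fun o'' =>
    { toFun := fun η => ⟨θ.1.symm.trans η.1, giso_trans c (giso_symm c θ.2) η.2⟩
      invFun := fun η => ⟨θ.1.trans η.1, giso_trans c θ.2 η.2⟩
      left_inv := fun η => Subtype.ext (by simp [← Equiv.trans_assoc])
      right_inv := fun η => Subtype.ext (by simp [← Equiv.trans_assoc]) })

/-- The numbered graphs with automorphism which are isomorphic to a graph of the family. -/
def IsIn (a : Num) : Prop := ∃ (o : O) (ι : X o ≃ Fin a.1), (c o).skel.map ι = a.2.skel

/-- The numberings of the graphs of the family which give a numbered graph. -/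
abbrev Numbering (a : Num) : Type :=
  {p : Σ o, X o ≃ Fin a.1 // (c p.1).skel.map p.2 = a.2.skel}

/-- A numbering of a graph of the family, with an automorphism. -/
abbrev NumAut : Type := Σ p : (Σ o, GIso c o o), Σ M, X p.1 ≃ Fin M

/-- The numbered graph with automorphism. -/
def NumAut.conf (z : NumAut c) : Conf (Fin z.2.1) :=
  ((c z.1.1).withAut z.1.2.1 z.1.2.2).map z.2.2

theorem NumAut.skel_conf (z : NumAut c) : (c z.1.1).skel.map z.2.2 = (NumAut.conf c z).skel := by
  rw [conf, skel_map, skel_withAut]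

/-- A numbered graph of the family with an automorphism is a numbered graph with automorphism with
a presentation as a graph of the family. -/
def NumAut.toNum (z : NumAut c) : Σ a : {a : Num // IsIn c a}, Numbering c a.1 :=
  ⟨⟨⟨z.2.1, z.conf c⟩, ⟨z.1.1, z.2.2, z.skel_conf c⟩⟩, ⟨⟨z.1.1, z.2.2⟩, z.skel_conf c⟩⟩

/-- Along a presentation by a member of the family, automorphisms of the numbered graph and of the
member correspond to each other by conjugation. -/
theorem NumAut.bijective_toNum : Function.Bijective (NumAut.toNum c) := by
  constructor
  · intro z z' h
    have h1 : (⟨z.1.1, z.2⟩ : Σ o, Σ M, X o ≃ Fin M) = ⟨z'.1.1, z'.2⟩ :=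
      congrArg (fun p : Σ a : {a : Num // IsIn c a}, Numbering c a.1 =>
        (⟨p.2.1.1, p.1.1.1, p.2.1.2⟩ : Σ o, Σ M, X o ≃ Fin M)) h
    have h2 : (⟨z.2.1, z.conf c⟩ : Num) = ⟨z'.2.1, z'.conf c⟩ :=
      congrArg (fun p : Σ a : {a : Num // IsIn c a}, Numbering c a.1 => p.1.1) h
    obtain ⟨⟨o, θ⟩, M, ι⟩ := z
    obtain ⟨⟨o', θ'⟩, M', ι'⟩ := z'
    obtain ⟨rfl, h1⟩ := Sigma.mk.inj h1
    obtain ⟨rfl, h1⟩ := Sigma.mk.inj (eq_of_heq h1)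
    obtain rfl := eq_of_heq h1
    have h3 := map_injective ι (eq_of_heq (Sigma.mk.inj h2).2)
    have h4 : θ = θ' := Subtype.ext (congrArg Conf.φ h3)
    rw [h4]
  · rintro ⟨⟨⟨M, a⟩, ha⟩, ⟨⟨o, ι⟩, h⟩⟩
    simp only at ι h
    have hb : (a.map ι.symm).skel = (c o).skel := by
      rw [skel_map, ← h, map_map, Equiv.self_trans_symm, map_refl]
    let z : NumAut c := ⟨⟨o, (a.map ι.symm).φ, by rw [← hb, skel_map_φ]⟩, M, ι⟩
    have hz : z.conf c = a := by
      have h5 : (c o).withAut (a.map ι.symm).φ (by rw [← hb, skel_map_φ]) = a.map ι.symm :=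
        eq_of_skel hb.symm rfl
      change ((c o).withAut (a.map ι.symm).φ _).map ι = a
      rw [h5, map_map, Equiv.symm_trans_self, map_refl]
    refine ⟨z, ?_⟩
    have key : ∀ (a' : Conf (Fin M)) (h1 : IsIn c ⟨M, a'⟩) (h2 : (c o).skel.map ι = a'.skel),
        a' = a → (⟨⟨⟨M, a'⟩, h1⟩, ⟨⟨o, ι⟩, h2⟩⟩ : Σ a : {a : Num // IsIn c a}, Numbering c a.1) =
          ⟨⟨⟨M, a⟩, ha⟩, ⟨⟨o, ι⟩, h⟩⟩ := by
      rintro a' h1 h2 rfl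
      rfl
    exact key _ _ _ hz

/-- The presentations of a numbered graph correspond to the isomorphisms with given source. -/
theorem numbering_equiv {a : Num} (p : Numbering c a) :
    Nonempty ((Σ o', GIso c p.1.1 o') ≃ Numbering c a) := by
  refine ⟨Equiv.ofBijective (fun q => ⟨⟨q.1, q.2.1.symm.trans p.1.2⟩, ?_⟩) ⟨?_, ?_⟩⟩
  · rw [← map_map, giso_symm c q.2.2, p.2]
  · rintro ⟨o, θ⟩ ⟨o', θ'⟩ h
    obtain ⟨rfl, h⟩ := Sigma.mk.inj (congrArg Subtype.val h)
    have h := eq_of_heq h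
    have h2 : θ.1 = θ'.1 := by
      have := congrArg (fun e => (e.trans p.1.2.symm).symm) h
      simpa [Equiv.trans_assoc] using this
    rw [Subtype.ext h2]
  · rintro ⟨⟨o', ι⟩, h⟩
    refine ⟨⟨o', p.1.2.trans ι.symm, ?_⟩, Subtype.ext ?_⟩
    · rw [← map_map, p.2, ← h, map_map, Equiv.self_trans_symm, map_refl]
    · simp [Equiv.trans_assoc]

variable {k : Type u} [Field k] [CharZero k] (χ : ℕ → Multiset ℕ → k) [∀ o, Fintype (X o)]

/-- The contribution of a graph of the family with an automorphism. -/
def aterm (p : Σ o, GIso c o o) : LambdaHbar k :=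
  ((numIso c p.1 : k)⁻¹) • ((c p.1).withAut p.2.1 p.2.2).weight χ

variable [hfin : ∀ o, Finite (Σ o', GIso c o o')]

theorem numIso_ne_zero (o : O) : (numIso c o : k) ≠ 0 := by
  have : Nonempty (Σ o', GIso c o o') := ⟨⟨o, Equiv.refl _, map_refl _⟩⟩
  rw [numIso]
  exact_mod_cast Nat.card_pos.ne'

/-- The sum over the isomorphism classes of graphs with automorphism of the family. -/
theorem infSum_aterm : (infSum fun p : Σ o, GIso c o o => aterm c χ p) = gsum χ (IsIn c) ∧
    IsSummable fun p : Σ o, GIso c o o => aterm c χ p := by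
  have hfinN : ∀ a : {a : Num // IsIn c a}, Finite (Numbering c a.1) := by
    rintro ⟨a, o, ι, h⟩
    obtain ⟨e⟩ := numbering_equiv c (⟨⟨o, ι⟩, h⟩ : Numbering c a)
    exact Finite.of_equiv _ e
  -- One family summed in two orders. Each `aterm` is spread evenly over the M! numberings of its
  -- graph; grouping by the resulting numbered graph yields `gsum`.
  obtain ⟨F, hF0⟩ : ∃ F : NumAut c → LambdaHbar k,
      ∀ z, F z = ((z.2.1.factorial : k)⁻¹) • aterm c χ z.1 := ⟨_, fun _ => rfl⟩
  have hF : ∀ z, F z = ((numIso c z.1.1 : k)⁻¹) • term χ ⟨z.2.1, z.conf c⟩ := by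
    intro z
    rw [hF0]
    simp only [aterm, term, NumAut.conf, weight_map]
    rw [smul_comm]
  have hs : IsSummable F := by
    refine isSummable_of_homog (fun z => (NumAut.toNum c z).1.1.2.wt)
      (fun z => by rw [hF]; exact (homog_term χ ⟨z.2.1, z.conf c⟩).smul _)
      (fun z => wt_nonneg _) fun n => ?_
    have h1 : {p : Σ a : {a : Num // IsIn c a}, Numbering c a.1 | p.1.1.2.wt = n}.Finite := by
      have h2 : (⋃ a ∈ {a : {a : Num // IsIn c a} | a.1.2.wt = n}, Set.range (Sigma.mk a)
          : Set (Σ a : {a : Num // IsIn c a}, Numbering c a.1)).Finite :=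
        ((finite_wt n).preimage Subtype.val_injective.injOn).biUnion fun a _ => Set.finite_range _
      refine h2.subset ?_
      rintro ⟨a, x⟩ ha
      exact Set.mem_biUnion (show a ∈ {a : {a : Num // IsIn c a} | a.1.2.wt = n} from ha) ⟨x, rfl⟩
    have h3 := Set.Finite.preimage (f := NumAut.toNum c) (NumAut.bijective_toNum c).1.injOn h1
    exact h3
  have e2 : (fun p : Σ o, GIso c o o => infSum fun j => F ⟨p, j⟩) = aterm c χ := by
    funext p
    simp only [hF0]
    exact infSum_numberings (X p.1) _
  have e1 := infSum_sigma hs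
  rw [e2] at e1
  refine ⟨?_, e1.2⟩
  let e := Equiv.ofBijective _ (NumAut.bijective_toNum c)
  rw [← e1.1, ← infSum_equiv e.symm F, (infSum_sigma (hs.comp_injective e.symm.injective)).1, gsum]
  congr 1
  funext a
  have := Fintype.ofFinite (Numbering c a.1)
  rw [infSum_fintype]
  obtain ⟨a, o, ι, h⟩ := a
  let p₀ : Numbering c a := ⟨⟨o, ι⟩, h⟩
  -- All presentations of a numbered graph carry the same factor 1/`numIso`, and there are `numIso`
  -- of them. So repeated isomorphic members of the family do no harm.
  have h1 : ∀ p : Numbering c a, F (e.symm ⟨⟨a, o, ι, h⟩, p⟩) =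
      ((numIso c o : k)⁻¹) • term χ a := by
    intro p
    obtain ⟨z, hz⟩ := e.surjective ⟨⟨a, o, ι, h⟩, p⟩
    have hz1 : (⟨z.2.1, z.conf c⟩ : Num) = a :=
      congrArg (fun p : Σ a : {a : Num // IsIn c a}, Numbering c a.1 => p.1.1) hz
    have hz2 : z.1.1 = p.1.1 :=
      congrArg (fun p : Σ a : {a : Num // IsIn c a}, Numbering c a.1 => p.2.1.1) hz
    rw [← hz, Equiv.symm_apply_apply, hF, hz1, hz2]
    congr 3
    refine (numIso_eq c ⟨ι.trans p.1.2.symm, ?_⟩).symm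
    rw [← map_map, h]
    exact (congrArg (fun d => d.map p.1.2.symm) p.2.symm).trans
      ((map_map _ _ _).trans (by rw [Equiv.self_trans_symm, map_refl]))
  rw [Finset.sum_congr rfl fun p _ => h1 p, Finset.sum_const, Finset.card_univ,
    ← Nat.card_eq_fintype_card]
  obtain ⟨e'⟩ := numbering_equiv c p₀
  rw [← Nat.card_congr e']
  change numIso c o • _ = _
  rw [← Nat.cast_smul_eq_nsmul k, smul_smul, mul_inv_cancel₀ (numIso_ne_zero c o), one_smul]

end Groupoid

end Conf

/-! ### Cycle index and orbit lengths. -/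

section CycleType

theorem orb_eq_support_cycleOf {n : ℕ} (σ : Perm (Fin n)) {x : Fin n} (hx : x ∈ σ.support) :
    orb σ x = (σ.cycleOf x).support := by
  ext y
  rw [mem_orb, Perm.mem_support_cycleOf_iff]
  exact ⟨fun h => ⟨h, hx⟩, fun h => h.1⟩

theorem cyc_support {n : ℕ} (σ : Perm (Fin n)) : cyc σ σ.support = σ.cycleType := by
  classical
  have hinj : Set.InjOn Perm.support (σ.cycleFactorsFinset : Set (Perm (Fin n))) := by
    intro c hc c' hc' h
    rw [Finset.mem_coe, Perm.mem_cycleFactorsFinset_iff] at hc hc'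
    refine Equiv.ext fun x => ?_
    by_cases hx : x ∈ c.support
    · rw [hc.2 x hx, hc'.2 x (h ▸ hx)]
    · rw [Perm.notMem_support.mp hx, Perm.notMem_support.mp (h ▸ hx)]
  have h : orbs σ σ.support = σ.cycleFactorsFinset.image Perm.support := by
    ext o
    rw [mem_orbs, Finset.mem_image]
    constructor
    · rintro ⟨x, hx, rfl⟩
      exact ⟨_, Perm.cycleOf_mem_cycleFactorsFinset_iff.mpr hx, (orb_eq_support_cycleOf σ hx).symm⟩
    · rintro ⟨c, hc, rfl⟩
      obtain ⟨x, hx⟩ := (Perm.mem_cycleFactorsFinset_iff.mp hc).1.nonempty_support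
      have hx' := Perm.mem_cycleFactorsFinset_support_le hc hx
      exact ⟨x, hx', by rw [orb_eq_support_cycleOf σ hx', ← Perm.cycle_is_cycleOf hx hc]⟩
  rw [cyc, h, Finset.image_val_of_injOn hinj, Multiset.map_map, Perm.cycleType_def]

theorem orb_of_fixed {X : Type} [Fintype X] {σ : Perm X} {x : X} (hx : σ x = x) :
    orb σ x = {x} := by
  ext y
  rw [mem_orb, Finset.mem_singleton]
  constructor
  · rintro ⟨i, rfl⟩
    exact Perm.zpow_apply_eq_self_of_apply_eq_self hx i
  · rintro rfl
    exact Perm.SameCycle.refl _ _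

theorem cyc_compl_support {n : ℕ} (σ : Perm (Fin n)) :
    cyc σ σ.supportᶜ = Multiset.replicate (n - σ.support.card) 1 := by
  classical
  have h : orbs σ (σ.supportᶜ : Finset (Fin n)) =
      Finset.image (fun x => ({x} : Finset (Fin n))) σ.supportᶜ := by
    have hx : ∀ x ∈ (σ.supportᶜ : Finset (Fin n)), orb σ x = {x} := fun x hx =>
      orb_of_fixed (Perm.notMem_support.mp (Finset.mem_compl.mp hx))
    ext o
    rw [mem_orbs, Finset.mem_image]
    exact exists_congr fun x => and_congr_right fun h => by rw [hx x h]
  rw [cyc, h, Finset.image_val_of_injOn (Finset.singleton_injective.injOn), Multiset.map_map,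
    Multiset.eq_replicate]
  constructor
  · rw [Multiset.card_map, ← Finset.card_def, Finset.card_compl, Fintype.card_fin]
  · intro b hb
    obtain ⟨x, -, rfl⟩ := Multiset.mem_map.mp hb
    exact Finset.card_singleton x

/-- The orbits of the points of a union of two disjoint sets, one of which is invariant. -/
theorem cyc_union {X : Type} [Fintype X] [DecidableEq X] {φ : Perm X} {L L' : Finset X}
    (hd : Disjoint (orbs φ L) (orbs φ L')) : cyc φ (L ∪ L') = cyc φ L + cyc φ L' := by
  classical
  have hu : orbs φ (L ∪ L') = (orbs φ L).disjUnion (orbs φ L') hd := by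
    ext o
    simp only [mem_orbs, Finset.mem_union, or_and_right, exists_or, Finset.mem_disjUnion]
  rw [cyc, hu, Finset.disjUnion_val, Multiset.map_add]
  rfl

theorem cyc_univ {n : ℕ} (σ : Perm (Fin n)) : cyc σ Finset.univ = σ.partition.parts := by
  rw [Perm.parts_partition, ← cyc_support, Fintype.card_fin, ← cyc_compl_support, ← cyc_union,
    Finset.union_compl]
  rw [Finset.disjoint_left]
  intro o ho ho'
  obtain ⟨x, hx, rfl⟩ := mem_orbs.mp ho
  obtain ⟨y, hy, he⟩ := mem_orbs.mp ho'
  rw [Finset.mem_compl, Perm.notMem_support] at hy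
  rw [orb_of_fixed hy] at he
  have : x = y := Finset.mem_singleton.mp (he ▸ mem_orb_self σ x)
  exact Perm.mem_support.mp hx (this ▸ hy)

theorem cycleIndex_eq {k : Type u} [Field k] {n : ℕ} (σ : Perm (Fin n)) :
    (cycleIndex σ : LambdaHbar k) =
      oprod σ Finset.univ fun x => pSum (orb σ x).card.toPNat' := by
  rw [oprod_eq_prod (H := fun o => pSum o.card.toPNat') (fun x => by rw [orb_apply])
    fun _ _ => rfl, cycleIndex, ← cyc_univ, cyc, Multiset.map_map]
  rfl

end CycleType

/-! ### Supertraces and the characteristic of an S-module. -/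

section Characters

variable {k : Type u} [Field k]

namespace DGRep

variable {G : Type} [Group G] (V : DGRep.{u, v} k G)

/-- The supertrace of the action of a group element. -/
def str (σ : G) : k := LinearMap.trace k V.carrier (V.scale (signOf k) ∘ₗ V.ρ σ)

theorem scale_ρ (c : ℤ → k) (σ : G) : V.scale c ∘ₗ V.ρ σ = V.ρ σ ∘ₗ V.scale c := by
  refine LinearMap.ext fun x => ?_
  rw [LinearMap.comp_apply, LinearMap.comp_apply]
  induction x using V.induction_gr with
  | hom j x hx => rw [V.scale_apply _ hx, V.scale_apply _ (V.ρ_mem σ j x hx), map_smul]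
  | zero => simp
  | add x y hx hy => simp [hx, hy]

theorem str_conj {σ τ : G} (h : IsConj σ τ) : V.str σ = V.str τ := by
  obtain ⟨g, rfl⟩ := isConj_iff.mp h
  have h1 : V.scale (signOf k) ∘ₗ V.ρ (g * σ * g⁻¹) =
      V.ρ g * ((V.scale (signOf k) ∘ₗ V.ρ σ) * V.ρ g⁻¹) := by
    rw [map_mul, map_mul, Module.End.mul_eq_comp, Module.End.mul_eq_comp, Module.End.mul_eq_comp,
      Module.End.mul_eq_comp, ← LinearMap.comp_assoc, ← LinearMap.comp_assoc, scale_ρ]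
    rfl
  rw [str, str, h1, LinearMap.trace_mul_comm, mul_assoc, ← map_mul, inv_mul_cancel, map_one,
    mul_one]

theorem finite_support_gr [FiniteDimensional k V.carrier] : {i | V.gr i ≠ ⊥}.Finite :=
  WellFoundedGT.finite_ne_bot_of_iSupIndep V.isInternal.submodule_iSupIndep

theorem grTrace_eq_zero {i : ℤ} (h : V.gr i = ⊥) (σ : G) : V.grTrace i σ = 0 := by
  have : Subsingleton (V.gr i) := by rw [h]; infer_instance
  rw [grTrace, Subsingleton.elim ((V.ρ σ).restrict (V.ρ_mem σ i)) 0, map_zero]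

theorem str_eq_sum [FiniteDimensional k V.carrier] (σ : G) :
    V.str σ = ∑ i ∈ V.finite_support_gr.toFinset, signOf k i * V.grTrace i σ := by
  have hm : ∀ i, Set.MapsTo (V.scale (signOf k) ∘ₗ V.ρ σ) (V.gr i) (V.gr i) := by
    intro i x hx
    rw [LinearMap.comp_apply, V.scale_apply _ (V.ρ_mem σ i x hx)]
    exact Submodule.smul_mem _ _ (V.ρ_mem σ i x hx)
  rw [str, LinearMap.trace_eq_sum_trace_restrict' V.isInternal V.finite_support_gr hm]
  refine Finset.sum_congr rfl fun i _ => ?_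
  rw [grTrace, ← smul_eq_mul, ← map_smul]
  congr 1
  refine LinearMap.ext fun x => Subtype.ext ?_
  exact V.scale_apply _ (V.ρ_mem σ i x x.2)

/-- The alternating sum over degrees of the traces is the trace of the action composed with the
operator (-1)^i, so the grading can be forgotten from here on. -/
theorem ch_eq {n : ℕ} (V : DGRep.{u, v} k (Perm (Fin n))) [FiniteDimensional k V.carrier] :
    V.ch = (n.factorial : k)⁻¹ • ∑ σ : Perm (Fin n), V.str σ • (cycleIndex σ : LambdaHbar k) := by
  rw [ch, finsum_eq_sum_of_support_subset (s := V.finite_support_gr.toFinset)]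
  · simp only [str_eq_sum, Finset.sum_smul, Finset.smul_sum]
    rw [Finset.sum_comm]
    refine Finset.sum_congr rfl fun σ _ => Finset.sum_congr rfl fun i _ => ?_
    rw [← Int.cast_smul_eq_zsmul k, smul_comm, mul_smul]
    rfl
  · intro i hi
    rw [Set.Finite.coe_toFinset]
    intro h
    refine hi ?_
    simp [V.grTrace_eq_zero h]

end DGRep

namespace StableSModule

variable (V : StableSModule.{u, v} k)

open scoped Classical in
/-- The supertrace, as a function of the genus and of the cycle type. -/
def char (g : ℕ) (s : Multiset ℕ) : k :=
  if h : ∃ (n : ℕ) (σ : Perm (Fin n)), σ.partition.parts = s then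
    (V.obj g h.choose).str h.choose_spec.choose
  else 0

/-- The parts determine n as their sum, and permutations with the same cycle type are conjugate, so
the choices made in `char` do not matter. -/
theorem char_parts (g : ℕ) {n : ℕ} (σ : Perm (Fin n)) :
    V.char g σ.partition.parts = (V.obj g n).str σ := by
  have h : ∃ (n' : ℕ) (σ' : Perm (Fin n')), σ'.partition.parts = σ.partition.parts := ⟨n, σ, rfl⟩
  rw [char, dif_pos h]
  have key : ∀ (n' : ℕ) (σ' : Perm (Fin n')), σ'.partition.parts = σ.partition.parts →
      (V.obj g n').str σ' = (V.obj g n).str σ := by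
    intro n' σ' he
    have hn : n' = n := by
      have h1 := σ'.partition.parts_sum
      have h2 := σ.partition.parts_sum
      simpa using h1.symm.trans ((congrArg Multiset.sum he).trans h2)
    subst hn
    exact DGRep.str_conj _ (Perm.partition_eq_of_isConj.mpr (Nat.Partition.ext he))
  exact key _ _ h.choose_spec.choose_spec

/-- The supertrace of a permutation which corresponds to a permutation of an invariant set. -/
theorem char_cyc (g : ℕ) {n : ℕ} (σ : Perm (Fin n)) {X : Type} [Fintype X] {ψ : Perm X}
    (j : Fin n ↪ X) (h : ∀ i, ψ (j i) = j (σ i)) :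
    V.char g (cyc ψ (Finset.univ.map j)) = (V.obj g n).str σ := by
  rw [cyc_map j h, cyc_univ, char_parts]

end StableSModule

end Characters

/-! ### Corollas and the characteristic of 𝒱. -/

namespace Conf

/-- The stable graph with one vertex of genus `g` and with `n` legs. -/
def corolla (g n : ℕ) (h : 2 < 2 * g + n) : Conf (Option (Fin n)) where
  vx _ := none
  gen _ := g
  inv x := x
  φ := 1
  vx_vx _ := rfl
  gen_vx _ := rfl
  inv_inv _ := rfl
  inv_vx _ := rfl
  φ_vx _ := rfl
  φ_gen _ := rfl
  φ_inv _ := rfl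
  stable x := by
    rw [Nat.card_congr (β := Fin n) ⟨fun y => y.1.get (Option.isSome_iff_ne_none.mpr
      fun he => y.2.2 he.symm), fun i => ⟨some i, rfl, Option.some_ne_none i |>.symm⟩,
      fun y => Subtype.ext (Option.some_get _), fun i => rfl⟩]
    simpa using h

/-- The types of the graphs with one vertex and without edges. -/
abbrev CType : Type := {a : ℕ × ℕ // 2 < 2 * a.1 + a.2}

/-- The family of the graphs with one vertex and without edges. -/
def corollas (a : CType) : Conf (Option (Fin a.1.2)) := corolla a.1.1 a.1.2 a.2

/-- The automorphism of a corolla given by a permutation of the legs. -/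
def corollaAut (a : CType) (σ : Perm (Fin a.1.2)) : GIso corollas a a :=
  ⟨Equiv.optionCongr σ, skel_map_iff.mpr ⟨fun _ => rfl, fun _ => rfl, fun _ => rfl⟩⟩

/-- The genus and the number of points identify the target. As `none` is the only vertex it is
preserved, and the rest is a permutation of the legs. -/
theorem corolla_surj (a : CType) (q : Σ b, GIso corollas a b) : ∃ σ, q = ⟨a, corollaAut a σ⟩ := by
  obtain ⟨b, θ, h⟩ := q
  obtain ⟨h1, h2, -⟩ := skel_map_iff.mp h
  have hg : b.1.1 = a.1.1 := h2 none
  have hn : b.1.2 = a.1.2 := by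
    have := Fintype.card_congr θ
    simp only [Fintype.card_option, Fintype.card_fin] at this
    omega
  obtain rfl : b = a := Subtype.ext (Prod.ext hg hn)
  have h0 : θ none = none := (h1 none).symm
  refine ⟨Equiv.removeNone θ, ?_⟩
  congr 1
  refine Subtype.ext (Equiv.ext fun x => ?_)
  rcases x with _ | x
  · exact h0
  · refine (Equiv.removeNone_some θ (Option.ne_none_iff_exists'.mp fun hx => ?_)).symm
    exact Option.some_ne_none x (θ.injective (hx.trans h0.symm))

theorem corollaAut_injective (a : CType) : Function.Injective (corollaAut a) := fun _ _ h =>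
  Equiv.optionCongr_injective (congrArg Subtype.val h)

/-- The isomorphisms of a corolla are the permutations of the legs. -/
def corollaIso (a : CType) : Perm (Fin a.1.2) ≃ Σ b, GIso corollas a b :=
  Equiv.ofBijective (fun σ => ⟨a, corollaAut a σ⟩)
    ⟨fun _ _ h => corollaAut_injective a (eq_of_heq (Sigma.mk.inj h).2),
      fun q => (corolla_surj a q).imp fun _ h => h.symm⟩

instance (a : CType) : Finite (Σ b, GIso corollas a b) := Finite.of_equiv _ (corollaIso a)

theorem numIso_corollas (a : CType) : numIso corollas a = a.1.2.factorial := by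
  rw [numIso, ← Nat.card_congr (corollaIso a), Nat.card_eq_fintype_card, Fintype.card_perm,
    Fintype.card_fin]

/-- Without edges, the vertex of a point and its genus are constant along the component relation, so
a connected graph has a single vertex. -/
theorem isIn_corollas (a : Num) : IsIn corollas a ↔ IsConn False a := by
  classical
  constructor
  · rintro ⟨o, ι, h⟩
    refine ⟨Or.inr fun x => ?_, conn_of_skel h ⟨⟨none⟩, fun x y => ?_⟩⟩
    · obtain ⟨x, rfl⟩ := ι.surjective x
      exact (skel_map_iff.mp h).2.2 x
    · have h0 : ∀ x, (corollas o).Rel x none := fun x => Relation.EqvGen.rel _ _ (Or.inl rfl)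
      exact (h0 x).trans _ _ _ (h0 y).symm
  · rintro ⟨h1, ⟨x⟩, h2⟩
    have h1 := h1.resolve_left id
    obtain ⟨M, c⟩ := a
    simp only at h1 h2 x
    have hv : ∀ y, c.vx y = c.vx x := fun y =>
      (h2 y x).invariant (f := c.vx) c.vx_vx fun y => by rw [h1]
    have hg : ∀ y, c.gen y = c.gen x := fun y =>
      (h2 y x).invariant (f := c.gen) c.gen_vx fun y => by rw [h1]
    have hst := c.stable x
    let n := Fintype.card {y // y ≠ c.vx x}
    have hn : Nat.card {y // c.vx y = c.vx x ∧ c.vx y ≠ y} = n := by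
      rw [Nat.card_eq_fintype_card]
      exact Fintype.card_congr (Equiv.subtypeEquivRight fun y => by
        rw [hv y]; exact ⟨fun h => h.2.symm, fun h => ⟨rfl, h.symm⟩⟩)
    rw [hn] at hst
    let e : Fin n ≃ {y // y ≠ c.vx x} := (Fintype.equivFin _).symm
    refine ⟨⟨(c.gen x, n), hst⟩, (Equiv.optionCongr e).trans (Equiv.optionSubtypeNe (c.vx x)),
      skel_map_iff.mpr ⟨fun y => hv _, fun y => hg _, fun y => h1 _⟩⟩

variable {k : Type u} [Field k] [CharZero k] (χ : ℕ → Multiset ℕ → k)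

/-- The vertex is an orbit of length 1, whose first return is σ itself; the legs give the cycle
index of σ. -/
theorem weight_corolla (a : CType) (σ : Perm (Fin a.1.2)) :
    ((corollas a).withAut (corollaAut a σ).1 (corollaAut a σ).2).weight χ =
      hbarPow ((a.1.1 : ℤ) - 1) * (χ a.1.1 σ.partition.parts • cycleIndex σ) := by
  classical
  set c := (corollas a).withAut (corollaAut a σ).1 (corollaAut a σ).2 with hc
  have hφ : ∀ i, c.φ (some i) = some (σ i) := fun i => rfl
  have hφ0 : c.φ none = none := rfl
  have he : c.edges = 0 := by
    have h1 : c.nonfix = ∅ := Finset.eq_empty_of_forall_notMem fun x hx => mem_nonfix.mp hx rfl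
    rw [edges, h1, Finset.card_empty]
  have hu : (Finset.univ : Finset (Option (Fin a.1.2))) =
      {none} ∪ Finset.univ.map Function.Embedding.some := by
    ext (_ | x) <;> simp
  have hf : c.flags none = Finset.univ.map Function.Embedding.some := by
    ext (_ | x)
    · rw [mem_flags]
      simp [hc, withAut, corollas, corolla]
    · rw [mem_flags]
      simp [hc, withAut, corollas, corolla]
  have ho : orb c.φ none = {none} := orb_of_fixed hφ0
  have hl0 : c.loc χ none =
      hbarPow ((a.1.1 : ℤ) - 1) * HahnSeries.C (χ a.1.1 σ.partition.parts) := by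
    rw [loc, if_pos (show c.vx none = none from rfl), ho, vfac, ho, hf, Finset.card_singleton, pow_one,
      cyc_map Function.Embedding.some hφ, cyc_univ]
    congr 2
    exact one_mul _
  rw [weight, he, hu, oprod_union, ← ho, oprod_orb (c.loc_φ χ), hl0,
    oprod_map (φ := σ) Function.Embedding.some hφ Finset.univ
      (f := fun x => pSum (orb σ x).card.toPNat') (fun x => by rw [orb_apply]) (c.loc_φ χ),
    ← cycleIndex_eq]
  · rw [Nat.cast_zero, hbarPow_zero, one_mul, mul_assoc, HahnSeries.C_mul_eq_smul]
  · intro x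
    rw [loc, if_neg, if_pos, card_orb_map Function.Embedding.some hφ]
    · rfl
    · exact (Option.some_ne_none x).symm
  · intro x hx
    rw [Finset.mem_singleton.mp hx, hφ0]
    exact Finset.mem_singleton_self _
  · simp

theorem gsum_corollas : gsum χ (IsConn False) = infSum fun a : CType =>
    hbarPow ((a.1.1 : ℤ) - 1) * ((a.1.2.factorial : k)⁻¹ •
      ∑ σ : Perm (Fin a.1.2), χ a.1.1 σ.partition.parts • cycleIndex σ) := by
  have h := infSum_aterm corollas χ
  rw [show IsIn corollas = IsConn False from funext fun a => propext (isIn_corollas a)] at h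
  rw [← h.1, (infSum_sigma h.2).1]
  congr 1
  funext a
  let e : Perm (Fin a.1.2) ≃ GIso corollas a a := Equiv.ofBijective (corollaAut a)
    ⟨corollaAut_injective a, fun θ => by
      obtain ⟨σ, hσ⟩ := corolla_surj a ⟨a, θ⟩
      exact ⟨σ, (eq_of_heq (Sigma.mk.inj hσ).2).symm⟩⟩
  rw [← infSum_equiv e, infSum_fintype, mul_smul_comm, Finset.mul_sum, Finset.smul_sum]
  refine Finset.sum_congr rfl fun σ _ => ?_
  rw [← weight_corolla, ← numIso_corollas]
  rfl

end Conf

open Conf in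
theorem StableSModule.characteristic_eq {k : Type u} [Field k] [CharZero k]
    (V : StableSModule.{u, v} k) [∀ g n, FiniteDimensional k (V.obj g n).carrier] :
    V.characteristic = gsum V.char (IsConn False) := by
  rw [gsum_corollas, characteristic]
  congr 1
  funext a
  rw [DGRep.ch_eq]
  simp only [char_parts]

theorem two_mul_card_edgeFinset {F : Type} [Fintype F] [DecidableEq F] {inv : F → F}
    (h : Function.Involutive inv) :
    2 * (edgeFinset inv).card = (Finset.univ.filter fun a => inv a ≠ a).card := by
  rw [Finset.card_eq_sum_card_image (fun a => s(a, inv a)), edgeFinset,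
    Finset.sum_const_nat (m := 2), mul_comm]
  intro b hb
  obtain ⟨a, ha, rfl⟩ := Finset.mem_image.mp hb
  have ha := (Finset.mem_filter.mp ha).2
  rw [Finset.card_eq_two]
  refine ⟨a, inv a, Ne.symm ha, ?_⟩
  ext x
  rw [Finset.mem_filter, Finset.mem_filter, Finset.mem_insert, Finset.mem_singleton, Sym2.eq_iff]
  constructor
  · rintro ⟨-, h1 | h1⟩
    · exact Or.inl h1.1
    · exact Or.inr h1.1
  · rintro (rfl | rfl)
    · exact ⟨⟨Finset.mem_univ _, ha⟩, Or.inl ⟨rfl, rfl⟩⟩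
    · exact ⟨⟨Finset.mem_univ _, by rw [h a]; exact Ne.symm ha⟩, Or.inr ⟨rfl, h a⟩⟩

/-! ### Finiteness of the stable graphs, and isomorphisms which permute the labels. -/

namespace StableGraph

variable {g n : ℕ}

theorem card_flags (Γ : StableGraph g n) :
    ∑ v, Γ.val v = n + 2 * (edgeFinset Γ.inv).card := by
  have hflag : Fintype.card Γ.Flag = ∑ v, Γ.val v := by simp
  have hleg : Fintype.card {a // Γ.inv a = a} = n := by
    rw [← Fintype.card_congr Γ.leg, Fintype.card_fin]
  rw [two_mul_card_edgeFinset Γ.inv_inv, ← hflag, ← Finset.card_univ]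
  refine Eq.trans ?_ (congrArg (· + _) hleg)
  rw [Fintype.card_subtype]
  convert (Finset.card_filter_add_card_filter_not (s := (Finset.univ : Finset Γ.Flag))
      (fun a => Γ.inv a = a)).symm

/-- Additivity of the Euler characteristic, by eliminating the number of edges between the genus
formula and the count of flags. As all summands are positive, it bounds the number of vertices, the
genera and the valences. -/
theorem sum_excess (Γ : StableGraph g n) :
    ∑ v, (2 * (Γ.genus v : ℤ) + Γ.val v - 2) = 2 * g + n - 2 := by
  have h1 := Γ.card_flags
  have h2 := Γ.genus_eq
  have h3 : ∑ v, (2 * (Γ.genus v : ℤ) + Γ.val v - 2) =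
      2 * ∑ v, ((Γ.genus v : ℤ) - 1) + ((∑ v, Γ.val v : ℕ) : ℤ) := by
    push_cast
    rw [Finset.mul_sum, ← Finset.sum_add_distrib]
    exact Finset.sum_congr rfl fun v _ => by ring
  rw [h3, h1]
  push_cast
  linarith

theorem nv_le (Γ : StableGraph g n) : Γ.nv ≤ 2 * g + n := by
  have h : ∑ _v : Fin Γ.nv, (1 : ℤ) ≤ ∑ v, (2 * (Γ.genus v : ℤ) + Γ.val v - 2) :=
    Finset.sum_le_sum fun v _ => by have := Γ.stable v; omega
  rw [Γ.sum_excess] at h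
  simp only [Finset.sum_const, Finset.card_univ, Fintype.card_fin, nsmul_eq_mul, mul_one] at h
  omega

theorem genus_val_le (Γ : StableGraph g n) (v : Fin Γ.nv) :
    2 * Γ.genus v + Γ.val v ≤ 2 * g + n := by
  have h := Finset.single_le_sum (f := fun v => 2 * (Γ.genus v : ℤ) + Γ.val v - 2)
    (s := Finset.univ) (fun v _ => by have := Γ.stable v; omega) (Finset.mem_univ v)
  rw [Γ.sum_excess] at h
  omega

instance : Finite (StableGraph g n) := by
  let B := 2 * g + n + 1
  let D := Σ m : Fin B, Σ _ : Fin m → Fin B, Σ val : Fin m → Fin B,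
    ((Σ v : Fin m, Fin (val v)) → Σ v : Fin m, Fin (val v)) × (Fin n → Σ v : Fin m, Fin (val v))
  let f : StableGraph g n → D := fun Γ => ⟨⟨Γ.nv, Nat.lt_succ_of_le Γ.nv_le⟩,
    fun v => ⟨Γ.genus v, by have := Γ.genus_val_le v; omega⟩,
    fun v => ⟨Γ.val v, by have := Γ.genus_val_le v; omega⟩, Γ.inv, fun i => Γ.leg i⟩
  refine Finite.of_injective f fun Γ Γ' h => ?_
  obtain ⟨m, gen, val, inv, h1, leg, h2, h3, h4⟩ := Γ
  obtain ⟨m', gen', val', inv', h1', leg', h2', h3', h4'⟩ := Γ'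
  obtain ⟨hm, h⟩ := Sigma.mk.inj h
  obtain rfl : m = m' := congrArg Fin.val hm
  obtain ⟨hg, h⟩ := Sigma.mk.inj (eq_of_heq h)
  obtain rfl : gen = gen' := funext fun v => congrArg Fin.val (congrFun hg v)
  obtain ⟨hv, h⟩ := Sigma.mk.inj (eq_of_heq h)
  obtain rfl : val = val' := funext fun v => congrArg Fin.val (congrFun hv v)
  obtain ⟨hi, hl⟩ := Prod.mk.inj (eq_of_heq h)
  obtain rfl : inv = inv' := hi
  obtain rfl : leg = leg' := Equiv.ext fun i => Subtype.ext (congrFun hl i)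
  rfl

/-- An isomorphism as a bijection between the vertices and flags. -/
def Iso.equiv {Γ Γ' : StableGraph g n} (e : Γ.Iso Γ') : Fin Γ.nv ⊕ Γ.Flag ≃ Fin Γ'.nv ⊕ Γ'.Flag :=
  Equiv.sumCongr e.vert (Equiv.sigmaCongr e.vert e.flag)

theorem Iso.equiv_injective {Γ Γ' : StableGraph g n} :
    Function.Injective (Iso.equiv : Γ.Iso Γ' → _) := by
  intro e e' h
  obtain ⟨vert, h1, flag, h2, h3⟩ := e
  obtain ⟨vert', h1', flag', h2', h3'⟩ := e'
  have hv : vert = vert' := Equiv.ext fun v =>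
    Sum.inl_injective (congrArg (fun f : _ ≃ _ => f (Sum.inl v)) h)
  subst hv
  have hf : flag = flag' := funext fun v => Equiv.ext fun i => by
    have := Sum.inr_injective (congrArg (fun f : _ ≃ _ => f (Sum.inr ⟨v, i⟩)) h)
    exact eq_of_heq (Sigma.mk.inj this).2
  subst hf
  rfl

instance (Γ Γ' : StableGraph g n) : Finite (Γ.Iso Γ') := Finite.of_injective _ Iso.equiv_injective

theorem smulLeg_inv_smulLeg (σ : Perm (Fin n)) (Γ : StableGraph g n) :
    (Γ.smulLeg σ).smulLeg σ⁻¹ = Γ := by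
  have : (σ⁻¹).symm.trans (σ.symm.trans Γ.leg) = Γ.leg := Equiv.ext fun i => by
    simp [Equiv.Perm.inv_def]
  change ({ Γ with leg := (σ⁻¹).symm.trans (σ.symm.trans Γ.leg) } : StableGraph g n) = Γ
  rw [this]

/-- The action of a permutation of the labels. -/
def smulEquiv (σ : Perm (Fin n)) : StableGraph g n ≃ StableGraph g n where
  toFun := smulLeg σ
  invFun := smulLeg σ⁻¹
  left_inv := smulLeg_inv_smulLeg σ
  right_inv Γ := by simpa using smulLeg_inv_smulLeg σ⁻¹ Γ

/-- Isomorphisms do not depend on the labels of the legs. -/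
def Iso.smulEquiv (σ : Perm (Fin n)) (Γ Γ' : StableGraph g n) :
    Γ.Iso Γ' ≃ (Γ.smulLeg σ).Iso (Γ'.smulLeg σ) where
  toFun e := e.smulLeg σ
  invFun e := ⟨e.vert, e.genus_vert, e.flag, e.inv_flag, fun i => by
    obtain ⟨j, rfl⟩ := σ.symm.surjective i
    exact e.leg_flag j⟩
  left_inv _ := rfl
  right_inv _ := rfl

/-- The number of isomorphisms with given source. -/
def numIso (Γ : StableGraph g n) : ℕ := Nat.card (Σ Γ', Γ.Iso Γ')

theorem numIso_smulLeg (σ : Perm (Fin n)) (Γ : StableGraph g n) :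
    (Γ.smulLeg σ).numIso = Γ.numIso :=
  (Nat.card_congr (Equiv.sigmaCongr (smulEquiv σ) fun Γ' => Iso.smulEquiv σ Γ Γ')).symm

/-- The underlying graph. -/
def conf (Γ : StableGraph g n) : Conf (Fin Γ.nv ⊕ Γ.Flag) where
  vx := Sum.elim Sum.inl fun a => Sum.inl a.1
  gen := Sum.elim Γ.genus fun a => Γ.genus a.1
  inv := Sum.map id Γ.inv
  φ := 1
  vx_vx x := by rcases x with x | x <;> rfl
  gen_vx x := by rcases x with x | x <;> rfl
  inv_inv x := by
    rcases x with x | x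
    · rfl
    · exact congrArg Sum.inr (Γ.inv_inv x)
  inv_vx x := by rcases x with x | x <;> rfl
  φ_vx _ := rfl
  φ_gen _ := rfl
  φ_inv _ := rfl
  stable x := by
    obtain ⟨v, h1, h2⟩ : ∃ v, Sum.elim (Sum.inl : Fin Γ.nv → Fin Γ.nv ⊕ Γ.Flag)
        (fun a => Sum.inl a.1) x = Sum.inl v ∧ Sum.elim Γ.genus (fun a => Γ.genus a.1) x =
        Γ.genus v := by
      rcases x with x | x
      · exact ⟨x, rfl, rfl⟩
      · exact ⟨x.1, rfl, rfl⟩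
    rw [h1, h2]
    let f : Fin (Γ.val v) → {y : Fin Γ.nv ⊕ Γ.Flag // Sum.elim Sum.inl (fun a => Sum.inl a.1) y =
        (Sum.inl v : Fin Γ.nv ⊕ Γ.Flag) ∧ Sum.elim Sum.inl (fun a => Sum.inl a.1) y ≠ y} :=
      fun i => ⟨Sum.inr ⟨v, i⟩, rfl, Sum.inl_ne_inr⟩
    have hf : Function.Bijective f := by
      constructor
      · intro i j h
        exact eq_of_heq (Sigma.mk.inj (Sum.inr_injective (congrArg Subtype.val h))).2
      · rintro ⟨w | ⟨w, i⟩, h, h'⟩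
        · exact (h' rfl).elim
        · obtain rfl := Sum.inl_injective h
          exact ⟨i, rfl⟩
    rw [← Nat.card_congr (Equiv.ofBijective f hf), Nat.card_eq_fintype_card, Fintype.card_fin]
    exact Γ.stable v

/-- Isomorphisms of the underlying unlabelled graphs are treated as isomorphisms of labelled graphs
after a relabelling by some σ; conversely σ is read off from the legs. -/
theorem Iso.skel_map_equiv {Γ Γ' : StableGraph g n} {σ : Perm (Fin n)}
    (e : (Γ.smulLeg σ).Iso Γ') : Γ.conf.skel.map e.equiv = Γ'.conf.skel := by
  refine Conf.skel_map_iff.mpr ⟨?_, ?_, ?_⟩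
  · rintro (v | a) <;> rfl
  · rintro (v | a)
    · exact (e.genus_vert v).symm
    · exact (e.genus_vert a.1).symm
  · rintro (v | a)
    · rfl
    · exact congrArg Sum.inr (e.inv_flag a)

theorem Iso.equiv_leg {Γ Γ' : StableGraph g n} {σ : Perm (Fin n)}
    (e : (Γ.smulLeg σ).Iso Γ') (i : Fin n) :
    e.equiv (Sum.inr (Γ.leg i : Γ.Flag)) = Sum.inr (Γ'.leg (σ i) : Γ'.Flag) := by
  obtain ⟨j, rfl⟩ := σ.symm.surjective i
  rw [Equiv.apply_symm_apply]
  exact congrArg Sum.inr (e.leg_flag j).symm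

/-- A bijection between the vertices and flags of two graphs which is an isomorphism is given by
bijections between the vertices and between the flags at each vertex. -/
theorem exists_vert_flag {g' n' : ℕ} {Γ : StableGraph g n} {Γ' : StableGraph g' n'}
    {θ : Fin Γ.nv ⊕ Γ.Flag ≃ Fin Γ'.nv ⊕ Γ'.Flag} (h : Γ.conf.skel.map θ = Γ'.conf.skel) :
    ∃ (vert : Fin Γ.nv ≃ Fin Γ'.nv) (flag : ∀ v, Fin (Γ.val v) ≃ Fin (Γ'.val (vert v))),
      θ = Equiv.sumCongr vert (Equiv.sigmaCongr vert flag) := by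
  obtain ⟨h1, -, -⟩ := Conf.skel_map_iff.mp h
  have hv : ∀ v, ∃ w, θ (Sum.inl v) = Sum.inl w := by
    intro v
    have h3 := h1 (Sum.inl v)
    rcases hθ : θ (Sum.inl v) with w | a
    · exact ⟨w, rfl⟩
    · rw [hθ] at h3
      change Sum.inl a.1 = θ (Sum.inl v) at h3
      exact (Sum.inl_ne_inr (h3.trans hθ)).elim
  choose vert hvert using hv
  have hf : ∀ v i, ∃ j : Fin (Γ'.val (vert v)), θ (Sum.inr ⟨v, i⟩) = Sum.inr ⟨vert v, j⟩ := by
    intro v i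
    have h3 := h1 (Sum.inr ⟨v, i⟩)
    change _ = θ (Sum.inl v) at h3
    rw [hvert] at h3
    rcases hθ : θ (Sum.inr ⟨v, i⟩) with w | ⟨w, j⟩
    · rw [hθ] at h3
      have h4 : w = vert v := Sum.inl_injective h3
      rw [h4, ← hvert] at hθ
      exact (Sum.inr_ne_inl (θ.injective hθ)).elim
    · rw [hθ] at h3
      obtain rfl : w = vert v := Sum.inl_injective h3
      exact ⟨j, rfl⟩
  choose flag hflag using hf
  have hvb : Function.Bijective vert := by
    constructor
    · intro v w hvw
      refine Sum.inl_injective (θ.injective ?_)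
      rw [hvert, hvert, hvw]
    · intro w
      obtain ⟨x, hx⟩ := θ.surjective (Sum.inl w)
      rcases x with v | ⟨v, i⟩
      · exact ⟨v, Sum.inl_injective ((hvert v).symm.trans hx)⟩
      · exact (Sum.inr_ne_inl ((hflag v i).symm.trans hx)).elim
  have hfb : ∀ v, Function.Bijective (flag v) := by
    intro v
    constructor
    · intro i j hij
      have : (⟨v, i⟩ : Γ.Flag) = ⟨v, j⟩ := by
        refine Sum.inr_injective (θ.injective ?_)
        rw [hflag, hflag, hij]
      exact eq_of_heq (Sigma.mk.inj this).2
    · intro j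
      obtain ⟨x, hx⟩ := θ.surjective (Sum.inr ⟨vert v, j⟩)
      rcases x with w | ⟨w, i⟩
      · exact (Sum.inl_ne_inr ((hvert w).symm.trans hx)).elim
      · have h5 := Sum.inr_injective ((hflag w i).symm.trans hx)
        obtain rfl : w = v := hvb.1 (Sigma.mk.inj h5).1
        exact ⟨i, eq_of_heq (Sigma.mk.inj h5).2⟩
  refine ⟨Equiv.ofBijective vert hvb, fun v => Equiv.ofBijective (flag v) (hfb v), ?_⟩
  refine Equiv.ext fun x => ?_
  rcases x with v | ⟨v, i⟩
  · exact hvert v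
  · exact hflag v i

/-- Legs, edges and the genera of the vertices are preserved without reference to labels, so the
total genus and the number of legs are invariants of the unlabelled graph. -/
theorem genus_legs_eq {g' n' : ℕ} {Γ : StableGraph g n} {Γ' : StableGraph g' n'}
    {θ : Fin Γ.nv ⊕ Γ.Flag ≃ Fin Γ'.nv ⊕ Γ'.Flag} (h : Γ.conf.skel.map θ = Γ'.conf.skel) :
    g = g' ∧ n = n' := by
  obtain ⟨vert, flag, rfl⟩ := exists_vert_flag h
  obtain ⟨-, h2, h3⟩ := Conf.skel_map_iff.mp h
  have hinv : ∀ a : Γ.Flag, Γ'.inv (Equiv.sigmaCongr vert flag a) =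
      Equiv.sigmaCongr vert flag (Γ.inv a) := fun a => Sum.inr_injective (h3 (Sum.inr a))
  have hn : n = n' := by
    have := Fintype.card_congr ((Γ.leg.trans ((Equiv.sigmaCongr vert flag).subtypeEquiv
      (p := fun a => Γ.inv a = a) (q := fun a => Γ'.inv a = a) fun a => by
        rw [hinv, Equiv.apply_eq_iff_eq])).trans Γ'.leg.symm)
    simpa using this
  have h4 := Γ.card_flags
  have h5 := Γ'.card_flags
  have h6 : ∑ v, Γ.val v = ∑ v, Γ'.val v := by
    rw [← vert.sum_comp]
    exact Finset.sum_congr rfl fun v _ => by simpa using Fintype.card_congr (flag v)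
  have h7 : ∑ v, ((Γ.genus v : ℤ) - 1) = ∑ v, ((Γ'.genus v : ℤ) - 1) := by
    rw [← vert.sum_comp]
    exact Finset.sum_congr rfl fun v _ => by rw [← show Γ'.genus (vert v) = Γ.genus v from h2 (Sum.inl v)]
  have h8 := Γ.genus_eq
  have h9 := Γ'.genus_eq
  constructor <;> omega

theorem exists_iso {Γ Γ' : StableGraph g n}
    {θ : Fin Γ.nv ⊕ Γ.Flag ≃ Fin Γ'.nv ⊕ Γ'.Flag} (h : Γ.conf.skel.map θ = Γ'.conf.skel) :
    ∃ (σ : Perm (Fin n)) (e : (Γ.smulLeg σ).Iso Γ'), e.equiv = θ := by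
  obtain ⟨vert, flag, rfl⟩ := exists_vert_flag h
  obtain ⟨-, h2, h3⟩ := Conf.skel_map_iff.mp h
  have hinv : ∀ a : Γ.Flag, Γ'.inv (Equiv.sigmaCongr vert flag a) =
      Equiv.sigmaCongr vert flag (Γ.inv a) := fun a => Sum.inr_injective (h3 (Sum.inr a))
  let L : {a // Γ.inv a = a} ≃ {a // Γ'.inv a = a} :=
    (Equiv.sigmaCongr vert flag).subtypeEquiv fun a => by rw [hinv, Equiv.apply_eq_iff_eq]
  let σ : Perm (Fin n) := (Γ.leg.trans L).trans Γ'.leg.symm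
  refine ⟨σ, ⟨vert, fun v => (h2 (Sum.inl v)).symm, flag, fun a => hinv a, fun i => ?_⟩, rfl⟩
  obtain ⟨j, rfl⟩ := σ.surjective i
  have h4 : Γ'.leg (σ j) = L (Γ.leg j) := Γ'.leg.apply_symm_apply _
  have h5 : (Γ.smulLeg σ).leg (σ j) = Γ.leg j := congrArg Γ.leg (σ.symm_apply_apply j)
  rw [h4, h5]
  rfl

end StableGraph

/-! ### The family of stable graphs represents all connected graphs. -/

namespace Conf

/-- The types of the stable graphs. -/
abbrev SType : Type := Σ a : CType, StableGraph a.1.1 a.1.2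

/-- The family of the stable graphs. -/
def graphs (o : SType) : Conf (Fin o.2.nv ⊕ o.2.Flag) := o.2.conf

/-- The isomorphism of graphs given by an isomorphism which permutes the labels of the legs. -/
def isoGIso (a : CType) (Γ Γ' : StableGraph a.1.1 a.1.2)
    (e : Σ σ : Perm (Fin a.1.2), (Γ.smulLeg σ).Iso Γ') : GIso graphs ⟨a, Γ⟩ ⟨a, Γ'⟩ :=
  ⟨e.2.equiv, e.2.skel_map_equiv⟩

theorem bijective_isoGIso (a : CType) (Γ Γ' : StableGraph a.1.1 a.1.2) :
    Function.Bijective (isoGIso a Γ Γ') := by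
  constructor
  · rintro ⟨σ, e⟩ ⟨σ', e'⟩ h
    have h1 : e.equiv = e'.equiv := congrArg Subtype.val h
    have h2 : σ = σ' := Equiv.ext fun i => by
      have h3 := e.equiv_leg i
      rw [h1] at h3
      exact Γ'.leg.injective (Subtype.ext (Sum.inr_injective (h3.symm.trans (e'.equiv_leg i))))
    subst h2
    rw [StableGraph.Iso.equiv_injective h1]
  · rintro ⟨θ, h⟩
    obtain ⟨σ, e, rfl⟩ := StableGraph.exists_iso h
    exact ⟨⟨σ, e⟩, rfl⟩

theorem bijective_gisoSelf (a : CType) (Γ : StableGraph a.1.1 a.1.2) : Function.Bijective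
    (fun q : Σ Γ', GIso graphs ⟨a, Γ⟩ ⟨a, Γ'⟩ =>
      (⟨⟨a, q.1⟩, q.2⟩ : Σ o', GIso graphs ⟨a, Γ⟩ o')) := by
  constructor
  · rintro ⟨Γ', θ⟩ ⟨Γ'', θ'⟩ h
    obtain ⟨h1, h2⟩ := Sigma.mk.inj h
    obtain rfl := eq_of_heq (Sigma.mk.inj h1).2
    obtain rfl : θ = θ' := eq_of_heq h2
    rfl
  · rintro ⟨⟨b, Γ'⟩, θ, h⟩
    obtain ⟨h1, h2⟩ := StableGraph.genus_legs_eq h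
    obtain rfl : a = b := Subtype.ext (Prod.ext h1 h2)
    exact ⟨⟨Γ', θ, h⟩, rfl⟩

theorem nonempty_gisoEquiv (a : CType) (Γ : StableGraph a.1.1 a.1.2) :
    Nonempty ((Σ o', GIso graphs ⟨a, Γ⟩ o') ≃
      Σ (σ : Perm (Fin a.1.2)) (Γ' : StableGraph a.1.1 a.1.2), (Γ.smulLeg σ).Iso Γ') :=
  ⟨(Equiv.ofBijective _ (bijective_gisoSelf a Γ)).symm.trans
    ((Equiv.sigmaCongrRight fun Γ' => (Equiv.ofBijective _ (bijective_isoGIso a Γ Γ')).symm).trans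
      ⟨fun x => ⟨x.2.1, x.1, x.2.2⟩, fun x => ⟨x.2.1, x.1, x.2.2⟩, fun _ => rfl, fun _ => rfl⟩)⟩

instance (o : SType) : Finite (Σ o', GIso graphs o o') := by
  obtain ⟨a, Γ⟩ := o
  obtain ⟨e⟩ := nonempty_gisoEquiv a Γ
  exact Finite.of_equiv _ e.symm

/-- The family forgets labels: for each of the n! permutations σ there are as many labelled
isomorphisms out of the relabelled graph as out of Γ. -/
theorem numIso_graphs (a : CType) (Γ : StableGraph a.1.1 a.1.2) :
    numIso graphs ⟨a, Γ⟩ = a.1.2.factorial * Γ.numIso := by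
  obtain ⟨e⟩ := nonempty_gisoEquiv a Γ
  rw [numIso, Nat.card_congr e, Nat.card_sigma]
  have h : ∀ σ : Perm (Fin a.1.2),
      Nat.card (Σ Γ' : StableGraph a.1.1 a.1.2, (Γ.smulLeg σ).Iso Γ') = Γ.numIso :=
    fun σ => Γ.numIso_smulLeg σ
  simp only [h]
  rw [Finset.sum_const, Finset.card_univ, Fintype.card_perm, Fintype.card_fin, smul_eq_mul]

end Conf

/-- The vertex at which a vertex or flag is. -/
def stdVx {m : ℕ} {val : Fin m → ℕ} : (Fin m ⊕ Σ v : Fin m, Fin (val v)) → Fin m :=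
  Sum.elim id Sigma.fst

theorem card_stdVx {m : ℕ} {val : Fin m → ℕ} (v : Fin m) :
    Nat.card {y : Fin m ⊕ Σ v : Fin m, Fin (val v) // Sum.inl (stdVx y) =
      (Sum.inl v : Fin m ⊕ Σ v : Fin m, Fin (val v)) ∧ Sum.inl (stdVx y) ≠ y} = val v := by
  let f : Fin (val v) → {y : Fin m ⊕ Σ v : Fin m, Fin (val v) // Sum.inl (stdVx y) =
      (Sum.inl v : Fin m ⊕ Σ v : Fin m, Fin (val v)) ∧ Sum.inl (stdVx y) ≠ y} :=
    fun i => ⟨Sum.inr ⟨v, i⟩, rfl, Sum.inl_ne_inr⟩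
  have hf : Function.Bijective f := by
    constructor
    · intro i j h
      exact eq_of_heq (Sigma.mk.inj (Sum.inr_injective (congrArg Subtype.val h))).2
    · rintro ⟨w | ⟨w, i⟩, h, h'⟩
      · exact (h' rfl).elim
      · obtain rfl : w = v := Sum.inl_injective h
        exact ⟨i, rfl⟩
  rw [← Nat.card_congr (Equiv.ofBijective f hf), Nat.card_eq_fintype_card, Fintype.card_fin]

namespace StableGraph

theorem conn_conf {g n : ℕ} (Γ : StableGraph g n) : Γ.conf.Conn := by
  obtain ⟨v₀⟩ := Γ.connected.nonempty
  have h0 : ∀ x, Γ.conf.Rel x (Sum.inl (stdVx x)) := fun x => by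
    rcases x with v | a
    · exact Relation.EqvGen.refl _
    · exact Relation.EqvGen.rel _ _ (Or.inl rfl)
  have h1 : ∀ a : Γ.Flag, Γ.conf.Rel (Sum.inl a.1) (Sum.inl (Γ.inv a).1) := fun a =>
    ((h0 (Sum.inr a)).symm.trans _ _ _ (Relation.EqvGen.rel _ _ (Or.inr rfl))).trans _ _ _
      (h0 (Sum.inr (Γ.inv a)))
  have h2 : ∀ v w, Γ.conf.Rel (Sum.inl v) (Sum.inl w) := by
    intro v w
    have h := Γ.connected.preconnected v w
    rw [SimpleGraph.reachable_iff_reflTransGen] at h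
    induction h with
    | refl => exact Relation.EqvGen.refl _
    | tail _ h ih =>
      refine ih.trans _ _ _ ?_
      obtain ⟨-, ⟨a, rfl, rfl⟩ | ⟨a, rfl, rfl⟩⟩ := h
      · exact h1 a
      · exact (h1 a).symm
  exact ⟨⟨Sum.inl v₀⟩, fun x y => ((h0 x).trans _ _ _ (h2 _ _)).trans _ _ _ (h0 y).symm⟩

end StableGraph

namespace Conf

/-- Once the points are arranged as numbered vertices and numbered flags at each vertex, the graph
can be read off. The genus must come out as a natural number, and this uses connectedness. -/
theorem exists_graph {m : ℕ} {val : Fin m → ℕ} (c : Conf (Fin m ⊕ Σ v : Fin m, Fin (val v)))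
    (hvx : ∀ x, c.vx x = Sum.inl (stdVx x)) (hc : c.Conn) :
    ∃ (o : SType) (ι : Fin o.2.nv ⊕ o.2.Flag ≃ Fin m ⊕ Σ v : Fin m, Fin (val v)),
      (graphs o).skel.map ι = c.skel := by
  classical
  have hil : ∀ v, c.inv (Sum.inl v) = Sum.inl v := fun v => by
    have h := c.inv_vx (Sum.inl v)
    rwa [hvx] at h
  have hi : ∀ a, ∃ b, c.inv (Sum.inr a) = Sum.inr b := by
    intro a
    rcases h : c.inv (Sum.inr a) with v | b
    · have h1 := c.inv_inv (Sum.inr a)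
      rw [h, hil] at h1
      exact (Sum.inl_ne_inr h1).elim
    · exact ⟨b, rfl⟩
  choose inv hinv using hi
  have hinvol : Function.Involutive inv := fun a => Sum.inr_injective (by
    rw [← hinv, ← hinv, c.inv_inv])
  let S := SimpleGraph.fromRel fun v w : Fin m => ∃ a, a.1 = v ∧ (inv a).1 = w
  have hconn : S.Connected := by
    have hr : ∀ x y, c.Rel x y → S.Reachable (stdVx x) (stdVx y) := by
      intro x y h
      induction h with
      | rel x y h =>
        rcases h with rfl | rfl
        · rw [hvx]
          exact SimpleGraph.Reachable.refl _
        · rcases x with v | a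
          · rw [hil]
          · rw [hinv]
            by_cases he : a.1 = (inv a).1
            · change S.Reachable a.1 (inv a).1
              rw [← he]
            · exact SimpleGraph.Adj.reachable ⟨he, Or.inl ⟨a, rfl, rfl⟩⟩
      | refl x => exact SimpleGraph.Reachable.refl _
      | symm x y _ ih => exact ih.symm
      | trans x y z _ _ h1 h2 => exact h1.trans h2
    obtain ⟨⟨x⟩, h⟩ := hc
    have : Nonempty (Fin m) := ⟨stdVx x⟩
    exact ⟨fun v w => hr _ _ (h (Sum.inl v) (Sum.inl w))⟩
  -- A connected graph on m vertices has at least m - 1 edges, loops and multiple edges only adding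
  -- to the count. Hence the genus is at least 0.
  have hle : m ≤ (edgeFinset inv).card + 1 := by
    have h1 := hconn.card_vert_le_card_edgeSet_add_one
    rw [Nat.card_eq_fintype_card, Fintype.card_fin] at h1
    refine h1.trans (Nat.add_le_add_right ?_ 1)
    have h2 : S.edgeSet ⊆ ((edgeFinset inv).image (Sym2.map Sigma.fst) : Finset _) := by
      intro e he
      induction e using Sym2.ind with
      | _ v w =>
        obtain ⟨hne, h⟩ := he
        rw [Finset.mem_coe, Finset.mem_image]
        rcases h with ⟨a, rfl, rfl⟩ | ⟨a, rfl, rfl⟩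
        · refine ⟨s(a, inv a), Finset.mem_image_of_mem _ (Finset.mem_filter.mpr
            ⟨Finset.mem_univ _, fun h => hne (by rw [h])⟩), rfl⟩
        · refine ⟨s(a, inv a), Finset.mem_image_of_mem _ (Finset.mem_filter.mpr
            ⟨Finset.mem_univ _, fun h => hne (by rw [h])⟩), Sym2.eq_swap⟩
    have h3 := Set.ncard_le_ncard h2 (Finset.finite_toSet _)
    rw [Set.ncard_coe_finset] at h3
    exact h3.trans Finset.card_image_le
  have hstab : ∀ v, 2 < 2 * c.gen (Sum.inl v) + val v := by
    intro v
    have h := c.stable (Sum.inl v)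
    simp only [hvx] at h
    rwa [show stdVx (Sum.inl v : Fin m ⊕ Σ v : Fin m, Fin (val v)) = v from rfl,
      card_stdVx v] at h
  have hg : 0 ≤ ∑ v, ((c.gen (Sum.inl v) : ℤ) - 1) + ((edgeFinset inv).card : ℤ) + 1 := by
    have h1 : -(m : ℤ) ≤ ∑ v : Fin m, ((c.gen (Sum.inl v) : ℤ) - 1) := by
      have h2 : ∑ _v : Fin m, (-1 : ℤ) ≤ ∑ v : Fin m, ((c.gen (Sum.inl v) : ℤ) - 1) :=
        Finset.sum_le_sum fun v _ => by omega
      simpa using h2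
    omega
  let Γ : StableGraph (∑ v, ((c.gen (Sum.inl v) : ℤ) - 1) +
      ((edgeFinset inv).card : ℤ) + 1).toNat (Fintype.card {a // inv a = a}) :=
    { nv := m
      genus := fun v => c.gen (Sum.inl v)
      val := val
      inv := inv
      inv_inv := hinvol
      leg := (Fintype.equivFin _).symm
      connected := hconn
      stable := hstab
      genus_eq := by
        rw [Int.toNat_of_nonneg hg] }
  refine ⟨⟨⟨(_, _), Γ.stable_genus⟩, Γ⟩, Equiv.refl _, skel_map_iff.mpr ⟨?_, ?_, ?_⟩⟩
  · rintro (v | a)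
    · exact hvx _
    · exact hvx _
  · rintro (v | a)
    · rfl
    · have h := c.gen_vx (Sum.inr a)
      rw [hvx] at h
      exact h.symm
  · rintro (v | a)
    · exact hil v
    · exact hinv a

theorem exists_std {X : Type} [Fintype X] (c : Conf X) :
    ∃ (m : ℕ) (val : Fin m → ℕ) (ι : X ≃ Fin m ⊕ Σ v : Fin m, Fin (val v)),
      ∀ x, (c.map ι).vx x = Sum.inl (stdVx x) := by
  classical
  let eV := (Fintype.equivFin {x // c.vx x = x}).symm
  let eF := fun v => (Fintype.equivFin {y // c.vx y = eV v ∧ c.vx y ≠ y}).symm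
  let f : (Fin (Fintype.card {x // c.vx x = x}) ⊕
      Σ v, Fin (Fintype.card {y // c.vx y = eV v ∧ c.vx y ≠ y})) → X := Sum.elim (fun v => (eV v).1) fun a => (eF a.1 a.2).1
  have hf : Function.Bijective f := by
    constructor
    · rintro (v | ⟨v, i⟩) (w | ⟨w, j⟩) h
      · exact congrArg Sum.inl (eV.injective (Subtype.ext h))
      · have h1 := (eF w j).2.2
        rw [← show (eV v).1 = (eF w j).1 from h] at h1
        exact (h1 (eV v).2).elim
      · have h1 := (eF v i).2.2
        rw [show (eF v i).1 = (eV w).1 from h] at h1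
        exact (h1 (eV w).2).elim
      · have h : (eF v i).1 = (eF w j).1 := h
        obtain rfl : v = w := eV.injective (Subtype.ext (by
          rw [← (eF v i).2.1, ← (eF w j).2.1, h]))
        rw [(eF v).injective (Subtype.ext h)]
    · intro x
      by_cases hx : c.vx x = x
      · exact ⟨Sum.inl (eV.symm ⟨x, hx⟩), by simp [f]⟩
      · refine ⟨Sum.inr ⟨eV.symm ⟨c.vx x, c.vx_vx x⟩, (eF _).symm ⟨x, by simp, hx⟩⟩, by simp [f]⟩
  refine ⟨_, _, (Equiv.ofBijective f hf).symm, fun x => ?_⟩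
  change (Equiv.ofBijective f hf).symm (c.vx (f x)) = _
  rw [Equiv.symm_apply_eq]
  rcases x with v | ⟨v, i⟩
  · exact (eV v).2
  · exact (eF v i).2.1

theorem isIn_graphs (a : Num) : IsIn graphs a ↔ IsConn True a := by
  constructor
  · rintro ⟨o, ι, h⟩
    exact ⟨Or.inl trivial, conn_of_skel h o.2.conn_conf⟩
  · rintro ⟨-, h⟩
    obtain ⟨m, val, ι, hι⟩ := exists_std a.2
    obtain ⟨o, ι', h'⟩ := exists_graph (a.2.map ι) hι
      (conn_of_skel (c := a.2) (c' := a.2.map ι) (e := ι) (skel_map _ _).symm h)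
    refine ⟨o, ι'.trans ι.symm, ?_⟩
    rw [← map_map, h', skel_map, map_map, Equiv.self_trans_symm, map_refl]

end Conf

theorem oprod_mul {X : Type} {R : Type*} [Fintype X] [CommMonoid R] {φ : Perm X} {L : Finset X} {f f' : X → R}
    (hf : ∀ x, f (φ x) = f x) (hf' : ∀ x, f' (φ x) = f' x) :
    oprod φ L (fun x => f x * f' x) = oprod φ L f * oprod φ L f' := by
  obtain ⟨H, hH⟩ := exists_orbit_function hf
  obtain ⟨H', hH'⟩ := exists_orbit_function hf'
  rw [oprod_eq_prod (H := fun o => H o * H' o) (fun x => by rw [hf, hf'])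
    (fun x _ => by rw [hH, hH']), oprod_eq_prod hf (fun x _ => hH x),
    oprod_eq_prod hf' (fun x _ => hH' x), Finset.prod_mul_distrib]

theorem hbarPow_sum {k : Type u} [Field k] {ι : Type*} (s : Finset ι) (f : ι → ℤ) :
    (hbarPow (∑ i ∈ s, f i) : LambdaHbar k) = ∏ i ∈ s, hbarPow (f i) := by
  classical
  induction s using Finset.induction_on with
  | empty => rfl
  | insert i s hi ih => rw [Finset.sum_insert hi, Finset.prod_insert hi, Conf.hbarPow_add, ih]

theorem oprod_hbarPow {k : Type u} [Field k] {X : Type} [Fintype X] {φ : Perm X} {f : X → ℤ}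
    (hf : ∀ x, f (φ x) = f x) : oprod φ Finset.univ
      (fun x => (hbarPow ((orb φ x).card * f x) : LambdaHbar k)) = hbarPow (∑ x, f x) := by
  rw [oprod_eq_prod (H := fun o => hbarPow (∑ x ∈ o, f x)) (fun x => by rw [orb_apply, hf]),
    ← hbarPow_sum, sum_orbs]
  intro x _
  congr 1
  rw [Finset.sum_congr rfl (g := fun _ => f x) fun y hy => invariant_of_step hf (mem_orb.mp hy),
    Finset.sum_const, nsmul_eq_mul]

instance (g n : ℕ) : Fintype (StableGraph g n) := Fintype.ofFinite _

instance {g n : ℕ} (Γ Γ' : StableGraph g n) : Fintype (Γ.Iso Γ') := Fintype.ofFinite _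

namespace StableGraph

variable {g n : ℕ} {k : Type u} [Field k] (χ : ℕ → Multiset ℕ → k)

/-- The underlying graph, with the automorphism given by an automorphism which permutes the
labels of the legs. -/
def autConf {Γ : StableGraph g n} {σ : Perm (Fin n)} (e : (Γ.smulLeg σ).Iso Γ) :
    Conf (Fin Γ.nv ⊕ Γ.Flag) :=
  Γ.conf.withAut e.equiv e.skel_map_equiv

/-- The permutation of the vertices. -/
def Iso.vertPerm {Γ : StableGraph g n} {σ : Perm (Fin n)} (e : (Γ.smulLeg σ).Iso Γ) :
    Perm (Fin Γ.nv) := e.vert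

/-- The product of the factors of the orbits of vertices. -/
def autFactor {Γ : StableGraph g n} {σ : Perm (Fin n)} (e : (Γ.smulLeg σ).Iso Γ) : k :=
  oprod e.vertPerm Finset.univ fun v => (autConf e).vfac χ (Sum.inl v)

/-- The exponents of ħ add up to ∑ (g(v) - 1) + |Edge| = g - 1, the legs give the cycle index of σ,
and the flags on edges contribute nothing further. -/
theorem weight_autConf {Γ : StableGraph g n} {σ : Perm (Fin n)} (e : (Γ.smulLeg σ).Iso Γ) :
    (autConf e).weight χ = hbarPow ((g : ℤ) - 1) * (autFactor χ e • cycleIndex σ) := by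
  classical
  set c := autConf e with hc
  let jv : Fin Γ.nv ↪ Fin Γ.nv ⊕ Γ.Flag := Function.Embedding.inl
  let jl : Fin n ↪ Fin Γ.nv ⊕ Γ.Flag := ⟨fun i => Sum.inr (Γ.leg i : Γ.Flag), fun i j h =>
    Γ.leg.injective (Subtype.ext (Sum.inr_injective h))⟩
  have hjv : ∀ v, c.φ (jv v) = jv (e.vertPerm v) := fun _ => rfl
  have hjl : ∀ i, c.φ (jl i) = jl (σ i) := e.equiv_leg
  have hedge : c.edges = (edgeFinset Γ.inv).card := by
    have h1 := c.two_mul_edges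
    have h2 : c.nonfix = (Finset.univ.filter fun a => Γ.inv a ≠ a).map Function.Embedding.inr := by
      ext x
      rw [Conf.mem_nonfix, Finset.mem_map]
      constructor
      · rcases x with v | a
        · exact fun h => (h rfl).elim
        · exact fun h => ⟨a, Finset.mem_filter.mpr ⟨Finset.mem_univ _, fun h' => h (congrArg _ h')⟩,
            rfl⟩
      · rintro ⟨a, ha, rfl⟩
        exact fun h => (Finset.mem_filter.mp ha).2 (Sum.inr_injective h)
    rw [h2, Finset.card_map, ← two_mul_card_edgeFinset Γ.inv_inv] at h1
    omega
  have hu : (Finset.univ : Finset (Fin Γ.nv ⊕ Γ.Flag)) =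
      Finset.univ.map jv ∪ (Finset.univ.map jl ∪ c.nonfix) := by
    ext x
    simp only [Finset.mem_univ, true_iff, Finset.mem_union, Finset.mem_map, true_and]
    rcases x with v | a
    · exact Or.inl ⟨v, rfl⟩
    · refine Or.inr ?_
      by_cases ha : Γ.inv a = a
      · exact Or.inl ⟨Γ.leg.symm ⟨a, ha⟩, congrArg Sum.inr (by simp)⟩
      · exact Or.inr (Conf.mem_nonfix.mpr fun h => ha (Sum.inr_injective h))
  have hinvl : ∀ i, c.inv (jl i) = jl i := fun i => congrArg Sum.inr (Γ.leg i).2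
  have hvxr : ∀ a : Γ.Flag, c.vx (Sum.inr a) ≠ Sum.inr a := fun a => Sum.inl_ne_inr
  have hd1 : Disjoint (Finset.univ.map jv) (Finset.univ.map jl ∪ c.nonfix) := by
    rw [Finset.disjoint_left]
    intro x hx hx'
    obtain ⟨v, -, rfl⟩ := Finset.mem_map.mp hx
    rcases Finset.mem_union.mp hx' with h | h
    · obtain ⟨i, -, h⟩ := Finset.mem_map.mp h
      exact Sum.inr_ne_inl h
    · exact Conf.mem_nonfix.mp h rfl
  have hd2 : Disjoint (Finset.univ.map jl) c.nonfix := by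
    rw [Finset.disjoint_left]
    intro x hx hx'
    obtain ⟨i, -, rfl⟩ := Finset.mem_map.mp hx
    exact Conf.mem_nonfix.mp hx' (hinvl i)
  have hm1 : ∀ x ∈ Finset.univ.map jv, c.φ x ∈ Finset.univ.map jv := by
    intro x hx
    obtain ⟨v, -, rfl⟩ := Finset.mem_map.mp hx
    exact Finset.mem_map.mpr ⟨_, Finset.mem_univ _, (hjv v).symm⟩
  have hm2 : ∀ x ∈ Finset.univ.map jl, c.φ x ∈ Finset.univ.map jl := by
    intro x hx
    obtain ⟨v, -, rfl⟩ := Finset.mem_map.mp hx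
    exact Finset.mem_map.mpr ⟨_, Finset.mem_univ _, (hjl v).symm⟩
  have hfac : ∀ v, c.vfac χ (Sum.inl (e.vertPerm v)) = c.vfac χ (Sum.inl v) := fun v =>
    c.isEmb_φ.vfac χ (Sum.inl v)
  have hgen : ∀ v, Γ.genus (e.vertPerm v) = Γ.genus v := fun v => (e.genus_vert v).symm
  have e1 : oprod c.φ (Finset.univ.map jv) (c.loc χ) =
      hbarPow (∑ v, ((Γ.genus v : ℤ) - 1)) * HahnSeries.C (autFactor χ e) := by
    rw [oprod_map (φ := e.vertPerm) jv hjv Finset.univ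
      (f := fun v => hbarPow ((orb e.vertPerm v).card * ((Γ.genus v : ℤ) - 1)) *
        HahnSeries.C (c.vfac χ (Sum.inl v))) (fun v => by rw [orb_apply, hfac, hgen]) (c.loc_φ χ),
      oprod_mul (fun v => by rw [orb_apply, hgen]) (fun v => by rw [hfac]),
      oprod_hbarPow fun v => by rw [hgen]]
    · congr 1
      exact (map_oprod (HahnSeries.C : k →+* LambdaHbar k).toMonoidHom e.vertPerm Finset.univ
        hfac).symm
    · intro v
      rw [Conf.loc, if_pos (show c.vx (jv v) = jv v from rfl), card_orb_map jv hjv]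
      rfl
  have e2 : oprod c.φ (Finset.univ.map jl) (c.loc χ) = cycleIndex σ := by
    rw [oprod_map (φ := σ) jl hjl Finset.univ
      (f := fun x => pSum (orb σ x).card.toPNat') (fun x => by rw [orb_apply]) (c.loc_φ χ),
      ← cycleIndex_eq]
    intro i
    rw [Conf.loc, if_neg (show c.vx (jl i) ≠ jl i from hvxr _), if_pos (hinvl i), card_orb_map jl hjl]
  have e3 : oprod c.φ c.nonfix (c.loc χ) = 1 := by
    rw [oprod_congr (c.loc_φ χ) (g := fun _ => 1) (fun _ => rfl), oprod_one]
    intro x hx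
    have hx' := Conf.mem_nonfix.mp hx
    rcases x with v | a
    · exact (hx' rfl).elim
    · rw [Conf.loc, if_neg (hvxr a), if_neg hx']
  rw [Conf.weight, hedge, hu, oprod_union hm1 hd1, oprod_union hm2 hd2, e1, e2, e3, mul_one,
    mul_assoc, HahnSeries.C_mul_eq_smul, ← mul_assoc, ← Conf.hbarPow_add]
  congr 2
  linarith [Γ.genus_eq]

end StableGraph

namespace Conf

variable {k : Type u} [Field k] [CharZero k] (χ : ℕ → Multiset ℕ → k)

/-- The generating function of connected graphs as a sum over stable graphs. -/
theorem gsum_graphs : gsum χ (IsConn True) = infSum fun a : CType =>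
    hbarPow ((a.1.1 : ℤ) - 1) * ((a.1.2.factorial : k)⁻¹ • ∑ σ : Perm (Fin a.1.2),
      (∑ Γ : StableGraph a.1.1 a.1.2, (Γ.numIso : k)⁻¹ *
        ∑ e : (Γ.smulLeg σ).Iso Γ, StableGraph.autFactor χ e) • cycleIndex σ) := by
  have h := infSum_aterm graphs χ
  rw [show IsIn graphs = IsConn True from funext fun a => propext (isIn_graphs a)] at h
  let E : (Σ a : CType, Σ Γ : StableGraph a.1.1 a.1.2,
      Σ σ : Perm (Fin a.1.2), (Γ.smulLeg σ).Iso Γ) ≃ Σ o : SType, GIso graphs o o :=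
    (Equiv.sigmaAssoc (fun (a : CType) (Γ : StableGraph a.1.1 a.1.2) => Σ σ : Perm (Fin a.1.2), (StableGraph.smulLeg σ Γ).Iso Γ)).symm.trans
      (Equiv.sigmaCongrRight fun o =>
        Equiv.ofBijective (isoGIso o.1 o.2 o.2) (bijective_isoGIso o.1 o.2 o.2))
  rw [← h.1, ← infSum_equiv E, (infSum_sigma (h.2.comp_injective E.injective)).1]
  congr 1
  funext a
  rw [infSum_fintype, Fintype.sum_sigma]
  simp only [Fintype.sum_sigma]
  have key : ∀ (Γ : StableGraph a.1.1 a.1.2) (σ : Perm (Fin a.1.2)) (e : (Γ.smulLeg σ).Iso Γ),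
      aterm graphs χ (E ⟨a, Γ, σ, e⟩) = hbarPow ((a.1.1 : ℤ) - 1) * (((a.1.2.factorial : k)⁻¹) •
        (((Γ.numIso : k)⁻¹ * StableGraph.autFactor χ e) • cycleIndex σ)) := by
    intro Γ σ e
    have h1 : aterm graphs χ (E ⟨a, Γ, σ, e⟩) = ((numIso graphs ⟨a, Γ⟩ : k)⁻¹) •
      (StableGraph.autConf e).weight χ := rfl
    rw [h1, StableGraph.weight_autConf, numIso_graphs, Nat.cast_mul, mul_inv, ← mul_smul_comm,
      smul_smul, smul_smul, mul_assoc]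
  simp only [key]
  rw [Finset.sum_comm]
  simp only [← Finset.mul_sum, ← Finset.smul_sum, ← Finset.sum_smul]

end Conf

/-! ### Removing a point from its cycle, as an induction principle for permutations. -/

section Skip

variable {X : Type} [Fintype X] [DecidableEq X]

/-- The permutation which skips the point `x`. -/
def skip (π : Perm X) (x : X) : Perm X := Equiv.swap x (π x) * π

theorem skip_self (π : Perm X) (x : X) : skip π x x = x := by simp [skip]

theorem skip_apply {π : Perm X} {x u : X} (hx : u ≠ x) (hu : π u ≠ x) : skip π x u = π u := by
  rw [skip, Perm.mul_apply, Equiv.swap_apply_of_ne_of_ne hu fun h => hx (π.injective h)]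

theorem skip_of_eq {π : Perm X} {x u : X} (hu : π u = x) : skip π x u = π x := by
  rw [skip, Perm.mul_apply, hu, Equiv.swap_apply_left]

theorem orb_skip {π : Perm X} {x u : X} (hx : u ≠ x) : orb (skip π x) u = (orb π u).erase x := by
  ext w
  rw [mem_orb, Finset.mem_erase, mem_orb]
  constructor
  · intro h
    refine ⟨?_, ?_⟩
    · rintro rfl
      exact hx (by simpa using (Perm.SameCycle.symm h).eq_of_left (skip_self π w) |>.symm)
    · refine sameCycle_of_step (f := id) (fun y => ?_) h
      by_cases hy : y = x
      · rw [hy, skip_self]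
      · by_cases hy' : π y = x
        · rw [skip_of_eq hy']
          exact ⟨2, by rw [← hy']; rfl⟩
        · rw [skip_apply hy hy']
          exact ⟨1, rfl⟩
  · rintro ⟨hw, h⟩
    -- A path of π is followed under the shortened permutation by replacing each visit to x with its
    -- successor.
    let r : X → X := fun u => if u = x then π x else u
    have hr : ∀ u, u ≠ x → r u = u := fun u hu => if_neg hu
    have hrx : r x = π x := if_pos rfl
    have := sameCycle_of_step (φ := skip π x) (f := r) (fun y => ?_) h
    · rwa [hr u hx, hr w hw] at this
    by_cases hy : y = x
    · subst hy
      by_cases h1 : π y = y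
      · rw [h1]
      · rw [hr _ h1, hrx]
    · rw [hr y hy]
      by_cases hy' : π y = x
      · rw [hy', hrx, ← skip_of_eq hy']
        exact ⟨1, rfl⟩
      · rw [hr _ hy', ← skip_apply hy hy']
        exact ⟨1, rfl⟩

/-- The product over the orbits of a permutation which skips a point. -/
theorem oprod_skip {R : Type*} [CommMonoid R] {π : Perm X} {x : X} (hx : π x ≠ x) {f f' : X → R}
    (hf : ∀ u, f (π u) = f u) (hf' : ∀ u, f' (skip π x u) = f' u) (h : ∀ u, u ≠ x → f' u = f u) :
    oprod (skip π x) Finset.univ f' = f' x * oprod π Finset.univ f := by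
  obtain ⟨H', hH'⟩ := exists_orbit_function hf'
  have hu : (Finset.univ : Finset X) = {x} ∪ Finset.univ.erase x := by
    ext u
    simp
  have hfx : ∀ u, ∃ u', u' ≠ x ∧ orb π u' = orb π u ∧ f u' = f u := by
    intro u
    by_cases hux : u = x
    · exact ⟨π u, hux ▸ hx, orb_apply π u, hf u⟩
    · exact ⟨u, hux, rfl, rfl⟩
  have h1 : oprod π Finset.univ f = ∏ o ∈ orbs π Finset.univ, H' (o.erase x) := by
    refine oprod_eq_prod (H := fun o => H' (o.erase x)) hf fun u _ => ?_
    obtain ⟨u', h1, h2, h3⟩ := hfx u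
    rw [← h2, ← orb_skip h1, hH', h u' h1, h3]
  have h2 : orbs (skip π x) (Finset.univ.erase x) =
      (orbs π Finset.univ).image fun o => o.erase x := by
    ext o
    rw [mem_orbs, Finset.mem_image]
    constructor
    · rintro ⟨u, hu, rfl⟩
      exact ⟨_, mem_orbs.mpr ⟨u, Finset.mem_univ _, rfl⟩,
        (orb_skip (Finset.ne_of_mem_erase hu)).symm⟩
    · rintro ⟨_, ho, rfl⟩
      obtain ⟨u, -, rfl⟩ := mem_orbs.mp ho
      obtain ⟨u', h1, h2, -⟩ := hfx u
      exact ⟨u', Finset.mem_erase.mpr ⟨h1, Finset.mem_univ _⟩, by rw [orb_skip h1, h2]⟩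
  have h3 : Set.InjOn (fun o : Finset X => o.erase x) (orbs π Finset.univ : Set (Finset X)) := by
    intro o ho o' ho' he
    obtain ⟨u, -, rfl⟩ := mem_orbs.mp ho
    obtain ⟨w, -, rfl⟩ := mem_orbs.mp ho'
    obtain ⟨u', h1, h2, -⟩ := hfx u
    have h4 : u' ∈ (orb π w).erase x := by
      rw [← show (orb π u).erase x = (orb π w).erase x from he, ← h2]
      exact Finset.mem_erase.mpr ⟨h1, mem_orb_self π u'⟩
    rw [← h2, orb_eq_of_sameCycle (mem_orb.mp (Finset.mem_of_mem_erase h4))]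
  conv_lhs => rw [hu]
  rw [oprod_union, h1]
  · congr 1
    · have : ({x} : Finset X) = orb (skip π x) x := (orb_of_fixed (skip_self π x)).symm
      rw [this, oprod_orb hf']
    · rw [oprod_eq_prod hf' fun u _ => hH' u, h2, Finset.prod_image h3]
  · intro u hu
    rw [Finset.mem_singleton.mp hu, skip_self]
    exact Finset.mem_singleton_self _
  · simp

theorem oprod_one_perm {R : Type*} [CommMonoid R] (f : X → R) :
    oprod 1 Finset.univ f = ∏ x, f x := by
  rw [oprod_eq_prod (H := fun o => ∏ x ∈ o, f x) fun x => rfl]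
  · have : orbs (1 : Perm X) Finset.univ = Finset.univ.image fun x => ({x} : Finset X) := by
      ext o
      rw [mem_orbs, Finset.mem_image]
      exact exists_congr fun x => and_congr_right fun _ => by rw [orb_of_fixed rfl]
    rw [this, Finset.prod_image Finset.singleton_injective.injOn]
    simp
  · intro x _
    rw [orb_of_fixed rfl, Finset.prod_singleton]

theorem skip_invariant {α : Type*} {π : Perm X} {f : X → α} (hf : ∀ u, f (π u) = f u) (x u : X) :
    f (skip π x u) = f u := by
  by_cases hx : u = x
  · rw [hx, skip_self]
  · by_cases hu : π u = x
    · rw [skip_of_eq hu, hf, ← hu, hf]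
    · rw [skip_apply hx hu, hf]

theorem swap_mul_skip (π : Perm X) (x : X) : Equiv.swap x (π x) * skip π x = π := by
  rw [skip, ← mul_assoc, Equiv.swap_mul_self, one_mul]

/-- Induction on permutations, by skipping points. -/
theorem skip_induction {P : Perm X → Prop} (one : P 1)
    (step : ∀ π x, π x ≠ x → P (skip π x) → P π) (π : Perm X) : P π := by
  induction h : π.support.card using Nat.strong_induction_on generalizing π with
  | _ N ih =>
    by_cases h1 : π = 1
    · exact h1 ▸ one
    · obtain ⟨x, hx⟩ : ∃ x, π x ≠ x := by
        by_contra hn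
        push Not at hn
        exact h1 (Equiv.ext hn)
      exact step π x hx (ih _ (h ▸ Perm.card_support_swap_mul hx) _ rfl)

end Skip

/-! ### State sums along a permutation as products of traces around its cycles. -/

section StateSum

variable {X : Type} [Fintype X] [DecidableEq X] {J : Type*} [Fintype J] [DecidableEq J]
  {R : Type*} [CommRing R]

/-- The product of matrices along a path of a permutation. -/
def around (K : X → Matrix J J R) (π : Perm X) : ℕ → X → Matrix J J R
  | 0, _ => 1
  | n + 1, x => K x * around K π n (π x)

theorem around_succ' (K : X → Matrix J J R) (π : Perm X) (n : ℕ) (x : X) :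
    around K π (n + 1) x = around K π n x * K ((π ^ n) x) := by
  induction n generalizing x with
  | zero => simp [around]
  | succ n ih =>
    rw [around, ih, ← mul_assoc]
    rfl

/-- The trace of the product of matrices around an orbit. -/
def loopTrace (K : X → Matrix J J R) (π : Perm X) (x : X) : R :=
  (around K π (orb π x).card x).trace

theorem loopTrace_apply (K : X → Matrix J J R) (π : Perm X) (x : X) :
    loopTrace K π (π x) = loopTrace K π x := by
  obtain ⟨n, hn⟩ := Nat.exists_eq_succ_of_ne_zero (card_orb_pos π x).ne'
  have hx : (π ^ n) (π x) = x := by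
    rw [← Perm.mul_apply, ← pow_succ, ← Nat.succ_eq_add_one, ← hn, pow_eq_self_iff]
  rw [loopTrace, loopTrace, orb_apply, hn, Nat.succ_eq_add_one, around_succ', hx, around,
    Matrix.trace_mul_comm]

theorem around_congr {K K' : X → Matrix J J R} {π π' : Perm X} (n : ℕ) (x : X)
    (h : ∀ i < n, K' ((π ^ i) x) = K ((π ^ i) x) ∧ π' ((π ^ i) x) = π ((π ^ i) x)) :
    around K' π' n x = around K π n x := by
  induction n generalizing x with
  | zero => rfl
  | succ n ih =>
    obtain ⟨h1, h2⟩ := h 0 (Nat.succ_pos n)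
    rw [pow_zero, Perm.one_apply] at h1 h2
    rw [around, around, h1, h2, ih]
    intro i hi
    have := h (i + 1) (Nat.succ_lt_succ hi)
    rwa [pow_succ, Perm.mul_apply] at this

/-- The sum over states on the points of the product of matrix entries along the arrows of a
permutation. -/
theorem sum_states (K : X → Matrix J J R) (π : Perm X) :
    ∑ a : X → J, ∏ x, K x (a x) (a (π x)) = oprod π Finset.univ (loopTrace K π) := by
  revert K
  refine skip_induction (P := fun π => ∀ K : X → Matrix J J R,
    ∑ a : X → J, ∏ x, K x (a x) (a (π x)) = oprod π Finset.univ (loopTrace K π)) ?_ ?_ π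
  · intro K
    have h1 : oprod 1 Finset.univ (loopTrace K 1) = ∏ x, (K x).trace := by
      rw [oprod_one_perm]
      refine Finset.prod_congr rfl fun x _ => ?_
      rw [loopTrace, orb_of_fixed rfl]
      simp [around]
    rw [h1]
    simp only [Perm.one_apply, Matrix.trace, Matrix.diag]
    rw [Finset.prod_univ_sum, Fintype.piFinset_univ]
  · intro π x hx ih K
    -- With no states, both sides vanish because there is at least one point and hence at least one
    -- cycle.
    rcases isEmpty_or_nonempty J with hJ | ⟨⟨j₀⟩⟩
    · have : IsEmpty (X → J) := ⟨fun a => hJ.elim (a x)⟩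
      rw [Finset.univ_eq_empty, Finset.sum_empty,
        oprod_eq_prod (loopTrace_apply K π) (H := fun _ => 0), Finset.prod_const, zero_pow]
      · exact Finset.card_ne_zero.mpr ⟨_, mem_orbs.mpr ⟨x, Finset.mem_univ _, rfl⟩⟩
      · intro u _
        simp [loopTrace, Matrix.trace]
    -- The predecessor of x. When x is removed from its cycle, the arrow leaving y has to carry both
    -- K y and K x.
    set y := π⁻¹ x with hy
    have hyx : π y = x := by simp [hy]
    have hne : y ≠ x := fun h => hx (by rw [← h, hyx, h])
    -- At x, now a fixed point, a matrix unit of trace 1 is placed: its loop contributes 1, and it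
    -- pins the state at x to j₀.
    let K' : X → Matrix J J R := fun u =>
      if u = x then Matrix.single j₀ j₀ 1 else if u = y then K y * K x else K u
    have hK'x : K' x = Matrix.single j₀ j₀ 1 := if_pos rfl
    have hK'y : K' y = K y * K x := by simp [K', hne]
    have hK' : ∀ u, u ≠ x → u ≠ y → K' u = K u := fun u h1 h2 => by simp [K', h1, h2]
    have hloopx : loopTrace K' (skip π x) x = 1 := by
      rw [loopTrace, orb_of_fixed (skip_self π x)]
      simp [around, hK'x]
    have hpath : ∀ n u, (∀ i < n, (π ^ i) u ≠ x ∧ (π ^ i) u ≠ y) →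
        around K' (skip π x) n u = around K π n u := by
      intro n u h
      refine around_congr n u fun i hi => ⟨hK' _ (h i hi).1 (h i hi).2, skip_apply (h i hi).1 ?_⟩
      intro h'
      exact (h i hi).2 (π.injective (h'.trans hyx.symm))
    have hoy : x ∈ orb π y := mem_orb.mpr ⟨1, by simp [hyx]⟩
    have hloopy : loopTrace K' (skip π x) y = loopTrace K π y := by
      have hc2 : 2 ≤ (orb π y).card := by
        have : ({x, y} : Finset X) ⊆ orb π y := by
          intro z hz
          rcases Finset.mem_insert.mp hz with rfl | hz
          · exact hoy
          · rw [Finset.mem_singleton.mp hz]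
            exact mem_orb_self π y
        exact (Finset.card_pair hne.symm).symm.le.trans (Finset.card_le_card this)
      obtain ⟨n, hn⟩ := Nat.exists_eq_add_of_le hc2
      rw [loopTrace, loopTrace, orb_skip hne, Finset.card_erase_of_mem hoy, hn,
        show 2 + n - 1 = n + 1 by omega, show 2 + n = n + 1 + 1 by omega, around, around, around,
        hK'y, skip_of_eq hyx, hyx, hpath, mul_assoc]
      intro i hi
      have h1 : (π ^ i) (π x) = (π ^ (i + 2)) y := by
        rw [pow_add, Perm.mul_apply, pow_two, Perm.mul_apply, hyx]
      rw [h1]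
      constructor
      · rw [← hyx]
        intro h
        have h2 : (π ^ (i + 2)) y = (π ^ 1) y := by rw [h, pow_one]
        rw [pow_eq_pow_iff, hn] at h2
        exact absurd (Nat.ModEq.eq_of_lt_of_lt h2 (by omega) (by omega)) (by omega)
      · intro h
        have h2 : (π ^ (i + 2)) y = (π ^ 0) y := by rw [h, pow_zero, Perm.one_apply]
        rw [pow_eq_pow_iff, hn] at h2
        exact absurd (Nat.ModEq.eq_of_lt_of_lt h2 (by omega) (by omega)) (by omega)
    have hloop : ∀ u, u ≠ x → loopTrace K' (skip π x) u = loopTrace K π u := by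
      intro u hu
      by_cases h : π.SameCycle y u
      · have h' : (skip π x).SameCycle y u := by
          rw [← mem_orb, orb_skip hne]
          exact Finset.mem_erase.mpr ⟨hu, mem_orb.mpr h⟩
        rw [invariant_of_step (loopTrace_apply K π) h,
          invariant_of_step (loopTrace_apply K' (skip π x)) h', hloopy]
      · have hxu : x ∉ orb π u := fun hx' => h (by
          rw [← mem_orb, orb_eq_of_sameCycle (mem_orb.mp hoy), ← orb_eq_of_sameCycle (mem_orb.mp hx')]
          exact mem_orb_self π u)
        rw [loopTrace, loopTrace, orb_skip hu, Finset.erase_eq_of_notMem hxu, hpath]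
        intro i _
        constructor
        · intro h'
          exact hxu (mem_orb.mpr ⟨i, by simpa using h'⟩)
        · intro h'
          exact h (Perm.SameCycle.symm ⟨i, by simpa using h'⟩)
    have h1 := oprod_skip hx (loopTrace_apply K π) (loopTrace_apply K' (skip π x)) hloop
    rw [hloopx, one_mul, ← ih K'] at h1
    rw [← h1]
    have hxu : (Finset.univ : Finset X) = insert x (insert y ((Finset.univ.erase x).erase y)) := by
      ext u
      by_cases h1 : u = x <;> by_cases h2 : u = y <;> simp [h1, h2]
    let e := Equiv.piSplitAt x fun _ => J
    rw [← e.symm.sum_comp, ← e.symm.sum_comp, Fintype.sum_prod_type_right,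
      Fintype.sum_prod_type_right]
    refine Finset.sum_congr rfl fun b _ => ?_
    have hbx : ∀ j, e.symm (j, b) x = j := fun j => by simp [e, Equiv.piSplitAt]
    have hb : ∀ j u, u ≠ x → e.symm (j, b) u = e.symm (j₀, b) u := fun j u hu => by
      simp [e, Equiv.piSplitAt, hu]
    have hrest : ∀ j, ∏ u ∈ (Finset.univ.erase x).erase y,
        K' u (e.symm (j, b) u) (e.symm (j, b) (skip π x u)) =
        ∏ u ∈ (Finset.univ.erase x).erase y, K u (e.symm (j₀, b) u) (e.symm (j₀, b) (π u)) := by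
      intro j
      refine Finset.prod_congr rfl fun u hu => ?_
      have h2 := Finset.ne_of_mem_erase hu
      have h3 := Finset.ne_of_mem_erase (Finset.mem_of_mem_erase hu)
      have h4 : π u ≠ x := fun h => h2 (π.injective (h.trans hyx.symm))
      rw [hK' u h3 h2, skip_apply h3 h4, hb j u h3, hb j _ h4]
    have hrest' : ∀ j, ∏ u ∈ (Finset.univ.erase x).erase y,
        K u (e.symm (j, b) u) (e.symm (j, b) (π u)) =
        ∏ u ∈ (Finset.univ.erase x).erase y, K u (e.symm (j₀, b) u) (e.symm (j₀, b) (π u)) := by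
      intro j
      refine Finset.prod_congr rfl fun u hu => ?_
      have h2 := Finset.ne_of_mem_erase hu
      have h3 := Finset.ne_of_mem_erase (Finset.mem_of_mem_erase hu)
      have h4 : π u ≠ x := fun h => h2 (π.injective (h.trans hyx.symm))
      rw [hb j u h3, hb j _ h4]
    have hsplit : ∀ f : X → R, ∏ u, f u =
        f x * (f y * ∏ u ∈ (Finset.univ.erase x).erase y, f u) := by
      intro f
      rw [hxu, Finset.prod_insert, Finset.prod_insert, ← hxu]
      · simp
      · simp [hne.symm]
    simp only [hsplit, hrest, hrest', skip_self, skip_of_eq hyx, hbx, hyx, hb _ _ hx, hb _ _ hne,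
      hK'x, hK'y]
    symm
    -- On the side of K' only the state j₀ at x survives. The entry of K y * K x then expands into
    -- the sum over the states at x on the other side.
    rw [Finset.sum_eq_single j₀]
    · rw [Matrix.single_apply_same, one_mul, Matrix.mul_apply, Finset.sum_mul]
      refine Finset.sum_congr rfl fun j _ => ?_
      ring
    · intro j _ hj
      rw [Matrix.single_apply_of_ne _ _ _ _ _ (fun h => hj h.1.symm), zero_mul]
    · intro h
      exact absurd (Finset.mem_univ _) h

end StateSum

theorem signOf_zero {k : Type u} [Field k] : signOf k 0 = 1 := by simp [signOf]

theorem signOf_mul_self {k : Type u} [Field k] (i : ℤ) : signOf k i * signOf k i = 1 := by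
  rw [← signOf_add, ← signOf_zero]
  exact signOf_eq_of_even ⟨i, by ring⟩

theorem signOf_sum {k : Type u} [Field k] {ι : Type*} (s : Finset ι) (f : ι → ℤ) :
    signOf k (∑ i ∈ s, f i) = ∏ i ∈ s, signOf k (f i) := by
  classical
  induction s using Finset.induction_on with
  | empty => exact signOf_zero
  | insert i s hi ih => rw [Finset.sum_insert hi, Finset.prod_insert hi, signOf_add, ih]

theorem sum_pairs {m : ℕ} (F : Fin m → Fin m → ℤ) (hF : ∀ v, F v v = 0) :
    ∑ v, ∑ w, F v w = ∑ v, ∑ w, if v < w then F v w + F w v else 0 := by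
  have h1 : ∀ v w, F v w = (if v < w then F v w else 0) + if w < v then F v w else 0 := by
    intro v w
    rcases lt_trichotomy v w with h | rfl | h
    · simp [h, h.not_gt]
    · simp [hF]
    · simp [h, h.not_gt]
  calc ∑ v, ∑ w, F v w
      = ∑ v, ∑ w, (if v < w then F v w else 0) + ∑ v, ∑ w, if w < v then F v w else 0 := by
        rw [← Finset.sum_add_distrib]
        refine Finset.sum_congr rfl fun v _ => ?_
        rw [← Finset.sum_add_distrib]
        exact Finset.sum_congr rfl fun w _ => h1 v w
    _ = _ := by
        rw [Finset.sum_comm (f := fun v w => if w < v then F v w else 0), ← Finset.sum_add_distrib]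
        refine Finset.sum_congr rfl fun v _ => ?_
        rw [← Finset.sum_add_distrib]
        refine Finset.sum_congr rfl fun w _ => ?_
        split_ifs <;> simp

/-- Pair by pair, two factors are interchanged by the composite exactly when they are interchanged
by one and only one of the two bijections; pairs interchanged twice contribute an even number. -/
theorem koszulExp_comp {m m' m'' : ℕ} (e : Fin m ≃ Fin m') (e' : Fin m' ≃ Fin m'')
    (δ : Fin m → ℤ) (δ' : Fin m' → ℤ) (hδ : ∀ v, δ' (e v) = δ v) :
    Even (koszulExp (e.trans e') δ - (koszulExp e' δ' + koszulExp e δ)) := by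
  have h1 : koszulExp e' δ' =
      ∑ v, ∑ w, if e v < e w ∧ e' (e w) < e' (e v) then δ v * δ w else 0 := by
    rw [koszulExp, ← e.sum_comp]
    refine Finset.sum_congr rfl fun v _ => ?_
    rw [← e.sum_comp]
    simp only [hδ]
  rw [h1, sum_pairs _ fun v => by simp, koszulExp, koszulExp, ← Finset.sum_add_distrib,
    ← Finset.sum_sub_distrib]
  refine Finset.even_sum _ fun v _ => ?_
  rw [← Finset.sum_add_distrib, ← Finset.sum_sub_distrib]
  refine Finset.even_sum _ fun w _ => ?_
  by_cases h : v < w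
  · have h2 : e v ≠ e w := e.injective.ne h.ne
    have h3 : e' (e v) ≠ e' (e w) := e'.injective.ne h2
    simp only [Equiv.trans_apply, h, true_and, if_true]
    rcases lt_or_gt_of_ne h2 with h4 | h4 <;> rcases lt_or_gt_of_ne h3 with h5 | h5 <;>
      simp [h4, h5, h4.not_gt, h5.not_gt, mul_comm]
  · simp [h]

/-- Each factor between a and b is crossed once by either of them, which is even as their degrees
agree. There remains the crossing of a with b, and the square of an integer has the parity of that
integer. -/
theorem koszulExp_swap {m : ℕ} {a b : Fin m} (hab : a < b) (δ : Fin m → ℤ) (h : δ a = δ b) :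
    Even (koszulExp (Equiv.swap a b) δ - δ a) := by
  have h1 : ∀ v w, (if v < w ∧ Equiv.swap a b w < Equiv.swap a b v then δ v * δ w else 0) =
      ((if v = a then (if a < w ∧ w < b then δ a * δ w else 0) else 0) +
      if w = b then (if a < v ∧ v < b then δ a * δ v else 0) else 0) +
      if v = a then (if w = b then δ a * δ a else 0) else 0 := by
    intro v w
    by_cases h1 : v = a
    · subst h1
      by_cases h2 : w = b
      · subst h2
        simp [hab, h]
      · by_cases h3 : w = v
        · simp [h3, hab.ne]
        · simp [h2, Equiv.swap_apply_of_ne_of_ne h3 h2]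
    · by_cases h2 : v = b
      · subst h2
        by_cases h3 : w = v
        · simp [h3, hab.ne']
        · by_cases h4 : w = a
          · simp [h4, hab.not_gt, h1, hab.ne]
          · simp only [Equiv.swap_apply_right, Equiv.swap_apply_of_ne_of_ne h4 h3, h1, h3, if_false,
              add_zero]
            rw [if_neg]
            rintro ⟨h5, h6⟩
            exact absurd (h5.trans h6) hab.not_gt
      · rw [Equiv.swap_apply_of_ne_of_ne h1 h2]
        by_cases h3 : w = b
        · subst h3
          simp only [Equiv.swap_apply_right, h1, if_false, if_true, zero_add, add_zero, ← h,
            mul_comm (δ a), and_comm]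
        · by_cases h4 : w = a
          · subst h4
            simp only [Equiv.swap_apply_left, h1, h3, if_false, add_zero]
            rw [if_neg]
            rintro ⟨h5, h6⟩
            exact absurd (h5.trans hab) h6.not_gt
          · rw [Equiv.swap_apply_of_ne_of_ne h4 h3]
            simp only [h1, h3, if_false, add_zero]
            rw [if_neg]
            rintro ⟨h5, h6⟩
            exact absurd h5 h6.not_gt
  have h2 : koszulExp (Equiv.swap a b) δ =
      2 * (∑ w, if a < w ∧ w < b then δ a * δ w else 0) + δ a * δ a := by
    rw [koszulExp]
    simp only [h1, Finset.sum_add_distrib]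
    have h3 : ∑ v, ∑ w, (if v = a then (if a < w ∧ w < b then δ a * δ w else 0) else 0) =
        ∑ w, if a < w ∧ w < b then δ a * δ w else 0 := by
      rw [Finset.sum_comm]
      simp
    have h4 : ∑ v, ∑ w, (if v = a then (if w = b then δ a * δ a else 0) else 0) = δ a * δ a := by
      rw [Finset.sum_comm]
      simp
    rw [h3, h4]
    simp only [Finset.sum_ite_eq', Finset.mem_univ, if_true]
    ring
  have h3 : koszulExp (Equiv.swap a b) δ - δ a =
      2 * (∑ w, if a < w ∧ w < b then δ a * δ w else 0) + δ a * (δ a - 1) := by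
    rw [h2]
    ring
  rw [h3]
  exact (even_two_mul _).add (Int.even_mul_pred_self _)

variable {k : Type u} [Field k]

/-- The Koszul sign of a permutation which preserves degrees. -/
theorem koszul_sign_eq {m : ℕ} (π : Perm (Fin m)) (δ : Fin m → ℤ) (hδ : ∀ v, δ (π v) = δ v) :
    signOf k (koszulExp π δ) * ∏ v, signOf k (δ v) =
      oprod π Finset.univ fun v => signOf k (δ v) := by
  revert hδ
  refine skip_induction (P := fun π => (∀ v, δ (π v) = δ v) → signOf k (koszulExp π δ) *
    ∏ v, signOf k (δ v) = oprod π Finset.univ fun v => signOf k (δ v)) ?_ ?_ π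
  · intro _
    have h : koszulExp (1 : Perm (Fin m)) δ = 0 := by
      refine Finset.sum_eq_zero fun v _ => Finset.sum_eq_zero fun w _ => if_neg ?_
      rintro ⟨h1, h2⟩
      exact absurd h1 h2.not_gt
    rw [h, signOf_zero, one_mul, oprod_one_perm]
  · intro π x hx ih hδ
    have h1 := ih (skip_invariant hδ x)
    -- Write π as a transposition of two factors of equal degree composed with the permutation which
    -- skips x. The sign of the transposition makes up for the new orbit {x} on the other side.
    have h2 : signOf k (koszulExp π δ) =
        signOf k (δ x) * signOf k (koszulExp (skip π x) δ) := by
      have h3 := koszulExp_comp (skip π x) (Equiv.swap x (π x)) δ δ (skip_invariant hδ x)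
      have h4 : (skip π x).trans (Equiv.swap x (π x)) = π := swap_mul_skip π x
      rw [h4] at h3
      rw [signOf_eq_of_even h3, signOf_add]
      congr 1
      rcases lt_or_gt_of_ne hx with h | h
      · rw [Equiv.swap_comm, signOf_eq_of_even (koszulExp_swap h δ (hδ x)), hδ]
      · rw [signOf_eq_of_even (koszulExp_swap h δ (hδ x).symm)]
    rw [h2, mul_assoc, h1, oprod_skip hx (f := fun v => signOf k (δ v)) (fun v => by rw [hδ])
      (fun v => by rw [skip_invariant hδ]) fun _ _ => rfl, ← mul_assoc, signOf_mul_self, one_mul]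

/-- A set of representatives of the orbits of a permutation. -/
theorem exists_reps {X : Type} [Fintype X] [DecidableEq X] (π : Perm X) : ∃ S : Finset X,
    (∀ x ∈ S, ∀ y ∈ S, π.SameCycle x y → x = y) ∧
    ∀ {R : Type u} [CommMonoid R] (f : X → R), (∀ x, f (π x) = f x) →
      oprod π Finset.univ f = ∏ x ∈ S, f x := by
  classical
  let r : Finset X → Option X := fun o => if ho : o.Nonempty then some ho.choose else none
  have hr : ∀ o ∈ orbs π Finset.univ, ∃ x, orb π x = o ∧ r o = some x := by
    intro o ho
    obtain ⟨x, -, rfl⟩ := mem_orbs.mp ho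
    have h := (orb_nonempty π x).choose_spec
    exact ⟨_, (orb_eq_of_sameCycle (mem_orb.mp h)).symm, dif_pos (orb_nonempty π x)⟩
  refine ⟨Finset.univ.filter fun x => r (orb π x) = some x, ?_, ?_⟩
  · intro x hx y hy h
    have h1 := (Finset.mem_filter.mp hx).2
    have h2 := (Finset.mem_filter.mp hy).2
    rw [orb_eq_of_sameCycle h, h2] at h1
    exact (Option.some_injective _ h1).symm
  · intro R _ f hf
    obtain ⟨H, hH⟩ := exists_orbit_function hf
    rw [oprod_eq_prod hf fun x _ => hH x]
    have h1 : orbs π Finset.univ =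
        (Finset.univ.filter fun x => r (orb π x) = some x).image (orb π) := by
      ext o
      rw [Finset.mem_image]
      constructor
      · intro ho
        obtain ⟨x, h1, h2⟩ := hr o ho
        exact ⟨x, Finset.mem_filter.mpr ⟨Finset.mem_univ _, h1 ▸ h2⟩, h1⟩
      · rintro ⟨x, -, rfl⟩
        exact mem_orbs.mpr ⟨x, Finset.mem_univ _, rfl⟩
    rw [h1, Finset.prod_image]
    · exact Finset.prod_congr rfl fun x _ => hH x
    · intro x hx y hy h
      have h1 := (Finset.mem_filter.mp hx).2
      have h2 := (Finset.mem_filter.mp hy).2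
      rw [show orb π x = orb π y from h, h2] at h1
      exact (Option.some_injective _ h1).symm

/-! ### The trace of a signed permutation of tensor factors. -/

section TensorTrace

open scoped TensorProduct

variable {k : Type u} [Field k] {m : ℕ} {W : Fin m → Type v} [∀ v, AddCommGroup (W v)]
  [∀ v, Module k (W v)] {ι : Fin m → Type} [∀ v, Fintype (ι v)]
  (b : ∀ v, Module.Basis (ι v) k (W v)) (deg : ∀ v, ι v → ℤ) (π : Perm (Fin m))
  (R : ∀ v, W v →ₗ[k] W (π v))

/-- The sum of linear maps along the arrows of a permutation. -/
def totalMap : (∀ v, W v) →ₗ[k] ∀ v, W v :=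
  ∑ v, LinearMap.single k W (π v) ∘ₗ R v ∘ₗ LinearMap.proj v

theorem totalMap_single (v : Fin m) (x : W v) :
    totalMap π R (Pi.single v x) = Pi.single (π v) (R v x) := by
  rw [totalMap, LinearMap.sum_apply, Finset.sum_eq_single v]
  · simp
  · intro w _ hw
    simp [Pi.single_eq_of_ne hw]
  · simp

variable [∀ v, DecidableEq (ι v)]

/-- The trace of a signed permutation of the factors of a tensor product, composed with linear
maps between the factors. -/
theorem trace_tensor_eq (hR : ∀ v i j, (b (π v)).repr (R v (b v i)) j ≠ 0 → deg (π v) j = deg v i)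
    {A : (⨂[k] v, W v) →ₗ[k] ⨂[k] v, W v}
    (hA : ∀ (a : ∀ v, ι v) (y : ∀ v, W v), (∀ v, y (π v) = R v (b v (a v))) →
      A (PiTensorProduct.tprod k fun v => b v (a v)) =
        signOf k (koszulExp π (fun v => deg v (a v)) + ∑ v, deg v (a v)) •
          PiTensorProduct.tprod k y)
    (F : Fin m → k) (hFπ : ∀ v, F (π v) = F v)
    (hF : ∀ v, ∑ i, signOf k (deg v i) * (b v).repr
      ((totalMap π R ^ (orb π v).card) (Pi.single v (b v i)) v) i = F v) :
    LinearMap.trace k _ A = oprod π Finset.univ F := by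
  obtain ⟨S, hS, hprod⟩ := exists_reps.{u} π
  let B := Pi.basis b
  -- Transposed, so that the entry at (p, q) belongs to the arrow from p to q and products are read
  -- along the path.
  let M : Matrix (Σ v, ι v) (Σ v, ι v) k := (LinearMap.toMatrix B B (totalMap π R)).transpose
  have hM : ∀ n p q, (M ^ n) p q =
      (b q.1).repr ((totalMap π R ^ n) (Pi.single p.1 (b p.1 p.2)) q.1) q.2 := by
    intro n p q
    rw [← Matrix.transpose_pow]
    change (LinearMap.toMatrix B B (totalMap π R) ^ n) q p = _
    rw [LinearMap.toMatrix_pow, LinearMap.toMatrix_apply, Pi.basis_apply, Pi.basis_repr]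
  have hM1 : ∀ p q, M p q = (b q.1).repr ((Pi.single (π p.1) (R p.1 (b p.1 p.2)) : ∀ v, W v) q.1)
      q.2 := by
    intro p q
    have := hM 1 p q
    rwa [pow_one, pow_one, totalMap_single] at this
  have hM0 : ∀ p q, π p.1 ≠ q.1 → M p q = 0 := by
    intro p q h
    rw [hM1, Pi.single_eq_of_ne (Ne.symm h), map_zero, Finsupp.zero_apply]
  -- Only one sign operator per orbit is inserted, at its representative: this is what the Koszul
  -- sign leaves of the operator (-1)^i on all the factors.
  let s : Fin m → (Σ v, ι v) → k := fun v p => if v ∈ S then signOf k (deg p.1 p.2) else 1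
  let K : Fin m → Matrix (Σ v, ι v) (Σ v, ι v) k := fun v =>
    Matrix.of fun p q => if p.1 = v then M p q else 0
  let K' : Fin m → Matrix (Σ v, ι v) (Σ v, ι v) k := fun v =>
    Matrix.of fun p q => s v p * K v p q
  have haround : ∀ n v p q, around K π (n + 1) v p q = if p.1 = v then (M ^ (n + 1)) p q else 0 := by
    intro n
    induction n with
    | zero =>
      intro v p q
      rw [around, around, mul_one, zero_add, pow_one]
      rfl
    | succ n ih =>
      intro v p q
      rw [around, Matrix.mul_apply]
      by_cases hp : p.1 = v
      · rw [if_pos hp, pow_succ', Matrix.mul_apply]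
        refine Finset.sum_congr rfl fun x _ => ?_
        rw [ih, show K v p x = M p x from if_pos hp]
        by_cases hx : x.1 = π v
        · rw [if_pos hx]
        · rw [if_neg hx, hM0 p x (by rw [hp]; exact Ne.symm hx), zero_mul, zero_mul]
      · rw [if_neg hp]
        refine Finset.sum_eq_zero fun x _ => ?_
        rw [show K v p x = 0 from if_neg hp, zero_mul]
  have hloop : ∀ v ∈ S, loopTrace K' π v = F v := by
    intro v hv
    obtain ⟨n, hn⟩ := Nat.exists_eq_succ_of_ne_zero (card_orb_pos π v).ne'
    have h1 : ∀ p q, around K' π (n + 1) v p q =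
        signOf k (deg p.1 p.2) * around K π (n + 1) v p q := by
      intro p q
      have h2 : around K' π n (π v) = around K π n (π v) := by
        refine around_congr n _ fun i hi => ⟨?_, rfl⟩
        have h3 : (π ^ i) (π v) ∉ S := by
          intro h
          have h4 : (π ^ (i + 1)) v = (π ^ 0) v := by
            rw [pow_zero, Perm.one_apply, pow_succ, Perm.mul_apply]
            exact hS _ h _ hv (Perm.SameCycle.symm ⟨i + 1, by
              rw [← Perm.mul_apply, ← pow_succ]; rfl⟩)
          rw [pow_eq_pow_iff, hn] at h4
          exact absurd (Nat.ModEq.eq_of_lt_of_lt h4 (by omega) (by omega)) (by omega)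
        ext p q
        change s _ p * _ = _
        rw [show s ((π ^ i) (π v)) p = 1 from if_neg h3, one_mul]
      rw [around, around, h2, Matrix.mul_apply, Matrix.mul_apply, Finset.mul_sum]
      refine Finset.sum_congr rfl fun x _ => ?_
      rw [← mul_assoc]
      congr 1
      change s v p * _ = _
      rw [show s v p = signOf k (deg p.1 p.2) from if_pos hv]
    rw [loopTrace, hn, Matrix.trace, ← hF v, Fintype.sum_sigma, Finset.sum_eq_single v]
    · refine Finset.sum_congr rfl fun i _ => ?_
      rw [Matrix.diag_apply, h1, haround, if_pos rfl, hM, hn]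
    · intro w _ hw
      refine Finset.sum_eq_zero fun i _ => ?_
      rw [Matrix.diag_apply, h1, haround, if_neg hw, mul_zero]
    · simp
  let T := Basis.piTensorProduct b
  rw [LinearMap.trace_eq_matrix_trace k T, Matrix.trace, hprod F hFπ,
    ← Finset.prod_congr rfl hloop, ← hprod _ (loopTrace_apply K' π), ← sum_states]
  -- The basis of the tensor product corresponds to the states which assign to each v a basis vector
  -- of its own factor. All other states contribute 0, since `K' v` vanishes on rows outside the
  -- factor v.
  refine Fintype.sum_of_injective (fun (a : ∀ v, ι v) (v : Fin m) => (⟨v, a v⟩ : Σ v, ι v)) ?_ _ _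
    ?_ ?_
  · intro a a' h
    funext v
    exact eq_of_heq (Sigma.mk.inj (congrFun h v)).2
  · intro a ha
    obtain ⟨v, hv⟩ : ∃ v, (a v).1 ≠ v := by
      by_contra h
      push Not at h
      refine ha ⟨fun v => cast (congrArg ι (h v)) (a v).2, funext fun v => ?_⟩
      exact Sigma.ext (h v).symm (cast_heq _ _)
    refine Finset.prod_eq_zero (Finset.mem_univ v) ?_
    change s v _ * (if (a v).1 = v then _ else 0) = 0
    rw [if_neg hv, mul_zero]
  · intro a
    let y : ∀ v, W v := fun w => (Pi.single (π (π.symm w)) (R _ (b _ (a (π.symm w)))) : ∀ v, W v) w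
    have hy : ∀ v, y (π v) = R v (b v (a v)) := by
      intro v
      simp only [y]
      rw [Equiv.symm_apply_apply, Pi.single_eq_same]
    rw [Matrix.diag_apply, LinearMap.toMatrix_apply, Basis.piTensorProduct_apply, hA a y hy, map_smul,
      Finsupp.smul_apply, Basis.piTensorProduct_repr_tprod_apply, ← Equiv.prod_comp π]
    have hK' : ∀ v, K' v ⟨v, a v⟩ ⟨π v, a (π v)⟩ =
        s v ⟨v, a v⟩ * (b (π v)).repr (y (π v)) (a (π v)) := by
      intro v
      change s v _ * (if v = v then M _ _ else 0) = _
      rw [if_pos rfl, hM1, hy, Pi.single_eq_same]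
    simp only [hK']
    rw [Finset.prod_mul_distrib, smul_eq_mul]
    -- A vanishing matrix entry makes both sides 0. Otherwise the maps force the degrees to be
    -- constant along orbits, as `koszul_sign_eq` requires.
    by_cases h0 : ∃ v, (b (π v)).repr (y (π v)) (a (π v)) = 0
    · obtain ⟨v, hv⟩ := h0
      rw [Finset.prod_eq_zero (Finset.mem_univ v) hv, mul_zero, mul_zero]
    · push Not at h0
      congr 1
      have hδ : ∀ v, deg (π v) (a (π v)) = deg v (a v) := fun v => hR v _ _ (by
        rw [← hy]; exact h0 v)
      rw [signOf_add, signOf_sum, koszul_sign_eq π _ hδ, hprod _ fun v => by rw [hδ]]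
      have h := Finset.prod_ite_mem Finset.univ S fun v => signOf k (deg v (a v))
      rw [Finset.univ_inter] at h
      exact h.symm

end TensorTrace

open scoped TensorProduct

namespace DGRep

variable {k : Type u} [Field k] {G : Type} [Group G] (V : DGRep.{u, v} k G)

/-- The index type of a homogeneous basis. -/
abbrev BasisIndex : Type := Σ i : ℤ, Fin (Module.finrank k (V.gr i))

/-- A homogeneous basis of a finite-dimensional complex. -/
def homBasis [FiniteDimensional k V.carrier] : Module.Basis V.BasisIndex k V.carrier :=
  V.isInternal.collectedBasis fun i => Module.finBasis k (V.gr i)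

instance [FiniteDimensional k V.carrier] : Fintype V.BasisIndex :=
  FiniteDimensional.fintypeBasisIndex V.homBasis

theorem homBasis_mem [FiniteDimensional k V.carrier] (a : V.BasisIndex) :
    V.homBasis a ∈ V.gr a.1 := V.isInternal.collectedBasis_mem _ a

theorem homBasis_repr [FiniteDimensional k V.carrier] {i : ℤ} {x : V.carrier} (hx : x ∈ V.gr i)
    {a : V.BasisIndex} (h : V.homBasis.repr x a ≠ 0) : a.1 = i := by
  by_contra hne
  exact h (V.isInternal.collectedBasis_repr_of_mem_ne _ (Ne.symm hne) hx)

theorem str_eq_sum_homBasis [FiniteDimensional k V.carrier] (σ : G) :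
    V.str σ = ∑ a, signOf k a.1 * V.homBasis.repr (V.ρ σ (V.homBasis a)) a := by
  classical
  rw [str, LinearMap.trace_eq_matrix_trace k V.homBasis, Matrix.trace]
  refine Finset.sum_congr rfl fun a _ => ?_
  rw [Matrix.diag_apply, LinearMap.toMatrix_apply, LinearMap.comp_apply,
    V.scale_apply _ (V.ρ_mem σ _ _ (V.homBasis_mem a)), map_smul]
  rfl

end DGRep

/-- The parities of a family of degrees. -/
def parity {m : ℕ} (s : Finset (Fin m)) (v : Fin m) : ℤ := if v ∈ s then 1 else 0

/-- A product of degrees matters only modulo 2. So the signed action of an isomorphism, defined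
degree by degree, is a finite sum over sets of odd factors, without any finiteness of the complexes.
-/
theorem koszulExp_parity {m m' : ℕ} (e : Fin m → Fin m') (δ : Fin m → ℤ) :
    Even (koszulExp e (parity (Finset.univ.filter fun v => Odd (δ v))) - koszulExp e δ) := by
  rw [koszulExp, koszulExp, ← Finset.sum_sub_distrib]
  refine Finset.even_sum _ fun v _ => ?_
  rw [← Finset.sum_sub_distrib]
  refine Finset.even_sum _ fun w _ => ?_
  split_ifs
  · simp only [parity, Finset.mem_filter, Finset.mem_univ, true_and, ← Int.not_even_iff_odd]
    by_cases hv : Even (δ v) <;> by_cases hw : Even (δ w) <;>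
      simp [hv, hw, Int.even_sub, Int.even_mul]
  · simp

/-! ### The signed action of isomorphisms on 𝒱((Γ)), and the supertraces of automorphisms. -/

namespace StableSModule

variable {k : Type u} [Field k] (V : StableSModule.{u, v} k) {g n : ℕ}

theorem relabel_relabel {g g' g'' a b c : ℕ} (hg : g = g') (hg' : g' = g'') (φ : Fin a ≃ Fin b)
    (φ' : Fin b ≃ Fin c) (x : (V.obj g a).carrier) :
    V.relabel hg' φ' (V.relabel hg φ x) = V.relabel (hg.trans hg') (φ.trans φ') x := by
  have hab : a = b := by simpa using Fintype.card_congr φ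
  have hbc : b = c := by simpa using Fintype.card_congr φ'
  subst hg hg' hab hbc
  change (V.obj g a).ρ φ' ((V.obj g a).ρ φ x) = (V.obj g a).ρ (φ' * φ) x
  rw [map_mul]
  rfl

variable {Γ Γ' : StableGraph g n}

/-- The isomorphism of tensor products induced by an isomorphism of graphs, without signs. -/
def tensorIso (e : Γ.Iso Γ') : V.tensor Γ →ₗ[k] V.tensor Γ' :=
  (PiTensorProduct.reindex k (fun w => (V.obj (Γ'.genus w) (Γ'.val w)).carrier)
    e.vert.symm).symm.toLinearMap ∘ₗ
      PiTensorProduct.map fun v => V.relabel (e.genus_vert v) (e.flag v)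

theorem tensorIso_tprod (e : Γ.Iso Γ') {x : ∀ v, (V.obj (Γ.genus v) (Γ.val v)).carrier}
    {y : ∀ v, (V.obj (Γ'.genus v) (Γ'.val v)).carrier}
    (h : ∀ v, y (e.vert v) = V.relabel (e.genus_vert v) (e.flag v) (x v)) :
    V.tensorIso e (PiTensorProduct.tprod k x) = PiTensorProduct.tprod k y := by
  rw [tensorIso, LinearMap.comp_apply, PiTensorProduct.map_tprod, LinearEquiv.coe_coe,
    LinearEquiv.symm_apply_eq, PiTensorProduct.reindex_tprod]
  exact congrArg _ (funext fun v => (h v).symm)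

/-- The isomorphism of tensor products induced by an isomorphism of graphs, with Koszul signs. -/
def signedIso (e : Γ.Iso Γ') : V.tensor Γ →ₗ[k] V.tensor Γ' :=
  ∑ s : Finset (Fin Γ.nv), signOf k (koszulExp e.vert (parity s)) • V.tensorIso e ∘ₗ
    PiTensorProduct.map fun v => (V.obj (Γ.genus v) (Γ.val v)).scale fun i =>
      if Odd i ↔ v ∈ s then 1 else 0

theorem map_scale_tprod (c : Fin Γ.nv → ℤ → k) {δ : Fin Γ.nv → ℤ}
    {x : ∀ v, (V.obj (Γ.genus v) (Γ.val v)).carrier}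
    (hx : ∀ v, x v ∈ (V.obj (Γ.genus v) (Γ.val v)).gr (δ v)) :
    PiTensorProduct.map (fun v => (V.obj (Γ.genus v) (Γ.val v)).scale (c v))
      (PiTensorProduct.tprod k x) = (∏ v, c v (δ v)) • PiTensorProduct.tprod k x := by
  rw [PiTensorProduct.map_tprod, ← MultilinearMap.map_smul_univ]
  exact congrArg _ (funext fun v => DGRep.scale_apply _ _ (hx v))

/-- On homogeneous factors, the only summand of `signedIso` which survives is that of the set of
factors of odd degree. -/
theorem signedIso_tprod (e : Γ.Iso Γ') {δ : Fin Γ.nv → ℤ}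
    {x : ∀ v, (V.obj (Γ.genus v) (Γ.val v)).carrier}
    {y : ∀ v, (V.obj (Γ'.genus v) (Γ'.val v)).carrier} (h : V.IsRelated Γ Γ' e δ x y) :
    V.signedIso e (PiTensorProduct.tprod k x) =
      signOf k (koszulExp e.vert δ) • PiTensorProduct.tprod k y := by
  rw [signedIso, LinearMap.sum_apply,
    Finset.sum_eq_single (Finset.univ.filter fun v => Odd (δ v))]
  · rw [LinearMap.smul_apply, LinearMap.comp_apply,
      V.map_scale_tprod (fun v i => if Odd i ↔ v ∈ _ then 1 else 0) h.mem,
      signOf_eq_of_even (koszulExp_parity e.vert δ), Finset.prod_eq_one, one_smul,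
      V.tensorIso_tprod e h.eq]
    intro v _
    exact if_pos (by simp)
  · intro s _ hs
    rw [LinearMap.smul_apply, LinearMap.comp_apply,
      V.map_scale_tprod (fun v i => if Odd i ↔ v ∈ s then 1 else 0) h.mem]
    obtain ⟨v, hv⟩ : ∃ v, ¬ (Odd (δ v) ↔ v ∈ s) := by
      by_contra hc
      push Not at hc
      exact hs (Finset.ext fun v => by simp [hc v])
    rw [Finset.prod_eq_zero (Finset.mem_univ v) (if_neg hv), zero_smul, map_zero, smul_zero]
  · simp

/-- Every family of elements has a family of images. -/
theorem exists_image (e : Γ.Iso Γ') (x : ∀ v, (V.obj (Γ.genus v) (Γ.val v)).carrier) :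
    ∃ y : ∀ v, (V.obj (Γ'.genus v) (Γ'.val v)).carrier,
      ∀ v, y (e.vert v) = V.relabel (e.genus_vert v) (e.flag v) (x v) := by
  have h : ∀ w, ∃ z : (V.obj (Γ'.genus w) (Γ'.val w)).carrier, ∀ v (hv : e.vert v = w),
      hv ▸ z = V.relabel (e.genus_vert v) (e.flag v) (x v) := by
    intro w
    obtain ⟨v, rfl⟩ := e.vert.surjective w
    refine ⟨V.relabel (e.genus_vert v) (e.flag v) (x v), fun v' hv' => ?_⟩
    obtain rfl := e.vert.injective hv'
    rfl
  choose y hy using h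
  exact ⟨y, fun v => hy _ v rfl⟩

/-- The operator `(-1) ^ i` on the component of degree `i` of `V((Γ))`. -/
def tensorSign (Γ : StableGraph g n) : V.tensor Γ →ₗ[k] V.tensor Γ :=
  PiTensorProduct.map fun v => (V.obj (Γ.genus v) (Γ.val v)).scale (signOf k)

theorem tensorSign_tprod {δ : Fin Γ.nv → ℤ} {x : ∀ v, (V.obj (Γ.genus v) (Γ.val v)).carrier}
    (hx : ∀ v, x v ∈ (V.obj (Γ.genus v) (Γ.val v)).gr (δ v)) :
    V.tensorSign Γ (PiTensorProduct.tprod k x) =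
      signOf k (∑ v, δ v) • PiTensorProduct.tprod k x := by
  rw [tensorSign, V.map_scale_tprod (fun _ => signOf k) hx, signOf_sum]

variable {σ : Perm (Fin n)}

/-- Following a vertex for t steps, the composite of the relabellings is the relabelling by the
bijection Φ which φ^t induces on its flags. This links the algebraic first return with the
combinatorial one. -/
theorem iterate_relabel (e : (Γ.smulLeg σ).Iso Γ) (t : ℕ) (v : Fin Γ.nv) :
    ∃ (w : Fin Γ.nv) (hw : Γ.genus v = Γ.genus w) (Φ : Fin (Γ.val v) ≃ Fin (Γ.val w)),
      (e.vertPerm ^ t) v = w ∧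
      (∀ i, ((StableGraph.autConf e).φ ^ t) (Sum.inr ⟨v, i⟩) = Sum.inr ⟨w, Φ i⟩) ∧
      ∀ x : (V.obj (Γ.genus v) (Γ.val v)).carrier,
        (totalMap (W := fun v => (V.obj (Γ.genus v) (Γ.val v)).carrier) e.vertPerm
          (fun v => V.relabel (e.genus_vert v) (e.flag v)) ^ t) (Pi.single v x) =
            Pi.single w (V.relabel hw Φ x) := by
  induction t with
  | zero =>
    refine ⟨v, rfl, Equiv.refl _, rfl, fun _ => rfl, fun x => ?_⟩
    have h : V.relabel rfl (Equiv.refl (Fin (Γ.val v))) x = x :=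
      LinearMap.congr_fun (map_one (V.obj (Γ.genus v) (Γ.val v)).ρ) x
    rw [h]
    rfl
  | succ t ih =>
    obtain ⟨w, hw, Φ, h1, h2, h3⟩ := ih
    refine ⟨e.vertPerm w, hw.trans (e.genus_vert w), Φ.trans (e.flag w), ?_, fun i => ?_,
      fun x => ?_⟩
    · rw [pow_succ', Perm.mul_apply, h1]
    · rw [pow_succ', Perm.mul_apply, h2]
      rfl
    · rw [pow_succ', Module.End.mul_apply, h3, totalMap_single]
      exact congrArg _ (V.relabel_relabel hw (e.genus_vert w) Φ (e.flag w) x)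

/-- The supertrace of an automorphism of `V((Γ))` is the product of the supertraces attached to
the orbits of vertices. -/
theorem trace_signedIso [CharZero k] [∀ g n, FiniteDimensional k (V.obj g n).carrier]
    (e : (Γ.smulLeg σ).Iso Γ) :
    LinearMap.trace k (V.tensor Γ) (V.signedIso e ∘ₗ V.tensorRelabel σ Γ ∘ₗ V.tensorSign Γ) =
      StableGraph.autFactor V.char e := by
  classical
  let W : Fin Γ.nv → Type v := fun v => (V.obj (Γ.genus v) (Γ.val v)).carrier
  refine trace_tensor_eq (W := W) (fun v => (V.obj (Γ.genus v) (Γ.val v)).homBasis)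
    (fun v a => a.1) e.vertPerm (fun v => V.relabel (e.genus_vert v) (e.flag v)) ?_ ?_ _ ?_ ?_
  · intro v i j h
    exact DGRep.homBasis_repr _ (V.relabel_mem _ _ _ _ (DGRep.homBasis_mem _ i)) h
  · intro a y hy
    have hm := fun v => (V.obj (Γ.genus v) (Γ.val v)).homBasis_mem (a v)
    rw [LinearMap.comp_apply, LinearMap.comp_apply, V.tensorSign_tprod hm, map_smul, map_smul]
    have h := V.signedIso_tprod e (δ := fun v => (a v).1)
      (x := fun v => (V.obj (Γ.genus v) (Γ.val v)).homBasis (a v)) (y := y) ⟨hm, hy⟩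
    rw [signOf_add, mul_comm, mul_smul]
    exact congrArg _ h
  · exact fun v => (StableGraph.autConf e).isEmb_φ.vfac V.char (Sum.inl v)
  · intro v
    -- After as many steps as the orbit has vertices, the target is v again and Φ is the permutation
    -- of its flags whose cycle type enters `vfac`.
    obtain ⟨w, hw, Φ, h1, h2, h3⟩ := V.iterate_relabel e (orb e.vertPerm v).card v
    have hv : (e.vertPerm ^ (orb e.vertPerm v).card) v = v :=
      (pow_eq_pow_iff _ v _ 0).mpr (by simp [Nat.ModEq])
    obtain rfl : v = w := hv.symm.trans h1
    have h4 : (StableGraph.autConf e).vfac V.char (Sum.inl v) =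
        (V.obj (Γ.genus v) (Γ.val v)).str Φ := by
      have h6 : (orb (StableGraph.autConf e).φ (Sum.inl v)).card = (orb e.vertPerm v).card :=
        card_orb_map (φ := e.vertPerm) (ψ := (StableGraph.autConf e).φ)
          ⟨Sum.inl, Sum.inl_injective⟩ (fun _ => rfl) v
      rw [Conf.vfac, h6]
      have h5 : (StableGraph.autConf e).flags (Sum.inl v) = Finset.univ.map
          ⟨fun i : Fin (Γ.val v) => (Sum.inr ⟨v, i⟩ : Fin Γ.nv ⊕ Γ.Flag), fun i j h => by
            simpa using h⟩ := by
        ext y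
        rw [Conf.mem_flags, Finset.mem_map]
        constructor
        · rcases y with w | ⟨w, i⟩
          · exact fun h => (h.2 rfl).elim
          · rintro ⟨h, -⟩
            obtain rfl := Sum.inl_injective h
            exact ⟨i, Finset.mem_univ _, rfl⟩
        · rintro ⟨i, -, rfl⟩
          exact ⟨rfl, Sum.inl_ne_inr⟩
      rw [h5]
      exact V.char_cyc _ Φ _ h2
    rw [h4, DGRep.str_eq_sum_homBasis]
    refine Finset.sum_congr rfl fun i _ => ?_
    rw [h3, Pi.single_eq_same]
    rfl

end StableSModule

/-! ### Averaging over isomorphisms, and the character of 𝕄𝒱((g, n)). -/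

namespace StableGraph

variable {g n : ℕ} {Γ Γ' Γ'' : StableGraph g n}

/-- The composition of isomorphisms. -/
def Iso.trans (e : Γ.Iso Γ') (e' : Γ'.Iso Γ'') : Γ.Iso Γ'' where
  vert := e.vert.trans e'.vert
  genus_vert v := (e.genus_vert v).trans (e'.genus_vert _)
  flag v := (e.flag v).trans (e'.flag _)
  inv_flag a := (e'.inv_flag ⟨e.vert a.1, e.flag a.1 a.2⟩).trans
    (congrArg (fun b : Γ'.Flag => (⟨e'.vert b.1, e'.flag b.1 b.2⟩ : Γ''.Flag)) (e.inv_flag a))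
  leg_flag i := (e'.leg_flag i).trans
    (congrArg (fun b : Γ'.Flag => (⟨e'.vert b.1, e'.flag b.1 b.2⟩ : Γ''.Flag)) (e.leg_flag i))

/-- An isomorphism is invertible, so composing with it is a bijection; the average over all
isomorphisms out of a graph is therefore invariant. -/
theorem Iso.trans_bijective (e : Γ.Iso Γ') :
    Function.Bijective (e.trans : Γ'.Iso Γ'' → Γ.Iso Γ'') := by
  constructor
  · intro f f' h
    refine Iso.equiv_injective (Equiv.ext fun x => ?_)
    obtain ⟨x, rfl⟩ := e.equiv.surjective x
    have := congrArg (fun f => f.equiv x) h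
    rcases x with x | x <;> exact this
  · intro f
    -- The inverse on flags is defined over the vertex `e.vert (e.vert.symm w)`, which equals w only
    -- propositionally; hence the cast.
    let flag : ∀ w, Fin (Γ'.val w) ≃ Fin (Γ''.val (f.vert (e.vert.symm w))) := fun w =>
      (finCongr (congrArg Γ'.val (e.vert.apply_symm_apply w)).symm).trans
        ((e.flag (e.vert.symm w)).symm.trans (f.flag (e.vert.symm w)))
    have key : ∀ b : Γ.Flag, (⟨f.vert (e.vert.symm (e.vert b.1)),
        flag (e.vert b.1) (e.flag b.1 b.2)⟩ : Γ''.Flag) = ⟨f.vert b.1, f.flag b.1 b.2⟩ := by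
      rintro ⟨v, i⟩
      have h : ∀ (v' : Fin Γ.nv) (h : v = v') (j : Fin (Γ'.val (e.vert v'))),
          HEq (e.flag v i) j → (⟨f.vert v', f.flag v' ((e.flag v').symm j)⟩ : Γ''.Flag) =
            ⟨f.vert v, f.flag v i⟩ := by
        rintro v' rfl j hj
        rw [← eq_of_heq hj, Equiv.symm_apply_apply]
      refine h _ (e.vert.symm_apply_apply v).symm _ ?_
      have h2 : ∀ {a b : ℕ} (h : a = b) (i : Fin a), HEq i (finCongr h i) := by
        rintro a _ rfl i
        rfl
      exact h2 _ _
    have hE : ∀ a : Γ'.Flag, ∃ b : Γ.Flag, (⟨e.vert b.1, e.flag b.1 b.2⟩ : Γ'.Flag) = a :=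
      (Equiv.sigmaCongr (β₂ := fun w => Fin (Γ'.val w)) e.vert e.flag).surjective
    refine ⟨⟨e.vert.symm.trans f.vert, fun w => ?_, flag, fun a => ?_, fun i => ?_⟩, ?_⟩
    · rw [Equiv.trans_apply, ← f.genus_vert, e.genus_vert, Equiv.apply_symm_apply]
    · obtain ⟨b, rfl⟩ := hE a
      rw [e.inv_flag]
      exact (congrArg Γ''.inv (key b)).trans ((f.inv_flag b).trans (key (Γ.inv b)).symm)
    · rw [e.leg_flag]
      exact (f.leg_flag i).trans (key _).symm
    · refine Iso.equiv_injective (Equiv.ext fun x => ?_)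
      rcases x with x | x
      · exact congrArg (fun v => Sum.inl (f.vert v)) (e.vert.symm_apply_apply x)
      · exact congrArg Sum.inr (key x)

/-- Isomorphisms out of isomorphic graphs correspond to each other. -/
def Iso.transEquiv (e : Γ.Iso Γ') : (Σ Γ'', Γ'.Iso Γ'') ≃ Σ Γ'', Γ.Iso Γ'' :=
  Equiv.sigmaCongrRight fun _ => Equiv.ofBijective e.trans e.trans_bijective

theorem Iso.numIso_eq (e : Γ.Iso Γ') : Γ'.numIso = Γ.numIso := Nat.card_congr e.transEquiv

theorem numIso_ne_zero (k : Type u) [Field k] [CharZero k] (Γ : StableGraph g n) :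
    (Γ.numIso : k) ≠ 0 := by
  have : Nonempty (Σ Γ', Γ.Iso Γ') :=
    ⟨⟨Γ, Equiv.refl _, fun _ => rfl, fun _ => Equiv.refl _, fun _ => rfl, fun _ => rfl⟩⟩
  exact Nat.cast_ne_zero.mpr Nat.card_pos.ne'

end StableGraph

/-- The trace of an endomorphism of a finite direct sum. -/
theorem trace_directSum {k : Type u} [Field k] {ι : Type} [Fintype ι] [DecidableEq ι]
    {M : ι → Type v} [∀ i, AddCommGroup (M i)] [∀ i, Module k (M i)]
    [∀ i, FiniteDimensional k (M i)] (A : DirectSum ι M →ₗ[k] DirectSum ι M) :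
    LinearMap.trace k _ A = ∑ i, LinearMap.trace k (M i)
      (DirectSum.component k ι M i ∘ₗ A ∘ₗ DirectSum.lof k ι M i) := by
  have h : A = ∑ i, (A ∘ₗ DirectSum.lof k ι M i) ∘ₗ DirectSum.component k ι M i := by
    refine DirectSum.linearMap_ext k fun i => LinearMap.ext fun x => ?_
    rw [LinearMap.comp_apply, LinearMap.comp_apply, LinearMap.sum_apply,
      Finset.sum_eq_single i]
    · simp [DirectSum.component.lof_self]
    · intro j _ hj
      simp [DirectSum.component.of, hj.symm]
    · simp
  conv_lhs => rw [h, map_sum]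
  exact Finset.sum_congr rfl fun i _ => LinearMap.trace_comp_comm' _ _

namespace StableSModule

variable {k : Type u} [Field k] (V : StableSModule.{u, v} k) {g n : ℕ}
variable {Γ Γ' Γ'' : StableGraph g n}

theorem tensor_ext {M : Type*} [AddCommGroup M] [Module k M] {f f' : V.tensor Γ →ₗ[k] M}
    (h : ∀ (δ : Fin Γ.nv → ℤ) (x : ∀ v, (V.obj (Γ.genus v) (Γ.val v)).carrier),
      (∀ v, x v ∈ (V.obj (Γ.genus v) (Γ.val v)).gr (δ v)) →
        f (PiTensorProduct.tprod k x) = f' (PiTensorProduct.tprod k x)) : f = f' := by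
  refine PiTensorProduct.ext (MultilinearMap.ext fun x => ?_)
  change f (PiTensorProduct.tprod k x) = f' (PiTensorProduct.tprod k x)
  choose s hs using fun v => (V.obj (Γ.genus v) (Γ.val v)).exists_sum_proj (x v)
  have hx : x = fun v => ∑ i ∈ s v, (V.obj (Γ.genus v) (Γ.val v)).proj i (x v) := funext hs
  have ht := (PiTensorProduct.tprod k
    (s := fun v : Fin Γ.nv => (V.obj (Γ.genus v) (Γ.val v)).carrier)).map_sum_finset
    (fun v i => (V.obj (Γ.genus v) (Γ.val v)).proj i (x v)) s
  rw [← hx] at ht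
  rw [ht, map_sum, map_sum]
  exact Finset.sum_congr rfl fun δ _ => h δ _ fun v => (V.obj _ _).proj_mem _ _

/-- The unsigned maps compose, and the Koszul signs satisfy the cocycle rule `koszulExp_comp`. -/
theorem signedIso_trans (e : Γ.Iso Γ') (e' : Γ'.Iso Γ'') :
    V.signedIso (e.trans e') = V.signedIso e' ∘ₗ V.signedIso e := by
  refine V.tensor_ext fun δ x hx => ?_
  obtain ⟨y, hy⟩ := V.exists_image e x
  obtain ⟨z, hz⟩ := V.exists_image e' y
  have h1 : V.IsRelated Γ Γ' e δ x y := ⟨hx, hy⟩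
  have h2 : V.IsRelated Γ' Γ'' e' _ y z := ⟨h1.mem', hz⟩
  have h3 : V.IsRelated Γ Γ'' (e.trans e') δ x z := ⟨hx, fun v => by
    have h4 := hz (e.vert v)
    rw [hy, relabel_relabel] at h4
    exact h4⟩
  rw [LinearMap.comp_apply, V.signedIso_tprod e h1, map_smul, V.signedIso_tprod e' h2,
    V.signedIso_tprod _ h3, smul_smul, ← signOf_add, add_comm]
  congr 1
  exact signOf_eq_of_even (koszulExp_comp e.vert e'.vert δ _ fun v => by simp)

theorem mkQ_signedIso (e : Γ.Iso Γ') (t : V.tensor Γ) :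
    (V.relations g n).mkQ (DirectSum.lof k _ (fun Γ => V.tensor Γ) Γ' (V.signedIso e t)) =
      (V.relations g n).mkQ (DirectSum.lof k _ (fun Γ => V.tensor Γ) Γ t) := by
  have h : (V.relations g n).mkQ ∘ₗ DirectSum.lof k _ (fun Γ => V.tensor Γ) Γ' ∘ₗ V.signedIso e =
      (V.relations g n).mkQ ∘ₗ DirectSum.lof k _ (fun Γ => V.tensor Γ) Γ := by
    refine V.tensor_ext fun δ x hx => ?_
    obtain ⟨y, hy⟩ := V.exists_image e x
    have h1 : V.IsRelated Γ Γ' e δ x y := ⟨hx, hy⟩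
    have h2 : (V.relations g n).mkQ (V.pureAt Γ' y) =
        signOf k (koszulExp e.vert δ) • (V.relations g n).mkQ (V.pureAt Γ x) := by
      rw [← map_smul, ← sub_eq_zero, ← map_sub, Submodule.mkQ_apply, Submodule.Quotient.mk_eq_zero]
      exact Submodule.subset_span ⟨Γ, Γ', e, δ, x, y, h1, rfl⟩
    rw [LinearMap.comp_apply, LinearMap.comp_apply, V.signedIso_tprod e h1, map_smul, map_smul]
    refine (congrArg _ h2).trans ?_
    rw [smul_smul, signOf_mul_self, one_smul]
    rfl
  exact LinearMap.congr_fun h t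

variable (g n) in
/-- The average over the isomorphisms out of a graph. -/
def average : V.graphSum g n →ₗ[k] V.graphSum g n :=
  DirectSum.toModule k _ _ fun Γ => (Γ.numIso : k)⁻¹ • ∑ p : Σ Γ', Γ.Iso Γ',
    DirectSum.lof k _ (fun Γ => V.tensor Γ) p.1 ∘ₗ V.signedIso p.2

theorem average_lof (t : V.tensor Γ) :
    V.average g n (DirectSum.lof k _ (fun Γ => V.tensor Γ) Γ t) =
      (Γ.numIso : k)⁻¹ • ∑ p : Σ Γ', Γ.Iso Γ',
        DirectSum.lof k _ (fun Γ => V.tensor Γ) p.1 (V.signedIso p.2 t) := by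
  rw [average, DirectSum.toModule_lof, LinearMap.smul_apply, LinearMap.sum_apply]
  rfl

theorem average_signedIso (e : Γ.Iso Γ') (t : V.tensor Γ) :
    V.average g n (DirectSum.lof k _ (fun Γ => V.tensor Γ) Γ' (V.signedIso e t)) =
      V.average g n (DirectSum.lof k _ (fun Γ => V.tensor Γ) Γ t) := by
  rw [average_lof, average_lof, e.numIso_eq]
  congr 1
  refine Fintype.sum_equiv e.transEquiv _ _ fun p => ?_
  exact congrArg _ (LinearMap.congr_fun (V.signedIso_trans e p.2) t).symm

/-- The average takes the same value on an element and on its image under an isomorphism. It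
therefore descends to the colimit, where it becomes a section of the projection. -/
theorem relations_le_ker_average : V.relations g n ≤ LinearMap.ker (V.average g n) := by
  refine Submodule.span_le.mpr ?_
  rintro _ ⟨Γ, Γ', e, δ, x, y, h, rfl⟩
  have h1 := V.average_signedIso e (PiTensorProduct.tprod k x)
  rw [V.signedIso_tprod e h, map_smul, map_smul] at h1
  change V.average g n _ = 0
  rw [map_sub, map_smul, sub_eq_zero]
  refine Eq.trans ?_ (congrArg (signOf k (koszulExp e.vert δ) • ·) h1)
  rw [smul_smul, signOf_mul_self, one_smul]
  rfl

variable [CharZero k]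

/-- In the colimit all the images of an element under isomorphisms coincide with it, and the average
has total weight 1. -/
theorem mkQ_average (z : V.graphSum g n) :
    (V.relations g n).mkQ (V.average g n z) = (V.relations g n).mkQ z := by
  have h : (V.relations g n).mkQ ∘ₗ V.average g n = (V.relations g n).mkQ := by
    refine DirectSum.linearMap_ext k fun Γ => LinearMap.ext fun t => ?_
    rw [LinearMap.comp_apply, LinearMap.comp_apply, average_lof, map_smul, map_sum,
      Finset.sum_congr rfl fun p _ => V.mkQ_signedIso p.2 t, Finset.sum_const, Finset.card_univ,
      ← Nat.card_eq_fintype_card, ← Nat.cast_smul_eq_nsmul k, smul_smul]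
    erw [inv_mul_cancel₀ (Γ.numIso_ne_zero k), one_smul]
    rfl
  exact LinearMap.congr_fun h z

theorem scale_mkQ (z : V.graphSum g n) :
    (V.free.obj g n).scale (signOf k) ((V.relations g n).mkQ z) =
      (V.relations g n).mkQ (V.graphMap V.tensorSign z) := by
  have h : (V.free.obj g n).scale (signOf k) ∘ₗ (V.relations g n).mkQ =
      (V.relations g n).mkQ ∘ₗ V.graphMap V.tensorSign := by
    refine DirectSum.linearMap_ext k fun Γ => V.tensor_ext fun δ x hx => ?_
    change (V.free.obj g n).scale (signOf k) ((V.relations g n).mkQ (V.pureAt Γ x)) =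
      (V.relations g n).mkQ (V.graphMap V.tensorSign (V.pureAt Γ x))
    have h1 : (V.relations g n).mkQ (V.pureAt Γ x) ∈ V.freeGr g n (∑ v, δ v) :=
      Submodule.subset_span ⟨Γ, δ, x, hx, rfl, rfl⟩
    refine (DGRep.scale_apply (V.free.obj g n) _ h1).trans ?_
    rw [V.graphMap_pureAt, V.tensorSign_tprod hx, map_smul, map_smul]
    rfl
  exact LinearMap.congr_fun h z

variable [∀ g n, FiniteDimensional k (V.obj g n).carrier]

instance (Γ : StableGraph g n) : FiniteDimensional k (V.tensor Γ) :=
  Module.Finite.of_basis (Basis.piTensorProduct fun v =>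
    (V.obj (Γ.genus v) (Γ.val v)).homBasis)

instance free_finiteDimensional (g n : ℕ) : FiniteDimensional k (V.free.obj g n).carrier := by
  have h : FiniteDimensional k (V.graphSum g n ⧸ V.relations g n) := inferInstance
  exact h

/-- The supertrace of a permutation on `𝕄V((g, n))`. -/
theorem free_str (σ : Perm (Fin n)) : (V.free.obj g n).str σ =
    ∑ Γ : StableGraph g n, (Γ.numIso : k)⁻¹ *
      ∑ e : (Γ.smulLeg σ).Iso Γ, StableGraph.autFactor V.char e := by
  let f : V.graphSum g n →ₗ[k] V.graphSum g n := V.graphRho g n σ ∘ₗ V.graphMap V.tensorSign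
  let s : V.freeCarrier g n →ₗ[k] V.graphSum g n :=
    (V.relations g n).liftQ (V.average g n) V.relations_le_ker_average
  -- As s is a section of the projection, the operator on the quotient factors through the direct
  -- sum over graphs.
  have h1 : ((V.free.obj g n).scale (signOf k) ∘ₗ (V.free.obj g n).ρ σ :
      V.freeCarrier g n →ₗ[k] V.freeCarrier g n) = (V.relations g n).mkQ ∘ₗ (f ∘ₗ s) := by
    refine LinearMap.ext fun z => ?_
    refine (LinearMap.congr_fun (DGRep.scale_ρ (V.free.obj g n) (signOf k) σ) z).trans ?_
    obtain ⟨z, rfl⟩ := (V.relations g n).mkQ_surjective z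
    change (V.free.obj g n).ρ σ ((V.free.obj g n).scale (signOf k) ((V.relations g n).mkQ z)) =
      (V.free.obj g n).ρ σ ((V.relations g n).mkQ (V.graphMap V.tensorSign (V.average g n z)))
    rw [← scale_mkQ, mkQ_average]
  have h2 : (V.free.obj g n).str σ = LinearMap.trace k (V.freeCarrier g n)
      ((V.relations g n).mkQ ∘ₗ (f ∘ₗ s)) := congrArg _ h1
  have h3 : (f ∘ₗ s) ∘ₗ (V.relations g n).mkQ = f ∘ₗ V.average g n := by
    rw [LinearMap.comp_assoc]
    exact congrArg _ (Submodule.liftQ_mkQ _ _ _)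
  -- Cyclicity of the trace, used twice, replaces the operator on the quotient by the relabelling
  -- followed by the average, on the direct sum over graphs. Only diagonal blocks count.
  rw [h2, LinearMap.trace_comp_comm', h3, LinearMap.trace_comp_comm', trace_directSum]
  refine Finset.sum_congr rfl fun Γ _ => ?_
  -- In the block of Γ, only the isomorphisms from the relabelled graph back to Γ remain, that is,
  -- the automorphisms inducing σ on the legs.
  have h4 : DirectSum.component k _ (fun Γ => V.tensor Γ) Γ ∘ₗ (V.average g n ∘ₗ f) ∘ₗ
      DirectSum.lof k _ (fun Γ => V.tensor Γ) Γ = (Γ.numIso : k)⁻¹ •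
        ∑ e : (Γ.smulLeg σ).Iso Γ, V.signedIso e ∘ₗ V.tensorRelabel σ Γ ∘ₗ V.tensorSign Γ := by
    refine LinearMap.ext fun t => ?_
    have h5 : f (DirectSum.lof k _ (fun Γ => V.tensor Γ) Γ t) =
        DirectSum.lof k _ (fun Γ => V.tensor Γ) (Γ.smulLeg σ)
          (V.tensorRelabel σ Γ (V.tensorSign Γ t)) := by
      change V.graphRho g n σ (V.graphMap V.tensorSign
        (DirectSum.lof k _ (fun Γ => V.tensor Γ) Γ t)) = _
      rw [graphMap, DirectSum.toModule_lof, LinearMap.comp_apply, graphRho, DirectSum.toModule_lof]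
      rfl
    rw [LinearMap.comp_apply, LinearMap.comp_apply, LinearMap.comp_apply, h5, average_lof,
      StableGraph.numIso_smulLeg, map_smul, LinearMap.smul_apply, map_sum, LinearMap.sum_apply,
      Fintype.sum_sigma, Finset.sum_eq_single Γ]
    · simp only [DirectSum.component.lof_self]
      rfl
    · intro Γ' _ hΓ
      refine Finset.sum_eq_zero fun e _ => ?_
      simp [DirectSum.component.of, hΓ]
    · simp
  rw [h4, map_smul, map_sum, smul_eq_mul]
  exact congrArg _ (Finset.sum_congr rfl fun e _ => V.trace_signedIso e)

/-- The characteristic of the free modular operad generated by a finite-dimensional stable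
`S`-module. -/
theorem free_characteristic : V.free.characteristic =
    plethLog (expLaplacian (plethExp V.characteristic)) := by
  rw [V.characteristic_eq, ← Conf.gsum_conn_eq, Conf.gsum_graphs, characteristic]
  congr 1
  funext a
  rw [DGRep.ch_eq]
  simp only [free_str]

end StableSModule

/-! ### The equivariant retraction of a complex onto its homology. -/

namespace DGRep

variable {k : Type u} [Field k] {G : Type} [Group G] (V : DGRep.{u, v} k G)

theorem ρ_inv_ρ (σ : G) (x : V.carrier) : V.ρ σ⁻¹ (V.ρ σ x) = x := by
  rw [← Module.End.mul_apply, ← map_mul, inv_mul_cancel, map_one]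
  rfl

/-- A generalized inverse of the differential which is homogeneous and equivariant. -/
theorem exists_pseudoinverse [CharZero k] [Fintype G] : ∃ h : V.carrier →ₗ[k] V.carrier,
    (∀ i, ∀ x ∈ V.gr i, h x ∈ V.gr (i + 1)) ∧ (∀ σ x, V.ρ σ (h x) = h (V.ρ σ x)) ∧
      ∀ x, V.d (h (V.d x)) = V.d x := by
  -- A linear section of d over its image, extended arbitrarily. Homogeneity and then equivariance
  -- are imposed afterwards, without spoiling d t d = d.
  obtain ⟨s, hs⟩ := V.d.rangeRestrict.exists_rightInverse_of_surjective V.d.range_rangeRestrict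
  obtain ⟨t, ht⟩ := s.exists_extend
  have hdt : ∀ x, V.d (t (V.d x)) = V.d x := by
    intro x
    have h1 : t (V.d x) = s ⟨V.d x, x, rfl⟩ := LinearMap.congr_fun ht ⟨V.d x, x, rfl⟩
    rw [h1]
    exact congrArg Subtype.val (LinearMap.congr_fun hs ⟨V.d x, x, rfl⟩)
  -- The part of t which is homogeneous of degree 1.
  let q : V.carrier →ₗ[k] V.carrier := DirectSum.toModule k ℤ V.carrier
    (fun i => V.proj (i + 1) ∘ₗ t ∘ₗ (V.gr i).subtype) ∘ₗ V.decomp.symm.toLinearMap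
  have hq : ∀ i, ∀ x ∈ V.gr i, q x = V.proj (i + 1) (t x) := by
    intro i x hx
    simp [q, V.decomp_symm_apply hx]
  have hdq : ∀ x, V.d (q (V.d x)) = V.d x := by
    intro x
    induction x using V.induction_gr with
    | hom i x hx =>
      rw [hq _ _ (V.d_mem i x hx), V.d_proj, hdt, add_sub_cancel_right]
      exact V.proj_apply_same (V.d_mem i x hx)
    | zero => simp
    | add x y hx hy => simp [hx, hy]
  let c : k := (Fintype.card G : k)⁻¹
  -- Average over the group; its order is invertible in characteristic 0.
  let h : V.carrier →ₗ[k] V.carrier := c • ∑ σ, V.ρ σ⁻¹ ∘ₗ q ∘ₗ V.ρ σ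
  have hh : ∀ x, h x = c • ∑ σ, V.ρ σ⁻¹ (q (V.ρ σ x)) := by
    intro x
    simp [h]
  refine ⟨h, fun i x hx => ?_, fun τ x => ?_, fun x => ?_⟩
  · rw [hh]
    refine Submodule.smul_mem _ _ (Submodule.sum_mem _ fun σ _ => V.ρ_mem _ _ _ ?_)
    rw [hq i _ (V.ρ_mem σ i x hx)]
    exact V.proj_mem _ _
  · rw [hh, hh, map_smul, map_sum]
    congr 1
    refine Fintype.sum_equiv (Equiv.mulRight τ⁻¹) _ _ fun σ => ?_
    change V.ρ τ _ = V.ρ (σ * τ⁻¹)⁻¹ (q (V.ρ (σ * τ⁻¹) (V.ρ τ x)))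
    rw [← Module.End.mul_apply, ← map_mul, ← Module.End.mul_apply (V.ρ (σ * τ⁻¹)), ← map_mul,
      inv_mul_cancel_right, mul_inv_rev, inv_inv]
  · rw [hh, map_smul, map_sum]
    have h1 : ∀ σ, V.d (V.ρ σ⁻¹ (q (V.ρ σ (V.d x)))) = V.d x := by
      intro σ
      rw [← V.ρ_d, V.ρ_d σ, hdq, ← V.ρ_d, ρ_inv_ρ]
    rw [Finset.sum_congr rfl fun σ _ => h1 σ, Finset.sum_const, Finset.card_univ,
      ← Nat.cast_smul_eq_nsmul k, smul_smul, inv_mul_cancel₀ (Nat.cast_ne_zero.mpr Fintype.card_ne_zero),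
      one_smul]

/-- The homology is an equivariant deformation retract. -/
theorem exists_retract [CharZero k] [Fintype G] : ∃ (h : V.carrier →ₗ[k] V.carrier)
    (i : V.homology.carrier →ₗ[k] V.carrier) (p : V.carrier →ₗ[k] V.homology.carrier),
    (∀ j, ∀ x ∈ V.gr j, h x ∈ V.gr (j + 1)) ∧ (∀ σ x, V.ρ σ (h x) = h (V.ρ σ x)) ∧
    (∀ j, ∀ x ∈ V.homology.gr j, i x ∈ V.gr j) ∧ (∀ σ x, V.ρ σ (i x) = i (V.homology.ρ σ x)) ∧
    (∀ j, ∀ x ∈ V.gr j, p x ∈ V.homology.gr j) ∧ (∀ σ x, V.homology.ρ σ (p x) = p (V.ρ σ x)) ∧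
    (∀ x, V.d (i x) = 0) ∧ (∀ x, p (V.d x) = 0) ∧ (∀ x, p (i x) = x) ∧
      ∀ x, i (p x) + (V.d (h x) + h (V.d x)) = x := by
  obtain ⟨h, h1, h2, h3⟩ := V.exists_pseudoinverse
  -- The map 1 - dh - hd takes values in cycles and kills boundaries, because d h d = d. It induces
  -- both i and p, so that i p is its square.
  let e : V.carrier →ₗ[k] V.carrier := LinearMap.id - V.d ∘ₗ h - h ∘ₗ V.d
  have he : ∀ x, e x = x - V.d (h x) - h (V.d x) := fun x => rfl
  have hde : ∀ x, V.d (e x) = 0 := fun x => by simp [he, V.d_d, h3]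
  have hed : ∀ x, e (V.d x) = 0 := fun x => by simp [he, V.d_d, h3]
  have hρ : ∀ σ x, V.ρ σ (e x) = e (V.ρ σ x) := fun σ x => by
    simp only [he, map_sub, V.ρ_d, h2]
  have hgr : ∀ j, ∀ x ∈ V.gr j, e x ∈ V.gr j := by
    intro j x hx
    have h4 := V.d_mem _ _ (h1 j x hx)
    have h5 := h1 _ _ (V.d_mem j x hx)
    rw [add_sub_cancel_right] at h4
    rw [sub_add_cancel] at h5
    exact Submodule.sub_mem _ (Submodule.sub_mem _ hx h4) h5
  let i : (LinearMap.ker V.d ⧸ V.bdry) →ₗ[k] V.carrier :=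
    V.bdry.liftQ (e ∘ₗ (LinearMap.ker V.d).subtype) (by
      rintro x ⟨y, hy⟩
      change e (x : V.carrier) = 0
      rw [show (x : V.carrier) = V.d y from hy.symm, hed])
  let c : V.carrier →ₗ[k] LinearMap.ker V.d := e.codRestrict _ hde
  let p : V.carrier →ₗ[k] (LinearMap.ker V.d ⧸ V.bdry) := V.bdry.mkQ ∘ₗ c
  -- The correction term is needed since e need not be idempotent: e² = 1 - dh - hd + d h h d, so
  -- the homotopy from i p to the identity is h - h h d.
  refine ⟨h - h ∘ₗ h ∘ₗ V.d, i, p, ?_, ?_, ?_, ?_, ?_, ?_, ?_, ?_, ?_, ?_⟩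
  · intro j x hx
    have h4 := h1 _ _ (h1 _ _ (V.d_mem j x hx))
    rw [sub_add_cancel] at h4
    exact Submodule.sub_mem _ (h1 j x hx) h4
  · intro σ x
    change V.ρ σ (h x - h (h (V.d x))) = h (V.ρ σ x) - h (h (V.d (V.ρ σ x)))
    rw [map_sub, h2, h2, h2, V.ρ_d]
  · rintro j _ ⟨x, hx, rfl⟩
    exact hgr j x hx
  · intro σ x
    obtain ⟨x, rfl⟩ := V.bdry.mkQ_surjective x
    exact hρ σ x
  · intro j x hx
    exact ⟨c x, hgr j x hx, rfl⟩
  · intro σ x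
    exact congrArg V.bdry.mkQ (Subtype.ext (hρ σ x))
  · intro x
    obtain ⟨x, rfl⟩ := V.bdry.mkQ_surjective x
    exact hde x
  · intro x
    have h4 : c (V.d x) = 0 := Subtype.ext (hed x)
    change V.bdry.mkQ (c (V.d x)) = 0
    rw [h4, map_zero]
  · intro x
    obtain ⟨⟨x, hx⟩, rfl⟩ := V.bdry.mkQ_surjective x
    have hx' : V.d x = 0 := hx
    refine (Submodule.Quotient.eq V.bdry).mpr ⟨- h x - h (e x), ?_⟩
    change V.d (- h x - h (e x)) = e (e x) - x
    rw [he (e x), hde, map_zero, sub_zero, map_sub, map_neg, he x, hx', map_zero, sub_zero]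
    abel
  · intro x
    change e (e x) + (V.d (h x - h (h (V.d x))) + (h (V.d x) - h (h (V.d (V.d x))))) = x
    rw [he (e x), hde, V.d_d, he]
    simp only [map_sub, map_zero, h3]
    abel

theorem ch_congr {n : ℕ} {V W : DGRep.{u, v} k (Perm (Fin n))} (Φ : V.carrier ≃ₗ[k] W.carrier)
    (h1 : ∀ i, ∀ x ∈ V.gr i, Φ x ∈ W.gr i) (h2 : ∀ i, ∀ x ∈ W.gr i, Φ.symm x ∈ V.gr i)
    (h3 : ∀ σ x, Φ (V.ρ σ x) = W.ρ σ (Φ x)) : V.ch = W.ch := by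
  have h : ∀ i σ, V.grTrace i σ = W.grTrace i σ := by
    intro i σ
    let Ψ : V.gr i ≃ₗ[k] W.gr i := LinearEquiv.ofLinearMap
      (Φ.toLinearMap.restrict (h1 i)) (Φ.symm.toLinearMap.restrict (h2 i))
      (LinearMap.ext fun x => Subtype.ext (Φ.apply_symm_apply x))
      (LinearMap.ext fun x => Subtype.ext (Φ.symm_apply_apply x))
    rw [grTrace, grTrace, ← LinearMap.trace_conj' _ Ψ]
    congr 1
    refine LinearMap.ext fun x => Subtype.ext ?_
    change Φ (V.ρ σ (Φ.symm x)) = W.ρ σ x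
    rw [h3, Φ.apply_symm_apply]
  simp only [ch, h]

end DGRep

/-! ### Functoriality of 𝕄 for graded equivariant maps. -/

namespace StableSModule

variable {k : Type u} [Field k]

/-- A homogeneous equivariant map of stable `S`-modules, which need not commute with the
differentials. -/
structure GrMap (V W : StableSModule.{u, v} k) where
  map : ∀ g n, (V.obj g n).carrier →ₗ[k] (W.obj g n).carrier
  map_mem : ∀ g n i, ∀ x ∈ (V.obj g n).gr i, map g n x ∈ (W.obj g n).gr i
  map_ρ : ∀ g n σ x, (W.obj g n).ρ σ (map g n x) = map g n ((V.obj g n).ρ σ x)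

namespace GrMap

variable {V W : StableSModule.{u, v} k} (f : GrMap V W) {g n : ℕ}

theorem map_relabel {g g' a b : ℕ} (hg : g = g') (φ : Fin a ≃ Fin b) (x : (V.obj g a).carrier) :
    f.map g' b (V.relabel hg φ x) = W.relabel hg φ (f.map g a x) := by
  have hab : a = b := by simpa using Fintype.card_congr φ
  subst hg hab
  exact (f.map_ρ g a φ x).symm

variable (g n) in
/-- The induced map on the direct sum over all graphs. -/
def graphSumMap : V.graphSum g n →ₗ[k] W.graphSum g n :=
  DirectSum.toModule k _ _ fun Γ => DirectSum.lof k _ (fun Γ => W.tensor Γ) Γ ∘ₗ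
    PiTensorProduct.map fun v => f.map (Γ.genus v) (Γ.val v)

theorem graphSumMap_pureAt (Γ : StableGraph g n)
    (x : ∀ v, (V.obj (Γ.genus v) (Γ.val v)).carrier) :
    f.graphSumMap g n (V.pureAt Γ x) = W.pureAt Γ fun v => f.map _ _ (x v) := by
  rw [graphSumMap, pureAt, DirectSum.toModule_lof, LinearMap.comp_apply,
    PiTensorProduct.map_tprod]
  rfl

theorem relations_le : V.relations g n ≤ (W.relations g n).comap (f.graphSumMap g n) := by
  refine Submodule.span_le.mpr ?_
  rintro _ ⟨Γ, Γ', e, δ, x, y, h, rfl⟩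
  change f.graphSumMap g n _ ∈ W.relations g n
  rw [map_sub, map_smul, graphSumMap_pureAt, graphSumMap_pureAt]
  refine Submodule.subset_span ⟨Γ, Γ', e, δ, _, _, ⟨fun v => f.map_mem _ _ _ _ (h.mem v),
    fun v => ?_⟩, rfl⟩
  rw [h.eq, map_relabel]

variable (g n) in
/-- The induced map of free modular operads. -/
def freeMap : V.freeCarrier g n →ₗ[k] W.freeCarrier g n :=
  (V.relations g n).mapQ (W.relations g n) (f.graphSumMap g n) f.relations_le

theorem freeMap_mkQ (Γ : StableGraph g n) (x : ∀ v, (V.obj (Γ.genus v) (Γ.val v)).carrier) :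
    f.freeMap g n ((V.relations g n).mkQ (V.pureAt Γ x)) =
      (W.relations g n).mkQ (W.pureAt Γ fun v => f.map _ _ (x v)) :=
  congrArg (W.relations g n).mkQ (f.graphSumMap_pureAt Γ x)

theorem freeMap_mem (i : ℤ) (z : V.freeCarrier g n) (hz : z ∈ V.freeGr g n i) :
    f.freeMap g n z ∈ W.freeGr g n i := by
  have h : V.freeGr g n i ≤ (W.freeGr g n i).comap (f.freeMap g n) := by
    refine Submodule.span_le.mpr ?_
    rintro _ ⟨Γ, δ, x, hx, hi, rfl⟩
    exact Submodule.subset_span ⟨Γ, δ, _, fun v => f.map_mem _ _ _ _ (hx v), hi, f.freeMap_mkQ Γ x⟩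
  exact h hz

theorem freeMap_rho (σ : Perm (Fin n)) (z : V.freeCarrier g n) :
    f.freeMap g n (V.freeRho g n σ z) = W.freeRho g n σ (f.freeMap g n z) := by
  refine V.free_induction (LinearMap.eqLocus (f.freeMap g n ∘ₗ V.freeRho g n σ)
    (W.freeRho g n σ ∘ₗ f.freeMap g n)) (fun Γ δ x _ => ?_) z
  rw [LinearMap.mem_eqLocus, LinearMap.comp_apply, LinearMap.comp_apply, freeMap_mkQ, freeRho_mkQ, freeRho_mkQ]
  exact f.freeMap_mkQ (Γ.smulLeg σ) x

theorem freeMap_d (hf : ∀ g n x, f.map g n ((V.obj g n).d x) = (W.obj g n).d (f.map g n x))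
    (z : V.freeCarrier g n) : f.freeMap g n (V.freeD g n z) = W.freeD g n (f.freeMap g n z) := by
  refine V.free_induction (LinearMap.eqLocus (f.freeMap g n ∘ₗ V.freeD g n)
    (W.freeD g n ∘ₗ f.freeMap g n)) (fun Γ δ x hx => ?_) z
  rw [LinearMap.mem_eqLocus, LinearMap.comp_apply, LinearMap.comp_apply, freeMap_mkQ, V.freeD_mkQ Γ δ x hx,
    W.freeD_mkQ Γ δ _ fun v => f.map_mem _ _ _ _ (hx v), map_sum]
  refine Finset.sum_congr rfl fun v _ => ?_
  rw [map_smul, freeMap_mkQ]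
  congr 3
  funext w
  rw [Function.apply_update (fun v => f.map (Γ.genus v) (Γ.val v)), hf]

theorem freeD_eq_zero (V : StableSModule.{u, v} k) (hd : ∀ g n x, (V.obj g n).d x = 0)
    (z : V.freeCarrier g n) : V.freeD g n z = 0 := by
  refine V.free_induction (LinearMap.ker (V.freeD g n)) (fun Γ δ x hx => ?_) z
  rw [LinearMap.mem_ker, V.freeD_mkQ Γ δ x hx]
  refine Finset.sum_eq_zero fun v _ => ?_
  rw [hd, pureAt, MultilinearMap.map_update_zero, map_zero, map_zero, smul_zero]

end GrMap

end StableSModule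

theorem degBefore_update_add_one {m : ℕ} (δ : Fin m → ℤ) {v w : Fin m} (h : v < w) :
    degBefore (Function.update δ v (δ v + 1)) w = degBefore δ w + 1 := by
  have h1 := degBefore_update_of_lt (Function.update δ v (δ v + 1)) h
  rw [Function.update_self, Function.update_idem, add_sub_cancel_right,
    Function.update_eq_self] at h1
  omega

/-! ### Homotopies extended to 𝕄𝒱 as derivations. -/

namespace StableSModule

variable {k : Type u} [Field k] (V : StableSModule.{u, v} k) {g n : ℕ}

/-- An equivariant operator of degree `1`. -/
structure Homotopy where
  map : ∀ g n, (V.obj g n).carrier →ₗ[k] (V.obj g n).carrier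
  map_mem : ∀ g n i, ∀ x ∈ (V.obj g n).gr i, map g n x ∈ (V.obj g n).gr (i + 1)
  map_ρ : ∀ g n σ x, (V.obj g n).ρ σ (map g n x) = map g n ((V.obj g n).ρ σ x)

namespace Homotopy

variable {V} (h : V.Homotopy) {Γ Γ' : StableGraph g n}

theorem map_relabel {g g' a b : ℕ} (hg : g = g') (φ : Fin a ≃ Fin b) (x : (V.obj g a).carrier) :
    h.map g' b (V.relabel hg φ x) = V.relabel hg φ (h.map g a x) := by
  have hab : a = b := by simpa using Fintype.card_congr φ
  subst hg hab
  exact (h.map_ρ g a φ x).symm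

/-- The application of the operator to the factor of the vertex `v`, with the Koszul sign. -/
def tensorAt (Γ : StableGraph g n) (v : Fin Γ.nv) : V.tensor Γ →ₗ[k] V.tensor Γ :=
  (PiTensorProduct.map fun w => if w = v then h.map (Γ.genus w) (Γ.val w) else LinearMap.id) ∘ₗ
    PiTensorProduct.map fun w => (V.obj (Γ.genus w) (Γ.val w)).scale
      fun i => if w < v then signOf k i else 1

variable (g n) in
/-- The extension of the operator to the direct sum over all graphs as a derivation. -/
def graphMap : V.graphSum g n →ₗ[k] V.graphSum g n :=
  V.graphMap fun Γ => ∑ v, h.tensorAt Γ v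

variable {δ : Fin Γ.nv → ℤ} {x : ∀ v, (V.obj (Γ.genus v) (Γ.val v)).carrier}

theorem tensorAt_tprod (v : Fin Γ.nv)
    (hx : ∀ v, x v ∈ (V.obj (Γ.genus v) (Γ.val v)).gr (δ v)) :
    h.tensorAt Γ v (PiTensorProduct.tprod k x) = signOf k (degBefore δ v) •
      PiTensorProduct.tprod k (Function.update x v (h.map _ _ (x v))) := by
  rw [tensorAt, LinearMap.comp_apply,
    V.map_scale_tprod (fun w i => if w < v then signOf k i else 1) hx, map_smul,
    PiTensorProduct.map_tprod, degBefore, signOf_sum]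
  congr 1
  · refine Finset.prod_congr rfl fun w _ => ?_
    split_ifs
    · rfl
    · exact signOf_zero.symm
  · congr 1
    funext w
    rcases eq_or_ne w v with rfl | hw
    · rw [if_pos rfl, Function.update_self]
    · rw [if_neg hw, Function.update_of_ne hw]
      rfl

theorem graphMap_pureAt (hx : ∀ v, x v ∈ (V.obj (Γ.genus v) (Γ.val v)).gr (δ v)) :
    h.graphMap g n (V.pureAt Γ x) = ∑ v, signOf k (degBefore δ v) •
      V.pureAt Γ (Function.update x v (h.map _ _ (x v))) := by
  rw [graphMap, V.graphMap_pureAt, LinearMap.sum_apply, map_sum]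
  refine Finset.sum_congr rfl fun v _ => ?_
  rw [h.tensorAt_tprod v hx, map_smul]
  rfl

theorem update_mem (v : Fin Γ.nv) (hx : ∀ v, x v ∈ (V.obj (Γ.genus v) (Γ.val v)).gr (δ v))
    (w : Fin Γ.nv) : Function.update x v (h.map _ _ (x v)) w ∈
      (V.obj (Γ.genus w) (Γ.val w)).gr (Function.update δ v (δ v + 1) w) := by
  rcases eq_or_ne w v with rfl | hw
  · rw [Function.update_self, Function.update_self]
    exact h.map_mem _ _ _ _ (hx w)
  · rw [Function.update_of_ne hw, Function.update_of_ne hw]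
    exact hx w

theorem relations_le : V.relations g n ≤ (V.relations g n).comap (h.graphMap g n) := by
  refine Submodule.span_le.mpr ?_
  rintro _ ⟨Γ, Γ', e, δ, x, y, hr, rfl⟩
  change h.graphMap g n _ ∈ V.relations g n
  rw [map_sub, map_smul, h.graphMap_pureAt hr.mem, h.graphMap_pureAt hr.mem', ← e.vert.sum_comp,
    Finset.smul_sum, ← Finset.sum_sub_distrib]
  refine Submodule.sum_mem _ fun v _ => ?_
  -- The sign rule already known for the differential is applied to the raised degrees: lowering δ'
  -- at v gives back δ.
  let δ' : Fin Γ.nv → ℤ := Function.update δ v (δ v + 1)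
  have hmem : V.pureAt Γ' (Function.update y (e.vert v) (h.map _ _ (y (e.vert v)))) -
      signOf k (koszulExp e.vert δ') • V.pureAt Γ (Function.update x v (h.map _ _ (x v))) ∈
        V.relations g n := by
    refine Submodule.subset_span ⟨Γ, Γ', e, δ', _, _, ⟨h.update_mem v hr.mem, fun w => ?_⟩, rfl⟩
    rcases eq_or_ne w v with rfl | hw
    · rw [Function.update_self, Function.update_self, hr.eq, map_relabel]
    · rw [Function.update_of_ne hw, Function.update_of_ne (e.vert.injective.ne hw), hr.eq]
  have hs := koszulExp_update e.vert δ' (fun w => δ' (e.vert.symm w)) (by simp) v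
  have h1 : Function.update δ' v (δ' v - 1) = δ := by simp [δ']
  have h2 : degBefore δ' v = degBefore δ v := degBefore_update_of_le δ le_rfl _
  have h3 : degBefore (fun w => δ' (e.vert.symm w)) (e.vert v) =
      degBefore (fun w => δ (e.vert.symm w)) (e.vert v) := by
    refine Finset.sum_congr rfl fun w _ => ?_
    split_ifs with hw
    · refine Function.update_of_ne ?_ _ _
      rintro rfl
      simp at hw
    · rfl
  rw [h1, h2, h3] at hs
  convert Submodule.smul_mem _
    (signOf k (degBefore (fun v => δ (e.vert.symm v)) (e.vert v))) hmem using 1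
  rw [smul_sub, smul_smul, smul_smul, ← signOf_add, ← signOf_add]
  congr 2
  refine signOf_eq_of_even ?_
  obtain ⟨c, hc⟩ := hs
  exact ⟨c - degBefore (fun v => δ (e.vert.symm v)) (e.vert v) +
    degBefore (fun v => δ (e.vert.symm v)) (e.vert v), by linarith⟩

variable (g n) in
/-- The extension of the operator to the free modular operad as a derivation. -/
def freeMap : V.freeCarrier g n →ₗ[k] V.freeCarrier g n :=
  (V.relations g n).mapQ (V.relations g n) (h.graphMap g n) h.relations_le

theorem freeMap_mkQ (hx : ∀ v, x v ∈ (V.obj (Γ.genus v) (Γ.val v)).gr (δ v)) :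
    h.freeMap g n ((V.relations g n).mkQ (V.pureAt Γ x)) = ∑ v, signOf k (degBefore δ v) •
      (V.relations g n).mkQ (V.pureAt Γ (Function.update x v (h.map _ _ (x v)))) := by
  change (V.relations g n).mkQ (h.graphMap g n _) = _
  rw [h.graphMap_pureAt hx, map_sum]
  simp only [map_smul]

variable (g n) in
/-- The anticommutator of the differential and the operator on the free modular operad. -/
def freeAnti : V.freeCarrier g n →ₗ[k] V.freeCarrier g n :=
  V.freeD g n ∘ₗ h.freeMap g n + h.freeMap g n ∘ₗ V.freeD g n

/-- The anticommutator is a derivation. -/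
theorem freeAnti_mkQ (hx : ∀ v, x v ∈ (V.obj (Γ.genus v) (Γ.val v)).gr (δ v)) :
    h.freeAnti g n ((V.relations g n).mkQ (V.pureAt Γ x)) =
      ∑ v, (V.relations g n).mkQ (V.pureAt Γ (Function.update x v
        ((V.obj _ _).d (h.map _ _ (x v)) + h.map _ _ ((V.obj _ _).d (x v))))) := by
  let D : Fin Γ.nv → (∀ v, (V.obj (Γ.genus v) (Γ.val v)).carrier) →
      ∀ v, (V.obj (Γ.genus v) (Γ.val v)).carrier :=
    fun v x => Function.update x v ((V.obj (Γ.genus v) (Γ.val v)).d (x v))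
  let H : Fin Γ.nv → (∀ v, (V.obj (Γ.genus v) (Γ.val v)).carrier) →
      ∀ v, (V.obj (Γ.genus v) (Γ.val v)).carrier :=
    fun v x => Function.update x v (h.map (Γ.genus v) (Γ.val v) (x v))
  let c : (∀ v, (V.obj (Γ.genus v) (Γ.val v)).carrier) → V.freeCarrier g n :=
    fun x => (V.relations g n).mkQ (V.pureAt Γ x)
  have hD : V.freeD g n (h.freeMap g n (c x)) = ∑ v, ∑ w,
      signOf k (degBefore δ v + degBefore (Function.update δ v (δ v + 1)) w) • c (D w (H v x)) := by
    simp only [c]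
    rw [h.freeMap_mkQ hx, map_sum]
    refine Finset.sum_congr rfl fun v _ => ?_
    rw [map_smul, V.freeD_mkQ Γ _ _ (h.update_mem v hx), Finset.smul_sum]
    refine Finset.sum_congr rfl fun w _ => ?_
    rw [smul_smul, ← signOf_add]
  have hH : h.freeMap g n (V.freeD g n (c x)) = ∑ v, ∑ w,
      signOf k (degBefore δ w + degBefore (Function.update δ w (δ w - 1)) v) • c (H v (D w x)) := by
    simp only [c]
    rw [V.freeD_mkQ Γ δ x hx, map_sum, Finset.sum_comm]
    refine Finset.sum_congr rfl fun w _ => ?_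
    rw [map_smul, h.freeMap_mkQ (V.update_mem Γ w δ x hx), Finset.smul_sum]
    refine Finset.sum_congr rfl fun v _ => ?_
    rw [smul_smul, ← signOf_add]
  have hodd : ∀ {i j : ℤ}, Even (i - j - 1) → signOf k i = - signOf k j := by
    intro i j hij
    have h1 : signOf k (-1) = -1 := by simp [signOf]
    rw [← neg_one_mul, ← h1, ← signOf_add]
    refine signOf_eq_of_even ?_
    obtain ⟨a, ha⟩ := hij
    exact ⟨a + 1, by linarith⟩
  change V.freeD g n (h.freeMap g n (c x)) + h.freeMap g n (V.freeD g n (c x)) = _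
  rw [hD, hH, ← Finset.sum_add_distrib]
  refine Finset.sum_congr rfl fun v _ => ?_
  rw [← Finset.sum_add_distrib, Finset.sum_eq_single v]
  · rw [degBefore_update_of_le δ le_rfl, degBefore_update_of_le δ le_rfl, signOf_add,
      signOf_mul_self, one_smul, one_smul]
    simp only [c, D, H, pureAt, Function.update_self, Function.update_idem]
    rw [← map_add, ← map_add, ← MultilinearMap.map_update_add]
  -- At distinct vertices the two operators of odd degree anticommute, so the mixed terms of dh and
  -- hd cancel.
  · intro w _ hw
    have hcomm : D w (H v x) = H v (D w x) := by
      simp only [D, H]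
      rw [Function.update_of_ne hw, Function.update_of_ne hw.symm, Function.update_comm hw]
    rw [hcomm, ← add_smul]
    refine smul_eq_zero_of_left ?_ _
    rw [add_eq_zero_iff_eq_neg]
    refine hodd ?_
    rcases lt_or_gt_of_ne hw with h1 | h1
    · rw [degBefore_update_of_le δ h1.le, degBefore_update_of_lt δ h1]
      exact ⟨0, by ring⟩
    · rw [degBefore_update_add_one δ h1, degBefore_update_of_le δ h1.le]
      exact ⟨0, by ring⟩
  · simp

variable (g n) in
/-- A polynomial in the anticommutator which kills the eigenvectors with eigenvalues
`1, …, B` and fixes the eigenvectors with eigenvalue `0`. -/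
def truncation : ℕ → V.freeCarrier g n →ₗ[k] V.freeCarrier g n
  | 0 => LinearMap.id
  | B + 1 => (LinearMap.id - ((B : k) + 1)⁻¹ • h.freeAnti g n) ∘ₗ truncation B

theorem truncation_succ (B : ℕ) (z : V.freeCarrier g n) : h.truncation g n (B + 1) z =
    h.truncation g n B z - ((B : k) + 1)⁻¹ • h.freeAnti g n (h.truncation g n B z) := rfl

/-- On a cycle z the anticommutator is d h z, a boundary. Each factor of the polynomial is 1 minus a
multiple of it, so the polynomial changes z by a boundary only. -/
theorem truncation_cycle [CharZero k] (B : ℕ) {z : V.freeCarrier g n} (hz : V.freeD g n z = 0) :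
    V.freeD g n (h.truncation g n B z) = 0 ∧ ∃ y, V.freeD g n y = h.truncation g n B z - z := by
  induction B with
  | zero => exact ⟨hz, 0, by simp [truncation]⟩
  | succ B ih =>
    obtain ⟨h1, y, hy⟩ := ih
    have h2 : h.freeAnti g n (h.truncation g n B z) =
        V.freeD g n (h.freeMap g n (h.truncation g n B z)) := by
      rw [freeAnti, LinearMap.add_apply, LinearMap.comp_apply, LinearMap.comp_apply, h1, map_zero,
        add_zero]
    rw [truncation_succ, h2]
    refine ⟨?_, y - ((B : k) + 1)⁻¹ • h.freeMap g n (h.truncation g n B z), ?_⟩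
    · rw [map_sub, map_smul, V.freeD_freeD, h1, smul_zero, sub_zero]
    · rw [map_sub, map_smul, hy]
      abel

theorem truncation_eigen (B : ℕ) {c : k} {z : V.freeCarrier g n}
    (hz : h.freeAnti g n z = c • z) :
    h.truncation g n B z = (∏ j ∈ Finset.range B, (1 - ((j : k) + 1)⁻¹ * c)) • z := by
  induction B with
  | zero => simp [truncation]
  | succ B ih =>
    rw [truncation_succ, ih, map_smul, hz, Finset.prod_range_succ, smul_comm _ c, smul_smul,
      smul_smul, ← sub_smul]
    congr 1
    ring

/-- Split each factor as f x + (x - f x). On the complement of the image of f, dh + hd is the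
identity, and on the image it is 0. A tensor with c factors in the complement is thus an eigenvector
with eigenvalue c, and the polynomial kills it unless c = 0, as c ≤ nv ≤ B. -/
theorem truncation_eq [CharZero k] (f : GrMap V V)
    (hf : ∀ g n x, f.map g n x + ((V.obj g n).d (h.map g n x) + h.map g n ((V.obj g n).d x)) = x)
    (hff : ∀ g n x, f.map g n (f.map g n x) = f.map g n x) (B : ℕ)
    (hB : Γ.nv ≤ B) (hx : ∀ v, x v ∈ (V.obj (Γ.genus v) (Γ.val v)).gr (δ v)) :
    h.truncation g n B ((V.relations g n).mkQ (V.pureAt Γ x)) =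
      f.freeMap g n ((V.relations g n).mkQ (V.pureAt Γ x)) := by
  let y : ∀ v, (V.obj (Γ.genus v) (Γ.val v)).carrier := fun v => f.map _ _ (x v)
  have hN : ∀ g n x, (V.obj g n).d (h.map g n x) + h.map g n ((V.obj g n).d x) =
      x - f.map g n x := fun g n x => eq_sub_of_add_eq' (hf g n x)
  have hsum : (V.relations g n).mkQ (V.pureAt Γ x) = ∑ s : Finset (Fin Γ.nv),
      (V.relations g n).mkQ (V.pureAt Γ (s.piecewise y (x - y))) := by
    rw [← map_sum]
    congr 1
    have h1 := (PiTensorProduct.tprod k (s := fun v : Fin Γ.nv =>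
      (V.obj (Γ.genus v) (Γ.val v)).carrier)).map_add_univ y (x - y)
    rw [add_sub_cancel] at h1
    rw [pureAt, h1, map_sum]
    rfl
  rw [hsum, map_sum, map_sum]
  refine Finset.sum_congr rfl fun s _ => ?_
  set u := s.piecewise y (x - y) with hu
  have hmem : ∀ v, u v ∈ (V.obj (Γ.genus v) (Γ.val v)).gr (δ v) := by
    intro v
    have h1 := f.map_mem _ _ _ _ (hx v)
    by_cases hv : v ∈ s
    · rw [hu, Finset.piecewise_eq_of_mem _ _ _ hv]
      exact h1
    · rw [hu, Finset.piecewise_eq_of_notMem _ _ _ hv]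
      exact Submodule.sub_mem _ (hx v) h1
  have hfu : ∀ v, f.map _ _ (u v) = if v ∈ s then u v else 0 := by
    intro v
    by_cases hv : v ∈ s
    · rw [if_pos hv, hu, Finset.piecewise_eq_of_mem _ _ _ hv]
      exact hff _ _ _
    · rw [if_neg hv, hu, Finset.piecewise_eq_of_notMem _ _ _ hv]
      change f.map _ _ (x v - f.map _ _ (x v)) = 0
      rw [map_sub, hff, sub_self]
  have hanti : h.freeAnti g n ((V.relations g n).mkQ (V.pureAt Γ u)) =
      ((sᶜ.card : ℕ) : k) • (V.relations g n).mkQ (V.pureAt Γ u) := by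
    rw [h.freeAnti_mkQ hmem, Nat.cast_smul_eq_nsmul, ← Finset.sum_const, ← Finset.sum_subset
      (Finset.subset_univ sᶜ)]
    · refine Finset.sum_congr rfl fun v hv => ?_
      rw [hN, hfu, if_neg (Finset.mem_compl.mp hv), sub_zero, Function.update_eq_self]
    · intro v _ hv
      rw [hN, hfu, if_pos (by simpa using hv), sub_self, pureAt, MultilinearMap.map_update_zero,
        map_zero, map_zero]
  rw [h.truncation_eigen B hanti, f.freeMap_mkQ]
  by_cases hs : s = Finset.univ
  · have h1 : (fun v => f.map _ _ (u v)) = u := funext fun v => by rw [hfu, hs, if_pos (by simp)]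
    rw [h1, hs, Finset.compl_univ, Finset.card_empty]
    simp
  · obtain ⟨v, hv⟩ : ∃ v, v ∉ s := by
      by_contra hc
      push Not at hc
      exact hs (Finset.eq_univ_iff_forall.mpr hc)
    have h1 : 0 < sᶜ.card := Finset.card_pos.mpr ⟨v, Finset.mem_compl.mpr hv⟩
    have h2 : sᶜ.card ≤ Γ.nv := (Finset.card_le_univ _).trans (Fintype.card_fin _).le
    have h3 : V.pureAt Γ (fun v => f.map _ _ (u v)) = 0 := by
      rw [pureAt, MultilinearMap.map_coord_zero _ v (by rw [hfu, if_neg hv]), map_zero]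
    -- For the eigenvalue c ≥ 1 the factor with j + 1 = c vanishes.
    rw [h3, map_zero, Finset.prod_eq_zero (i := sᶜ.card - 1) (Finset.mem_range.mpr (by omega)),
      zero_smul]
    rw [Nat.cast_sub h1, Nat.cast_one, sub_add_cancel, inv_mul_cancel₀, sub_self]
    exact Nat.cast_ne_zero.mpr h1.ne'

/-- The map induced by `f` is homotopic to the identity on cycles. -/
theorem exists_boundary [CharZero k] (f : GrMap V V)
    (hf : ∀ g n x, f.map g n x + ((V.obj g n).d (h.map g n x) + h.map g n ((V.obj g n).d x)) = x)
    (hff : ∀ g n x, f.map g n (f.map g n x) = f.map g n x)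
    {z : V.freeCarrier g n} (hz : V.freeD g n z = 0) :
    ∃ y, V.freeD g n y = f.freeMap g n z - z := by
  -- The bound 2g + n on the number of vertices is uniform over all stable graphs of this type, so
  -- one polynomial serves for all of them.
  have h1 : h.truncation g n (2 * g + n) z = f.freeMap g n z := by
    refine V.free_induction (LinearMap.eqLocus (h.truncation g n (2 * g + n)) (f.freeMap g n))
      (fun Γ δ x hx => ?_) z
    exact h.truncation_eq f hf hff _ Γ.nv_le hx
  rw [← h1]
  exact (h.truncation_cycle _ hz).2

end Homotopy

end StableSModule

/-! ### 𝕄 commutes with homology. -/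

namespace StableSModule

variable {k : Type u} [Field k] [CharZero k] (V : StableSModule.{u, v} k)

/-- The free modular operad is compatible with homology. -/
theorem exists_homologyEquiv (g n : ℕ) :
    ∃ Φ : (V.homology.free.obj g n).carrier ≃ₗ[k] (V.free.homology.obj g n).carrier,
      (∀ i, ∀ x ∈ (V.homology.free.obj g n).gr i, Φ x ∈ (V.free.homology.obj g n).gr i) ∧
      (∀ i, ∀ x ∈ (V.free.homology.obj g n).gr i, Φ.symm x ∈ (V.homology.free.obj g n).gr i) ∧
      ∀ σ x, Φ ((V.homology.free.obj g n).ρ σ x) = (V.free.homology.obj g n).ρ σ (Φ x) := by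
  choose h i p h1 h2 h3 h4 h5 h6 h7 h8 h9 h10 using fun g n => (V.obj g n).exists_retract
  let hm : V.Homotopy := ⟨h, h1, h2⟩
  let I : GrMap V.homology V := ⟨i, h3, h4⟩
  let P : GrMap V V.homology := ⟨p, h5, h6⟩
  let f : GrMap V V := ⟨fun g n => i g n ∘ₗ p g n, fun g n j x hx => h3 g n j _ (h5 g n j x hx),
    fun g n σ x => (h4 g n σ _).trans (congrArg (i g n) (h6 g n σ x))⟩
  have hf : ∀ z, f.freeMap g n z = I.freeMap g n (P.freeMap g n z) := fun z =>
    V.free_induction (LinearMap.eqLocus (f.freeMap g n) (I.freeMap g n ∘ₗ P.freeMap g n))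
      (fun Γ δ x _ => by
        rw [LinearMap.mem_eqLocus, LinearMap.comp_apply, f.freeMap_mkQ, P.freeMap_mkQ,
          I.freeMap_mkQ]
        rfl) z
  have hPI : ∀ z, P.freeMap g n (I.freeMap g n z) = z := fun z =>
    V.homology.free_induction (LinearMap.eqLocus (P.freeMap g n ∘ₗ I.freeMap g n) LinearMap.id)
      (fun Γ δ x _ => by
        rw [LinearMap.mem_eqLocus, LinearMap.comp_apply, I.freeMap_mkQ, P.freeMap_mkQ]
        exact congrArg (fun x => (V.homology.relations g n).mkQ (V.homology.pureAt Γ x))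
          (funext fun v => h9 _ _ (x v))) z
  have hd0 : ∀ z, V.homology.freeD g n z = 0 := GrMap.freeD_eq_zero _ fun _ _ _ => rfl
  have hId : ∀ z, V.freeD g n (I.freeMap g n z) = 0 := fun z => by
    rw [← I.freeMap_d (fun g n x => (map_zero (i g n)).trans (h7 g n x).symm), hd0, map_zero]
  have hPd : ∀ z, P.freeMap g n (V.freeD g n z) = 0 := fun z => by
    rw [P.freeMap_d (fun g n x => h8 g n x), hd0]
  let B : Submodule k (LinearMap.ker (V.freeD g n)) :=
    (LinearMap.range (V.freeD g n)).submoduleOf (LinearMap.ker (V.freeD g n))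
  let a₀ : V.homology.freeCarrier g n →ₗ[k] LinearMap.ker (V.freeD g n) :=
    (I.freeMap g n).codRestrict _ hId
  let a : V.homology.freeCarrier g n →ₗ[k] (LinearMap.ker (V.freeD g n) ⧸ B) := B.mkQ ∘ₗ a₀
  let b : (LinearMap.ker (V.freeD g n) ⧸ B) →ₗ[k] V.homology.freeCarrier g n :=
    B.liftQ (P.freeMap g n ∘ₗ (LinearMap.ker (V.freeD g n)).subtype) (by
      rintro x ⟨y, hy⟩
      change P.freeMap g n (x : V.freeCarrier g n) = 0
      rw [show (x : V.freeCarrier g n) = V.freeD g n y from hy.symm, hPd])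
  -- One composite is the identity because p i = 1 holds strictly; the other is so only modulo
  -- boundaries, by `exists_boundary`.
  let Φ : V.homology.freeCarrier g n ≃ₗ[k] (LinearMap.ker (V.freeD g n) ⧸ B) :=
    LinearEquiv.ofLinearMap a b (LinearMap.ext fun z => by
      obtain ⟨⟨z, hz⟩, rfl⟩ := B.mkQ_surjective z
      obtain ⟨y, hy⟩ := hm.exists_boundary f (fun g n x => h10 g n x)
        (fun g n x => congrArg (i g n) (h9 g n (p g n x))) (show V.freeD g n z = 0 from hz)
      exact (Submodule.Quotient.eq B).mpr ⟨y, hy.trans (by rw [hf]; rfl)⟩) (LinearMap.ext hPI)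
  refine ⟨Φ, fun j x hx => ⟨a₀ x, I.freeMap_mem j x hx, rfl⟩, ?_, fun σ x => ?_⟩
  · rintro j _ ⟨x, hx, rfl⟩
    exact P.freeMap_mem j x.1 hx
  · exact congrArg B.mkQ (Subtype.ext (I.freeMap_rho σ x))

end StableSModule

end ModOp

end

/-- The second statement is the first one for the homology, which has zero differential, transported
along the graded and equivariant isomorphism between 𝕄H(𝒱) and H(𝕄𝒱). -/
theorem mainTheorem4 {k : Type u} [Field k] [CharZero k]
    (V : ModOp.StableSModule.{u, v} k) :
    ((∀ g n, FiniteDimensional k (V.obj g n).carrier) →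
      (∀ g n, FiniteDimensional k (V.free.obj g n).carrier) ∧
        V.free.characteristic =
          ModOp.plethLog (ModOp.expLaplacian (ModOp.plethExp V.characteristic))) ∧
    ((∀ g n, FiniteDimensional k (V.homology.obj g n).carrier) →
      (∀ g n, FiniteDimensional k (V.free.homology.obj g n).carrier) ∧
        V.free.homology.characteristic =
          ModOp.plethLog (ModOp.expLaplacian (ModOp.plethExp V.homology.characteristic))) := by
  refine ⟨fun h => ⟨fun g n => V.free_finiteDimensional g n, V.free_characteristic⟩, fun h => ?_⟩
  have hfree := fun g n => V.homology.free_finiteDimensional g n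
  choose Φ h1 h2 h3 using V.exists_homologyEquiv
  refine ⟨fun g n => LinearEquiv.finiteDimensional (Φ g n), ?_⟩
  rw [← V.homology.free_characteristic, ModOp.StableSModule.characteristic,
    ModOp.StableSModule.characteristic]
  congr 1
  funext a
  rw [ModOp.DGRep.ch_congr (Φ a.1.1 a.1.2) (h1 _ _) (h2 _ _) (h3 _ _)]
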